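/- Let $d\ge 1$ and let $\mu=\rho\,dx$ be a measure on $\mathbb R^d$ with $\rho=\varphi^2$, $\varphi\in H^{1,2}_{loc}(\mathbb R^d)$, and $\operatorname{supp}(\mu)=\mathbb R^d$. *Notation.* For $V\subset\mathbb R^d$ open, $H^{1,2}_0(V,\mu)$ is the closure of $C_0^\infty(V)$ in $L^2(V,\mu)$ with respect to $(\int_V u^2d\mu+\int_V\|\nabla u\|^2d\mu)^{1/2}$, and $H^{1,2}_{loc}(\mathbb R^d,\mu)$ is the set of all $u$ with $\chi u\in H^{1,2}_0(\mathbb R^d,\mu)$ for all $\chi\in C_0^\infty(\mathbb R^d)$. Functions on $V$ are extended by zero to $\mathbb R^d$. For a space $\mathcal A$ of functions, $\mathcal A_b$ denotes its essentially bounded elements, $\mathcal A_0$ those $u\in\mathcal A$ for which $\operatorname{supp}(|u|\mu)$ is compact, and $\mathcal A_{0,b}=\mathcal A_0\cap\mathcal A_b$. An operator $S$ on $L^1(\mathbb R^d,\mu)$ is sub-Markovian if $0\le f\le 1$ implies $0\le Sf\le 1$. *Assumptions.* Let $A=(a_{ij})_{1\le i,j\le d}$ with $a_{ij}=a_{ji}\in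 H^{1,2}_{loc}(\mathbb R^d,\mu)$ be locally strictly elliptic: for every relatively compact $V$ there is $\nu_V>0$ with $\nu_V^{-1}\|\xi\|^2\le\langle A(x)\xi,\xi\rangle\le\nu_V\|\xi\|^2$ for all $\xi\in\mathbb R^d$ and ($\mu$-a.e.) $x\in V$. Let $\mathbf G=(g_1,\dots,g_d)\in L^2_{loc}(\mathbb R^d,\mathbb R^d,\mu)$, and let $\mu$ be infinitesimally invariant: $$\int_{\mathbb R^d}\Big(\tfrac12\sum_{i,j}a_{ij}\partial_{ij}u+\sum_i g_i\partial_iu\Big)d\mu=0\qquad\text{for all }u\in C_0^\infty(\mathbb R^d).$$ Put $\beta_i=\frac12\sum_j\big(\partial_ja_{ij}+a_{ij}\frac{\partial_j\rho}{\rho}\big)$ for $1\le i\le d$, and $\mathbf B=\mathbf G-\beta$. Let $(\mathcal E^0,D(\mathcal E^0))$ be the closure on $L^2(\mathbb R^d,\mu)$ of $\mathcal E^0(u,v)=\frac12\int\langle A\nabla u,\nabla v\rangle d\mu$, $u,v\in C_0^\infty(\mathbb R^d)$, and $(L^0,D(L^0))$ its generator, so that $\mathcal E^0(u,v)=-\int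 L^0u\,v\,d\mu$ for $u\in D(L^0)$, $v\in D(\mathcal E^0)$. For $V$ relatively compact and open let $(L^{0,V},D(L^{0,V}))$ be, in the same way, the generator of $(\mathcal E^0,H^{1,2}_0(V,\mu))$ on $L^2(V,\mu)$, let $\overline L^V$ be the closure on $L^1(V,\mu)$ of $L^{0,V}u+\langle\mathbf B,\nabla u\rangle$, $u\in D(L^{0,V})_b$, and for $\alpha>0$ and $f\in L^1(\mathbb R^d,\mu)$ let $\overline G^V_\alpha f=(\alpha-\overline L^V)^{-1}(f1_V)$. *Claim.* There is a closed extension $(\overline L,D(\overline L))$ on $L^1(\mathbb R^d,\mu)$ of $$Lu=L^0u+\langle\mathbf B,\nabla u\rangle,\qquad u\in D(L^0)_{0,b},$$ with the following properties. (i) $(\overline L,D(\overline L))$ generates a $C_0$-semigroup of contractions on $L^1(\mathbb R^d,\mu)$ that consists of sub-Markovian operators. In particular $C_0^\infty(\mathbb R^d)\subset D(\overline L)$ and $\overline Lu=\frac12\sum_{i,j}a_{ij}\partial_{ij}u+\sum_ig_i\partial_iu$ for $u\in C_0^\infty(\mathbb R^d)$. (ii) For $\alpha>0$ the operator $\alpha-\overline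 L:D(\overline L)\to L^1(\mathbb R^d,\mu)$ is bijective; the inverses $\overline G_\alpha=(\alpha-\overline L)^{-1}$ form a $C_0$-resolvent of contractions on $L^1(\mathbb R^d,\mu)$, and each $\alpha\overline G_\alpha$ is a sub-Markovian contraction. If $(V_n)_{n\ge1}$ is any increasing sequence of relatively compact open sets with $\bigcup_nV_n=\mathbb R^d$, then the $\overline G^{V_n}_\alpha f$ are well defined and $\lim_{n\to\infty}\overline G^{V_n}_\alpha f=\overline G_\alpha f$ in $L^1(\mathbb R^d,\mu)$ for all $f\in L^1(\mathbb R^d,\mu)$ and $\alpha>0$; if $f\ge0$, the sequence $(\overline G^{V_n}_\alpha f)_n$ is increasing. (iii) $D(\overline L)_b\subset D(\mathcal E^0)$, $$\mathcal E^0(u,v)-\int_{\mathbb R^d}\langle\mathbf B,\nabla u\rangle v\,d\mu=-\int_{\mathbb R^d}\overline Lu\,v\,d\mu\qquad\text{for }u\in D(\overline L)_b,\ v\in H^{1,2}_0(\mathbb R^d,\mu)_{0,b},$$ and $\mathcal E^0(u,u)\le-\int_{\mathbb R^d}\overline Lu\,u\,d\mu$ for $u\in D(\overline L)_b$. -/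

import Mathlib

open MeasureTheory Filter Topology Gradient ContDiff ENNReal NNReal

noncomputable section

/-- The Euclidean space `ℝ^d`. -/
abbrev RSpace (d : ℕ) : Type := EuclideanSpace ℝ (Fin d)

/-- `f ∈ C₀^∞(V)`: smooth with compact support contained in `V` (for open `V`). -/
structure IsTestFun {d : ℕ} (V : Set (RSpace d)) (f : RSpace d → ℝ) : Prop where
  smooth : ContDiff ℝ ∞ f
  compact : HasCompactSupport f
  subset : tsupport f ⊆ V

/-- `f ∈ L²_loc(ν)`, i.e. `f ∈ L²(V, ν)` for every relatively compact `V`. -/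
def MemL2Loc {d : ℕ} {F : Type*} [NormedAddCommGroup F] (ν : Measure (RSpace d))
    (f : RSpace d → F) : Prop :=
  ∀ V : Set (RSpace d), IsCompact (closure V) → MemLp f 2 (ν.restrict V)

/-- `φ ∈ H^{1,2}_loc(ℝ^d)` (with respect to Lebesgue measure), with weak gradient `Dφ`. -/
structure HasWeakGradLoc {d : ℕ} (φ : RSpace d → ℝ) (Dφ : RSpace d → RSpace d) : Prop where
  memL2Loc : MemL2Loc volume φ
  grad_memL2Loc : MemL2Loc volume Dφ
  integral_eq : ∀ η : RSpace d → ℝ, IsTestFun Set.univ η →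
    ∫ x, φ x • ∇ η x = - ∫ x, η x • Dφ x

/-- `u ∈ H₀^{1,2}(V, μ)`, with gradient `F`: the closure of `C₀^∞(V)` with respect to the norm
`(∫ u² dμ + ∫ ‖∇u‖² dμ)^{1/2}`. Functions on `V` are extended by zero to `ℝ^d`
(so that `u` and `F` vanish `μ`-a.e. off `V`). -/
def HasGradZero {d : ℕ} (μ : Measure (RSpace d)) (V : Set (RSpace d))
    (u : RSpace d → ℝ) (F : RSpace d → RSpace d) : Prop :=
  MemLp u 2 μ ∧ MemLp F 2 μ ∧
    ∃ f : ℕ → RSpace d → ℝ, (∀ n, IsTestFun V (f n)) ∧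
      Tendsto (fun n => eLpNorm (fun x => u x - f n x) 2 μ) atTop (𝓝 0) ∧
      Tendsto (fun n => eLpNorm (fun x => F x - ∇ (f n) x) 2 μ) atTop (𝓝 0)

/-- `u ∈ H^{1,2}_loc(ℝ^d, μ)`, with gradient `D`: for all `χ ∈ C₀^∞(ℝ^d)` the product `χ u` is in
`H₀^{1,2}(ℝ^d, μ)`, with gradient `χ D + u ∇χ`. -/
def HasGradLoc {d : ℕ} (μ : Measure (RSpace d))
    (u : RSpace d → ℝ) (D : RSpace d → RSpace d) : Prop :=
  ∀ χ : RSpace d → ℝ, IsTestFun Set.univ χ →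
    HasGradZero μ Set.univ (fun x => χ x * u x) (fun x => χ x • D x + u x • ∇ χ x)

/-- `⟨M ξ, ζ⟩`. -/
def matInner {d : ℕ} (M : Matrix (Fin d) (Fin d) ℝ) (ξ ζ : RSpace d) : ℝ :=
  ∑ i, ∑ j, M i j * ξ j * ζ i

/-- Local strict ellipticity of `A`, with respect to the measure `μ`. -/
def LocallyElliptic {d : ℕ} (μ : Measure (RSpace d))
    (A : RSpace d → Matrix (Fin d) (Fin d) ℝ) : Prop :=
  ∀ V : Set (RSpace d), IsCompact (closure V) → ∃ ν : ℝ, 0 < ν ∧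
    ∀ᵐ x ∂μ, x ∈ V → ∀ ξ : RSpace d,
      ν⁻¹ * ‖ξ‖ ^ 2 ≤ matInner (A x) ξ ξ ∧ matInner (A x) ξ ξ ≤ ν * ‖ξ‖ ^ 2

/-- The second partial derivative `∂_{ij} f`. -/
def partial2 {d : ℕ} (i j : Fin d) (f : RSpace d → ℝ) (x : RSpace d) : ℝ :=
  fderiv ℝ (fun y => fderiv ℝ f y (EuclideanSpace.single j 1)) x (EuclideanSpace.single i 1)

/-- `L f = ½ ∑ a_{ij} ∂_{ij} f + ∑ g_i ∂_i f`. -/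
def diffOp {d : ℕ} (A : RSpace d → Matrix (Fin d) (Fin d) ℝ) (G : RSpace d → RSpace d)
    (f : RSpace d → ℝ) (x : RSpace d) : ℝ :=
  (1 / 2) * ∑ i, ∑ j, A x i j * partial2 i j f x + inner ℝ (G x) (∇ f x)

/-- The vector field `β^{ρ,A}`, `β_i = ½ ∑_j (∂_j a_{ij} + a_{ij} ∂_j ρ / ρ)`, for `ρ = φ²`, whose
gradient is `∂_j ρ = 2 φ ∂_j φ`. Here `Dφ` is the gradient of `φ` and `DA i j` that of `a_{ij}`.
The value on `{φ = 0}`, a null set of `ρ dx`, is irrelevant. -/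
def betaField {d : ℕ} (φ : RSpace d → ℝ) (Dφ : RSpace d → RSpace d)
    (A : RSpace d → Matrix (Fin d) (Fin d) ℝ) (DA : Fin d → Fin d → RSpace d → RSpace d)
    (x : RSpace d) : RSpace d :=
  WithLp.toLp 2 fun i =>
    (1 / 2) * ∑ j, (DA i j x j + A x i j * ((2 * φ x * Dφ x j) / (φ x) ^ 2))

/-- `E⁰(u, v) = ½ ∫ ⟨A ∇u, ∇v⟩ dμ`, as a function of the gradients `F = ∇u`, `H = ∇v`. -/
def energy {d : ℕ} (μ : Measure (RSpace d)) (A : RSpace d → Matrix (Fin d) (Fin d) ℝ)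
    (F H : RSpace d → RSpace d) : ℝ :=
  (1 / 2) * ∫ x, matInner (A x) (F x) (H x) ∂μ

/-- `u ∈ D(E⁰)`, with gradient `F`: the closure in `L²(ℝ^d, μ)` of the form `E⁰` on
`C₀^∞(ℝ^d)`. -/
def InFormDomain {d : ℕ} (μ : Measure (RSpace d)) (A : RSpace d → Matrix (Fin d) (Fin d) ℝ)
    (u : RSpace d → ℝ) (F : RSpace d → RSpace d) : Prop :=
  MemLp u 2 μ ∧ AEStronglyMeasurable F μ ∧
    ∃ f : ℕ → RSpace d → ℝ, (∀ n, IsTestFun Set.univ (f n)) ∧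
      Tendsto (fun n => eLpNorm (fun x => u x - f n x) 2 μ) atTop (𝓝 0) ∧
      Tendsto (fun n => ∫⁻ x, ENNReal.ofReal
        (matInner (A x) (F x - ∇ (f n) x) (F x - ∇ (f n) x)) ∂μ) atTop (𝓝 0)

/-- The generator of the form `E⁰` with domain `Dom` (a set of functions `u` paired with their
gradients `F`) on `L²(V, μ)`, the functions of `L²(μ)` that vanish off `V`:
`u` (with gradient `F`) is in the domain of the generator, which maps it to `w ∈ L²(V, μ)`, i.e.
`E⁰(u, v) = - ∫_V w v dμ` for all `v` in `Dom`. -/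
def FormGenerator {d : ℕ} (μ : Measure (RSpace d)) (A : RSpace d → Matrix (Fin d) (Fin d) ℝ)
    (V : Set (RSpace d)) (Dom : (RSpace d → ℝ) → (RSpace d → RSpace d) → Prop)
    (u : RSpace d → ℝ) (F : RSpace d → RSpace d) (w : RSpace d → ℝ) : Prop :=
  Dom u F ∧ MemLp w 2 μ ∧ (∀ᵐ x ∂μ, x ∉ V → w x = 0) ∧
    ∀ v H, Dom v H → energy μ A F H = - ∫ x, w x * v x ∂μ

/-- `u ∈ D(L⁰)`, with gradient `F` and `L⁰ u = w`. -/
def FullGenerator {d : ℕ} (μ : Measure (RSpace d)) (A : RSpace d → Matrix (Fin d) (Fin d) ℝ)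
    (u : RSpace d → ℝ) (F : RSpace d → RSpace d) (w : RSpace d → ℝ) : Prop :=
  FormGenerator μ A Set.univ (InFormDomain μ A) u F w

/-- `u ∈ D(L^{0,V})`, with gradient `F` and `L^{0,V} u = w`: the generator of
`(E⁰, H₀^{1,2}(V, μ))`. -/
def DirichletGenerator {d : ℕ} (μ : Measure (RSpace d))
    (A : RSpace d → Matrix (Fin d) (Fin d) ℝ) (V : Set (RSpace d))
    (u : RSpace d → ℝ) (F : RSpace d → RSpace d) (w : RSpace d → ℝ) : Prop :=
  FormGenerator μ A V (HasGradZero μ V) u F w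

/-- `supp (|u| μ)` is compact. -/
def HasCompactEssSupp {d : ℕ} (μ : Measure (RSpace d)) (u : RSpace d → ℝ) : Prop :=
  ∃ K : Set (RSpace d), IsCompact K ∧ ∀ᵐ x ∂μ, x ∉ K → u x = 0

/-- The graph of `L^V u = L^{0,V} u + ⟨B, ∇u⟩`, `u ∈ D(L^{0,V})_b`, in `L¹(V, μ)`, the functions of
`L¹(μ)` that vanish off `V`. -/
def dirichletOpGraph {d : ℕ} (μ : Measure (RSpace d))
    (A : RSpace d → Matrix (Fin d) (Fin d) ℝ) (B : RSpace d → RSpace d) (V : Set (RSpace d)) :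
    Set (Lp ℝ 1 μ × Lp ℝ 1 μ) :=
  {p | ∃ F w, DirichletGenerator μ A V p.1 F w ∧ MemLp p.1 ∞ μ ∧
    p.2 =ᵐ[μ] fun x => w x + inner ℝ (B x) (F x)}

/-- `g = G^V_α f = (α - L̄^V)⁻¹ (f 1_V)`, where `L̄^V` is the closure of `L^V` in `L¹(V, μ)`. -/
def IsDirichletResolvent {d : ℕ} (μ : Measure (RSpace d))
    (A : RSpace d → Matrix (Fin d) (Fin d) ℝ) (B : RSpace d → RSpace d) (V : Set (RSpace d))
    (α : ℝ) (f g : Lp ℝ 1 μ) : Prop :=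
  ∃ h : Lp ℝ 1 μ, (g, h) ∈ closure (dirichletOpGraph μ A B V) ∧
    (α • g - h : Lp ℝ 1 μ) =ᵐ[μ] V.indicator f

/-- `0 ≤ f ≤ 1` implies `0 ≤ S f ≤ 1`. -/
def IsSubMarkovian {d : ℕ} {μ : Measure (RSpace d)} (S : Lp ℝ 1 μ →L[ℝ] Lp ℝ 1 μ) : Prop :=
  ∀ f : Lp ℝ 1 μ, (∀ᵐ x ∂μ, 0 ≤ f x ∧ f x ≤ 1) → ∀ᵐ x ∂μ, 0 ≤ S f x ∧ S f x ≤ 1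

/-- `(T_t)_{t ≥ 0}` is a `C₀`-semigroup of contractions on `X`. -/
structure IsContractionSemigroup {X : Type*} [NormedAddCommGroup X] [NormedSpace ℝ X]
    (T : ℝ≥0 → X →L[ℝ] X) : Prop where
  zero : T 0 = ContinuousLinearMap.id ℝ X
  add : ∀ s t, T (s + t) = (T s).comp (T t)
  contraction : ∀ t, ‖T t‖ ≤ 1
  continuity : ∀ f, Tendsto (fun t => T t f) (𝓝[>] 0) (𝓝 f)

/-- `(L, D(L))` is the infinitesimal generator of `(T_t)`: `L f = lim_{t → 0+} (T_t f - f) / t`,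
`D(L)` consisting of all `f` for which the limit exists. -/
def IsGeneratorOf {X : Type*} [NormedAddCommGroup X] [NormedSpace ℝ X]
    (L : X →ₗ.[ℝ] X) (T : ℝ≥0 → X →L[ℝ] X) : Prop :=
  ∀ f g : X, (f, g) ∈ L.graph ↔
    Tendsto (fun t : ℝ≥0 => (t : ℝ)⁻¹ • (T t f - f)) (𝓝[>] 0) (𝓝 g)

/-- `(R_α)_{α > 0}` is a `C₀`-resolvent of contractions on `X` (values at `α ≤ 0` are ignored). -/
structure IsContractionResolvent {X : Type*} [NormedAddCommGroup X] [NormedSpace ℝ X]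
    (R : ℝ → X →L[ℝ] X) : Prop where
  resolvent_eq : ∀ α β, 0 < α → 0 < β → R α - R β = (β - α) • (R α).comp (R β)
  contraction : ∀ α, 0 < α → ‖α • R α‖ ≤ 1
  continuity : ∀ f, Tendsto (fun α => α • R α f) atTop (𝓝 f)

/-- `R = (α - L)⁻¹`: the operator `α - L : D(L) → X` is bijective, with inverse `R`. -/
def IsInverseOfSub {X : Type*} [NormedAddCommGroup X] [NormedSpace ℝ X]
    (L : X →ₗ.[ℝ] X) (α : ℝ) (R : X →L[ℝ] X) : Prop :=
  ∀ f u : X, R f = u ↔ (u, α • u - f) ∈ L.graph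

end

/-! ### Mollification and the weak product rule. -/

noncomputable section

open scoped Convolution

/-! Integration by parts against the weight `φ²` (`HasWeakGradLoc.integral_sq_mul_fderiv`) shows
that `μ` has the logarithmic gradient `2∇φ/φ` in `L²_loc(μ)`. Gradients in `H^{1,2}_0` are therefore
unique, test functions lie in the domain of the symmetric generator `L⁰`, where `L⁰` has drift `β`,
and `μ` is invariant for the `β`-part. Hence invariance for `G` says exactly that `B = G - β` has
divergence zero. All of this is packaged in `AdmissibleCoeff`, and the analysis uses nothing else
about `φ`.

On a relatively compact open `V`, the equation `αu - L⁰u - ⟨B,∇u⟩ = f` is solved weakly in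
`H^{1,2}_0(V, μ)`. Since `B` is only locally square integrable, the drift form is not bounded on
`H^{1,2}_0`; it is tested with bounded functions only, and existence comes from Lions' projection
theorem (`exists_weakSol`). If a solution is tested with `ψ(u)`, `ψ` a smooth increasing step with
primitive `Ψ`, the drift term becomes `∫ ⟨B, ∇Ψ(u)⟩ = 0` and the energy term is nonnegative. The
resulting inequality `WeakSol.estimate` contains `L¹`-contractivity, positivity and the upper
bounds. It extends to closures in `L¹`, so that `α - L̄^V` is injective with closed range, and the
range is everything since bounded data can be solved for. That the closure of the bounded weak
solutions is the prescribed closure of `L^V` is `weakGraph_subset_closure`, where a weak solution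
`u` is approximated by `βG⁰_β u`.

A comparison argument (`WeakSol.le_of_subset`) makes these resolvents increasing in `V` on
nonnegative data. Monotone convergence in `L¹` gives the global resolvent, and interlacing shows
that every exhaustion has the same limit. A compactly supported bounded element of `D(L⁰)` is a weak
solution on all large balls, so it is reproduced by the global resolvent; this gives the extension
property and, as test functions are dense, strong continuity. The Hille–Yosida theorem, proved
through Yosida approximations, yields the semigroup. Closed convex sets invariant under all `αR_α`
stay invariant under it, which gives the sub-Markov property.

For bounded `u` in the domain, with image `w`, the functions `λR_λu` are replaced by resolvents on
large balls. These are weak solutions bounded by the bound of `u`, and their energies tend to `-∫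
wu`. Convex combinations of tails which nearly minimize the energy are Cauchy by the parallelogram
law. Their limit is the gradient of `u`; the weak equation and the energy bound survive because both
are convex conditions (`exists_inFormDomain_of_weakSol`). -/

theorem memLp_bdd_smul {α F : Type*} [MeasurableSpace α] {μ : Measure α} [NormedAddCommGroup F]
    [NormedSpace ℝ F] {p : ℝ≥0∞} {g : α → ℝ} {f : α → F} (hf : MemLp f p μ)
    (hg : AEStronglyMeasurable g μ) {C : ℝ} (hC : ∀ᵐ x ∂μ, ‖g x‖ ≤ C) :
    MemLp (fun x => g x • f x) p μ := by
  refine hf.of_le_mul (c := C) (hg.smul hf.1) ?_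
  filter_upwards [hC] with x hx
  rw [norm_smul]
  gcongr

theorem memLp_mul_bdd {α : Type*} [MeasurableSpace α] {μ : Measure α} {p : ℝ≥0∞} {f g : α → ℝ}
    (hf : MemLp f p μ) (hg : AEStronglyMeasurable g μ) {C : ℝ} (hC : ∀ᵐ x ∂μ, ‖g x‖ ≤ C) :
    MemLp (fun x => f x * g x) p μ := by
  simpa only [smul_eq_mul, mul_comm] using memLp_bdd_smul hf hg hC

/-- Correlations of square integrable functions are continuous. -/
theorem continuous_integral_translate_mul {d : ℕ} {p g : RSpace d → ℝ}
    (hp : MemLp p 2 volume) (hg : MemLp g 2 volume) :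
    Continuous fun s : RSpace d => ∫ x, p (s + x) * g x := by
  have h : ∀ s : RSpace d, ∫ x, p (s + x) * g x =
      inner ℝ (hg.toLp g) (DomAddAct.mk s +ᵥ hp.toLp p) := by
    intro s
    rw [L2.inner_def]
    refine integral_congr_ae ?_
    have h1 : (DomAddAct.mk s +ᵥ hp.toLp p : Lp ℝ 2 (volume : Measure (RSpace d)))
        =ᵐ[volume] fun x => p (s + x) := by
      rw [DomAddAct.mk_vadd_toLp]
      exact MemLp.coeFn_toLp _
    filter_upwards [h1, hg.coeFn_toLp] with x hx1 hx2
    rw [hx1, hx2]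
    simp
  simp_rw [h]
  have : Fact ((2 : ℝ≥0∞) ≠ ⊤) := ⟨by simp⟩
  have : Continuous fun s : RSpace d => (DomAddAct.mk s +ᵥ hp.toLp p) := by
    have h2 : Continuous fun s : RSpace d => DomAddAct.mk s := DomAddAct.continuous_mk
    exact h2.vadd continuous_const
  exact continuous_const.inner this

/-- Fubini moves the mollifier from `p` onto the correlation of `p` and `g`. The correlation is
continuous, so weak convergence of mollifications reduces to pointwise convergence at `0`. -/
theorem integral_convolution_mul {d : ℕ} {ψ p g : RSpace d → ℝ}
    (hψ : Integrable ψ volume)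
    (hp : MemLp p 2 volume) (hg : MemLp g 2 volume) :
    ∫ x, (ψ ⋆[ContinuousLinearMap.lsmul ℝ ℝ, volume] p) x * g x
      = (ψ ⋆[ContinuousLinearMap.lsmul ℝ ℝ, volume] fun s => ∫ x, p (s + x) * g x) 0 := by
  simp only [convolution_def, ContinuousLinearMap.lsmul_apply, smul_eq_mul]
  have hint : Integrable (fun z : RSpace d × RSpace d => ψ z.1 * (p (-z.1 + z.2) * g z.2))
      (volume.prod volume) := by
    have hm : AEStronglyMeasurable (fun z : RSpace d × RSpace d => ψ z.1 * (p (-z.1 + z.2) * g z.2))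
        (volume.prod volume) := by
      refine hψ.aestronglyMeasurable.comp_fst.mul (AEStronglyMeasurable.mul ?_ hg.1.comp_snd)
      have : Measure.QuasiMeasurePreserving (fun z : RSpace d × RSpace d => -z.1 + z.2)
          (volume.prod volume) volume := by
        have h1 := quasiMeasurePreserving_sub (volume : Measure (RSpace d)) (volume : Measure (RSpace d))
        have h2 : (fun z : RSpace d × RSpace d => -z.1 + z.2)
          = (fun z : RSpace d × RSpace d => z.1 - z.2) ∘ Prod.swap := by
          ext1 z; simp [sub_eq_neg_add]
        rw [h2]
        exact h1.comp Measure.measurePreserving_swap.quasiMeasurePreserving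
      exact hp.1.comp_quasiMeasurePreserving this
    rw [integrable_prod_iff hm]
    have hps : ∀ t : RSpace d, MemLp (fun x => p (-t + x)) 2 volume := fun t =>
      hp.comp_measurePreserving (measurePreserving_add_left volume (-t))
    constructor
    · refine Eventually.of_forall fun t => ?_
      have h1 : Integrable (fun x => p (-t + x) * g x) volume := (hps t).integrable_mul hg
      exact h1.const_mul (ψ t)
    · have hb : ∀ t, ∫ x, ‖ψ t * (p (-t + x) * g x)‖ ≤
          ‖ψ t‖ * (∫ x, (p x ^ 2 + g x ^ 2)) := by
        intro t
        simp_rw [norm_mul]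
        rw [integral_const_mul]
        refine mul_le_mul_of_nonneg_left ?_ (norm_nonneg _)
        have e : ∫ x, (p x ^ 2 + g x ^ 2) = ∫ x, (p (-t + x) ^ 2 + g x ^ 2) := by
          rw [integral_add hp.integrable_sq hg.integrable_sq,
            integral_add (hps t).integrable_sq hg.integrable_sq,
            integral_add_left_eq_self (fun x => p x ^ 2) (-t)]
        rw [e]
        refine integral_mono_of_nonneg (Eventually.of_forall fun x => by positivity)
          ((hps t).integrable_sq.add hg.integrable_sq) (Eventually.of_forall fun x => ?_)
        have h1 := sq_nonneg (‖p (-t + x)‖ - ‖g x‖)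
        have h2 : ‖p (-t + x)‖ ^ 2 = p (-t + x) ^ 2 := by simp
        have h3 : ‖g x‖ ^ 2 = g x ^ 2 := by simp
        have h4 : 0 ≤ ‖p (-t + x)‖ * ‖g x‖ := by positivity
        simp only
        nlinarith
      refine Integrable.mono' (hψ.norm.mul_const (∫ x, (p x ^ 2 + g x ^ 2))) hm.norm.integral_prod_right'
        (Eventually.of_forall fun t => ?_)
      rw [Real.norm_of_nonneg (integral_nonneg fun _ => norm_nonneg _)]
      exact hb t
  have h1 : ∫ x, (∫ t, ψ t * p (x - t)) * g x = ∫ x, ∫ t, ψ t * (p (-t + x) * g x) := by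
    congr 1; ext1 x
    rw [← integral_mul_const]
    congr 1; ext1 t
    rw [neg_add_eq_sub]; ring
  have h2 : ∫ t, ψ t * ∫ x, p (0 - t + x) * g x = ∫ t, ∫ x, ψ t * (p (-t + x) * g x) := by
    congr 1; ext1 t
    rw [← integral_const_mul]
    simp only [zero_sub]
  rw [h1, h2]
  exact (integral_integral_swap (f := fun t x => ψ t * (p (-t + x) * g x)) hint).symm

/-- The product rule `∂(p²) = 2 p ∂p` for weak directional derivatives. -/
theorem integral_sq_mul_fderiv {d : ℕ} {p q : RSpace d → ℝ} (e : RSpace d)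
    (hp : MemLp p 2 volume) (hq : MemLp q 2 volume)
    (hw : ∀ ζ : RSpace d → ℝ, IsTestFun Set.univ ζ →
      ∫ x, p x * fderiv ℝ ζ x e = - ∫ x, ζ x * q x)
    {η : RSpace d → ℝ} (hη : IsTestFun Set.univ η) :
    ∫ x, p x ^ 2 * fderiv ℝ η x e = - ∫ x, 2 * η x * p x * q x := by
  let φ : ℕ → ContDiffBump (0 : RSpace d) := fun n =>
    { rIn := 1 / (2 * ((n : ℝ) + 1)), rOut := 1 / ((n : ℝ) + 1), rIn_pos := by positivity
      rIn_lt_rOut := by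
        apply one_div_lt_one_div_of_lt <;> nlinarith [(Nat.cast_nonneg n : (0 : ℝ) ≤ n)] }
  have hφ : Tendsto (fun n => (φ n).rOut) atTop (𝓝 0) := tendsto_one_div_add_atTop_nhds_zero_nat
  have lim : ∀ {a b : RSpace d → ℝ}, MemLp a 2 volume → MemLp b 2 volume →
      Tendsto (fun n => ∫ x, ((φ n).normed volume ⋆[ContinuousLinearMap.lsmul ℝ ℝ, volume] a) x * b x)
        atTop (𝓝 (∫ x, a x * b x)) := by
    intro a b ha hb
    have h := ContDiffBump.convolution_tendsto_right_of_continuous (μ := volume) hφ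
      (continuous_integral_translate_mul ha hb) 0
    simp only [zero_add] at h
    refine h.congr fun n => ?_
    rw [integral_convolution_mul (φ n).integrable_normed ha hb]
  have hηb : ∃ C, ∀ x, ‖η x‖ ≤ C := hη.compact.exists_bound_of_continuous hη.smooth.continuous
  obtain ⟨C, hC⟩ := hηb
  have hηd : Continuous fun x => fderiv ℝ η x e :=
    (hη.smooth.continuous_fderiv (by simp)).clm_apply continuous_const
  have hηdc : HasCompactSupport fun x => fderiv ℝ η x e := hη.compact.fderiv_apply ℝ e
  obtain ⟨C', hC'⟩ := hηdc.exists_bound_of_continuous hηd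
  have hpd : MemLp (fun x => p x * fderiv ℝ η x e) 2 volume :=
    memLp_mul_bdd hp hηd.aestronglyMeasurable (C := C') (Eventually.of_forall hC')
  have hpη : MemLp (fun x => p x * η x) 2 volume :=
    memLp_mul_bdd hp hη.smooth.continuous.aestronglyMeasurable (C := C) (Eventually.of_forall hC)
  have hqη : MemLp (fun x => q x * η x) 2 volume :=
    memLp_mul_bdd hq hη.smooth.continuous.aestronglyMeasurable (C := C) (Eventually.of_forall hC)
  have hploc : LocallyIntegrable p volume := hp.locallyIntegrable (by norm_num)
  -- The weak derivative of `p` is tested with `Pη`, where `P = ψ ⋆ p` is smooth. All three terms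
  -- then converge as the mollifier shrinks, and two of the limits coincide.
  have key : ∀ n, (∫ x, ((φ n).normed volume ⋆[ContinuousLinearMap.lsmul ℝ ℝ, volume] q) x * (p x * η x)) +
      (∫ x, ((φ n).normed volume ⋆[ContinuousLinearMap.lsmul ℝ ℝ, volume] p) x * (p x * fderiv ℝ η x e)) =
      - ∫ x, ((φ n).normed volume ⋆[ContinuousLinearMap.lsmul ℝ ℝ, volume] p) x * (q x * η x) := by
    intro n
    set ψ := (φ n).normed volume with hψ
    have hψs : ContDiff ℝ ∞ ψ := (φ n).contDiff_normed
    have hψc : HasCompactSupport ψ := (φ n).hasCompactSupport_normed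
    set P := ψ ⋆[ContinuousLinearMap.lsmul ℝ ℝ, volume] p with hP
    have hPs : ContDiff ℝ ∞ P := hψc.contDiff_convolution_left _ hψs hploc
    have hcomm : P = p ⋆[ContinuousLinearMap.lsmul ℝ ℝ, volume] ψ := by
      ext1 x
      rw [hP, convolution_eq_swap, convolution_def]
      congr 1; ext1 t; simp [mul_comm]
    have hPd : ∀ x, fderiv ℝ P x e = (ψ ⋆[ContinuousLinearMap.lsmul ℝ ℝ, volume] q) x := by
      intro x
      have h1 := hψc.hasFDerivAt_convolution_right (ContinuousLinearMap.lsmul ℝ ℝ) hploc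
        (hψs.of_le (by simp)) x
      rw [hcomm, h1.fderiv, convolution_precompR_apply _ hploc (hψc.fderiv ℝ)
        (hψs.continuous_fderiv (by simp)),
        convolution_eq_swap (f := ψ), convolution_def]
      simp only [ContinuousLinearMap.lsmul_apply, smul_eq_mul]
      have hd : ∀ t, fderiv ℝ (fun t => ψ (x - t)) t e = - fderiv ℝ ψ (x - t) e := by
        intro t
        have := ((hψs.differentiable (by simp)) (x - t)).hasFDerivAt.comp t
          ((hasFDerivAt_const x t).sub (hasFDerivAt_id t))
        have h2 := this.fderiv
        simp only [Function.comp_def] at h2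
        erw [h2]
        simp
      -- The reflected mollifier is itself a test function; inserted in `hw` it shows that `ψ ⋆ p`
      -- has derivative `ψ ⋆ q`.
      have ht : IsTestFun Set.univ fun t => ψ (x - t) :=
        ⟨hψs.comp (contDiff_const.sub contDiff_id),
          hψc.comp_homeomorph (Homeomorph.subLeft x), Set.subset_univ _⟩
      have := hw _ ht
      simp_rw [hd] at this
      rw [← neg_inj, ← this, ← integral_neg]
      simp
    have ht : IsTestFun Set.univ fun x => P x * η x :=
      ⟨hPs.mul hη.smooth, hη.compact.mul_left, Set.subset_univ _⟩
    have hPc : Continuous P := hPs.continuous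
    have hqloc : LocallyIntegrable q volume := hq.locallyIntegrable (by norm_num)
    have hQc : Continuous (ψ ⋆[ContinuousLinearMap.lsmul ℝ ℝ, volume] q) :=
      (hψc.contDiff_convolution_left (n := 0) _ (hψs.of_le (by simp)) hqloc).continuous
    have h := hw _ ht
    have hfd : ∀ x, fderiv ℝ (fun x => P x * η x) x e =
        (ψ ⋆[ContinuousLinearMap.lsmul ℝ ℝ, volume] q) x * η x + P x * fderiv ℝ η x e := by
      intro x
      have h3 : HasFDerivAt (fun x => P x * η x) _ x :=
        ((hPs.differentiable (by simp)) x).hasFDerivAt.mul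
        ((hη.smooth.differentiable (by simp)) x).hasFDerivAt
      rw [h3.fderiv, ← hPd x]
      simp; ring
    simp_rw [hfd] at h
    rw [← integral_add]
    · rw [show (∫ x, P x * (q x * η x)) = ∫ x, P x * η x * q x by congr 1; ext1 x; ring, ← h]
      congr 1; ext1 x; ring
    · have : (fun x => (ψ ⋆[ContinuousLinearMap.lsmul ℝ ℝ, volume] q) x * (p x * η x)) =
        fun x => ((ψ ⋆[ContinuousLinearMap.lsmul ℝ ℝ, volume] q) x * η x) • p x := by
        ext1 x; simp; ring
      rw [this]
      exact hploc.integrable_smul_left_of_hasCompactSupport (hQc.mul hη.smooth.continuous)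
        hη.compact.mul_left
    · have : (fun x => P x * (p x * fderiv ℝ η x e)) =
        fun x => (P x * fderiv ℝ η x e) • p x := by
        ext1 x; simp; ring
      rw [this]
      exact hploc.integrable_smul_left_of_hasCompactSupport (hPc.mul hηd) hηdc.mul_left
  have h1 := (lim hq hpη).add (lim hp hpd)
  simp_rw [key] at h1
  have h2 := tendsto_nhds_unique h1 (lim hp hqη).neg
  have e1 : ∫ x, p x ^ 2 * fderiv ℝ η x e = ∫ x, p x * (p x * fderiv ℝ η x e) := by
    congr 1; ext1 x; ring
  have e2 : ∫ x, 2 * η x * p x * q x = 2 * ∫ x, p x * (q x * η x) := by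
    rw [← integral_const_mul]; congr 1; ext1 x; ring
  have e3 : ∫ x, q x * (p x * η x) = ∫ x, p x * (q x * η x) := by
    congr 1; ext1 x; ring
  rw [e3] at h2
  rw [e1, e2]; linarith

/-! ### Test functions, their gradients, and cutoffs. -/

theorem inner_gradient_eq {d : ℕ} (f : RSpace d → ℝ) (x e : RSpace d) :
    inner ℝ (∇ f x) e = fderiv ℝ f x e := by
  simp [gradient]

theorem MemL2Loc.memLp_smul {d : ℕ} {F : Type*} [NormedAddCommGroup F] [NormedSpace ℝ F]
    {ν : Measure (RSpace d)} {f : RSpace d → F} (hf : MemL2Loc ν f) {g : RSpace d → ℝ}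
    (hg : AEStronglyMeasurable g ν) {C : ℝ} (hC : ∀ᵐ x ∂ν, ‖g x‖ ≤ C) {K : Set (RSpace d)}
    (hK : IsCompact K) (h0 : ∀ x ∉ K, g x = 0) : MemLp (fun x => g x • f x) 2 ν := by
  have h1 : (fun x => g x • f x) = K.indicator fun x => g x • f x := by
    ext1 x
    by_cases hx : x ∈ K
    · simp [hx]
    · simp [hx, h0 x hx]
  rw [h1, memLp_indicator_iff_restrict hK.measurableSet]
  exact memLp_bdd_smul (hf K (by rwa [hK.isClosed.closure_eq])) hg.restrict (ae_restrict_of_ae hC)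

theorem IsTestFun.exists_bound {d : ℕ} {V : Set (RSpace d)} {f : RSpace d → ℝ}
    (hf : IsTestFun V f) : ∃ C, ∀ x, ‖f x‖ ≤ C :=
  hf.compact.exists_bound_of_continuous hf.smooth.continuous

theorem IsTestFun.continuous_gradient {d : ℕ} {V : Set (RSpace d)} {f : RSpace d → ℝ}
    (hf : IsTestFun V f) : Continuous (∇ f) :=
  (InnerProductSpace.toDual ℝ (RSpace d)).symm.continuous.comp
    (hf.smooth.continuous_fderiv (by simp))

theorem gradient_eq_zero_of_notMem_tsupport {d : ℕ} {f : RSpace d → ℝ} {x : RSpace d}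
    (hx : x ∉ tsupport f) : ∇ f x = 0 := by
  have : fderiv ℝ f x = 0 := by
    by_contra h
    exact hx (support_fderiv_subset ℝ h)
  simp [gradient, this]

theorem IsTestFun.hasCompactSupport_gradient {d : ℕ} {V : Set (RSpace d)} {f : RSpace d → ℝ}
    (hf : IsTestFun V f) : HasCompactSupport (∇ f) :=
  HasCompactSupport.intro hf.compact fun _ hx => gradient_eq_zero_of_notMem_tsupport hx

theorem IsTestFun.exists_bound_gradient {d : ℕ} {V : Set (RSpace d)} {f : RSpace d → ℝ}
    (hf : IsTestFun V f) : ∃ C, ∀ x, ‖∇ f x‖ ≤ C :=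
  hf.hasCompactSupport_gradient.exists_bound_of_continuous hf.continuous_gradient

theorem MemL2Loc.memLp_test_smul {d : ℕ} {F : Type*} [NormedAddCommGroup F] [NormedSpace ℝ F]
    {ν : Measure (RSpace d)} {f : RSpace d → F} (hf : MemL2Loc ν f) {g : RSpace d → ℝ}
    (hg : Continuous g) (hc : HasCompactSupport g) : MemLp (fun x => g x • f x) 2 ν := by
  obtain ⟨C, hC⟩ := hc.exists_bound_of_continuous hg
  exact hf.memLp_smul hg.aestronglyMeasurable (Eventually.of_forall hC) hc
    fun x hx => image_eq_zero_of_notMem_tsupport hx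

/-- A smooth cutoff function which is `1` near a compact set. -/
theorem exists_cutoff {d : ℕ} {K V : Set (RSpace d)} (hK : IsCompact K) (hV : IsOpen V)
    (hKV : K ⊆ V) : ∃ χ : RSpace d → ℝ, IsTestFun V χ ∧ (∀ x, 0 ≤ χ x ∧ χ x ≤ 1) ∧
      (∀ x ∈ K, χ x = 1) ∧ ∀ x ∈ K, ∇ χ x = 0 := by
  obtain ⟨L, hL, hKL, hLV⟩ := exists_compact_between hK hV hKV
  obtain ⟨M, hM, hLM, hMV⟩ := exists_compact_between hL hV hLV
  obtain ⟨f, hf1, hf0, hf01⟩ := exists_contMDiffMap_one_nhds_of_subset_interior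
    (n := ⊤) (modelWithCornersSelf ℝ (RSpace d)) hL.isClosed hLM
  have hsup : tsupport f ⊆ M := by
    refine closure_minimal (fun x hx => ?_) hM.isClosed
    by_contra h
    exact hx (hf0 x h)
  have hev : ∀ x ∈ K, f =ᶠ[𝓝 x] fun _ => 1 := fun x hx =>
    Filter.Eventually.filter_mono (nhds_le_nhdsSet (interior_subset (hKL hx))) hf1
  refine ⟨f, ⟨f.contMDiff.contDiff, hM.of_isClosed_subset (isClosed_tsupport _) hsup,
    hsup.trans hMV⟩, fun x => hf01 x, fun x hx => (hev x hx).eq_of_nhds, fun x hx => ?_⟩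
  have : fderiv ℝ f x = 0 := by
    rw [(hev x hx).fderiv_eq]; simp
  simp [gradient, this]

theorem IsTestFun.mul {d : ℕ} {V W : Set (RSpace d)} {f g : RSpace d → ℝ}
    (hf : IsTestFun V f) (hg : IsTestFun W g) : IsTestFun (V ∩ W) (fun x => f x * g x) :=
  ⟨hf.smooth.mul hg.smooth, hf.compact.mul_right, Set.subset_inter
    ((tsupport_mul_subset_left (f := f) (g := g)).trans hf.subset)
    ((tsupport_mul_subset_right (f := f) (g := g)).trans hg.subset)⟩

theorem fderiv_mul_test {d : ℕ} {V W : Set (RSpace d)} {f g : RSpace d → ℝ}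
    (hf : IsTestFun V f) (hg : IsTestFun W g) (x e : RSpace d) :
    fderiv ℝ (fun x => f x * g x) x e = f x * fderiv ℝ g x e + g x * fderiv ℝ f x e := by
  have h : HasFDerivAt (fun x => f x * g x) _ x :=
    ((hf.smooth.differentiable (by simp)) x).hasFDerivAt.mul
      ((hg.smooth.differentiable (by simp)) x).hasFDerivAt
  rw [h.fderiv]; simp

theorem gradient_mul_test {d : ℕ} {V W : Set (RSpace d)} {f g : RSpace d → ℝ}
    (hf : IsTestFun V f) (hg : IsTestFun W g) (x : RSpace d) :
    ∇ (fun x => f x * g x) x = f x • ∇ g x + g x • ∇ f x := by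
  refine ext_inner_right ℝ fun e => ?_
  rw [inner_gradient_eq, fderiv_mul_test hf hg, inner_add_left, real_inner_smul_left,
    real_inner_smul_left, inner_gradient_eq, inner_gradient_eq]

theorem MemL2Loc.inner_const {d : ℕ} {ν : Measure (RSpace d)} {f : RSpace d → RSpace d}
    (hf : MemL2Loc ν f) (e : RSpace d) : MemL2Loc ν fun x => inner ℝ (f x) e :=
  fun V hV => (hf V hV).inner_const e

theorem MemL2Loc.locallyIntegrable {d : ℕ} {F : Type*} [NormedAddCommGroup F]
    {ν : Measure (RSpace d)} [IsFiniteMeasureOnCompacts ν] {f : RSpace d → F}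
    (hf : MemL2Loc ν f) : LocallyIntegrable f ν := by
  rw [locallyIntegrable_iff]
  intro K hK
  have : IsFiniteMeasure (ν.restrict K) := ⟨by simpa using hK.measure_lt_top⟩
  exact (hf K (by rwa [hK.isClosed.closure_eq])).integrable (by norm_num)

/-! ### Integration by parts for the weight `φ²`. -/

theorem HasWeakGradLoc.integral_mul_fderiv {d : ℕ} {φ : RSpace d → ℝ} {Dφ : RSpace d → RSpace d}
    (hφ : HasWeakGradLoc φ Dφ) (e : RSpace d) {η : RSpace d → ℝ} (hη : IsTestFun Set.univ η) :
    ∫ x, φ x * fderiv ℝ η x e = - ∫ x, η x * inner ℝ (Dφ x) e := by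
  have h := congrArg (fun v => inner ℝ v e) (hφ.integral_eq η hη)
  simp only [inner_neg_left] at h
  have h1 : Integrable (fun x => φ x • ∇ η x) volume :=
    hφ.memL2Loc.locallyIntegrable.integrable_smul_right_of_hasCompactSupport
      hη.continuous_gradient hη.hasCompactSupport_gradient
  have h2 : Integrable (fun x => η x • Dφ x) volume :=
    hφ.grad_memL2Loc.locallyIntegrable.integrable_smul_left_of_hasCompactSupport
      hη.smooth.continuous hη.compact
  rw [real_inner_comm, ← integral_inner h1, real_inner_comm, ← integral_inner h2] at h
  simp only [inner_smul_right] at h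
  have c1 : ∀ x, inner ℝ e (∇ η x) = fderiv ℝ η x e := fun x => by
    rw [real_inner_comm, inner_gradient_eq]
  have c2 : ∀ x, inner ℝ e (Dφ x) = inner ℝ (Dφ x) e := fun x => real_inner_comm _ _
  simpa only [c1, c2] using h

/-- Integration by parts for the weight `φ²` with `φ ∈ H^{1,2}_loc`. -/
theorem HasWeakGradLoc.integral_sq_mul_fderiv {d : ℕ} {φ : RSpace d → ℝ}
    {Dφ : RSpace d → RSpace d} (hφ : HasWeakGradLoc φ Dφ) (e : RSpace d) {η : RSpace d → ℝ}
    (hη : IsTestFun Set.univ η) :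
    ∫ x, φ x ^ 2 * fderiv ℝ η x e = - ∫ x, 2 * η x * φ x * inner ℝ (Dφ x) e := by
  -- Multiplication by `χ` makes `φ` globally square integrable. As `χ = 1` and `∇χ = 0` on the
  -- support of `η`, the cutoff disappears from the final identity.
  obtain ⟨χ, hχ, -, hχ1, hχ0⟩ := exists_cutoff hη.compact isOpen_univ (Set.subset_univ _)
  have hχd : Continuous fun x => fderiv ℝ χ x e :=
    (hχ.smooth.continuous_fderiv (by simp)).clm_apply continuous_const
  have hχdc : HasCompactSupport fun x => fderiv ℝ χ x e := hχ.compact.fderiv_apply ℝ e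
  have hp : MemLp (fun x => χ x * φ x) 2 volume :=
    hφ.memL2Loc.memLp_test_smul hχ.smooth.continuous hχ.compact
  have hq : MemLp (fun x => χ x * inner ℝ (Dφ x) e + fderiv ℝ χ x e * φ x) 2 volume :=
    ((hφ.grad_memL2Loc.inner_const e).memLp_test_smul hχ.smooth.continuous hχ.compact).add
      (hφ.memL2Loc.memLp_test_smul hχd hχdc)
  have hw : ∀ ζ : RSpace d → ℝ, IsTestFun Set.univ ζ →
      ∫ x, (χ x * φ x) * fderiv ℝ ζ x e =
        - ∫ x, ζ x * (χ x * inner ℝ (Dφ x) e + fderiv ℝ χ x e * φ x) := by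
    intro ζ hζ
    have hζd : Continuous fun x => fderiv ℝ ζ x e :=
      (hζ.smooth.continuous_fderiv (by simp)).clm_apply continuous_const
    have h1 := hφ.integral_mul_fderiv e (by simpa using hχ.mul hζ : IsTestFun Set.univ _)
    simp_rw [fderiv_mul_test hχ hζ] at h1
    have i1 : Integrable (fun x => (χ x * φ x) * fderiv ℝ ζ x e) volume := by
      have := hφ.memL2Loc.locallyIntegrable.integrable_smul_left_of_hasCompactSupport
        (hχ.smooth.continuous.mul hζd) hχ.compact.mul_right
      refine this.congr (Eventually.of_forall fun x => ?_)
      simp; ring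
    have i2 : Integrable (fun x => ζ x * (fderiv ℝ χ x e * φ x)) volume := by
      have := hφ.memL2Loc.locallyIntegrable.integrable_smul_left_of_hasCompactSupport
        (hζ.smooth.continuous.mul hχd) hζ.compact.mul_right
      refine this.congr (Eventually.of_forall fun x => ?_)
      simp; ring
    have i3 : Integrable (fun x => ζ x * (χ x * inner ℝ (Dφ x) e)) volume := by
      have := (hφ.grad_memL2Loc.inner_const e).locallyIntegrable.integrable_smul_left_of_hasCompactSupport
        (hζ.smooth.continuous.mul hχ.smooth.continuous) hζ.compact.mul_right
      refine this.congr (Eventually.of_forall fun x => ?_)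
      simp; ring
    have e1 : ∫ x, φ x * (χ x * fderiv ℝ ζ x e + ζ x * fderiv ℝ χ x e) =
        (∫ x, (χ x * φ x) * fderiv ℝ ζ x e) + ∫ x, ζ x * (fderiv ℝ χ x e * φ x) := by
      rw [← integral_add i1 i2]; congr 1; ext1 x; ring
    have e2 : ∫ x, ζ x * (χ x * inner ℝ (Dφ x) e + fderiv ℝ χ x e * φ x) =
        (∫ x, ζ x * (χ x * inner ℝ (Dφ x) e)) + ∫ x, ζ x * (fderiv ℝ χ x e * φ x) := by
      rw [← integral_add i3 i2]; congr 1; ext1 x; ring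
    have e3 : ∫ x, χ x * ζ x * inner ℝ (Dφ x) e = ∫ x, ζ x * (χ x * inner ℝ (Dφ x) e) := by
      congr 1; ext1 x; ring
    rw [e1, e3] at h1
    rw [e2]; linarith
  have key := _root_.integral_sq_mul_fderiv e hp hq hw hη
  refine Eq.trans (integral_congr_ae (.of_forall fun x => ?_))
    (key.trans (congrArg _ (integral_congr_ae (.of_forall fun x => ?_))))
  · beta_reduce
    by_cases hx : x ∈ tsupport η
    · simp [hχ1 x hx]
    · rw [← inner_gradient_eq, gradient_eq_zero_of_notMem_tsupport hx]; simp
  · beta_reduce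
    by_cases hx : x ∈ tsupport η
    · rw [← inner_gradient_eq χ, hχ0 x hx]; simp [hχ1 x hx]
    · simp [image_eq_zero_of_notMem_tsupport hx]

end

noncomputable section

/-! ### The bilinear form of a matrix -/

/-- The matrix-vector product `M ξ`. -/
def matVec {d : ℕ} (M : Matrix (Fin d) (Fin d) ℝ) (ξ : RSpace d) : RSpace d :=
  WithLp.toLp 2 fun i => ∑ j, M i j * ξ j

theorem inner_matVec {d : ℕ} (M : Matrix (Fin d) (Fin d) ℝ) (ξ ζ : RSpace d) :
    inner ℝ (matVec M ξ) ζ = matInner M ξ ζ := by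
  rw [PiLp.inner_apply]
  unfold matInner matVec
  refine Finset.sum_congr rfl fun i _ => ?_
  simp [Finset.mul_sum]
  refine Finset.sum_congr rfl fun j _ => ?_
  ring

theorem matVec_add {d : ℕ} (M : Matrix (Fin d) (Fin d) ℝ) (ξ ζ : RSpace d) :
    matVec M (ξ + ζ) = matVec M ξ + matVec M ζ := by
  ext i; simp [matVec, mul_add, Finset.sum_add_distrib]

theorem matVec_smul {d : ℕ} (M : Matrix (Fin d) (Fin d) ℝ) (c : ℝ) (ξ : RSpace d) :
    matVec M (c • ξ) = c • matVec M ξ := by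
  ext i; simp [matVec, Finset.mul_sum, mul_left_comm]

theorem matVec_sub {d : ℕ} (M : Matrix (Fin d) (Fin d) ℝ) (ξ ζ : RSpace d) :
    matVec M (ξ - ζ) = matVec M ξ - matVec M ζ := by
  rw [sub_eq_add_neg, ← neg_one_smul ℝ ζ, matVec_add, matVec_smul]; simp [sub_eq_add_neg]

@[simp] theorem matVec_zero {d : ℕ} (M : Matrix (Fin d) (Fin d) ℝ) : matVec M 0 = 0 := by
  ext i; simp [matVec]

theorem matInner_symm {d : ℕ} {M : Matrix (Fin d) (Fin d) ℝ} (hM : ∀ i j, M j i = M i j)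
    (ξ ζ : RSpace d) : matInner M ξ ζ = matInner M ζ ξ := by
  unfold matInner
  rw [Finset.sum_comm]
  refine Finset.sum_congr rfl fun i _ => Finset.sum_congr rfl fun j _ => ?_
  rw [hM]; ring

theorem matInner_add_left {d : ℕ} (M : Matrix (Fin d) (Fin d) ℝ) (ξ ξ' ζ : RSpace d) :
    matInner M (ξ + ξ') ζ = matInner M ξ ζ + matInner M ξ' ζ := by
  simp only [← inner_matVec, matVec_add, inner_add_left]

theorem matInner_smul_left {d : ℕ} (M : Matrix (Fin d) (Fin d) ℝ) (c : ℝ) (ξ ζ : RSpace d) :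
    matInner M (c • ξ) ζ = c * matInner M ξ ζ := by
  simp only [← inner_matVec, matVec_smul, real_inner_smul_left]

theorem matInner_sub_left {d : ℕ} (M : Matrix (Fin d) (Fin d) ℝ) (ξ ξ' ζ : RSpace d) :
    matInner M (ξ - ξ') ζ = matInner M ξ ζ - matInner M ξ' ζ := by
  simp only [← inner_matVec, matVec_sub, inner_sub_left]

theorem matInner_add_right {d : ℕ} (M : Matrix (Fin d) (Fin d) ℝ) (ξ ζ ζ' : RSpace d) :
    matInner M ξ (ζ + ζ') = matInner M ξ ζ + matInner M ξ ζ' := by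
  simp only [← inner_matVec, inner_add_right]

theorem matInner_smul_right {d : ℕ} (M : Matrix (Fin d) (Fin d) ℝ) (c : ℝ) (ξ ζ : RSpace d) :
    matInner M ξ (c • ζ) = c * matInner M ξ ζ := by
  simp only [← inner_matVec, real_inner_smul_right]

theorem matInner_sub_right {d : ℕ} (M : Matrix (Fin d) (Fin d) ℝ) (ξ ζ ζ' : RSpace d) :
    matInner M ξ (ζ - ζ') = matInner M ξ ζ - matInner M ξ ζ' := by
  simp only [← inner_matVec, inner_sub_right]

@[simp] theorem matInner_zero_left {d : ℕ} (M : Matrix (Fin d) (Fin d) ℝ) (ζ : RSpace d) :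
    matInner M 0 ζ = 0 := by simp [matInner]

@[simp] theorem matInner_zero_right {d : ℕ} (M : Matrix (Fin d) (Fin d) ℝ) (ζ : RSpace d) :
    matInner M ζ 0 = 0 := by simp [matInner]

/-- The Cauchy–Schwarz inequality for a symmetric nonnegative matrix. -/
theorem matInner_sq_le {d : ℕ} {M : Matrix (Fin d) (Fin d) ℝ} (hM : ∀ i j, M j i = M i j)
    (h0 : ∀ ξ, 0 ≤ matInner M ξ ξ) (ξ ζ : RSpace d) :
    matInner M ξ ζ ^ 2 ≤ matInner M ξ ξ * matInner M ζ ζ := by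
  have h : ∀ t : ℝ, 0 ≤ matInner M ζ ζ * (t * t) + (2 * matInner M ξ ζ) * t + matInner M ξ ξ := by
    intro t
    have h1 := h0 (ξ + t • ζ)
    rw [matInner_add_left, matInner_add_right, matInner_add_right, matInner_smul_left,
      matInner_smul_left, matInner_smul_right, matInner_smul_right, matInner_symm hM ζ ξ] at h1
    linarith
  have := discrim_le_zero h
  unfold discrim at this
  nlinarith

theorem abs_matInner_le {d : ℕ} {M : Matrix (Fin d) (Fin d) ℝ} (hM : ∀ i j, M j i = M i j)
    (h0 : ∀ ξ, 0 ≤ matInner M ξ ξ) (ξ ζ : RSpace d) :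
    |matInner M ξ ζ| ≤ (matInner M ξ ξ + matInner M ζ ζ) / 2 := by
  have h1 := h0 (ξ + ζ)
  have h2 := h0 (ξ - ζ)
  rw [matInner_add_left, matInner_add_right, matInner_add_right, matInner_symm hM ζ ξ] at h1
  rw [matInner_sub_left, matInner_sub_right, matInner_sub_right, matInner_symm hM ζ ξ] at h2
  rw [abs_le]
  constructor <;> linarith

/-- Cauchy–Schwarz with `ζ = Mξ` bounds `‖Mξ‖⁴` by `ν²‖ξ‖²‖Mξ‖²`. Thus the ellipticity bound on the
quadratic form already bounds the vectors `Mξ`. -/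
theorem norm_matVec_le {d : ℕ} {M : Matrix (Fin d) (Fin d) ℝ} (hM : ∀ i j, M j i = M i j)
    (h0 : ∀ ξ, 0 ≤ matInner M ξ ξ) {ν : ℝ} (hν : 0 < ν) (h1 : ∀ ξ, matInner M ξ ξ ≤ ν * ‖ξ‖ ^ 2)
    (ξ : RSpace d) : ‖matVec M ξ‖ ≤ ν * ‖ξ‖ := by
  have h2 := matInner_sq_le hM h0 ξ (matVec M ξ)
  rw [← inner_matVec, real_inner_self_eq_norm_sq] at h2
  have h3 : matInner M ξ ξ * matInner M (matVec M ξ) (matVec M ξ) ≤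
      (ν * ‖ξ‖ ^ 2) * (ν * ‖matVec M ξ‖ ^ 2) :=
    mul_le_mul (h1 _) (h1 _) (h0 _) (by positivity)
  by_contra hlt
  push Not at hlt
  have h5 : 0 ≤ ν * ‖ξ‖ := by positivity
  have h6 : 0 < ‖matVec M ξ‖ := lt_of_le_of_lt h5 hlt
  have h4 : (ν * ‖ξ‖) ^ 2 < ‖matVec M ξ‖ ^ 2 := by gcongr
  have : (ν * ‖ξ‖) ^ 2 * ‖matVec M ξ‖ ^ 2 < ‖matVec M ξ‖ ^ 2 * ‖matVec M ξ‖ ^ 2 := by gcongr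
  nlinarith

theorem aestronglyMeasurable_coord {d : ℕ} {μ : Measure (RSpace d)} {F : RSpace d → RSpace d}
    (hF : AEStronglyMeasurable F μ) (i : Fin d) : AEStronglyMeasurable (fun x => F x i) μ :=
  (EuclideanSpace.proj (𝕜 := ℝ) i).continuous.comp_aestronglyMeasurable hF

theorem aestronglyMeasurable_of_coord {d : ℕ} {μ : Measure (RSpace d)} {F : RSpace d → RSpace d}
    (hF : ∀ i, AEStronglyMeasurable (fun x => F x i) μ) : AEStronglyMeasurable F μ := by
  have h : AEMeasurable (fun x => (F x).ofLp) μ := aemeasurable_pi_lambda _ fun i => (hF i).aemeasurable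
  exact ((WithLp.measurable_toLp 2 _).comp_aemeasurable h).aestronglyMeasurable

/-! ### Admissible coefficients -/

/-- A diffusion matrix `A` and a drift `B` with divergence zero with respect to a measure `μ` that
has a logarithmic gradient `Λ` in `L²_loc`. -/
structure AdmissibleCoeff {d : ℕ} (μ : Measure (RSpace d))
    (A : RSpace d → Matrix (Fin d) (Fin d) ℝ) (B : RSpace d → RSpace d) : Prop where
  finite : IsFiniteMeasureOnCompacts μ
  meas : ∀ i j, AEStronglyMeasurable (fun x => A x i j) μ
  symm : ∀ᵐ x ∂μ, ∀ i j, A x j i = A x i j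
  elliptic : LocallyElliptic μ A
  drift : MemL2Loc μ B
  divFree : ∀ f, IsTestFun Set.univ f → ∫ x, inner ℝ (B x) (∇ f x) ∂μ = 0
  logGrad : ∃ Λ : RSpace d → RSpace d, MemL2Loc μ Λ ∧ ∀ η e, IsTestFun Set.univ η →
    ∫ x, fderiv ℝ η x e ∂μ = - ∫ x, η x * inner ℝ (Λ x) e ∂μ

variable {d : ℕ} {μ : Measure (RSpace d)} {A : RSpace d → Matrix (Fin d) (Fin d) ℝ}
  {B : RSpace d → RSpace d}

theorem AdmissibleCoeff.zero_drift (h : AdmissibleCoeff μ A B) : AdmissibleCoeff μ A 0 :=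
  { h with
    drift := fun _ _ => MemLp.zero
    divFree := fun f _ => by simp }

theorem AdmissibleCoeff.bounds (h : AdmissibleCoeff μ A B) {V : Set (RSpace d)}
    (hV : IsCompact (closure V)) : ∃ ν : ℝ, 0 < ν ∧ ∀ᵐ x ∂μ, x ∈ V → ∀ ξ : RSpace d,
      ν⁻¹ * ‖ξ‖ ^ 2 ≤ matInner (A x) ξ ξ ∧ ‖matVec (A x) ξ‖ ≤ ν * ‖ξ‖ := by
  obtain ⟨ν, hν, h1⟩ := h.elliptic V hV
  refine ⟨ν, hν, ?_⟩
  filter_upwards [h1, h.symm] with x hx hs hxV ξ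
  exact ⟨(hx hxV ξ).1, norm_matVec_le hs (fun ξ => (by positivity : 0 ≤ ν⁻¹ * ‖ξ‖ ^ 2).trans
    (hx hxV ξ).1) hν (fun ξ => (hx hxV ξ).2) ξ⟩

theorem AdmissibleCoeff.ae_pos (h : AdmissibleCoeff μ A B) :
    ∀ᵐ x ∂μ, ∃ ν : ℝ, 0 < ν ∧ ∀ ξ : RSpace d, ν⁻¹ * ‖ξ‖ ^ 2 ≤ matInner (A x) ξ ξ := by
  have h1 : ∀ n : ℕ, ∃ ν : ℝ, 0 < ν ∧ ∀ᵐ x ∂μ, x ∈ Metric.ball (0 : RSpace d) n → ∀ ξ : RSpace d,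
      ν⁻¹ * ‖ξ‖ ^ 2 ≤ matInner (A x) ξ ξ ∧ ‖matVec (A x) ξ‖ ≤ ν * ‖ξ‖ := fun n =>
    h.bounds Metric.isBounded_ball.isCompact_closure
  choose ν hν h2 using h1
  filter_upwards [ae_all_iff.2 h2] with x hx
  obtain ⟨n, hn⟩ := exists_nat_gt ‖x‖
  exact ⟨ν n, hν n, fun ξ => (hx n (by simpa using hn) ξ).1⟩

theorem AdmissibleCoeff.ae_nonneg (h : AdmissibleCoeff μ A B) :
    ∀ᵐ x ∂μ, ∀ ξ : RSpace d, 0 ≤ matInner (A x) ξ ξ := by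
  filter_upwards [h.ae_pos] with x ⟨ν, hν, hx⟩ ξ
  exact (by positivity : 0 ≤ ν⁻¹ * ‖ξ‖ ^ 2).trans (hx ξ)

theorem AdmissibleCoeff.aestronglyMeasurable_matVec (h : AdmissibleCoeff μ A B)
    {F : RSpace d → RSpace d} (hF : AEStronglyMeasurable F μ) :
    AEStronglyMeasurable (fun x => matVec (A x) (F x)) μ := by
  refine aestronglyMeasurable_of_coord fun i => ?_
  simp only [matVec]
  exact Finset.aestronglyMeasurable_fun_sum _ fun j _ =>
    (h.meas i j).mul (aestronglyMeasurable_coord hF j)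

theorem AdmissibleCoeff.aestronglyMeasurable_matInner (h : AdmissibleCoeff μ A B)
    {F H : RSpace d → RSpace d} (hF : AEStronglyMeasurable F μ) (hH : AEStronglyMeasurable H μ) :
    AEStronglyMeasurable (fun x => matInner (A x) (F x) (H x)) μ := by
  simp only [← inner_matVec]
  exact (h.aestronglyMeasurable_matVec hF).inner hH

theorem AdmissibleCoeff.memLp_matVec (h : AdmissibleCoeff μ A B) {V : Set (RSpace d)}
    (hV : IsCompact (closure V)) {F : RSpace d → RSpace d} (hF : MemLp F 2 μ)
    (h0 : ∀ᵐ x ∂μ, x ∉ V → F x = 0) : MemLp (fun x => matVec (A x) (F x)) 2 μ := by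
  obtain ⟨ν, hν, h1⟩ := h.bounds hV
  refine hF.of_le_mul (c := ν) (h.aestronglyMeasurable_matVec hF.1) ?_
  filter_upwards [h1, h0] with x hx hx0
  by_cases hxV : x ∈ V
  · exact (hx hxV _).2
  · simp [hx0 hxV]

/-! ### Convergence in `L²` -/

theorem tendsto_toLp_iff {α E : Type*} [MeasurableSpace α] {ν : Measure α} [NormedAddCommGroup E]
    {p : ℝ≥0∞} [Fact (1 ≤ p)] {f : α → E} {fn : ℕ → α → E} (hf : MemLp f p ν)
    (hfn : ∀ n, MemLp (fn n) p ν) :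
    Tendsto (fun n => (hfn n).toLp (fn n)) atTop (𝓝 (hf.toLp f)) ↔
      Tendsto (fun n => eLpNorm (fun x => f x - fn n x) p ν) atTop (𝓝 0) := by
  rw [Lp.tendsto_Lp_iff_tendsto_eLpNorm'']
  refine tendsto_congr fun n => ?_
  rw [← eLpNorm_neg]
  congr 1; ext x; simp

theorem tendsto_integral_inner {α E : Type*} [MeasurableSpace α] {ν : Measure α}
    [NormedAddCommGroup E] [InnerProductSpace ℝ E] {f g : α → E} {fn gn : ℕ → α → E}
    (hf : MemLp f 2 ν) (hg : MemLp g 2 ν) (hfn : ∀ n, MemLp (fn n) 2 ν)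
    (hgn : ∀ n, MemLp (gn n) 2 ν)
    (h1 : Tendsto (fun n => eLpNorm (fun x => f x - fn n x) 2 ν) atTop (𝓝 0))
    (h2 : Tendsto (fun n => eLpNorm (fun x => g x - gn n x) 2 ν) atTop (𝓝 0)) :
    Tendsto (fun n => ∫ x, inner ℝ (fn n x) (gn n x) ∂ν) atTop
      (𝓝 (∫ x, inner ℝ (f x) (g x) ∂ν)) := by
  have key : ∀ {a b : α → E} (ha : MemLp a 2 ν) (hb : MemLp b 2 ν),
      ∫ x, inner ℝ (a x) (b x) ∂ν = inner ℝ (ha.toLp a) (hb.toLp b) := by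
    intro a b ha hb
    rw [L2.inner_def]
    refine integral_congr_ae ?_
    filter_upwards [ha.coeFn_toLp, hb.coeFn_toLp] with x hx hy
    rw [hx, hy]
  rw [key hf hg]
  simp_rw [key (hfn _) (hgn _)]
  exact ((tendsto_toLp_iff hf hfn).2 h1).inner ((tendsto_toLp_iff hg hgn).2 h2)

theorem tendsto_integral_mul {α : Type*} [MeasurableSpace α] {ν : Measure α}
    {f g : α → ℝ} {fn gn : ℕ → α → ℝ}
    (hf : MemLp f 2 ν) (hg : MemLp g 2 ν) (hfn : ∀ n, MemLp (fn n) 2 ν)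
    (hgn : ∀ n, MemLp (gn n) 2 ν)
    (h1 : Tendsto (fun n => eLpNorm (fun x => f x - fn n x) 2 ν) atTop (𝓝 0))
    (h2 : Tendsto (fun n => eLpNorm (fun x => g x - gn n x) 2 ν) atTop (𝓝 0)) :
    Tendsto (fun n => ∫ x, fn n x * gn n x ∂ν) atTop (𝓝 (∫ x, f x * g x ∂ν)) := by
  have := tendsto_integral_inner hf hg hfn hgn h1 h2
  simpa only [RCLike.inner_apply, conj_trivial, mul_comm] using this

theorem eLpNorm_sub_self_tendsto {α E : Type*} [MeasurableSpace α] {ν : Measure α}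
    [NormedAddCommGroup E] (f : α → E) (p : ℝ≥0∞) :
    Tendsto (fun _ : ℕ => eLpNorm (fun x => f x - f x) p ν) atTop (𝓝 0) := by
  simp

theorem integrable_inner_of_memLp {α E : Type*} [MeasurableSpace α] {ν : Measure α}
    [NormedAddCommGroup E] [InnerProductSpace ℝ E] {f g : α → E} (hf : MemLp f 2 ν)
    (hg : MemLp g 2 ν) : Integrable (fun x => inner ℝ (f x) (g x)) ν := by
  refine (L2.integrable_inner (𝕜 := ℝ) (hf.toLp f) (hg.toLp g)).congr ?_
  filter_upwards [hf.coeFn_toLp, hg.coeFn_toLp] with x hx hy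
  rw [hx, hy]

/-- Dominated convergence for products `aₙ F` with `F ∈ L²` and `aₙ → 0` boundedly. -/
theorem tendsto_eLpNorm_smul_of_bdd {α E : Type*} [MeasurableSpace α] {ν : Measure α}
    [NormedAddCommGroup E] [NormedSpace ℝ E] {F : α → E} (hF : MemLp F 2 ν) {a : ℕ → α → ℝ}
    (ha : ∀ n, AEStronglyMeasurable (a n) ν) {C : ℝ} (hC : ∀ n, ∀ᵐ x ∂ν, ‖a n x‖ ≤ C)
    (hlim : ∀ᵐ x ∂ν, Tendsto (fun n => a n x) atTop (𝓝 0)) :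
    Tendsto (fun n => eLpNorm (fun x => a n x • F x) 2 ν) atTop (𝓝 0) := by
  have h2 : ∀ f : α → E, eLpNorm f 2 ν = (∫⁻ x, ‖f x‖ₑ ^ (2 : ℝ) ∂ν) ^ (1 / (2 : ℝ)) := by
    intro f
    rw [eLpNorm_eq_lintegral_rpow_enorm_toReal (by norm_num) (by norm_num)]
    norm_num
  simp_rw [h2]
  have h3 : Tendsto (fun n => ∫⁻ x, ‖a n x • F x‖ₑ ^ (2 : ℝ) ∂ν) atTop (𝓝 (∫⁻ _, 0 ∂ν)) := by
    refine tendsto_lintegral_of_dominated_convergence' (fun x => ‖C • F x‖ₑ ^ (2 : ℝ))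
      (fun n => (((ha n).smul hF.1).enorm).pow_const _) (fun n => ?_) ?_ ?_
    · filter_upwards [hC n] with x hx
      gcongr
      rw [enorm_smul, enorm_smul]
      gcongr
      rw [← ofReal_norm, ← ofReal_norm]
      exact ENNReal.ofReal_le_ofReal (hx.trans (by rw [Real.norm_eq_abs]; exact le_abs_self C))
    · have h4 := (hF.const_smul C).2.ne
      rw [Pi.smul_def, h2] at h4
      intro h5
      rw [h5] at h4
      exact h4 (by simp)
    · filter_upwards [hlim] with x hx
      have h5 : Tendsto (fun n => ‖a n x • F x‖ₑ) atTop (𝓝 0) := by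
        have := (hx.smul_const (F x)).enorm
        simpa using this
      have := h5.ennrpow_const 2
      simpa using this
  have := h3.ennrpow_const (1 / 2)
  simpa using this

theorem tendsto_eLpNorm_zero_of_le {α E E' : Type*} [MeasurableSpace α] {ν : Measure α}
    [NormedAddCommGroup E] [NormedAddCommGroup E'] {p : ℝ≥0∞} {f : ℕ → α → E} {g : ℕ → α → E'}
    {C : ℝ} (hle : ∀ n, ∀ᵐ x ∂ν, ‖f n x‖ ≤ C * ‖g n x‖)
    (hg : Tendsto (fun n => eLpNorm (g n) p ν) atTop (𝓝 0)) :
    Tendsto (fun n => eLpNorm (f n) p ν) atTop (𝓝 0) := by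
  have h1 : Tendsto (fun n => ENNReal.ofReal C * eLpNorm (g n) p ν) atTop (𝓝 0) := by
    have := ENNReal.Tendsto.const_mul (a := ENNReal.ofReal C) hg (Or.inr ENNReal.ofReal_ne_top)
    simpa using this
  exact tendsto_of_tendsto_of_tendsto_of_le_of_le tendsto_const_nhds h1 (fun _ => zero_le)
    fun n => eLpNorm_le_mul_eLpNorm_of_ae_le_mul (hle n) p

theorem tendsto_eLpNorm_zero_add {α E : Type*} [MeasurableSpace α] {ν : Measure α}
    [NormedAddCommGroup E] {p : ℝ≥0∞} (hp : 1 ≤ p) {f g : ℕ → α → E}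
    (hfm : ∀ n, AEStronglyMeasurable (f n) ν) (hgm : ∀ n, AEStronglyMeasurable (g n) ν)
    (hf : Tendsto (fun n => eLpNorm (f n) p ν) atTop (𝓝 0))
    (hg : Tendsto (fun n => eLpNorm (g n) p ν) atTop (𝓝 0)) :
    Tendsto (fun n => eLpNorm (fun x => f n x + g n x) p ν) atTop (𝓝 0) := by
  have h1 := hf.add hg
  rw [add_zero] at h1
  exact tendsto_of_tendsto_of_tendsto_of_le_of_le tendsto_const_nhds h1 (fun _ => zero_le)
    fun n => eLpNorm_add_le (hfm n) (hgm n) hp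

end

noncomputable section

variable {d : ℕ} {μ : Measure (RSpace d)} {A : RSpace d → Matrix (Fin d) (Fin d) ℝ}
  {B : RSpace d → RSpace d}

/-! ### Test functions -/

theorem IsTestFun.mono {V W : Set (RSpace d)} {f : RSpace d → ℝ} (hf : IsTestFun V f)
    (h : V ⊆ W) : IsTestFun W f := ⟨hf.smooth, hf.compact, hf.subset.trans h⟩

theorem IsTestFun.zero (V : Set (RSpace d)) : IsTestFun V fun _ => 0 :=
  ⟨contDiff_const, HasCompactSupport.zero, by simp [tsupport]⟩

theorem IsTestFun.add {V : Set (RSpace d)} {f g : RSpace d → ℝ} (hf : IsTestFun V f)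
    (hg : IsTestFun V g) : IsTestFun V (fun x => f x + g x) :=
  ⟨hf.smooth.add hg.smooth, hf.compact.add hg.compact,
    (tsupport_add f g).trans (Set.union_subset hf.subset hg.subset)⟩

theorem IsTestFun.const_mul {V : Set (RSpace d)} {f : RSpace d → ℝ} (hf : IsTestFun V f)
    (c : ℝ) : IsTestFun V (fun x => c * f x) :=
  ⟨contDiff_const.mul hf.smooth, hf.compact.mul_left,
    (tsupport_mul_subset_right (f := fun _ => c) (g := f)).trans hf.subset⟩

theorem IsTestFun.comp {V : Set (RSpace d)} {f : RSpace d → ℝ} (hf : IsTestFun V f)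
    {g : ℝ → ℝ} (hg : ContDiff ℝ ∞ g) (h0 : g 0 = 0) : IsTestFun V (fun x => g (f x)) :=
  ⟨hg.comp hf.smooth, hf.compact.comp_left h0,
    (closure_mono (Function.support_comp_subset h0 f)).trans hf.subset⟩

theorem IsTestFun.hasFDerivAt {V : Set (RSpace d)} {f : RSpace d → ℝ} (hf : IsTestFun V f)
    (x : RSpace d) : HasFDerivAt f (fderiv ℝ f x) x :=
  ((hf.smooth.differentiable (by simp)) x).hasFDerivAt

theorem IsTestFun.gradient_add {V W : Set (RSpace d)} {f g : RSpace d → ℝ} (hf : IsTestFun V f)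
    (hg : IsTestFun W g) (x : RSpace d) : ∇ (fun x => f x + g x) x = ∇ f x + ∇ g x := by
  have h : HasFDerivAt (fun x => f x + g x) _ x := (hf.hasFDerivAt x).add (hg.hasFDerivAt x)
  simp [gradient, h.fderiv]

theorem IsTestFun.gradient_const_mul {V : Set (RSpace d)} {f : RSpace d → ℝ} (hf : IsTestFun V f)
    (c : ℝ) (x : RSpace d) : ∇ (fun x => c * f x) x = c • ∇ f x := by
  have h : HasFDerivAt (fun x => c * f x) _ x := (hf.hasFDerivAt x).const_mul c
  simp [gradient, h.fderiv]

theorem IsTestFun.gradient_comp {V : Set (RSpace d)} {f : RSpace d → ℝ} (hf : IsTestFun V f)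
    {g : ℝ → ℝ} (hg : ContDiff ℝ ∞ g) (x : RSpace d) :
    ∇ (fun x => g (f x)) x = deriv g (f x) • ∇ f x := by
  have h1 : HasDerivAt g (deriv g (f x)) (f x) := ((hg.differentiable (by simp)) _).hasDerivAt
  have h : HasFDerivAt (fun x => g (f x)) _ x := h1.comp_hasFDerivAt x (hf.hasFDerivAt x)
  simp [gradient, h.fderiv]

theorem gradient_const_zero (x : RSpace d) : ∇ (fun _ : RSpace d => (0 : ℝ)) x = 0 := by
  simp [gradient]

theorem IsTestFun.memLp [IsFiniteMeasureOnCompacts μ] {V : Set (RSpace d)} {f : RSpace d → ℝ}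
    (hf : IsTestFun V f) (p : ℝ≥0∞) : MemLp f p μ :=
  hf.smooth.continuous.memLp_of_hasCompactSupport hf.compact

theorem IsTestFun.memLp_gradient [IsFiniteMeasureOnCompacts μ] {V : Set (RSpace d)}
    {f : RSpace d → ℝ} (hf : IsTestFun V f) (p : ℝ≥0∞) : MemLp (∇ f) p μ :=
  hf.continuous_gradient.memLp_of_hasCompactSupport hf.hasCompactSupport_gradient

/-! ### The space `H₀^{1,2}(V, μ)` as a closed subspace of `L² × L²` -/

/-- The Hilbert space of pairs of a function and a vector field. -/
abbrev PairSpace (μ : Measure (RSpace d)) : Type := WithLp 2 (Lp ℝ 2 μ × Lp (RSpace d) 2 μ)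

/-- The pairs `(f, ∇ f)` with `f ∈ C₀^∞(V)`. -/
def testPairs (μ : Measure (RSpace d)) (V : Set (RSpace d)) : Submodule ℝ (PairSpace μ) where
  carrier := {z | ∃ f, IsTestFun V f ∧ z.fst =ᵐ[μ] f ∧ z.snd =ᵐ[μ] ∇ f}
  zero_mem' := by
    refine ⟨_, IsTestFun.zero V, Lp.coeFn_zero _ _ _, (Lp.coeFn_zero _ _ _).trans ?_⟩
    exact Eventually.of_forall fun x => (gradient_const_zero x).symm
  add_mem' := by
    rintro a b ⟨f, hf, h1, h2⟩ ⟨g, hg, h3, h4⟩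
    refine ⟨_, hf.add hg, ?_, ?_⟩
    · filter_upwards [h1, h3, Lp.coeFn_add a.fst b.fst] with x k1 k2 k3
      rw [WithLp.add_fst, k3, Pi.add_apply, k1, k2]
    · filter_upwards [h2, h4, Lp.coeFn_add a.snd b.snd] with x k1 k2 k3
      rw [WithLp.add_snd, k3, Pi.add_apply, k1, k2, hf.gradient_add hg]
  smul_mem' := by
    rintro c a ⟨f, hf, h1, h2⟩
    refine ⟨_, hf.const_mul c, ?_, ?_⟩
    · filter_upwards [h1, Lp.coeFn_smul c a.fst] with x k1 k3
      rw [WithLp.smul_fst, k3, Pi.smul_apply, k1, smul_eq_mul]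
    · filter_upwards [h2, Lp.coeFn_smul c a.snd] with x k1 k3
      rw [WithLp.smul_snd, k3, Pi.smul_apply, k1, hf.gradient_const_mul]

/-- `H₀^{1,2}(V, μ)`, as a set of pairs of a function and its gradient. -/
def sobolevPairs (μ : Measure (RSpace d)) (V : Set (RSpace d)) : Submodule ℝ (PairSpace μ) :=
  (testPairs μ V).topologicalClosure

theorem tendsto_pair_iff {z : PairSpace μ} {zn : ℕ → PairSpace μ} :
    Tendsto zn atTop (𝓝 z) ↔ Tendsto (fun n => (zn n).fst) atTop (𝓝 z.fst) ∧
      Tendsto (fun n => (zn n).snd) atTop (𝓝 z.snd) := by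
  have h := (WithLp.homeomorphProd 2 (Lp ℝ 2 μ) (Lp (RSpace d) 2 μ)).isInducing.tendsto_nhds_iff
    (f := zn) (l := atTop) (y := z)
  rw [h, nhds_prod_eq, tendsto_prod_iff']
  rfl

/-- The pair `(u, F)` as an element of `L² × L²`. -/
def mkPair {u : RSpace d → ℝ} {F : RSpace d → RSpace d} (hu : MemLp u 2 μ) (hF : MemLp F 2 μ) :
    PairSpace μ := WithLp.toLp 2 (hu.toLp u, hF.toLp F)

/-- The sequential definition becomes membership in a closed subspace of a Hilbert space, from which
the linear structure of `H₀^{1,2}` is read off and to which Lions' theorem applies. -/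
theorem hasGradZero_iff [IsFiniteMeasureOnCompacts μ] {V : Set (RSpace d)} {u : RSpace d → ℝ}
    {F : RSpace d → RSpace d} :
    HasGradZero μ V u F ↔ ∃ z ∈ sobolevPairs μ V, z.fst =ᵐ[μ] u ∧ z.snd =ᵐ[μ] F := by
  constructor
  · rintro ⟨hu, hF, f, hf, h1, h2⟩
    refine ⟨mkPair hu hF, ?_, hu.coeFn_toLp, hF.coeFn_toLp⟩
    refine mem_closure_of_tendsto (f := fun n => mkPair ((hf n).memLp 2) ((hf n).memLp_gradient 2))
      (b := atTop) ?_ (Eventually.of_forall fun n =>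
        ⟨f n, hf n, ((hf n).memLp 2).coeFn_toLp, ((hf n).memLp_gradient 2).coeFn_toLp⟩)
    rw [tendsto_pair_iff]
    exact ⟨(tendsto_toLp_iff hu fun n => (hf n).memLp 2).2 h1,
      (tendsto_toLp_iff hF fun n => (hf n).memLp_gradient 2).2 h2⟩
  · rintro ⟨z, hz, h1, h2⟩
    obtain ⟨zn, hzn, hlim⟩ := mem_closure_iff_seq_limit.1 hz
    choose f hf hf1 hf2 using hzn
    rw [tendsto_pair_iff] at hlim
    refine ⟨(memLp_congr_ae h1).1 (Lp.memLp _), (memLp_congr_ae h2).1 (Lp.memLp _), f, hf, ?_, ?_⟩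
    · have := (Lp.tendsto_Lp_iff_tendsto_eLpNorm' _ _).1 hlim.1
      refine this.congr fun n => ?_
      rw [← eLpNorm_neg]
      refine eLpNorm_congr_ae ?_
      filter_upwards [h1, hf1 n] with x k1 k2
      simp [k1, k2]
    · have := (Lp.tendsto_Lp_iff_tendsto_eLpNorm' _ _).1 hlim.2
      refine this.congr fun n => ?_
      rw [← eLpNorm_neg]
      refine eLpNorm_congr_ae ?_
      filter_upwards [h2, hf2 n] with x k1 k2
      simp [k1, k2]

theorem HasGradZero.congr {V : Set (RSpace d)} {u u' : RSpace d → ℝ} {F F' : RSpace d → RSpace d}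
    (h : HasGradZero μ V u F) (hu : u =ᵐ[μ] u') (hF : F =ᵐ[μ] F') : HasGradZero μ V u' F' := by
  obtain ⟨h1, h2, f, hf, h3, h4⟩ := h
  refine ⟨(memLp_congr_ae hu).1 h1, (memLp_congr_ae hF).1 h2, f, hf, ?_, ?_⟩
  · refine h3.congr fun n => eLpNorm_congr_ae ?_
    filter_upwards [hu] with x hx
    rw [hx]
  · refine h4.congr fun n => eLpNorm_congr_ae ?_
    filter_upwards [hF] with x hx
    rw [hx]

theorem HasGradZero.mono {V W : Set (RSpace d)} {u : RSpace d → ℝ} {F : RSpace d → RSpace d}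
    (h : HasGradZero μ V u F) (hVW : V ⊆ W) : HasGradZero μ W u F := by
  obtain ⟨h1, h2, f, hf, h3⟩ := h
  exact ⟨h1, h2, f, fun n => (hf n).mono hVW, h3⟩

theorem IsTestFun.hasGradZero [IsFiniteMeasureOnCompacts μ] {V : Set (RSpace d)} {f : RSpace d → ℝ}
    (hf : IsTestFun V f) : HasGradZero μ V f (∇ f) :=
  ⟨hf.memLp 2, hf.memLp_gradient 2, fun _ => f, fun _ => hf, eLpNorm_sub_self_tendsto _ _,
    eLpNorm_sub_self_tendsto _ _⟩

theorem HasGradZero.add [IsFiniteMeasureOnCompacts μ] {V : Set (RSpace d)} {u v : RSpace d → ℝ}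
    {F H : RSpace d → RSpace d} (hu : HasGradZero μ V u F) (hv : HasGradZero μ V v H) :
    HasGradZero μ V (fun x => u x + v x) (fun x => F x + H x) := by
  rw [hasGradZero_iff] at *
  obtain ⟨z, hz, h1, h2⟩ := hu
  obtain ⟨y, hy, h3, h4⟩ := hv
  exact ⟨z + y, Submodule.add_mem _ hz hy, (Lp.coeFn_add _ _).trans (h1.add h3),
    (Lp.coeFn_add _ _).trans (h2.add h4)⟩

theorem HasGradZero.const_smul [IsFiniteMeasureOnCompacts μ] {V : Set (RSpace d)}
    {u : RSpace d → ℝ} {F : RSpace d → RSpace d} (hu : HasGradZero μ V u F) (c : ℝ) :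
    HasGradZero μ V (fun x => c * u x) (fun x => c • F x) := by
  rw [hasGradZero_iff] at *
  obtain ⟨z, hz, h1, h2⟩ := hu
  exact ⟨c • z, Submodule.smul_mem _ _ hz, (Lp.coeFn_smul _ _).trans (h1.const_smul c),
    (Lp.coeFn_smul _ _).trans (h2.const_smul c)⟩

theorem HasGradZero.sub [IsFiniteMeasureOnCompacts μ] {V : Set (RSpace d)} {u v : RSpace d → ℝ}
    {F H : RSpace d → RSpace d} (hu : HasGradZero μ V u F) (hv : HasGradZero μ V v H) :
    HasGradZero μ V (fun x => u x - v x) (fun x => F x - H x) := by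
  refine (hu.add (hv.const_smul (-1))).congr ?_ ?_ <;>
  exact Eventually.of_forall fun x => by simp [sub_eq_add_neg]

/-- An approximating sequence of test functions that also converges almost everywhere. -/
theorem HasGradZero.exists_seq [IsFiniteMeasureOnCompacts μ] {V : Set (RSpace d)}
    {u : RSpace d → ℝ} {F : RSpace d → RSpace d} (h : HasGradZero μ V u F) :
    ∃ f : ℕ → RSpace d → ℝ, (∀ n, IsTestFun V (f n)) ∧
      Tendsto (fun n => eLpNorm (fun x => u x - f n x) 2 μ) atTop (𝓝 0) ∧
      Tendsto (fun n => eLpNorm (fun x => F x - ∇ (f n) x) 2 μ) atTop (𝓝 0) ∧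
      ∀ᵐ x ∂μ, Tendsto (fun n => f n x) atTop (𝓝 (u x)) := by
  obtain ⟨hu, hF, f, hf, h1, h2⟩ := h
  have hm : TendstoInMeasure μ f atTop u := by
    refine tendstoInMeasure_of_tendsto_eLpNorm (p := 2) (by norm_num)
      (fun n => ((hf n).memLp 2).1) hu.1 (h1.congr fun n => ?_)
    rw [← eLpNorm_neg]
    congr 1; ext x; simp
  obtain ⟨ns, hns, hae⟩ := hm.exists_seq_tendsto_ae
  exact ⟨fun n => f (ns n), fun n => hf _, h1.comp hns.tendsto_atTop, h2.comp hns.tendsto_atTop, hae⟩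

theorem eq_zero_of_tendsto_of_support {E : Type*} [NormedAddCommGroup E] {V : Set (RSpace d)}
    {u : RSpace d → E} {f : ℕ → RSpace d → E} (hu : AEStronglyMeasurable u μ)
    (hfm : ∀ n, AEStronglyMeasurable (f n) μ)
    (h1 : Tendsto (fun n => eLpNorm (fun x => u x - f n x) 2 μ) atTop (𝓝 0))
    (h0 : ∀ n, ∀ x ∉ V, f n x = 0) : ∀ᵐ x ∂μ, x ∉ V → u x = 0 := by
  have hm : TendstoInMeasure μ f atTop u := by
    refine tendstoInMeasure_of_tendsto_eLpNorm (p := 2) (by norm_num) hfm hu (h1.congr fun n => ?_)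
    rw [← eLpNorm_neg]
    congr 1; ext x; simp
  obtain ⟨ns, -, hae⟩ := hm.exists_seq_tendsto_ae
  filter_upwards [hae] with x hx hxV
  simp_rw [h0 _ x hxV] at hx
  exact (tendsto_nhds_unique hx tendsto_const_nhds)

theorem HasGradZero.ae_eq_zero [IsFiniteMeasureOnCompacts μ] {V : Set (RSpace d)}
    {u : RSpace d → ℝ} {F : RSpace d → RSpace d} (h : HasGradZero μ V u F) :
    ∀ᵐ x ∂μ, x ∉ V → u x = 0 ∧ F x = 0 := by
  obtain ⟨hu, hF, f, hf, h1, h2⟩ := h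
  have k1 := eq_zero_of_tendsto_of_support hu.1 (fun n => ((hf n).memLp 2).1) h1
    fun n x hx => image_eq_zero_of_notMem_tsupport fun h => hx ((hf n).subset h)
  have k2 := eq_zero_of_tendsto_of_support hF.1 (fun n => ((hf n).memLp_gradient 2).1) h2
    fun n x hx => gradient_eq_zero_of_notMem_tsupport fun h => hx ((hf n).subset h)
  filter_upwards [k1, k2] with x a b hx
  exact ⟨a hx, b hx⟩

/-! ### Uniqueness of the gradient -/

/-- The logarithmic gradient is applied to the product `fη`. The left side no longer differentiates
`f`, so it is continuous in `f` for `L²` convergence; this is the source of closability. -/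
theorem IsTestFun.integral_mul_fderiv {Λ : RSpace d → RSpace d} [IsFiniteMeasureOnCompacts μ]
    (hΛ : MemL2Loc μ Λ)
    (hlog : ∀ η e, IsTestFun Set.univ η →
      ∫ x, fderiv ℝ η x e ∂μ = - ∫ x, η x * inner ℝ (Λ x) e ∂μ)
    {f η : RSpace d → ℝ} (hf : IsTestFun Set.univ f) (hη : IsTestFun Set.univ η) (e : RSpace d) :
    ∫ x, f x * (fderiv ℝ η x e + η x * inner ℝ (Λ x) e) ∂μ = - ∫ x, inner ℝ (∇ f x) (η x • e) ∂μ := by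
  have h1 := hlog _ e (by simpa using hf.mul hη : IsTestFun Set.univ _)
  simp_rw [fderiv_mul_test hf hη] at h1
  have hηd : Continuous fun x => fderiv ℝ η x e :=
    (hη.smooth.continuous_fderiv (by simp)).clm_apply continuous_const
  have hfd : Continuous fun x => fderiv ℝ f x e :=
    (hf.smooth.continuous_fderiv (by simp)).clm_apply continuous_const
  have i1 : Integrable (fun x => f x * fderiv ℝ η x e) μ :=
    (hf.smooth.continuous.mul hηd).integrable_of_hasCompactSupport hf.compact.mul_right
  have i2 : Integrable (fun x => η x * fderiv ℝ f x e) μ :=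
    (hη.smooth.continuous.mul hfd).integrable_of_hasCompactSupport hη.compact.mul_right
  have i3 : Integrable (fun x => f x * η x * inner ℝ (Λ x) e) μ :=
    (hΛ.inner_const e).locallyIntegrable.integrable_smul_left_of_hasCompactSupport
      (hf.smooth.continuous.mul hη.smooth.continuous) hf.compact.mul_right
  rw [integral_add i1 i2] at h1
  have e1 : ∫ x, f x * (fderiv ℝ η x e + η x * inner ℝ (Λ x) e) ∂μ =
      (∫ x, f x * fderiv ℝ η x e ∂μ) + ∫ x, f x * η x * inner ℝ (Λ x) e ∂μ := by
    rw [← integral_add i1 i3]; congr 1; ext1 x; ring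
  have e2 : ∫ x, inner ℝ (∇ f x) (η x • e) ∂μ = ∫ x, η x * fderiv ℝ f x e ∂μ := by
    congr 1; ext1 x; rw [inner_smul_right, inner_gradient_eq]
  rw [e1, e2]; linarith

/-- The gradient of an `L²_loc`-limit of test functions is unique. -/
theorem AdmissibleCoeff.ae_gradient_unique (h : AdmissibleCoeff μ A B) {u : RSpace d → ℝ}
    {F F' : RSpace d → RSpace d} {f f' : ℕ → RSpace d → ℝ}
    (hu : ∀ K, IsCompact K → MemLp u 2 (μ.restrict K))
    (hF : ∀ K, IsCompact K → MemLp F 2 (μ.restrict K))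
    (hF' : ∀ K, IsCompact K → MemLp F' 2 (μ.restrict K))
    (hf : ∀ n, IsTestFun Set.univ (f n)) (hf' : ∀ n, IsTestFun Set.univ (f' n))
    (h1 : ∀ K, IsCompact K →
      Tendsto (fun n => eLpNorm (fun x => u x - f n x) 2 (μ.restrict K)) atTop (𝓝 0))
    (h2 : ∀ K, IsCompact K →
      Tendsto (fun n => eLpNorm (fun x => F x - ∇ (f n) x) 2 (μ.restrict K)) atTop (𝓝 0))
    (h1' : ∀ K, IsCompact K →
      Tendsto (fun n => eLpNorm (fun x => u x - f' n x) 2 (μ.restrict K)) atTop (𝓝 0))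
    (h2' : ∀ K, IsCompact K →
      Tendsto (fun n => eLpNorm (fun x => F' x - ∇ (f' n) x) 2 (μ.restrict K)) atTop (𝓝 0)) :
    F =ᵐ[μ] F' := by
  have := h.finite
  obtain ⟨Λ, hΛ, hlog⟩ := h.logGrad
  -- In the limit, the pairing of the gradient with `ηe` is expressed through `u` alone, whichever
  -- approximating sequence is used.
  have key : ∀ (G : RSpace d → RSpace d) (g : ℕ → RSpace d → ℝ),
      (∀ K, IsCompact K → MemLp G 2 (μ.restrict K)) → (∀ n, IsTestFun Set.univ (g n)) →
      (∀ K, IsCompact K →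
        Tendsto (fun n => eLpNorm (fun x => u x - g n x) 2 (μ.restrict K)) atTop (𝓝 0)) →
      (∀ K, IsCompact K →
        Tendsto (fun n => eLpNorm (fun x => G x - ∇ (g n) x) 2 (μ.restrict K)) atTop (𝓝 0)) →
      ∀ η e, IsTestFun Set.univ η →
        ∫ x, u x * (fderiv ℝ η x e + η x * inner ℝ (Λ x) e) ∂μ =
          - ∫ x, inner ℝ (G x) (η x • e) ∂μ := by
    intro G g hG hg k1 k2 η e hη
    set K := tsupport η with hKdef
    have hK : IsCompact K := hη.compact
    have hηd : Continuous fun x => fderiv ℝ η x e :=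
      (hη.smooth.continuous_fderiv (by simp)).clm_apply continuous_const
    have r1 : ∀ w : RSpace d → ℝ, ∫ x, w x * (fderiv ℝ η x e + η x * inner ℝ (Λ x) e) ∂μ =
        ∫ x, w x * (fderiv ℝ η x e + η x * inner ℝ (Λ x) e) ∂(μ.restrict K) := by
      intro w
      refine (setIntegral_eq_integral_of_forall_compl_eq_zero fun x hx => ?_).symm
      rw [← inner_gradient_eq, gradient_eq_zero_of_notMem_tsupport hx,
        image_eq_zero_of_notMem_tsupport hx]
      simp
    have r2 : ∀ W : RSpace d → RSpace d, ∫ x, inner ℝ (W x) (η x • e) ∂μ =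
        ∫ x, inner ℝ (W x) (η x • e) ∂(μ.restrict K) := by
      intro W
      refine (setIntegral_eq_integral_of_forall_compl_eq_zero fun x hx => ?_).symm
      rw [image_eq_zero_of_notMem_tsupport hx]
      simp
    have m1 : MemLp (fun x => fderiv ℝ η x e + η x * inner ℝ (Λ x) e) 2 (μ.restrict K) :=
      ((hηd.memLp_of_hasCompactSupport (hη.compact.fderiv_apply ℝ e)).add
        ((hΛ.inner_const e).memLp_test_smul hη.smooth.continuous hη.compact)).restrict K
    have m2 : MemLp (fun x => η x • e) 2 (μ.restrict K) :=
      ((hη.smooth.continuous.smul continuous_const).memLp_of_hasCompactSupport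
        hη.compact.smul_right).restrict K
    have t1 := tendsto_integral_mul (hu K hK) m1 (fun n => ((hg n).memLp 2).restrict K)
      (fun _ => m1) (k1 K hK) (eLpNorm_sub_self_tendsto _ _)
    have t2 := tendsto_integral_inner (hG K hK) m2 (fun n => ((hg n).memLp_gradient 2).restrict K)
      (fun _ => m2) (k2 K hK) (eLpNorm_sub_self_tendsto _ _)
    rw [r1, r2]
    refine tendsto_nhds_unique t1 ((t2.neg).congr fun n => ?_)
    rw [← r1, ← r2, (hg n).integral_mul_fderiv hΛ hlog hη]
  have li : ∀ G : RSpace d → RSpace d, (∀ K, IsCompact K → MemLp G 2 (μ.restrict K)) →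
      LocallyIntegrable G μ := by
    intro G hG
    rw [locallyIntegrable_iff]
    intro K hK
    have : IsFiniteMeasure (μ.restrict K) := ⟨by simpa using hK.measure_lt_top⟩
    exact (hG K hK).integrable (by norm_num)
  refine ae_eq_of_integral_contDiff_smul_eq (li F hF) (li F' hF') fun η hη hηc => ?_
  have hη' : IsTestFun Set.univ η := ⟨hη, hηc, Set.subset_univ _⟩
  have iF : ∀ G : RSpace d → RSpace d, LocallyIntegrable G μ → Integrable (fun x => η x • G x) μ := fun G hG =>
    hG.integrable_smul_left_of_hasCompactSupport hη.continuous hηc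
  refine ext_inner_right ℝ fun e => ?_
  have e1 := (key F f hF hf h1 h2 η e hη').symm.trans (key F' f' hF' hf' h1' h2' η e hη')
  rw [real_inner_comm, ← integral_inner (iF F (li F hF)), real_inner_comm e,
    ← integral_inner (iF F' (li F' hF'))]
  rw [neg_inj] at e1
  have c : ∀ (G : RSpace d → RSpace d) x, inner ℝ e (η x • G x) = inner ℝ (G x) (η x • e) :=
    fun G x => by rw [inner_smul_right, inner_smul_right, real_inner_comm]
  simpa only [c] using e1

theorem tendsto_eLpNorm_restrict {E : Type*} [NormedAddCommGroup E] {f : ℕ → RSpace d → E}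
    (h : Tendsto (fun n => eLpNorm (f n) 2 μ) atTop (𝓝 0)) (K : Set (RSpace d)) :
    Tendsto (fun n => eLpNorm (f n) 2 (μ.restrict K)) atTop (𝓝 0) :=
  tendsto_of_tendsto_of_tendsto_of_le_of_le tendsto_const_nhds h (fun _ => zero_le)
    fun _ => eLpNorm_mono_measure _ Measure.restrict_le_self

theorem HasGradZero.ae_unique (h : AdmissibleCoeff μ A B) {V W : Set (RSpace d)} {u : RSpace d → ℝ}
    {F F' : RSpace d → RSpace d} (h1 : HasGradZero μ V u F) (h2 : HasGradZero μ W u F') :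
    F =ᵐ[μ] F' := by
  obtain ⟨hu, hF, f, hf, k1, k2⟩ := h1
  obtain ⟨-, hF', f', hf', k1', k2'⟩ := h2
  exact h.ae_gradient_unique (fun K _ => hu.restrict K) (fun K _ => hF.restrict K)
    (fun K _ => hF'.restrict K) (fun n => (hf n).mono (Set.subset_univ _))
    (fun n => (hf' n).mono (Set.subset_univ _)) (fun K _ => tendsto_eLpNorm_restrict k1 K)
    (fun K _ => tendsto_eLpNorm_restrict k2 K) (fun K _ => tendsto_eLpNorm_restrict k1' K)
    (fun K _ => tendsto_eLpNorm_restrict k2' K)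

/-! ### Chain rule and product rule -/

theorem lipschitz_of_deriv_bound {g : ℝ → ℝ} (hg : ContDiff ℝ ∞ g) {C : ℝ}
    (hC : ∀ t, |deriv g t| ≤ C) (s t : ℝ) : |g s - g t| ≤ C * |s - t| := by
  have := Convex.norm_image_sub_le_of_norm_deriv_le (f := g) (s := Set.univ) (x := t) (y := s)
    (fun x _ => (hg.differentiable (by simp)) x) (fun x _ => hC x) convex_univ trivial trivial
  simpa using this

/-- The difference splits as `g'(fₙ)(F - ∇fₙ) + (g'(u) - g'(fₙ))F`. The first summand is small since
`g'` is bounded; the second by dominated convergence, for which the almost everywhere convergence of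
`fₙ` is needed. -/
theorem tendsto_gradient_comp [IsFiniteMeasureOnCompacts μ] {V : Set (RSpace d)} {u : RSpace d → ℝ}
    {F : RSpace d → RSpace d} {f : ℕ → RSpace d → ℝ} (hu : AEStronglyMeasurable u μ)
    (hF : MemLp F 2 μ) (hf : ∀ n, IsTestFun V (f n))
    (h2 : Tendsto (fun n => eLpNorm (fun x => F x - ∇ (f n) x) 2 μ) atTop (𝓝 0))
    (h3 : ∀ᵐ x ∂μ, Tendsto (fun n => f n x) atTop (𝓝 (u x)))
    {g : ℝ → ℝ} (hg : ContDiff ℝ ∞ g) {C : ℝ} (hC : ∀ t, |deriv g t| ≤ C) :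
    Tendsto (fun n => eLpNorm (fun x => deriv g (u x) • F x - ∇ (fun y => g (f n y)) x) 2 μ)
      atTop (𝓝 0) := by
  have hgd : Continuous (deriv g) := hg.continuous_deriv (by simp)
  have t1 : Tendsto (fun n => eLpNorm (fun x => deriv g (f n x) • (F x - ∇ (f n) x)) 2 μ)
      atTop (𝓝 0) :=
    tendsto_eLpNorm_zero_of_le (C := C) (fun n => Eventually.of_forall fun x => by
      rw [norm_smul]; exact mul_le_mul_of_nonneg_right (hC _) (norm_nonneg _)) h2
  have t2 : Tendsto (fun n => eLpNorm (fun x => (deriv g (u x) - deriv g (f n x)) • F x) 2 μ)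
      atTop (𝓝 0) := by
    refine tendsto_eLpNorm_smul_of_bdd (a := fun n x => deriv g (u x) - deriv g (f n x)) hF
      (fun n => (hgd.comp_aestronglyMeasurable hu).sub
      (hgd.comp_aestronglyMeasurable ((hf n).memLp 2 (μ := μ)).1)) (C := C + C)
      (fun n => Eventually.of_forall fun x => ?_) ?_
    · exact (norm_sub_le _ _).trans (add_le_add (hC _) (hC _))
    · filter_upwards [h3] with x hx
      have := ((hgd.tendsto (u x)).comp hx).const_sub (deriv g (u x))
      simpa using this
  have t3 := tendsto_eLpNorm_zero_add (by norm_num)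
    (fun n => (hgd.comp_aestronglyMeasurable ((hf n).memLp 2 (μ := μ)).1).smul
      (hF.1.sub ((hf n).memLp_gradient 2 (μ := μ)).1))
    (fun n => ((hgd.comp_aestronglyMeasurable hu).sub
      (hgd.comp_aestronglyMeasurable ((hf n).memLp 2 (μ := μ)).1)).smul hF.1) t1 t2
  refine t3.congr fun n => ?_
  congr 1; ext1 x
  rw [(hf n).gradient_comp hg]
  simp only [Pi.smul_apply', Pi.sub_apply]
  module

theorem HasGradZero.comp [IsFiniteMeasureOnCompacts μ] {V : Set (RSpace d)} {u : RSpace d → ℝ}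
    {F : RSpace d → RSpace d} (h : HasGradZero μ V u F) {g : ℝ → ℝ} (hg : ContDiff ℝ ∞ g)
    (h0 : g 0 = 0) {C : ℝ} (hC : ∀ t, |deriv g t| ≤ C) :
    HasGradZero μ V (fun x => g (u x)) (fun x => deriv g (u x) • F x) := by
  have hgd : Continuous (deriv g) := hg.continuous_deriv (by simp)
  have hu := h.1
  have hF := h.2.1
  obtain ⟨f, hf, h1, h2, h3⟩ := h.exists_seq
  have mu : MemLp (fun x => g (u x)) 2 μ := by
    refine hu.of_le_mul (c := C) (hg.continuous.comp_aestronglyMeasurable hu.1)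
      (Eventually.of_forall fun x => ?_)
    have := lipschitz_of_deriv_bound hg hC (u x) 0
    simpa [h0] using this
  have mF : MemLp (fun x => deriv g (u x) • F x) 2 μ :=
    memLp_bdd_smul hF (hgd.comp_aestronglyMeasurable hu.1) (Eventually.of_forall fun x => hC _)
  refine ⟨mu, mF, fun n x => g (f n x), fun n => (hf n).comp hg h0, ?_,
    tendsto_gradient_comp hu.1 hF hf h2 h3 hg hC⟩
  exact tendsto_eLpNorm_zero_of_le (C := C) (fun n => Eventually.of_forall fun x =>
      lipschitz_of_deriv_bound hg hC (u x) (f n x)) h1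

/-- A smooth bounded function which is the identity on `[-M, M]`. -/
theorem exists_smooth_truncation (M : ℝ) : ∃ g : ℝ → ℝ, ContDiff ℝ ∞ g ∧ g 0 = 0 ∧
    (∃ C, ∀ t, |deriv g t| ≤ C) ∧ (∃ C, ∀ t, |g t| ≤ C) ∧ (∀ t, |t| ≤ M → g t = t) ∧
    ∀ t, |t| ≤ M → deriv g t = 1 := by
  let b : ContDiffBump (0 : ℝ) := ⟨|M| + 1, |M| + 2, by positivity, by linarith⟩
  have hs : ContDiff ℝ ∞ fun t => t * b t := contDiff_id.mul b.contDiff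
  have hc : HasCompactSupport fun t => t * b t := b.hasCompactSupport.mul_left
  refine ⟨fun t => t * b t, hs, by simp, ?_, ?_, fun t ht => ?_, fun t ht => ?_⟩
  · obtain ⟨C, hC⟩ := (hc.deriv).exists_bound_of_continuous (hs.continuous_deriv (by simp))
    exact ⟨C, hC⟩
  · obtain ⟨C, hC⟩ := hc.exists_bound_of_continuous hs.continuous
    exact ⟨C, hC⟩
  · have : b t = 1 := b.one_of_mem_closedBall (by
      simp only [Metric.mem_closedBall, dist_zero_right, Real.norm_eq_abs, b]
      linarith [le_abs_self M])
    simp [this]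
  · have hev : (fun t => t * b t) =ᶠ[𝓝 t] fun t => t := by
      filter_upwards [Metric.ball_mem_nhds t one_pos] with s hs
      have hst : |s| ≤ |t| + 1 := by
        have : |s - t| < 1 := by simpa [Real.dist_eq] using hs
        have h3 := abs_sub_abs_le_abs_sub s t
        linarith
      have : b s = 1 := b.one_of_mem_closedBall (by
        simp only [Metric.mem_closedBall, dist_zero_right, Real.norm_eq_abs, b]
        linarith [le_abs_self M])
      simp [this]
    rw [hev.deriv_eq]; simp

theorem exists_ae_bound {α : Type*} [MeasurableSpace α] {ν : Measure α} {u : α → ℝ}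
    (hu : MemLp u ∞ ν) : ∃ M, 0 ≤ M ∧ ∀ᵐ x ∂ν, |u x| ≤ M := by
  have h := hu.2
  rw [eLpNorm_exponent_top] at h
  refine ⟨(eLpNormEssSup u ν).toReal, ENNReal.toReal_nonneg, ?_⟩
  filter_upwards [ae_le_eLpNormEssSup (f := u) (μ := ν)] with x hx
  rw [← Real.norm_eq_abs, ← toReal_enorm]
  exact ENNReal.toReal_mono h.ne hx

theorem memLp_top_of_ae_bound {α : Type*} [MeasurableSpace α] {ν : Measure α} {u : α → ℝ}
    (hu : AEStronglyMeasurable u ν) {M : ℝ} (h : ∀ᵐ x ∂ν, |u x| ≤ M) : MemLp u ∞ ν :=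
  memLp_top_of_bound hu M h

/-- Bounded elements of `H₀^{1,2}(V, μ)` have uniformly bounded approximating sequences. -/
theorem HasGradZero.exists_bdd_seq [IsFiniteMeasureOnCompacts μ] {V : Set (RSpace d)}
    {u : RSpace d → ℝ} {F : RSpace d → RSpace d} (h : HasGradZero μ V u F) (hb : MemLp u ∞ μ) :
    ∃ (f : ℕ → RSpace d → ℝ) (C : ℝ), (∀ n, IsTestFun V (f n)) ∧ (∀ n x, |f n x| ≤ C) ∧
      Tendsto (fun n => eLpNorm (fun x => u x - f n x) 2 μ) atTop (𝓝 0) ∧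
      Tendsto (fun n => eLpNorm (fun x => F x - ∇ (f n) x) 2 μ) atTop (𝓝 0) ∧
      ∀ᵐ x ∂μ, Tendsto (fun n => f n x) atTop (𝓝 (u x)) := by
  obtain ⟨M, -, hM⟩ := exists_ae_bound hb
  obtain ⟨g, hg, g0, ⟨C, hC⟩, ⟨C', hC'⟩, hg1, hg2⟩ := exists_smooth_truncation M
  obtain ⟨f, hf, h1, h2, h3⟩ := h.exists_seq
  refine ⟨fun n x => g (f n x), C', fun n => (hf n).comp hg g0, fun n x => hC' _, ?_, ?_, ?_⟩
  · refine tendsto_eLpNorm_zero_of_le (C := C) (fun n => ?_) h1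
    filter_upwards [hM] with x hx
    have := lipschitz_of_deriv_bound hg hC (u x) (f n x)
    rwa [hg1 _ hx] at this
  · refine (tendsto_gradient_comp h.1.1 h.2.1 hf h2 h3 hg hC).congr fun n =>
      eLpNorm_congr_ae ?_
    filter_upwards [hM] with x hx
    rw [hg2 _ hx, one_smul]
  · filter_upwards [h3, hM] with x hx hxM
    have := (hg.continuous.tendsto (u x)).comp hx
    rwa [hg1 _ hxM] at this

/-- The product rule in `H₀^{1,2}`. -/
theorem HasGradZero.mul [IsFiniteMeasureOnCompacts μ] {V W : Set (RSpace d)}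
    {u v : RSpace d → ℝ} {F H : RSpace d → RSpace d} (hu : HasGradZero μ V u F)
    (hub : MemLp u ∞ μ) (hv : HasGradZero μ W v H) (hvb : MemLp v ∞ μ) :
    HasGradZero μ (V ∩ W) (fun x => u x * v x) (fun x => u x • H x + v x • F x) := by
  obtain ⟨M, -, hM⟩ := exists_ae_bound hub
  obtain ⟨N, -, hN⟩ := exists_ae_bound hvb
  obtain ⟨f, C, hf, hfC, f1, f2, f3⟩ := hu.exists_bdd_seq hub
  obtain ⟨g, D, hg, hgD, g1, g2, g3⟩ := hv.exists_bdd_seq hvb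
  have mF := hu.2.1
  have mH := hv.2.1
  have mf : ∀ n, AEStronglyMeasurable (f n) μ := fun n => ((hf n).memLp 2 (μ := μ)).1
  have mg : ∀ n, AEStronglyMeasurable (g n) μ := fun n => ((hg n).memLp 2 (μ := μ)).1
  have mgf : ∀ n, AEStronglyMeasurable (∇ (f n)) μ := fun n => ((hf n).memLp_gradient 2 (μ := μ)).1
  have mgg : ∀ n, AEStronglyMeasurable (∇ (g n)) μ := fun n => ((hg n).memLp_gradient 2 (μ := μ)).1
  -- The two summands of the product rule are symmetric. Each splits as `fₙ(H - ∇gₙ) + (u - fₙ)H`,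
  -- and uniform boundedness of `fₙ` controls both pieces.
  have half : ∀ {V W : Set (RSpace d)} {u v : RSpace d → ℝ} {H : RSpace d → RSpace d}
      {f g : ℕ → RSpace d → ℝ} {M C : ℝ}, AEStronglyMeasurable u μ → MemLp H 2 μ →
      (∀ᵐ x ∂μ, |u x| ≤ M) → (∀ n, IsTestFun V (f n)) → (∀ n, IsTestFun W (g n)) →
      (∀ n x, |f n x| ≤ C) →
      Tendsto (fun n => eLpNorm (fun x => H x - ∇ (g n) x) 2 μ) atTop (𝓝 0) →
      (∀ᵐ x ∂μ, Tendsto (fun n => f n x) atTop (𝓝 (u x))) →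
      Tendsto (fun n => eLpNorm (fun x => u x • H x - f n x • ∇ (g n) x) 2 μ) atTop (𝓝 0) := by
    intro V W u v H f g M C hu hH hM hf hg hC h2 h3
    have mf : ∀ n, AEStronglyMeasurable (f n) μ := fun n => ((hf n).memLp 2 (μ := μ)).1
    have mgg : ∀ n, AEStronglyMeasurable (∇ (g n)) μ := fun n =>
      ((hg n).memLp_gradient 2 (μ := μ)).1
    have t1 : Tendsto (fun n => eLpNorm (fun x => f n x • (H x - ∇ (g n) x)) 2 μ) atTop (𝓝 0) :=
      tendsto_eLpNorm_zero_of_le (C := C) (fun n => Eventually.of_forall fun x => by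
        rw [norm_smul]; exact mul_le_mul_of_nonneg_right (hC n x) (norm_nonneg _)) h2
    have t2 : Tendsto (fun n => eLpNorm (fun x => (u x - f n x) • H x) 2 μ) atTop (𝓝 0) := by
      refine tendsto_eLpNorm_smul_of_bdd (a := fun n x => u x - f n x) hH
        (fun n => hu.sub (mf n)) (C := M + C) (fun n => ?_) ?_
      · filter_upwards [hM] with x hx
        exact (norm_sub_le _ _).trans (add_le_add hx (hC n x))
      · filter_upwards [h3] with x hx
        simpa using hx.const_sub (u x)
    refine (tendsto_eLpNorm_zero_add (by norm_num) (fun n => (mf n).smul (hH.1.sub (mgg n)))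
      (fun n => (hu.sub (mf n)).smul hH.1) t1 t2).congr fun n => ?_
    congr 1; ext1 x
    simp only [Pi.smul_apply', Pi.sub_apply]
    module
  have k1 := half (v := v) hu.1.1 mH hM hf hg hfC g2 f3
  have k2 := half (v := u) hv.1.1 mF hN hg hf hgD f2 g3
  refine ⟨memLp_mul_bdd hu.1 hv.1.1 hN, (memLp_bdd_smul mH hu.1.1 hM).add
    (memLp_bdd_smul mF hv.1.1 hN), fun n x => f n x * g n x, fun n => (hf n).mul (hg n), ?_, ?_⟩
  · have t1 : Tendsto (fun n => eLpNorm (fun x => f n x * (v x - g n x)) 2 μ) atTop (𝓝 0) :=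
      tendsto_eLpNorm_zero_of_le (C := C) (fun n => Eventually.of_forall fun x => by
        rw [norm_mul]; exact mul_le_mul_of_nonneg_right (hfC n x) (norm_nonneg _)) g1
    have t2 : Tendsto (fun n => eLpNorm (fun x => v x * (u x - f n x)) 2 μ) atTop (𝓝 0) := by
      refine tendsto_eLpNorm_zero_of_le (C := N) (fun n => ?_) f1
      filter_upwards [hN] with x hx
      rw [norm_mul]; exact mul_le_mul_of_nonneg_right hx (norm_nonneg _)
    refine (tendsto_eLpNorm_zero_add (by norm_num) (fun n => (mf n).mul (hv.1.1.sub (mg n)))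
      (fun n => hv.1.1.mul (hu.1.1.sub (mf n))) t1 t2).congr fun n => ?_
    congr 1; ext1 x
    simp only [Pi.mul_apply, Pi.sub_apply]
    ring
  · refine (tendsto_eLpNorm_zero_add (by norm_num)
      (fun n => (hu.1.1.smul mH.1).sub ((mf n).smul (mgg n)))
      (fun n => (hv.1.1.smul mF.1).sub ((mg n).smul (mgf n))) k1 k2).congr fun n => ?_
    congr 1; ext1 x
    rw [gradient_mul_test (hf n) (hg n)]
    simp only [Pi.smul_apply', Pi.sub_apply]
    module

end

/-! ### Lions' projection theorem. -/

noncomputable section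

/-- Lions' projection theorem: a form that is coercive on a subspace `S` of test vectors, and
continuous in its other argument, represents every bounded functional. -/
theorem exists_inner_eq_of_coercive {H : Type*} [NormedAddCommGroup H] [InnerProductSpace ℝ H]
    [CompleteSpace H] (S : Submodule ℝ H) (Z : S →ₗ[ℝ] H) {c : ℝ} (hc : 0 < c)
    (hZ : ∀ v : S, c * ‖(v : H)‖ ^ 2 ≤ inner ℝ (v : H) (Z v)) (l : H →L[ℝ] ℝ) :
    ∃ u ∈ S.topologicalClosure, ∀ v : S, inner ℝ u (Z v) = l v := by
  let K := S.topologicalClosure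
  have : CompleteSpace K := S.isClosed_topologicalClosure.completeSpace_coe
  -- Only vectors of `K` are paired with `Z v`, so `Z` may be projected to `K`. Coercivity then
  -- makes `T` bounded below.
  let T : S →ₗ[ℝ] K := K.orthogonalProjectionOnto.toLinearMap ∘ₗ Z
  have hT : ∀ (u : K) (v : S), inner ℝ (u : H) (Z v) = inner ℝ u (T v) := fun u v => by
    rw [real_inner_comm, real_inner_comm (T v)]
    exact (Submodule.inner_orthogonalProjectionOnto_eq_of_mem_right u (Z v)).symm
  have hb : ∀ v : S, c * ‖(v : H)‖ ≤ ‖T v‖ := by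
    intro v
    have h1 := hZ v
    have hvK : (v : H) ∈ K := S.le_topologicalClosure v.2
    rw [hT ⟨v, hvK⟩ v] at h1
    have h2 : inner ℝ (⟨v, hvK⟩ : K) (T v) ≤ ‖(v : H)‖ * ‖T v‖ := real_inner_le_norm _ _
    rcases (norm_nonneg (v : H)).eq_or_lt with h0 | h0
    · rw [← h0]; simp
    · have : ‖(v : H)‖ * (c * ‖(v : H)‖) ≤ ‖(v : H)‖ * ‖T v‖ := by nlinarith
      exact le_of_mul_le_mul_left this h0
  have hinj : Function.Injective T := by
    rw [injective_iff_map_eq_zero]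
    intro v hv
    have := hb v
    rw [hv, norm_zero] at this
    have h3 : ‖(v : H)‖ ≤ 0 := by
      by_contra hlt
      push Not at hlt
      nlinarith
    exact Subtype.ext (norm_le_zero_iff.1 h3)
  let e := LinearEquiv.ofInjective T hinj
  -- The functional `T v ↦ l v` is well defined and bounded because `T` is bounded below.
  -- Hahn–Banach extends it to `K`, and its Riesz representative is the solution.
  let g : LinearMap.range T →ₗ[ℝ] ℝ := (l.toLinearMap ∘ₗ S.subtype) ∘ₗ e.symm.toLinearMap
  have hg : ∀ y, ‖g y‖ ≤ (‖l‖ / c) * ‖y‖ := by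
    intro y
    obtain ⟨v, rfl⟩ := e.surjective y
    have h1 : g (e v) = l v := by simp [g]
    have h2 : ‖e v‖ = ‖T v‖ := rfl
    rw [h1, h2, div_mul_eq_mul_div, le_div_iff₀ hc]
    calc ‖l v‖ * c ≤ (‖l‖ * ‖(v : H)‖) * c := by gcongr; exact l.le_opNorm _
      _ = ‖l‖ * (c * ‖(v : H)‖) := by ring
      _ ≤ ‖l‖ * ‖T v‖ := by gcongr; exact hb v
  obtain ⟨G, hG, -⟩ := exists_extension_norm_eq (LinearMap.range T) (g.mkContinuous _ hg)
  refine ⟨((InnerProductSpace.toDual ℝ K).symm G : K), Subtype.mem _, fun v => ?_⟩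
  rw [hT, InnerProductSpace.toDual_symm_apply]
  have h1 := hG (e v)
  have h2 : ((e v : LinearMap.range T) : K) = T v := rfl
  rw [h2] at h1
  rw [h1]
  simp [g]

variable {d : ℕ} {μ : Measure (RSpace d)} {A : RSpace d → Matrix (Fin d) (Fin d) ℝ}
  {B : RSpace d → RSpace d} {V W : Set (RSpace d)} {u v : RSpace d → ℝ}
  {F H : RSpace d → RSpace d} {h : RSpace d → ℝ}

/-! ### The energy and the drift on `H₀^{1,2}(V, μ)`. -/

theorem energy_eq_integral_inner (F H : RSpace d → RSpace d) :
    energy μ A F H = (1 / 2) * ∫ x, inner ℝ (matVec (A x) (F x)) (H x) ∂μ := by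
  simp only [energy, inner_matVec]

theorem AdmissibleCoeff.energy_symm (hc : AdmissibleCoeff μ A B) (F H : RSpace d → RSpace d) :
    energy μ A F H = energy μ A H F := by
  unfold energy
  congr 1
  refine integral_congr_ae ?_
  filter_upwards [hc.symm] with x hx
  exact matInner_symm hx _ _

theorem AdmissibleCoeff.energy_nonneg (hc : AdmissibleCoeff μ A B) (F : RSpace d → RSpace d) :
    0 ≤ energy μ A F F := by
  unfold energy
  refine mul_nonneg (by norm_num) (integral_nonneg_of_ae ?_)
  filter_upwards [hc.ae_nonneg] with x hx
  exact hx _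

theorem HasGradZero.memLp_matVec (hc : AdmissibleCoeff μ A B) (hV : IsCompact (closure V))
    (hu : HasGradZero μ V u F) : MemLp (fun x => matVec (A x) (F x)) 2 μ := by
  have := hc.finite
  exact hc.memLp_matVec hV hu.2.1 (hu.ae_eq_zero.mono fun x hx hxV => (hx hxV).2)

theorem HasGradZero.integrable_matInner (hc : AdmissibleCoeff μ A B) (hV : IsCompact (closure V))
    (hu : HasGradZero μ V u F) (hH : MemLp H 2 μ) :
    Integrable (fun x => matInner (A x) (F x) (H x)) μ := by
  simp only [← inner_matVec]
  exact integrable_inner_of_memLp (hu.memLp_matVec hc hV) hH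

theorem HasGradZero.energy_add_right (hc : AdmissibleCoeff μ A B) (hV : IsCompact (closure V))
    (hu : HasGradZero μ V u F) {H H' : RSpace d → RSpace d} (hH : MemLp H 2 μ)
    (hH' : MemLp H' 2 μ) :
    energy μ A F (fun x => H x + H' x) = energy μ A F H + energy μ A F H' := by
  unfold energy
  simp only [matInner_add_right]
  rw [integral_add (hu.integrable_matInner hc hV hH) (hu.integrable_matInner hc hV hH')]
  ring

theorem energy_smul_right (c : ℝ) (F H : RSpace d → RSpace d) :
    energy μ A F (fun x => c • H x) = c * energy μ A F H := by
  unfold energy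
  simp only [matInner_smul_right, integral_const_mul]
  ring

theorem energy_smul_left (c : ℝ) (F H : RSpace d → RSpace d) :
    energy μ A (fun x => c • F x) H = c * energy μ A F H := by
  unfold energy
  simp only [matInner_smul_left, integral_const_mul]
  ring

theorem HasGradZero.energy_sub_right (hc : AdmissibleCoeff μ A B) (hV : IsCompact (closure V))
    (hu : HasGradZero μ V u F) {H H' : RSpace d → RSpace d} (hH : MemLp H 2 μ)
    (hH' : MemLp H' 2 μ) :
    energy μ A F (fun x => H x - H' x) = energy μ A F H - energy μ A F H' := by
  unfold energy
  simp only [matInner_sub_right]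
  rw [integral_sub (hu.integrable_matInner hc hV hH) (hu.integrable_matInner hc hV hH')]
  ring

theorem AdmissibleCoeff.integrable_inner_drift (hc : AdmissibleCoeff μ A B)
    (hV : IsCompact (closure V)) (hF : MemLp F 2 μ) (h0 : ∀ᵐ x ∂μ, x ∉ V → F x = 0) :
    Integrable (fun x => inner ℝ (B x) (F x)) μ := by
  have h1 : IntegrableOn (fun x => inner ℝ (B x) (F x)) (closure V) μ :=
    integrable_inner_of_memLp (hc.drift (closure V) (by simpa using hV)) (hF.restrict _)
  refine h1.integrable_of_ae_notMem_eq_zero ?_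
  filter_upwards [h0] with x hx hxV
  rw [hx fun h => hxV (subset_closure h), inner_zero_right]

theorem HasGradZero.integrable_inner_drift (hc : AdmissibleCoeff μ A B)
    (hV : IsCompact (closure V)) (hu : HasGradZero μ V u F) :
    Integrable (fun x => inner ℝ (B x) (F x)) μ := by
  have := hc.finite
  exact hc.integrable_inner_drift hV hu.2.1 (hu.ae_eq_zero.mono fun x hx hxV => (hx hxV).2)

/-- The drift has divergence zero, tested with elements of `H₀^{1,2}(V, μ)`. -/
theorem HasGradZero.integral_inner_drift (hc : AdmissibleCoeff μ A B)
    (hV : IsCompact (closure V)) (hu : HasGradZero μ V u F) :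
    ∫ x, inner ℝ (B x) (F x) ∂μ = 0 := by
  have := hc.finite
  have h0 := hu.ae_eq_zero
  obtain ⟨hu2, hF, f, hf, h1, h2⟩ := hu
  have hBm := hc.drift (closure V) (by simpa using hV)
  have t := tendsto_integral_inner hBm (hF.restrict (closure V)) (fun _ => hBm)
    (fun n => ((hf n).memLp_gradient 2).restrict (closure V)) (eLpNorm_sub_self_tendsto _ _)
    (tendsto_eLpNorm_restrict h2 _)
  have e : ∀ n, ∫ x in closure V, inner ℝ (B x) (∇ (f n) x) ∂μ = 0 := by
    intro n
    rw [setIntegral_eq_integral_of_forall_compl_eq_zero,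
      hc.divFree _ ((hf n).mono (Set.subset_univ _))]
    intro x hx
    rw [gradient_eq_zero_of_notMem_tsupport fun h => hx (subset_closure ((hf n).subset h)),
      inner_zero_right]
  simp_rw [e] at t
  rw [← tendsto_nhds_unique t tendsto_const_nhds]
  refine (setIntegral_eq_integral_of_ae_compl_eq_zero ?_).symm
  filter_upwards [h0] with x hx hxV
  rw [(hx fun h => hxV (subset_closure h)).2, inner_zero_right]

theorem measure_lt_top_of_isCompact_closure [IsFiniteMeasureOnCompacts μ]
    (hV : IsCompact (closure V)) : μ V < ⊤ :=
  (measure_mono subset_closure).trans_lt hV.measure_lt_top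

theorem integrable_of_memLp_of_support [IsFiniteMeasureOnCompacts μ] (hV : IsCompact (closure V))
    {p : ℝ≥0∞} (hp : 1 ≤ p) (hu : MemLp u p μ) (h0 : ∀ᵐ x ∂μ, x ∉ V → u x = 0) :
    Integrable u μ := by
  have : IsFiniteMeasure (μ.restrict (closure V)) := ⟨by simpa using hV.measure_lt_top⟩
  have h1 : IntegrableOn u (closure V) μ := (hu.restrict _).integrable hp
  refine h1.integrable_of_ae_notMem_eq_zero ?_
  filter_upwards [h0] with x hx hxV using hx fun h => hxV (subset_closure h)

theorem HasGradZero.integrable [IsFiniteMeasureOnCompacts μ] (hV : IsCompact (closure V))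
    (hu : HasGradZero μ V u F) : Integrable u μ :=
  integrable_of_memLp_of_support hV (by norm_num) hu.1 (hu.ae_eq_zero.mono fun _ h k => (h k).1)

theorem integrable_mul_bdd {α : Type*} [MeasurableSpace α] {ν : Measure α} {f g : α → ℝ}
    (hf : Integrable f ν) (hg : MemLp g ∞ ν) : Integrable (fun x => f x * g x) ν := by
  obtain ⟨M, -, hM⟩ := exists_ae_bound hg
  exact hf.mul_bdd hg.1 hM

/-! ### Weak solutions on a relatively compact open set. -/

/-- `u ∈ H₀^{1,2}(V, μ)`, with gradient `F`, solves `L⁰ u + ⟨B, ∇u⟩ = h` weakly on `V`. -/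
structure WeakSol (μ : Measure (RSpace d)) (A : RSpace d → Matrix (Fin d) (Fin d) ℝ)
    (B : RSpace d → RSpace d) (V : Set (RSpace d)) (u : RSpace d → ℝ) (F : RSpace d → RSpace d)
    (h : RSpace d → ℝ) : Prop where
  grad : HasGradZero μ V u F
  int : Integrable h μ
  supp : ∀ᵐ x ∂μ, x ∉ V → h x = 0
  eq : ∀ v H, HasGradZero μ V v H → MemLp v ∞ μ →
    energy μ A F H - ∫ x, inner ℝ (B x) (F x) * v x ∂μ = - ∫ x, h x * v x ∂μ

/-- It suffices to test weak solutions with smooth functions. -/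
theorem WeakSol.of_test (hc : AdmissibleCoeff μ A B) (hV : IsCompact (closure V))
    (hu : HasGradZero μ V u F) (hh : Integrable h μ) (h0 : ∀ᵐ x ∂μ, x ∉ V → h x = 0)
    (heq : ∀ v, IsTestFun V v →
      energy μ A F (∇ v) - ∫ x, inner ℝ (B x) (F x) * v x ∂μ = - ∫ x, h x * v x ∂μ) :
    WeakSol μ A B V u F h := by
  have := hc.finite
  refine ⟨hu, hh, h0, fun v H hv hvb => ?_⟩
  obtain ⟨f, C, hf, hC, h1, h2, h3⟩ := hv.exists_bdd_seq hvb
  have t1 : Tendsto (fun n => energy μ A F (∇ (f n))) atTop (𝓝 (energy μ A F H)) := by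
    simp only [energy_eq_integral_inner]
    have hm := hu.memLp_matVec hc hV
    exact (tendsto_integral_inner hm hv.2.1 (fun _ => hm) (fun n => (hf n).memLp_gradient 2)
      (eLpNorm_sub_self_tendsto _ _) h2).const_mul _
  -- The factors `⟨B, F⟩` and `h` are merely integrable, so `L²` convergence of the test functions
  -- is not enough; their uniform bound permits dominated convergence.
  have dct : ∀ g : RSpace d → ℝ, Integrable g μ →
      Tendsto (fun n => ∫ x, g x * f n x ∂μ) atTop (𝓝 (∫ x, g x * v x ∂μ)) := by
    intro g hg
    refine tendsto_integral_of_dominated_convergence (fun x => ‖g x‖ * C)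
      (fun n => hg.1.mul ((hf n).memLp 2 (μ := μ)).1) (hg.norm.mul_const C)
      (fun n => Eventually.of_forall fun x => ?_) ?_
    · rw [norm_mul]; gcongr; exact hC n x
    · filter_upwards [h3] with x hx using hx.const_mul _
  refine tendsto_nhds_unique (t1.sub (dct _ (hu.integrable_inner_drift hc hV))) ?_
  refine ((dct h hh).neg).congr fun n => (heq _ (hf n)).symm

theorem inner_pair (z : PairSpace μ) {v : RSpace d → ℝ} {H : RSpace d → RSpace d}
    (hv : MemLp v 2 μ) (hH : MemLp H 2 μ) {u : RSpace d → ℝ} {F : RSpace d → RSpace d}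
    (h1 : z.fst =ᵐ[μ] u) (h2 : z.snd =ᵐ[μ] F) :
    inner ℝ z (mkPair hv hH) = (∫ x, u x * v x ∂μ) + ∫ x, inner ℝ (F x) (H x) ∂μ := by
  rw [WithLp.prod_inner_apply, L2.inner_def, L2.inner_def]
  congr 1
  · refine integral_congr_ae ?_
    filter_upwards [h1, hv.coeFn_toLp] with x k1 k2
    have k3 : (mkPair hv hH).fst x = v x := k2
    have k4 : z.fst x = u x := k1
    change inner ℝ (z.fst x) ((mkPair hv hH).fst x) = _
    rw [k3, k4]; simp [mul_comm]
  · refine integral_congr_ae ?_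
    filter_upwards [h2, hH.coeFn_toLp] with x k1 k2
    have k3 : (mkPair hv hH).snd x = H x := k2
    change inner ℝ (z.snd x) ((mkPair hv hH).snd x) = _
    rw [k3, k1]

/-- Lax–Milgram is not available, because `⟨B, ∇u⟩ v` need not be integrable for unbounded `v`.
Lions' theorem needs boundedness only in `u` for each fixed smooth `v`. Coercivity on test functions
holds since the drift vanishes on the diagonal. -/
theorem exists_weakSol (hc : AdmissibleCoeff μ A B) (hV : IsCompact (closure V)) {α : ℝ}
    (hα : 0 < α) {f : RSpace d → ℝ} (hf : MemLp f 2 μ) (hf0 : ∀ᵐ x ∂μ, x ∉ V → f x = 0) :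
    ∃ u F, WeakSol μ A B V u F (fun x => α * u x - f x) := by
  have := hc.finite
  have hsnd : ∀ z : testPairs μ V, ∃ g, IsTestFun V g ∧ (z : PairSpace μ).fst =ᵐ[μ] g ∧
    (z : PairSpace μ).snd =ᵐ[μ] ∇ g := fun z => z.2
  have m1 : ∀ z : testPairs μ V, MemLp (fun x => α * (z : PairSpace μ).fst x) 2 μ := fun z =>
    (Lp.memLp _).const_mul α
  have m2 : ∀ z : testPairs μ V, MemLp (fun x => (1 / 2 : ℝ) • matVec (A x) ((z : PairSpace μ).snd x)
      - (z : PairSpace μ).fst x • B x) 2 μ := by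
    intro z
    obtain ⟨g, hg, h1, h2⟩ := hsnd z
    have h3 : MemLp (fun x => matVec (A x) ((z : PairSpace μ).snd x)) 2 μ := by
      refine (memLp_congr_ae ?_).1 (hg.hasGradZero.memLp_matVec hc hV)
      filter_upwards [h2] with x hx
      rw [hx]
    have h4 : MemLp (fun x => (z : PairSpace μ).fst x • B x) 2 μ := by
      refine (memLp_congr_ae ?_).1 (hc.drift.memLp_test_smul hg.smooth.continuous hg.compact)
      filter_upwards [h1] with x hx
      rw [hx]
    exact (h3.const_smul (1 / 2 : ℝ)).sub h4
  -- `Z` sends `(g, ∇g)` to `(αg, ½A∇g - gB)`, so that pairing `(w, K)` with it gives the full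
  -- bilinear form. The entry `gB` is square integrable because `g` is bounded with compact support.
  let Z : testPairs μ V →ₗ[ℝ] PairSpace μ :=
    { toFun := fun z => mkPair (m1 z) (m2 z)
      map_add' := by
        intro z y
        apply (WithLp.equiv 2 _).injective
        refine Prod.ext (Lp.ext ?_) (Lp.ext ?_)
        · refine (m1 (z + y)).coeFn_toLp.trans (EventuallyEq.trans ?_ (Lp.coeFn_add _ _).symm)
          filter_upwards [(m1 z).coeFn_toLp, (m1 y).coeFn_toLp,
            Lp.coeFn_add (z : PairSpace μ).fst (y : PairSpace μ).fst] with x k1 k2 k3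
          refine Eq.trans ?_ (congrArg₂ (· + ·) k1 k2).symm
          change α * ((z : PairSpace μ).fst + (y : PairSpace μ).fst : Lp ℝ 2 μ) x = _
          rw [k3, Pi.add_apply]; ring
        · refine (m2 (z + y)).coeFn_toLp.trans (EventuallyEq.trans ?_ (Lp.coeFn_add _ _).symm)
          filter_upwards [(m2 z).coeFn_toLp, (m2 y).coeFn_toLp,
            Lp.coeFn_add (z : PairSpace μ).fst (y : PairSpace μ).fst,
            Lp.coeFn_add (z : PairSpace μ).snd (y : PairSpace μ).snd] with x k1 k2 k3 k4
          refine Eq.trans ?_ (congrArg₂ (· + ·) k1 k2).symm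
          change (1 / 2 : ℝ) • matVec (A x) (((z : PairSpace μ).snd + (y : PairSpace μ).snd :
              Lp (RSpace d) 2 μ) x) - ((z : PairSpace μ).fst + (y : PairSpace μ).fst : Lp ℝ 2 μ) x • B x = _
          rw [k3, k4, Pi.add_apply, Pi.add_apply, matVec_add]
          module
      map_smul' := by
        intro c z
        apply (WithLp.equiv 2 _).injective
        refine Prod.ext (Lp.ext ?_) (Lp.ext ?_)
        · refine (m1 (c • z)).coeFn_toLp.trans (EventuallyEq.trans ?_ (Lp.coeFn_smul _ _).symm)
          filter_upwards [(m1 z).coeFn_toLp, Lp.coeFn_smul c (z : PairSpace μ).fst] with x k1 k3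
          refine Eq.trans ?_ (congrArg (c • ·) k1).symm
          change α * (c • (z : PairSpace μ).fst : Lp ℝ 2 μ) x = _
          rw [k3, Pi.smul_apply, smul_eq_mul, smul_eq_mul]; ring
        · refine (m2 (c • z)).coeFn_toLp.trans (EventuallyEq.trans ?_ (Lp.coeFn_smul _ _).symm)
          filter_upwards [(m2 z).coeFn_toLp, Lp.coeFn_smul c (z : PairSpace μ).fst,
            Lp.coeFn_smul c (z : PairSpace μ).snd] with x k1 k3 k4
          refine Eq.trans ?_ (congrArg (c • ·) k1).symm
          change (1 / 2 : ℝ) • matVec (A x) ((c • (z : PairSpace μ).snd :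
              Lp (RSpace d) 2 μ) x) - (c • (z : PairSpace μ).fst : Lp ℝ 2 μ) x • B x = _
          rw [k3, k4, Pi.smul_apply, Pi.smul_apply, matVec_smul, smul_eq_mul]
          module }
  have hZdef : ∀ z, Z z = mkPair (m1 z) (m2 z) := fun _ => rfl
  have hZ : ∀ (y : PairSpace μ) (w : RSpace d → ℝ) (K : RSpace d → RSpace d), HasGradZero μ V w K →
      y.fst =ᵐ[μ] w → y.snd =ᵐ[μ] K → ∀ (z : testPairs μ V) (g : RSpace d → ℝ), IsTestFun V g →
      (z : PairSpace μ).fst =ᵐ[μ] g → (z : PairSpace μ).snd =ᵐ[μ] ∇ g →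
      inner ℝ y (Z z) = α * (∫ x, w x * g x ∂μ) + energy μ A K (∇ g) -
        ∫ x, inner ℝ (B x) (K x) * g x ∂μ := by
    intro y w K hw h1 h2 z g hg h3 h4
    rw [hZdef, inner_pair _ _ _ h1 h2]
    have e1 : ∫ x, w x * (α * (z : PairSpace μ).fst x) ∂μ = α * ∫ x, w x * g x ∂μ := by
      rw [← integral_const_mul]
      refine integral_congr_ae ?_
      filter_upwards [h3] with x hx
      rw [hx]; ring
    have e2 : ∫ x, inner ℝ (K x) ((1 / 2 : ℝ) • matVec (A x) ((z : PairSpace μ).snd x)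
        - (z : PairSpace μ).fst x • B x) ∂μ = energy μ A K (∇ g) -
        ∫ x, inner ℝ (B x) (K x) * g x ∂μ := by
      unfold energy
      rw [← integral_const_mul, ← integral_sub]
      · refine integral_congr_ae ?_
        filter_upwards [h3, h4, hc.symm] with x hx hy hs
        rw [hx, hy, inner_sub_right, inner_smul_right, inner_smul_right, real_inner_comm,
          inner_matVec, matInner_symm hs, real_inner_comm (B x)]
        ring
      · exact (hw.integrable_matInner hc hV (hg.memLp_gradient 2)).const_mul _
      · exact integrable_mul_bdd (hw.integrable_inner_drift hc hV) (hg.memLp ∞)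
    rw [e1, e2]; ring
  obtain ⟨ν, hν, hell⟩ := hc.bounds hV
  have hcoer : ∀ z : testPairs μ V, min α (ν⁻¹ / 2) * ‖(z : PairSpace μ)‖ ^ 2 ≤
      inner ℝ (z : PairSpace μ) (Z z) := by
    intro z
    obtain ⟨g, hg, h1, h2⟩ := hsnd z
    rw [hZ _ g (∇ g) hg.hasGradZero h1 h2 z g hg h1 h2]
    have hz : mkPair (hg.memLp 2 (μ := μ)) (hg.memLp_gradient 2) = (z : PairSpace μ) := by
      apply (WithLp.equiv 2 _).injective
      exact Prod.ext (Lp.ext ((hg.memLp 2).coeFn_toLp.trans h1.symm))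
        (Lp.ext ((hg.memLp_gradient 2).coeFn_toLp.trans h2.symm))
    have e1 : ‖(z : PairSpace μ)‖ ^ 2 = (∫ x, g x * g x ∂μ) +
        ∫ x, inner ℝ (∇ g x) (∇ g x) ∂μ := by
      rw [← real_inner_self_eq_norm_sq]
      nth_rw 2 [← hz]
      exact inner_pair _ _ _ h1 h2
    -- Twice the integrand is `⟨B, ∇(g²)⟩`, and `g²` is again a test function.
    have e2 : ∫ x, inner ℝ (B x) (∇ g x) * g x ∂μ = 0 := by
      have h3 := hc.divFree _ (by simpa using (hg.mul hg).mono (Set.subset_univ _))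
      simp_rw [gradient_mul_test hg hg, inner_add_right, inner_smul_right] at h3
      have h4 : ∫ x, (g x * inner ℝ (B x) (∇ g x) + g x * inner ℝ (B x) (∇ g x)) ∂μ =
          2 * ∫ x, inner ℝ (B x) (∇ g x) * g x ∂μ := by
        rw [← integral_const_mul]; congr 1; ext1 x; ring
      linarith
    have e3 : ν⁻¹ / 2 * ∫ x, inner ℝ (∇ g x) (∇ g x) ∂μ ≤ energy μ A (∇ g) (∇ g) := by
      unfold energy
      rw [div_mul_eq_mul_div, div_eq_inv_mul, ← integral_const_mul, one_div]
      refine mul_le_mul_of_nonneg_left (integral_mono_ae ?_ ?_ ?_) (by norm_num)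
      · exact (integrable_inner_of_memLp (hg.memLp_gradient 2) (hg.memLp_gradient 2)).const_mul _
      · exact hg.hasGradZero.integrable_matInner hc hV (hg.memLp_gradient 2)
      · filter_upwards [hell] with x hx
        by_cases hxV : x ∈ V
        · simp only [real_inner_self_eq_norm_sq]; exact (hx hxV _).1
        · simp [gradient_eq_zero_of_notMem_tsupport fun h => hxV (hg.subset h)]
    have p1 : 0 ≤ ∫ x, g x * g x ∂μ := integral_nonneg fun x => mul_self_nonneg _
    have p2 : 0 ≤ ∫ x, inner ℝ (∇ g x) (∇ g x) ∂μ := integral_nonneg fun x => real_inner_self_nonneg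
    rw [e1, e2, mul_add, sub_zero]
    refine add_le_add (mul_le_mul_of_nonneg_right (min_le_left _ _) p1) (le_trans ?_ e3)
    exact mul_le_mul_of_nonneg_right (min_le_right _ _) p2
  have hpos : 0 < min α (ν⁻¹ / 2) := lt_min hα (by positivity)
  -- The functional to be represented is pairing with `(f, 0)`, that is `∫ fv`.
  obtain ⟨y, hy, hyeq⟩ := exists_inner_eq_of_coercive (testPairs μ V) Z hpos hcoer
    (innerSL ℝ (mkPair hf (MemLp.zero : MemLp (0 : RSpace d → RSpace d) 2 μ)))
  have hyu : HasGradZero μ V y.fst y.snd := hasGradZero_iff.2 ⟨y, hy, EventuallyEq.rfl, EventuallyEq.rfl⟩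
  refine ⟨y.fst, y.snd, WeakSol.of_test hc hV hyu ?_ ?_ ?_⟩
  · exact ((hyu.integrable hV).const_mul α).sub
      (integrable_of_memLp_of_support hV (by norm_num) hf hf0)
  · filter_upwards [hyu.ae_eq_zero, hf0] with x hx hx' hxV
    rw [(hx hxV).1, hx' hxV]; simp
  · intro g hg
    have k1 := (hg.memLp 2 (μ := μ)).coeFn_toLp
    have k2 := (hg.memLp_gradient 2 (μ := μ)).coeFn_toLp
    let z : testPairs μ V := ⟨mkPair (hg.memLp 2) (hg.memLp_gradient 2), g, hg, k1, k2⟩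
    have h1 := hyeq z
    rw [hZ y _ _ hyu EventuallyEq.rfl EventuallyEq.rfl z g hg k1 k2, innerSL_apply_apply,
      inner_pair _ _ _ hf.coeFn_toLp
        (MemLp.zero : MemLp (0 : RSpace d → RSpace d) 2 μ).coeFn_toLp] at h1
    simp only [Pi.zero_apply, inner_zero_left, integral_zero, add_zero] at h1
    have i1 : Integrable (fun x => y.fst x * g x) μ := hyu.1.integrable_mul (hg.memLp 2)
    have i2 : Integrable (fun x => f x * g x) μ := hf.integrable_mul (hg.memLp 2)
    have e1 : ∫ x, (α * y.fst x - f x) * g x ∂μ =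
        α * (∫ x, y.fst x * g x ∂μ) - ∫ x, f x * g x ∂μ := by
      rw [← integral_const_mul, ← integral_sub (i1.const_mul α) i2]
      congr 1; ext1 x; ring
    rw [e1]; linarith

end

noncomputable section

variable {d : ℕ} {μ : Measure (RSpace d)} {A : RSpace d → Matrix (Fin d) (Fin d) ℝ}
  {B : RSpace d → RSpace d} {V W : Set (RSpace d)} {u v : RSpace d → ℝ}
  {F H : RSpace d → RSpace d} {h : RSpace d → ℝ}

/-! ### Smooth approximations of the Heaviside function -/

theorem exists_bound_deriv_smoothTransition : ∃ C, ∀ t, |deriv Real.smoothTransition t| ≤ C := by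
  have hcont : Continuous (deriv Real.smoothTransition) :=
    (Real.smoothTransition.contDiff (n := 1)).continuous_deriv (by simp)
  obtain ⟨C, hC⟩ := (isCompact_Icc (a := (0 : ℝ)) (b := 1)).exists_bound_of_continuousOn
    hcont.continuousOn
  refine ⟨max C 0, fun t => ?_⟩
  by_cases ht : t ∈ Set.Icc (0 : ℝ) 1
  · exact (hC t ht).trans (le_max_left _ _)
  · have : deriv Real.smoothTransition t = 0 := by
      rw [Set.mem_Icc, not_and_or, not_le, not_le] at ht
      rcases ht with ht | ht
      · have : Real.smoothTransition =ᶠ[𝓝 t] fun _ => 0 := by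
          filter_upwards [Iio_mem_nhds ht] with s hs
          exact Real.smoothTransition.zero_of_nonpos hs.le
        rw [this.deriv_eq]; simp
      · have : Real.smoothTransition =ᶠ[𝓝 t] fun _ => 1 := by
          filter_upwards [Ioi_mem_nhds ht] with s hs
          exact Real.smoothTransition.one_of_one_le hs.le
        rw [this.deriv_eq]; simp
    rw [this, abs_zero]; exact le_max_right _ _

/-- A smooth substitute for the indicator of `(k, ∞)`. The primitive `Ψ` is supplied because `ψ(u)∇u
= ∇Ψ(u)`, which makes the drift term vanish. -/
theorem exists_smooth_step (k : ℝ) {ε : ℝ} (hε : 0 < ε) : ∃ ψ Ψ : ℝ → ℝ,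
    ContDiff ℝ ∞ ψ ∧ ContDiff ℝ ∞ Ψ ∧ Ψ 0 = 0 ∧ deriv Ψ = ψ ∧ (∀ t, 0 ≤ ψ t ∧ ψ t ≤ 1) ∧
    (∀ t, 0 ≤ deriv ψ t) ∧ (∃ C, ∀ t, |deriv ψ t| ≤ C) ∧ (∀ t ≤ k, ψ t = 0) ∧
    ∀ t, k + ε ≤ t → ψ t = 1 := by
  let ψ : ℝ → ℝ := fun t => Real.smoothTransition ((t - k) / ε)
  have hψ : ContDiff ℝ ∞ ψ :=
    Real.smoothTransition.contDiff.comp ((contDiff_id.sub contDiff_const).div_const ε)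
  have hmono : Monotone ψ := fun s t hst => Real.smoothTransition.monotone (by gcongr)
  have hderiv : ∀ t, deriv (fun t => ∫ s in (0 : ℝ)..t, ψ s) t = ψ t := fun t =>
    hψ.continuous.deriv_integral _ _ _
  have hdiff : ∀ t, HasDerivAt (fun t => ∫ s in (0 : ℝ)..t, ψ s) (ψ t) t := fun t =>
    hψ.continuous.integral_hasStrictDerivAt 0 t |>.hasDerivAt
  obtain ⟨C, hC⟩ := exists_bound_deriv_smoothTransition
  refine ⟨ψ, fun t => ∫ s in (0 : ℝ)..t, ψ s, hψ, ?_, by simp, funext hderiv,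
    fun t => ⟨Real.smoothTransition.nonneg _, Real.smoothTransition.le_one _⟩,
    fun t => hmono.deriv_nonneg, ⟨C * |1 / ε|, fun t => ?_⟩, fun t ht => ?_, fun t ht => ?_⟩
  · rw [contDiff_infty_iff_deriv]
    exact ⟨fun t => (hdiff t).differentiableAt, by rw [funext hderiv]; exact hψ⟩
  · have h1 : HasDerivAt (fun t => (t - k) / ε) (1 / ε) t :=
      ((hasDerivAt_id t).sub_const k).div_const ε
    have h2 : HasDerivAt Real.smoothTransition (deriv Real.smoothTransition ((t - k) / ε))
        ((t - k) / ε) :=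
      ((Real.smoothTransition.contDiff (n := 1)).differentiable (by simp) _).hasDerivAt
    have h3 : HasDerivAt ψ (deriv Real.smoothTransition ((t - k) / ε) * (1 / ε)) t :=
      HasDerivAt.comp (h := fun t => (t - k) / ε) t h2 h1
    rw [h3.deriv, abs_mul]
    gcongr
    exact hC _
  · exact Real.smoothTransition.zero_of_nonpos (div_nonpos_of_nonpos_of_nonneg (by linarith) hε.le)
  · exact Real.smoothTransition.one_of_one_le ((one_le_div hε).2 (by linarith))

/-! ### Linear structure of weak solutions -/

theorem WeakSol.congr {u' h' : RSpace d → ℝ} (hs : WeakSol μ A B V u F h) (hu : u =ᵐ[μ] u')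
    (hh : h =ᵐ[μ] h') : WeakSol μ A B V u' F h' := by
  refine ⟨hs.grad.congr hu EventuallyEq.rfl, hs.int.congr hh, ?_, fun v H hv hvb => ?_⟩
  · filter_upwards [hs.supp, hh] with x hx hx' hxV
    rw [← hx', hx hxV]
  · rw [hs.eq v H hv hvb]
    congr 1
    refine integral_congr_ae ?_
    filter_upwards [hh] with x hx
    rw [hx]

theorem WeakSol.const_mul (hc : AdmissibleCoeff μ A B) (hs : WeakSol μ A B V u F h) (c : ℝ) :
    WeakSol μ A B V (fun x => c * u x) (fun x => c • F x) (fun x => c * h x) := by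
  have := hc.finite
  refine ⟨hs.grad.const_smul c, hs.int.const_mul c, ?_, fun v H hv hvb => ?_⟩
  · filter_upwards [hs.supp] with x hx hxV
    rw [hx hxV, mul_zero]
  · simp only [energy_smul_left, inner_smul_right, mul_assoc, integral_const_mul]
    rw [← mul_sub, hs.eq v H hv hvb]; ring

theorem WeakSol.neg (hc : AdmissibleCoeff μ A B) (hs : WeakSol μ A B V u F h) :
    WeakSol μ A B V (fun x => - u x) (fun x => - F x) (fun x => - h x) := by
  have := hs.const_mul hc (-1)
  simpa using this

theorem WeakSol.sub (hc : AdmissibleCoeff μ A B) (hV : IsCompact (closure V))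
    {u' h' : RSpace d → ℝ} {F' : RSpace d → RSpace d}
    (hs : WeakSol μ A B V u F h) (hs' : WeakSol μ A B V u' F' h') :
    WeakSol μ A B V (fun x => u x - u' x) (fun x => F x - F' x) (fun x => h x - h' x) := by
  have := hc.finite
  refine ⟨hs.grad.sub hs'.grad, hs.int.sub hs'.int, ?_, fun v H hv hvb => ?_⟩
  · filter_upwards [hs.supp, hs'.supp] with x hx hx' hxV
    rw [hx hxV, hx' hxV, sub_zero]
  · have e1 : energy μ A (fun x => F x - F' x) H = energy μ A F H - energy μ A F' H := by
      rw [hc.energy_symm, hv.energy_sub_right hc hV hs.grad.2.1 hs'.grad.2.1, hc.energy_symm,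
        hc.energy_symm H]
    have e2 : ∫ x, inner ℝ (B x) (F x - F' x) * v x ∂μ = (∫ x, inner ℝ (B x) (F x) * v x ∂μ) -
        ∫ x, inner ℝ (B x) (F' x) * v x ∂μ := by
      rw [← integral_sub (integrable_mul_bdd (hs.grad.integrable_inner_drift hc hV) hvb)
        (integrable_mul_bdd (hs'.grad.integrable_inner_drift hc hV) hvb)]
      congr 1; ext1 x; rw [inner_sub_right]; ring
    have e3 : ∫ x, (h x - h' x) * v x ∂μ = (∫ x, h x * v x ∂μ) - ∫ x, h' x * v x ∂μ := by
      rw [← integral_sub (integrable_mul_bdd hs.int hvb) (integrable_mul_bdd hs'.int hvb)]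
      congr 1; ext1 x; ring
    rw [e1, e2, e3]
    linarith [hs.eq v H hv hvb, hs'.eq v H hv hvb]

/-! ### The basic `L¹` estimate -/

/-- Testing a weak solution with an increasing function of itself. -/
theorem WeakSol.integral_mul_comp_nonpos (hc : AdmissibleCoeff μ A B) (hV : IsCompact (closure V))
    (hs : WeakSol μ A B V u F h) {ψ Ψ : ℝ → ℝ} (hψ : ContDiff ℝ ∞ ψ) (hΨ : ContDiff ℝ ∞ Ψ)
    (hΨ0 : Ψ 0 = 0) (hΨψ : deriv Ψ = ψ) (hψ0 : ψ 0 = 0) (hψ1 : ∀ t, |ψ t| ≤ 1)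
    (hmono : ∀ t, 0 ≤ deriv ψ t) {C : ℝ} (hC : ∀ t, |deriv ψ t| ≤ C) :
    ∫ x, h x * ψ (u x) ∂μ ≤ 0 := by
  have := hc.finite
  have hb : MemLp (fun x => ψ (u x)) ∞ μ :=
    memLp_top_of_ae_bound (hψ.continuous.comp_aestronglyMeasurable hs.grad.1.1)
      (Eventually.of_forall fun x => hψ1 _)
  have h1 := hs.eq _ _ (hs.grad.comp hψ hψ0 hC) hb
  -- `ψ(u)F` is the gradient of `Ψ(u)`, on which the divergence-free field integrates to zero.
  have h2 : ∫ x, inner ℝ (B x) (F x) * ψ (u x) ∂μ = 0 := by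
    have h3 := (hs.grad.comp hΨ hΨ0 (by rw [hΨψ]; exact hψ1)).integral_inner_drift hc hV
    simp_rw [hΨψ, inner_smul_right] at h3
    simpa only [mul_comm] using h3
  have h4 : 0 ≤ energy μ A F (fun x => deriv ψ (u x) • F x) := by
    unfold energy
    refine mul_nonneg (by norm_num) (integral_nonneg_of_ae ?_)
    filter_upwards [hc.ae_nonneg] with x hx
    rw [matInner_smul_right]
    exact mul_nonneg (hmono _) (hx _)
  rw [h2] at h1
  linarith

theorem integrable_posPart_sub {α : Type*} [MeasurableSpace α] {ν : Measure α} {f : α → ℝ}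
    (hf : Integrable f ν) {k : ℝ} (hk : 0 ≤ k) : Integrable (fun x => max (f x - k) 0) ν := by
  refine hf.norm.mono' ((hf.1.sub aestronglyMeasurable_const).sup aestronglyMeasurable_const)
    (Eventually.of_forall fun x => ?_)
  rw [Real.norm_of_nonneg (le_max_right _ _), Real.norm_eq_abs]
  exact max_le (by linarith [le_abs_self (f x)]) (abs_nonneg _)

/-- With `f = αu - h` and `ψ` close to the indicator of `(k, ∞)`, testing with `ψ(u)` gives `α∫(u -
k)ψ(u) ≤ ∫(f - αk)ψ(u) ≤ ∫(f - αk)⁺`. The case `k = 0`, applied to `u` and `-u`, is the `L¹`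
contraction; `k > 0` gives the upper bounds. -/
theorem WeakSol.estimate (hc : AdmissibleCoeff μ A B) (hVo : IsOpen V) (hV : IsCompact (closure V))
    (hs : WeakSol μ A B V u F h) {α k : ℝ} (hα : 0 < α) (hk : 0 ≤ k) :
    α * ∫ x, max (u x - k) 0 ∂μ ≤ ∫ x, max (α * u x - h x - α * k) 0 ∂μ := by
  have := hc.finite
  have hu := hs.grad.integrable hV
  have hf : Integrable (fun x => α * u x - h x) μ := (hu.const_mul α).sub hs.int
  have step : ∀ ε > 0, α * ∫ x, max (u x - (k + ε)) 0 ∂μ ≤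
      ∫ x, max (α * u x - h x - α * k) 0 ∂μ := by
    intro ε hε
    obtain ⟨ψ, Ψ, hψ, hΨ, hΨ0, hΨψ, h01, hmono, ⟨C, hC⟩, hz, hone⟩ := exists_smooth_step k hε
    have hψ0 : ψ 0 = 0 := hz 0 hk
    have hψ1 : ∀ t, |ψ t| ≤ 1 := fun t => abs_le.2 ⟨by linarith [(h01 t).1], (h01 t).2⟩
    have h1 := hs.integral_mul_comp_nonpos hc hV hψ hΨ hΨ0 hΨψ hψ0 hψ1 hmono hC
    have hg := hs.grad.comp hψ hψ0 hC
    have hb : MemLp (fun x => ψ (u x)) ∞ μ :=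
      memLp_top_of_ae_bound (hψ.continuous.comp_aestronglyMeasurable hs.grad.1.1)
        (Eventually.of_forall fun x => hψ1 _)
    have i1 : Integrable (fun x => h x * ψ (u x)) μ := integrable_mul_bdd hs.int hb
    have i2 : Integrable (fun x => u x * ψ (u x)) μ := integrable_mul_bdd hu hb
    have i3 : Integrable (fun x => ψ (u x)) μ := hg.integrable hV
    have i4 : Integrable (fun x => u x * ψ (u x) - k * ψ (u x)) μ := i2.sub (i3.const_mul k)
    calc α * ∫ x, max (u x - (k + ε)) 0 ∂μ ≤ α * ∫ x, (u x * ψ (u x) - k * ψ (u x)) ∂μ := by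
          refine mul_le_mul_of_nonneg_left (integral_mono
            (integrable_posPart_sub hu (by linarith)) i4 fun x => ?_) hα.le
          simp only
          rcases le_total (u x) (k + ε) with hx | hx
          · rw [max_eq_right (by linarith), ← sub_mul]
            rcases le_total (u x) k with hx' | hx'
            · rw [hz _ hx', mul_zero]
            · exact mul_nonneg (by linarith) (h01 _).1
          · rw [hone _ hx]
            exact max_le (by linarith) (by linarith)
      _ ≤ α * (∫ x, (u x * ψ (u x) - k * ψ (u x)) ∂μ) - ∫ x, h x * ψ (u x) ∂μ := by linarith
      _ = ∫ x, (α * u x - h x - α * k) * ψ (u x) ∂μ := by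
          rw [← integral_const_mul, ← integral_sub (i4.const_mul α) i1]
          congr 1; ext1 x; ring
      _ ≤ ∫ x, max (α * u x - h x - α * k) 0 ∂μ := by
          refine integral_mono ?_ (integrable_posPart_sub hf (by positivity)) fun x => ?_
          · have := (i4.const_mul α).sub i1
            refine this.congr (Eventually.of_forall fun x => ?_)
            simp; ring
          · simp only
            rcases le_total (α * u x - h x - α * k) 0 with hx | hx
            · exact (mul_nonpos_of_nonpos_of_nonneg hx (h01 _).1).trans (le_max_right _ _)
            · exact (mul_le_of_le_one_right hx (h01 _).2).trans (le_max_left _ _)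
  refine le_of_forall_pos_le_add fun δ hδ => ?_
  -- Replacing `k + ε` by `k` costs at most `ε` on `V` and nothing outside, hence `εμ(V)` in total.
  -- The choice of `ε` keeps this below `δ/α`, with `m + 1` in place of `m` to allow `m = 0`.
  set m := (μ V).toReal
  have hm : 0 ≤ m := ENNReal.toReal_nonneg
  set ε := δ / (α * (m + 1)) with hεdef
  have hε : 0 < ε := by positivity
  have hVfin := measure_lt_top_of_isCompact_closure (μ := μ) hV
  have iV : Integrable (V.indicator fun _ => ε) μ :=
    (integrable_indicator_iff hVo.measurableSet).2 (integrableOn_const hVfin.ne)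
  have h2 : ∫ x, max (u x - k) 0 ∂μ ≤ (∫ x, max (u x - (k + ε)) 0 ∂μ) + ε * m := by
    have e1 : ε * m = ∫ x, V.indicator (fun _ => ε) x ∂μ := by
      rw [integral_indicator hVo.measurableSet, setIntegral_const, smul_eq_mul, mul_comm]; rfl
    rw [e1, ← integral_add (integrable_posPart_sub hu (by linarith)) iV]
    refine integral_mono_ae (integrable_posPart_sub hu hk)
      ((integrable_posPart_sub hu (by linarith)).add iV) ?_
    filter_upwards [hs.grad.ae_eq_zero] with x hx
    by_cases hxV : x ∈ V
    · rw [Set.indicator_of_mem hxV]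
      refine max_le ?_ (by positivity)
      linarith [le_max_left (u x - (k + ε)) 0]
    · rw [(hx hxV).1, max_eq_right (by linarith)]
      exact add_nonneg (le_max_right _ _) (Set.indicator_nonneg (fun _ _ => hε.le) _)
  have h3 := step ε hε
  have h4 : α * (ε * m) ≤ δ := by
    have : α * (ε * m) = δ * (m / (m + 1)) := by
      rw [hεdef]; field_simp
    rw [this]
    exact mul_le_of_le_one_right hδ.le ((div_le_one (by positivity)).2 (by linarith))
  calc α * ∫ x, max (u x - k) 0 ∂μ ≤ α * ((∫ x, max (u x - (k + ε)) 0 ∂μ) + ε * m) := by gcongr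
    _ ≤ _ := by rw [mul_add]; linarith

theorem integral_abs_eq_posPart {α : Type*} [MeasurableSpace α] {ν : Measure α} {f : α → ℝ}
    (hf : Integrable f ν) :
    ∫ x, |f x| ∂ν = (∫ x, max (f x - 0) 0 ∂ν) + ∫ x, max (- f x - 0) 0 ∂ν := by
  have hn : Integrable (fun x => - f x) ν := hf.neg
  rw [← integral_add (integrable_posPart_sub hf le_rfl) (integrable_posPart_sub hn le_rfl)]
  congr 1; ext1 x
  rcases le_total 0 (f x) with hx | hx
  · rw [abs_of_nonneg hx, max_eq_left (by linarith), max_eq_right (by linarith)]; ring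
  · rw [abs_of_nonpos hx, max_eq_right (by linarith), max_eq_left (by linarith)]; ring

/-- Weak solutions depend on the data like an `L¹` contraction. -/
theorem WeakSol.integral_abs_le (hc : AdmissibleCoeff μ A B) (hVo : IsOpen V)
    (hV : IsCompact (closure V)) (hs : WeakSol μ A B V u F h) {α : ℝ} (hα : 0 < α) :
    α * ∫ x, |u x| ∂μ ≤ ∫ x, |α * u x - h x| ∂μ := by
  have := hc.finite
  have hu := hs.grad.integrable hV
  have hf : Integrable (fun x => α * u x - h x) μ := (hu.const_mul α).sub hs.int
  rw [integral_abs_eq_posPart hu, integral_abs_eq_posPart hf, mul_add]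
  refine add_le_add ?_ ?_
  · simpa using hs.estimate hc hVo hV hα le_rfl
  · have := (hs.neg hc).estimate hc hVo hV hα le_rfl
    simp only [mul_zero] at this
    refine this.trans (le_of_eq ?_)
    congr 1; ext1 x; congr 1; ring

theorem ae_le_of_integral_posPart_nonpos {α : Type*} [MeasurableSpace α] {ν : Measure α}
    {f : α → ℝ} (hf : Integrable f ν) {k : ℝ} (hk : 0 ≤ k) (h : ∫ x, max (f x - k) 0 ∂ν ≤ 0) :
    ∀ᵐ x ∂ν, f x ≤ k := by
  have h1 : ∫ x, max (f x - k) 0 ∂ν = 0 := le_antisymm h (integral_nonneg fun _ => le_max_right _ _)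
  replace h1 := (integral_eq_zero_iff_of_nonneg (f := fun x => max (f x - k) 0)
    (fun _ => le_max_right _ _) (integrable_posPart_sub hf hk)).1 h1
  filter_upwards [h1] with x hx
  have := le_max_left (f x - k) 0
  rw [show max (f x - k) 0 = 0 from hx] at this
  linarith

/-- At level `k = M/α` the right-hand side of the basic estimate vanishes. -/
theorem WeakSol.ae_le (hc : AdmissibleCoeff μ A B) (hVo : IsOpen V) (hV : IsCompact (closure V))
    (hs : WeakSol μ A B V u F h) {α M : ℝ} (hα : 0 < α) (hM : 0 ≤ M)
    (hle : ∀ᵐ x ∂μ, α * u x - h x ≤ M) : ∀ᵐ x ∂μ, u x ≤ M / α := by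
  have := hc.finite
  refine ae_le_of_integral_posPart_nonpos (hs.grad.integrable hV) (by positivity) ?_
  have h1 := hs.estimate hc hVo hV hα (k := M / α) (by positivity)
  have h2 : ∫ x, max (α * u x - h x - α * (M / α)) 0 ∂μ = 0 := by
    refine integral_eq_zero_of_ae ?_
    filter_upwards [hle] with x hx
    rw [mul_div_cancel₀ _ hα.ne', max_eq_right (by linarith)]; rfl
  rw [h2] at h1
  by_contra hlt
  push Not at hlt
  nlinarith

theorem WeakSol.ae_abs_le (hc : AdmissibleCoeff μ A B) (hVo : IsOpen V) (hV : IsCompact (closure V))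
    (hs : WeakSol μ A B V u F h) {α M : ℝ} (hα : 0 < α) (hM : 0 ≤ M)
    (hle : ∀ᵐ x ∂μ, |α * u x - h x| ≤ M) : ∀ᵐ x ∂μ, |u x| ≤ M / α := by
  have h1 := hs.ae_le hc hVo hV hα hM (hle.mono fun x hx => (abs_le.1 hx).2)
  have h2 := (hs.neg hc).ae_le hc hVo hV hα hM (hle.mono fun x hx => by
    linarith [(abs_le.1 hx).1])
  filter_upwards [h1, h2] with x a b
  exact abs_le.2 ⟨by linarith, a⟩

/-! ### Convergence in `L¹` -/

theorem L1_dist_eq {α : Type*} [MeasurableSpace α] {ν : Measure α} (f g : Lp ℝ 1 ν) :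
    dist f g = ∫ x, |f x - g x| ∂ν := by
  rw [L1.dist_eq_integral_dist]; simp only [Real.dist_eq]

/-- Products with one factor fixed in `L²` and the other tending to zero there are dominated as
assumed, by Young's inequality. First `δ` is made small against `∫ w`, then `n` large. -/
theorem tendsto_integral_abs_of_young {α : Type*} [MeasurableSpace α] {ν : Measure α}
    {e q : ℕ → α → ℝ} {w : α → ℝ} (hw : Integrable w ν)
    (hq : ∀ n, Integrable (q n) ν)
    (hle : ∀ n, ∀ δ > 0, ∀ᵐ x ∂ν, |e n x| ≤ (δ * w x + δ⁻¹ * q n x))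
    (hlim : Tendsto (fun n => ∫ x, q n x ∂ν) atTop (𝓝 0)) :
    Tendsto (fun n => ∫ x, |e n x| ∂ν) atTop (𝓝 0) := by
  rw [Metric.tendsto_atTop]
  intro ε hε
  set m := |∫ x, w x ∂ν| with hm
  set δ := ε / (2 * (m + 1)) with hδ
  have hmp : 0 ≤ m := abs_nonneg _
  have hδp : 0 < δ := by positivity
  obtain ⟨N, hN⟩ := (Metric.tendsto_atTop.1 hlim) (δ * (ε / 2)) (by positivity)
  refine ⟨N, fun n hn => ?_⟩
  have h1 : ∫ x, |e n x| ∂ν ≤ δ * (∫ x, w x ∂ν) + δ⁻¹ * ∫ x, q n x ∂ν := by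
    rw [← integral_const_mul, ← integral_const_mul,
      ← integral_add (hw.const_mul _) ((hq n).const_mul _)]
    exact integral_mono_of_nonneg (Eventually.of_forall fun x => abs_nonneg _)
      ((hw.const_mul _).add ((hq n).const_mul _)) (hle n δ hδp)
  have h2 := hN n hn
  rw [Real.dist_eq, sub_zero] at h2 ⊢
  rw [abs_of_nonneg (integral_nonneg fun x => abs_nonneg _)]
  have h3 : δ * (∫ x, w x ∂ν) ≤ ε / 2 := by
    calc δ * (∫ x, w x ∂ν) ≤ δ * (m + 1) := by
          gcongr; linarith [le_abs_self (∫ x, w x ∂ν)]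
      _ = ε / 2 := by rw [hδ]; field_simp
  have h4 : δ⁻¹ * (∫ x, q n x ∂ν) < ε / 2 := by
    rw [inv_mul_lt_iff₀ hδp]
    exact (le_abs_self _).trans_lt h2
  linarith

theorem tendsto_integral_abs_of_sq [IsFiniteMeasureOnCompacts μ] (hVo : IsOpen V)
    (hV : IsCompact (closure V)) {e : ℕ → RSpace d → ℝ} (he : ∀ n, MemLp (e n) 2 μ)
    (h0 : ∀ n, ∀ᵐ x ∂μ, x ∉ V → e n x = 0)
    (hlim : Tendsto (fun n => ∫ x, e n x ^ 2 ∂μ) atTop (𝓝 0)) :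
    Tendsto (fun n => ∫ x, |e n x| ∂μ) atTop (𝓝 0) := by
  have hVfin := measure_lt_top_of_isCompact_closure (μ := μ) hV
  refine tendsto_integral_abs_of_young (w := V.indicator fun _ => 1) (q := fun n x => e n x ^ 2)
    ((integrable_indicator_iff hVo.measurableSet).2 (integrableOn_const hVfin.ne))
    (fun n => (he n).integrable_sq) (fun n δ hδ => ?_) hlim
  filter_upwards [h0 n] with x hx
  by_cases hxV : x ∈ V
  · rw [Set.indicator_of_mem hxV, mul_one, ← sub_nonneg]
    have : δ + δ⁻¹ * e n x ^ 2 - |e n x| = δ⁻¹ * ((δ - |e n x| / 2) ^ 2 + 3 / 4 * |e n x| ^ 2) := by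
      rw [← sq_abs (e n x)]
      field_simp; ring
    rw [this]; positivity
  · rw [hx hxV, Set.indicator_of_notMem hxV]; simp

/-- `g` is only integrable, so the uniform bound on `e n` provides a majorant. Convergence in `L¹`
gives almost everywhere convergence along subsequences only, whence the subsequence argument. -/
theorem tendsto_integral_mul_of_bdd {α : Type*} [MeasurableSpace α] {ν : Measure α}
    {g : α → ℝ} (hg : Integrable g ν) {e : ℕ → α → ℝ} (he : ∀ n, Integrable (e n) ν) {C : ℝ}
    (hC : ∀ n, ∀ᵐ x ∂ν, |e n x| ≤ C) (hlim : Tendsto (fun n => ∫ x, |e n x| ∂ν) atTop (𝓝 0)) :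
    Tendsto (fun n => ∫ x, g x * e n x ∂ν) atTop (𝓝 0) := by
  refine tendsto_of_subseq_tendsto fun ns hns => ?_
  have hm : TendstoInMeasure ν (fun n => e (ns n)) atTop (fun _ => (0 : ℝ)) := by
    refine tendstoInMeasure_of_tendsto_eLpNorm (p := 1) (by norm_num)
      (fun n => (he _).1) aestronglyMeasurable_const ?_
    have h1 : Tendsto (fun n => ENNReal.ofReal (∫ x, |e (ns n) x| ∂ν)) atTop (𝓝 0) := by
      have := (ENNReal.continuous_ofReal.tendsto 0).comp (hlim.comp hns)
      simpa [Function.comp_def] using this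
    refine h1.congr fun n => ?_
    rw [eLpNorm_one_eq_lintegral_enorm]
    have := ofReal_integral_norm_eq_lintegral_enorm (he (ns n))
    simp only [Real.norm_eq_abs] at this
    rw [this]; simp
  obtain ⟨ms, -, hms⟩ := hm.exists_seq_tendsto_ae
  refine ⟨ms, ?_⟩
  have : Tendsto (fun n => ∫ x, g x * e (ns (ms n)) x ∂ν) atTop (𝓝 (∫ _, (0 : ℝ) ∂ν)) := by
    refine tendsto_integral_of_dominated_convergence (fun x => ‖g x‖ * C)
      (fun n => hg.1.mul (he _).1) (hg.norm.mul_const C) (fun n => ?_) ?_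
    · filter_upwards [hC (ns (ms n))] with x hx
      rw [norm_mul]; gcongr; exact hx
    · filter_upwards [hms] with x hx
      simpa using hx.const_mul (g x)
  simpa using this

/-- Integrable functions on an open set are approximated by test functions in `L¹`. -/
theorem exists_test_integral_abs_sub_le [IsFiniteMeasureOnCompacts μ] (hVo : IsOpen V)
    (hV : IsCompact (closure V)) {f : RSpace d → ℝ} (hf : Integrable f μ)
    (h0 : ∀ᵐ x ∂μ, x ∉ V → f x = 0) {ε : ℝ} (hε : 0 < ε) :
    ∃ g, IsTestFun V g ∧ ∫ x, |f x - g x| ∂μ ≤ ε := by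
  obtain ⟨g, hgc, hgs, hg⟩ := (memLp_one_iff_integrable.2 hf).exist_eLpNorm_sub_le (by norm_num)
    le_rfl (ε := ε / 2) (by positivity)
  have hgi : Integrable g μ := hgs.continuous.integrable_of_hasCompactSupport hgc
  have h1 : ∫ x, |f x - g x| ∂μ ≤ ε / 2 := by
    rw [eLpNorm_one_eq_lintegral_enorm, ← ofReal_integral_norm_eq_lintegral_enorm (hf.sub hgi),
      ENNReal.ofReal_le_ofReal_iff (by positivity)] at hg
    exact hg
  -- The approximation `g` need not be supported in `V`. Cutoffs along an exhaustion of `V` by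
  -- compacts correct this, and cutting off `f` itself costs little by dominated convergence.
  obtain ⟨K, hKc, hKV, hKU, hKm⟩ := hVo.exists_iUnion_isClosed
  have hKcomp : ∀ n, IsCompact (K n) := fun n =>
    hV.of_isClosed_subset (hKc n) ((hKV n).trans subset_closure)
  choose χ hχ hχ01 hχ1 hχ2 using fun n => exists_cutoff (hKcomp n) hVo (hKV n)
  have hlim : Tendsto (fun n => ∫ x, |(1 - χ n x) * f x| ∂μ) atTop (𝓝 (∫ _, (0 : ℝ) ∂μ)) := by
    refine tendsto_integral_of_dominated_convergence (fun x => ‖f x‖)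
      (fun n => ((aestronglyMeasurable_const.sub
        (hχ n).smooth.continuous.aestronglyMeasurable).mul hf.1).norm) hf.norm
      (fun n => Eventually.of_forall fun x => ?_) ?_
    · rw [Real.norm_eq_abs, abs_abs, abs_mul, Real.norm_eq_abs]
      refine mul_le_of_le_one_left (abs_nonneg _) (abs_le.2 ⟨?_, ?_⟩) <;>
        linarith [(hχ01 n x).1, (hχ01 n x).2]
    · filter_upwards [h0] with x hx
      by_cases hxV : x ∈ V
      · rw [← hKU, Set.mem_iUnion] at hxV
        obtain ⟨N, hN⟩ := hxV
        refine tendsto_const_nhds.congr' ?_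
        filter_upwards [eventually_ge_atTop N] with n hn
        rw [hχ1 n x (hKm hn hN)]; simp
      · simp [hx hxV]
  rw [integral_zero] at hlim
  obtain ⟨n, hn⟩ := ((tendsto_order.1 hlim).2 (ε / 2) (by positivity)).exists
  refine ⟨fun x => χ n x * g x, ?_, ?_⟩
  · refine ⟨(hχ n).smooth.mul hgs, (hχ n).compact.mul_right, ?_⟩
    exact (tsupport_mul_subset_left (f := χ n) (g := g)).trans (hχ n).subset
  · have i1 : Integrable (fun x => |(1 - χ n x) * f x|) μ := by
      refine Integrable.abs (hf.bdd_mul (c := 1) (aestronglyMeasurable_const.sub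
        (hχ n).smooth.continuous.aestronglyMeasurable) (Eventually.of_forall fun x => ?_))
      exact abs_le.2 ⟨by linarith [(hχ01 n x).2],
        by linarith [(hχ01 n x).1]⟩
    have i2 : Integrable (fun x => |f x - g x|) μ := (hf.sub hgi).abs
    calc ∫ x, |f x - χ n x * g x| ∂μ ≤ ∫ x, (|(1 - χ n x) * f x| + |f x - g x|) ∂μ := by
          refine integral_mono_of_nonneg (Eventually.of_forall fun x => abs_nonneg _)
            (i1.add i2) (Eventually.of_forall fun x => ?_)
          have e : f x - χ n x * g x = (1 - χ n x) * f x + χ n x * (f x - g x) := by ring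
          simp only
          rw [e]
          refine (abs_add_le _ _).trans (add_le_add le_rfl ?_)
          rw [abs_mul, abs_of_nonneg (hχ01 n x).1]
          exact mul_le_of_le_one_left (abs_nonneg _) (hχ01 n x).2
      _ ≤ ε := by rw [integral_add i1 i2]; linarith

/-! ### Approximation by the domain of the symmetric generator -/

theorem AdmissibleCoeff.exists_norm_sq_le_energy (hc : AdmissibleCoeff μ A B)
    (hV : IsCompact (closure V)) : ∃ ν : ℝ, 0 < ν ∧ ∀ u F, HasGradZero μ V u F →
      ∫ x, ‖F x‖ ^ 2 ∂μ ≤ ν * energy μ A F F := by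
  have := hc.finite
  obtain ⟨ν, hν, hell⟩ := hc.bounds hV
  -- The factor `2` cancels the `½` in `energy`.
  refine ⟨2 * ν, by positivity, fun u F hu => ?_⟩
  unfold energy
  rw [show ∀ r : ℝ, 2 * ν * (1 / 2 * r) = ν * r by intro r; ring, ← integral_const_mul]
  have i0 : Integrable (fun x => ‖F x‖ ^ 2) μ := by
    simpa only [real_inner_self_eq_norm_sq] using integrable_inner_of_memLp hu.2.1 hu.2.1
  refine integral_mono_ae i0
    ((hu.integrable_matInner hc hV hu.2.1).const_mul ν) ?_
  filter_upwards [hell, hu.ae_eq_zero] with x hx hx0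
  by_cases hxV : x ∈ V
  · have := (hx hxV (F x)).1
    rwa [inv_mul_le_iff₀ hν] at this
  · simp [(hx0 hxV).2]

/-- The symmetric equation with right-hand side in `L²` can be tested with all of `H₀^{1,2}`. -/
theorem WeakSol.energy_eq (hc : AdmissibleCoeff μ A B) (hV : IsCompact (closure V))
    (hs : WeakSol μ A 0 V u F h) (hh : MemLp h 2 μ) (hv : HasGradZero μ V v H) :
    energy μ A F H = - ∫ x, h x * v x ∂μ := by
  have := hc.finite
  have hm := hs.grad.memLp_matVec hc hV
  obtain ⟨hv2, hH, f, hf, h1, h2⟩ := hv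
  have t1 : Tendsto (fun n => energy μ A F (∇ (f n))) atTop (𝓝 (energy μ A F H)) := by
    simp only [energy_eq_integral_inner]
    exact (tendsto_integral_inner hm hH (fun _ => hm) (fun n => (hf n).memLp_gradient 2)
      (eLpNorm_sub_self_tendsto _ _) h2).const_mul _
  have t2 := (tendsto_integral_mul hh hv2 (fun _ => hh) (fun n => (hf n).memLp 2)
      (eLpNorm_sub_self_tendsto _ _) h1).neg
  refine tendsto_nhds_unique t1 (t2.congr fun n => ?_)
  have := hs.eq _ _ (hf n).hasGradZero ((hf n).memLp ∞)
  simpa using this.symm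

/-- Testing the symmetric equation with the solution. -/
theorem WeakSol.energy_self (hs : WeakSol μ A 0 V u F h) (hb : MemLp u ∞ μ) :
    energy μ A F F = - ∫ x, h x * u x ∂μ := by
  have := hs.eq u F hs.grad hb
  simpa using this

/-- Resolvents of the symmetric generator converge on test functions. -/
theorem WeakSol.integral_sq_sub_test_le (hc : AdmissibleCoeff μ A B) (hV : IsCompact (closure V))
    {g : RSpace d → ℝ} (hg : IsTestFun V g) {β : ℝ} (hb : MemLp u ∞ μ)
    (hs : WeakSol μ A 0 V u F (fun x => β * u x - β * g x)) :
    β * ∫ x, (u x - g x) ^ 2 ∂μ ≤ energy μ A (∇ g) (∇ g) := by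
  have := hc.finite
  have hg0 := hg.hasGradZero (μ := μ)
  have hd := hs.grad.sub hg0
  have h1 := hs.eq _ _ hd (hb.sub (hg.memLp ∞))
  have e1 : ∫ x, (β * u x - β * g x) * (u x - g x) ∂μ = β * ∫ x, (u x - g x) ^ 2 ∂μ := by
    rw [← integral_const_mul]; congr 1; ext1 x; ring
  simp only [Pi.zero_apply, inner_zero_left, zero_mul, integral_zero, sub_zero] at h1
  rw [e1] at h1
  have h2 := hd.energy_sub_right hc hV hs.grad.2.1 hg0.2.1
  have h3 := hc.energy_symm (fun x => F x - ∇ g x) F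
  have h5 := hg0.energy_sub_right hc hV hs.grad.2.1 hg0.2.1
  have h6 := hc.energy_symm (fun x => F x - ∇ g x) (∇ g)
  have h7 := hc.energy_nonneg (fun x => F x - ∇ g x)
  have h8 := hc.energy_nonneg F
  have h9 := hs.grad.energy_sub_right hc hV hs.grad.2.1 hg0.2.1
  have h10 := hc.energy_symm F (∇ g)
  have h11 := hc.energy_nonneg (∇ g)
  -- The equation reads `β∫(u - g)² = E⁰(F, ∇g) - E⁰(F, F)`. Nonnegativity of the energy of `F - ∇g`
  -- gives `2E⁰(F, ∇g) ≤ E⁰(F, F) + E⁰(∇g, ∇g)`.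
  linarith

/-! ### Weak solutions and the closure of `L^V`. -/

/-- The graph of weak solutions in `L¹`. -/
def weakGraph (μ : Measure (RSpace d)) (A : RSpace d → Matrix (Fin d) (Fin d) ℝ)
    (B : RSpace d → RSpace d) (V : Set (RSpace d)) : Set (Lp ℝ 1 μ × Lp ℝ 1 μ) :=
  {p | ∃ F, WeakSol μ A B V p.1 F p.2 ∧ MemLp p.1 ∞ μ}

theorem dirichletOpGraph_subset_weakGraph (hc : AdmissibleCoeff μ A B)
    (hV : IsCompact (closure V)) : dirichletOpGraph μ A B V ⊆ weakGraph μ A B V := by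
  have := hc.finite
  rintro p ⟨F, w, ⟨hu, hw, hw0, heq⟩, hb, hp⟩
  refine ⟨F, ⟨hu, L1.integrable_coeFn _, ?_, fun v H hv hvb => ?_⟩, hb⟩
  · filter_upwards [hp, hw0, hu.ae_eq_zero] with x hx hx0 hx1 hxV
    rw [hx, hx0 hxV, (hx1 hxV).2, inner_zero_right, add_zero]
  · rw [heq v H hv]
    have i1 : Integrable (fun x => w x * v x) μ := hw.integrable_mul hv.1
    have i2 := integrable_mul_bdd (hu.integrable_inner_drift hc hV) hvb
    rw [sub_eq_iff_eq_add, ← sub_eq_iff_eq_add', sub_neg_eq_add, neg_add_eq_sub, sub_eq_iff_eq_add,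
      ← integral_add i2 i1]
    refine integral_congr_ae ?_
    filter_upwards [hp] with x hx
    rw [hx]; ring

/-- The drift moves to the right-hand side as a source. It is a product of two functions in `L²(V)`,
so the new source is only in `L¹`; this is why weak solutions allow integrable right-hand sides. -/
theorem WeakSol.zero_drift_of (hc : AdmissibleCoeff μ A B) (hV : IsCompact (closure V))
    (hs : WeakSol μ A B V u F h) : WeakSol μ A 0 V u F (fun x => h x - inner ℝ (B x) (F x)) := by
  have := hc.finite
  have hI := hs.grad.integrable_inner_drift hc hV
  refine ⟨hs.grad, hs.int.sub hI, ?_, fun v H hv hvb => ?_⟩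
  · filter_upwards [hs.supp, hs.grad.ae_eq_zero] with x hx hx' hxV
    rw [hx hxV, (hx' hxV).2, inner_zero_right, sub_zero]
  · have h1 := hs.eq v H hv hvb
    have i1 := integrable_mul_bdd hI hvb
    have i2 := integrable_mul_bdd hs.int hvb
    have e : ∫ x, (h x - inner ℝ (B x) (F x)) * v x ∂μ =
        (∫ x, h x * v x ∂μ) - ∫ x, inner ℝ (B x) (F x) * v x ∂μ := by
      rw [← integral_sub i2 i1]; congr 1; ext1 x; ring
    rw [e]
    simp only [Pi.zero_apply, inner_zero_left, zero_mul, integral_zero, sub_zero]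
    linarith

/-- If `β (u_β - u)` solves the resolvent equation of the symmetric operator with integrable right
hand side `β g`, it converges to `g` in `L¹`. -/
theorem tendsto_integral_abs_resolvent (hc : AdmissibleCoeff μ A B) (hVo : IsOpen V)
    (hV : IsCompact (closure V)) {g : RSpace d → ℝ} (hg : Integrable g μ)
    (hg0 : ∀ᵐ x ∂μ, x ∉ V → g x = 0) {β : ℕ → ℝ} (hβ : ∀ n, 0 < β n)
    (hβt : Tendsto β atTop atTop) {e : ℕ → RSpace d → ℝ} {E : ℕ → RSpace d → RSpace d}
    (hs : ∀ n, WeakSol μ A 0 V (e n) (E n) (fun x => β n * e n x - g x)) :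
    Tendsto (fun n => ∫ x, |β n * e n x - g x| ∂μ) atTop (𝓝 0) := by
  have := hc.finite
  have hc0 := hc.zero_drift
  rw [Metric.tendsto_atTop]
  intro ε hε
  -- Let `z` be the solution with datum `βg'`. It converges to `g'` in `L²`, while the `L¹`
  -- contraction bounds the distance from `βe` to `z` by that from `g` to `g'`, uniformly in `β`.
  obtain ⟨g', hg', hgg'⟩ := exists_test_integral_abs_sub_le hVo hV hg hg0 (ε := ε / 4) (by positivity)
  choose z Z hz using fun n => exists_weakSol hc0 hV (hβ n) (f := fun x => β n * g' x)
    ((hg'.memLp 2).const_mul _) (Eventually.of_forall fun x hx => by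
      rw [image_eq_zero_of_notMem_tsupport fun h => hx (hg'.subset h), mul_zero])
  obtain ⟨M, hM⟩ := hg'.exists_bound
  have hM0 : 0 ≤ M := (abs_nonneg _).trans (hM 0)
  have hzb : ∀ n, MemLp (z n) ∞ μ := fun n => by
    refine memLp_top_of_ae_bound (hz n).grad.1.1 ((hz n).ae_abs_le hc0 hVo hV (hβ n)
      (M := β n * M) (mul_nonneg (hβ n).le hM0) (Eventually.of_forall fun x => ?_))
    rw [_root_.sub_sub_cancel, abs_mul, abs_of_pos (hβ n)]
    exact mul_le_mul_of_nonneg_left (hM x) (hβ n).le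
  have hzg : ∀ n, HasGradZero μ V (fun x => z n x - g' x) (fun x => Z n x - ∇ g' x) := fun n =>
    (hz n).grad.sub hg'.hasGradZero
  have t1 : Tendsto (fun n => ∫ x, (z n x - g' x) ^ 2 ∂μ) atTop (𝓝 0) := by
    refine squeeze_zero (fun n => integral_nonneg fun x => sq_nonneg _) (fun n => ?_)
      ((tendsto_const_nhds (x := energy μ A (∇ g') (∇ g'))).div_atTop hβt)
    rw [le_div_iff₀' (hβ n)]
    exact (hz n).integral_sq_sub_test_le hc hV hg' (hzb n)
  have t2 := tendsto_integral_abs_of_sq hVo hV (fun n => (hzg n).1)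
    (fun n => (hzg n).ae_eq_zero.mono fun x hx hxV => (hx hxV).1) t1
  have hβz : ∀ n, ∫ x, |β n * e n x - z n x| ∂μ ≤ ∫ x, |g x - g' x| ∂μ := by
    intro n
    have h1 := (((hs n).const_mul hc0 (β n)).sub hc0 hV (hz n)).integral_abs_le hc0 hVo hV (hβ n)
    have e1 : ∫ x, |β n * (β n * e n x - z n x) - (β n * (β n * e n x - g x) -
        (β n * z n x - β n * g' x))| ∂μ = β n * ∫ x, |g x - g' x| ∂μ := by
      rw [← integral_const_mul]; congr 1; ext1 x
      rw [← abs_of_pos (hβ n), ← abs_mul, abs_of_pos (hβ n)]; congr 1; ring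
    rw [e1] at h1
    exact le_of_mul_le_mul_left h1 (hβ n)
  obtain ⟨N, hN⟩ := (Metric.tendsto_atTop.1 t2) (ε / 4) (by positivity)
  refine ⟨N, fun n hn => ?_⟩
  have h1 := hN n hn
  rw [Real.dist_eq, sub_zero, abs_of_nonneg (integral_nonneg fun x => abs_nonneg _)] at h1 ⊢
  have ie := (hs n).grad.integrable hV
  have iz := (hz n).grad.integrable hV
  have ig' := hg'.hasGradZero (μ := μ) |>.integrable hV
  have i1 : Integrable (fun x => |β n * e n x - z n x|) μ := ((ie.const_mul _).sub iz).abs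
  have i2 : Integrable (fun x => |z n x - g' x|) μ := (iz.sub ig').abs
  have i3 : Integrable (fun x => |g x - g' x|) μ := (hg.sub ig').abs
  have i12 : Integrable (fun x => |β n * e n x - z n x| + |z n x - g' x|) μ := i1.add i2
  have h2 : ∫ x, |β n * e n x - g x| ∂μ ≤
      ∫ x, (|β n * e n x - z n x| + |z n x - g' x| + |g x - g' x|) ∂μ := by
    refine integral_mono_of_nonneg (Eventually.of_forall fun x => abs_nonneg _) (i12.add i3)
      (Eventually.of_forall fun x => ?_)
    have e1 : β n * e n x - g x = (β n * e n x - z n x) + (z n x - g' x) + (g' x - g x) := by ring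
    simp only
    rw [e1, abs_sub_comm (g x)]
    exact (abs_add_le _ _).trans (add_le_add (abs_add_le _ _) le_rfl)
  rw [integral_add i12 i3, integral_add i1 i2] at h2
  have := hβz n
  linarith

/-- For a bounded weak solution `u`, put `Uₙ = βₙG⁰_{βₙ}u`. This is bounded and lies in
`D(L^{0,V})`, with image `βₙeₙ` where `eₙ = Uₙ - u`. As `eₙ` solves the symmetric resolvent equation
with datum `g = h - ⟨B,∇u⟩`, the images `βₙeₙ` tend to `g` in `L¹`. It remains to see that `⟨B,
∇eₙ⟩` tends to zero, for which the energy of `eₙ` has to vanish in the limit. -/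
theorem weakGraph_subset_closure (hc : AdmissibleCoeff μ A B) (hVo : IsOpen V)
    (hV : IsCompact (closure V)) : weakGraph μ A B V ⊆ closure (dirichletOpGraph μ A B V) := by
  have := hc.finite
  have hc0 := hc.zero_drift
  rintro p ⟨F, hs, hb⟩
  obtain ⟨M, hM0, hM⟩ := exists_ae_bound hb
  have hI := hs.grad.integrable_inner_drift hc hV
  have hs0 := hs.zero_drift_of hc hV
  set g : RSpace d → ℝ := fun x => p.2 x - inner ℝ (B x) (F x) with hgdef
  have hg : Integrable g μ := hs0.int
  let β : ℕ → ℝ := fun n => n + 1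
  have hβ : ∀ n, 0 < β n := fun n => by positivity
  have hβt : Tendsto β atTop atTop := tendsto_atTop_add_const_right _ _ tendsto_natCast_atTop_atTop
  choose U D hU using fun n => exists_weakSol hc0 hV (hβ n) (f := fun x => β n * p.1 x)
    (hs.grad.1.const_mul _) (hs.grad.ae_eq_zero.mono fun x hx hxV => by rw [(hx hxV).1, mul_zero])
  have hUb : ∀ n, ∀ᵐ x ∂μ, |U n x| ≤ M := fun n => by
    have h1 := (hU n).ae_abs_le hc0 hVo hV (hβ n) (M := β n * M) (mul_nonneg (hβ n).le hM0) (by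
      filter_upwards [hM] with x hx
      rw [_root_.sub_sub_cancel, abs_mul, abs_of_pos (hβ n)]
      exact mul_le_mul_of_nonneg_left hx (hβ n).le)
    filter_upwards [h1] with x hx
    rwa [mul_div_cancel_left₀ _ (hβ n).ne'] at hx
  let e : ℕ → RSpace d → ℝ := fun n x => U n x - p.1 x
  let E : ℕ → RSpace d → RSpace d := fun n x => D n x - F x
  have hse : ∀ n, WeakSol μ A 0 V (e n) (E n) (fun x => β n * e n x - g x) := fun n => by
    refine ((hU n).sub hc0 hV hs0).congr EventuallyEq.rfl (Eventually.of_forall fun x => ?_)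
    simp only [e]; ring
  have heb : ∀ n, ∀ᵐ x ∂μ, |e n x| ≤ 2 * M := fun n => by
    filter_upwards [hUb n, hM] with x h1 h2
    exact (abs_sub _ _).trans (by linarith)
  have heM : ∀ n, MemLp (e n) ∞ μ := fun n => memLp_top_of_ae_bound (hse n).grad.1.1 (heb n)
  have hei : ∀ n, Integrable (e n) μ := fun n => (hse n).grad.integrable hV
  -- This identity is used twice. Boundedness of its right side makes `∫ eₙ²` vanish in the limit;
  -- then the right side itself vanishes, and with it the energy.
  have hself : ∀ n, energy μ A (E n) (E n) + β n * ∫ x, e n x ^ 2 ∂μ = ∫ x, g x * e n x ∂μ := by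
    intro n
    have i1 : Integrable (fun x => g x * e n x) μ := integrable_mul_bdd hg (heM n)
    have i2 : Integrable (fun x => e n x ^ 2) μ := (hse n).grad.1.integrable_sq
    rw [(hse n).energy_self (heM n), ← integral_const_mul, neg_add_eq_sub,
      ← integral_sub (i2.const_mul _) (integrable_mul_bdd (hse n).int (heM n))]
    congr 1; ext1 x; ring
  have hbd : ∀ n, ∫ x, g x * e n x ∂μ ≤ ∫ x, |g x| * (2 * M) ∂μ := fun n => by
    refine integral_mono_ae (integrable_mul_bdd hg (heM n)) (hg.abs.mul_const _) ?_
    filter_upwards [heb n] with x hx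
    calc g x * e n x ≤ |g x * e n x| := le_abs_self _
      _ = |g x| * |e n x| := abs_mul _ _
      _ ≤ _ := mul_le_mul_of_nonneg_left hx (abs_nonneg _)
  have hen0 : ∀ n, 0 ≤ energy μ A (E n) (E n) := fun n => hc.energy_nonneg _
  have hsq0 : ∀ n, 0 ≤ ∫ x, e n x ^ 2 ∂μ := fun n => integral_nonneg fun x => sq_nonneg _
  have t1 : Tendsto (fun n => ∫ x, e n x ^ 2 ∂μ) atTop (𝓝 0) := by
    refine squeeze_zero hsq0 (fun n => ?_)
      ((tendsto_const_nhds (x := ∫ x, |g x| * (2 * M) ∂μ)).div_atTop hβt)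
    rw [le_div_iff₀' (hβ n)]
    linarith [hself n, hbd n, hen0 n]
  have t2 := tendsto_integral_abs_of_sq hVo hV (fun n => (hse n).grad.1)
    (fun n => (hse n).grad.ae_eq_zero.mono fun x hx hxV => (hx hxV).1) t1
  have t3 := tendsto_integral_mul_of_bdd hg hei heb t2
  have t4 : Tendsto (fun n => energy μ A (E n) (E n)) atTop (𝓝 0) := by
    refine squeeze_zero hen0 (fun n => ?_) t3
    have := mul_nonneg (hβ n).le (hsq0 n)
    linarith [hself n]
  obtain ⟨ν, hν, hνE⟩ := hc.exists_norm_sq_le_energy hV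
  have t5 : Tendsto (fun n => ∫ x, ‖E n x‖ ^ 2 ∂μ) atTop (𝓝 0) := by
    refine squeeze_zero (fun n => integral_nonneg fun x => sq_nonneg _)
      (fun n => hνE _ _ (hse n).grad) ?_
    simpa using t4.const_mul ν
  -- Young's inequality pairs the fixed integrable weight `‖B‖²` on `V` with `‖Eₙ‖²`, whose integral
  -- tends to zero.
  have t6 : Tendsto (fun n => ∫ x, |inner ℝ (B x) (E n x)| ∂μ) atTop (𝓝 0) := by
    have hB : IntegrableOn (fun x => ‖B x‖ ^ 2) V μ := by
      have := integrable_inner_of_memLp (hc.drift V hV) (hc.drift V hV)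
      simpa only [real_inner_self_eq_norm_sq, IntegrableOn] using this
    refine tendsto_integral_abs_of_young (w := V.indicator fun x => ‖B x‖ ^ 2)
      (q := fun n x => ‖E n x‖ ^ 2) ((integrable_indicator_iff hVo.measurableSet).2 hB)
      (fun n => ?_) (fun n δ hδ => ?_) t5
    · simpa only [real_inner_self_eq_norm_sq] using
        integrable_inner_of_memLp (hse n).grad.2.1 (hse n).grad.2.1
    · filter_upwards [(hse n).grad.ae_eq_zero] with x hx
      by_cases hxV : x ∈ V
      · rw [Set.indicator_of_mem hxV]
        refine (abs_real_inner_le_norm _ _).trans ?_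
        rw [← sub_nonneg]
        have : δ * ‖B x‖ ^ 2 + δ⁻¹ * ‖E n x‖ ^ 2 - ‖B x‖ * ‖E n x‖ =
            δ⁻¹ * ((δ * ‖B x‖ - ‖E n x‖ / 2) ^ 2 + 3 / 4 * ‖E n x‖ ^ 2) := by
          field_simp; ring
        rw [this]; positivity
      · rw [(hx hxV).2, Set.indicator_of_notMem hxV]; simp
  have t7 := tendsto_integral_abs_resolvent hc hVo hV hg hs0.supp hβ hβt hse
  have iU : ∀ n, Integrable (U n) μ := fun n => (hU n).grad.integrable hV
  have iD : ∀ n, Integrable (fun x => inner ℝ (B x) (D n x)) μ := fun n =>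
    (hU n).grad.integrable_inner_drift hc hV
  have iW : ∀ n, Integrable (fun x => β n * e n x + inner ℝ (B x) (D n x)) μ := fun n =>
    ((hei n).const_mul _).add (iD n)
  refine mem_closure_of_tendsto (b := atTop)
    (f := fun n => ((iU n).toL1 (U n), (iW n).toL1 _)) ?_ (Eventually.of_forall fun n => ?_)
  · rw [Prod.tendsto_iff]
    constructor <;> rw [tendsto_iff_dist_tendsto_zero]
    · refine t2.congr fun n => ?_
      rw [L1_dist_eq]
      refine integral_congr_ae ?_
      filter_upwards [(iU n).coeFn_toL1] with x hx
      simp only [hx, e]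
    · refine squeeze_zero (fun n => dist_nonneg) (fun n => ?_) (by simpa using t7.add t6)
      have iE : Integrable (fun x => inner ℝ (B x) (E n x)) μ :=
        (hse n).grad.integrable_inner_drift hc hV
      have iw : Integrable (fun x => |β n * e n x - g x|) μ := (hse n).int.abs
      rw [L1_dist_eq, ← integral_add iw iE.abs]
      refine integral_mono_of_nonneg (Eventually.of_forall fun x => abs_nonneg _) (iw.add iE.abs) ?_
      filter_upwards [(iW n).coeFn_toL1] with x hx
      simp only [hx]
      have e1 : β n * e n x + inner ℝ (B x) (D n x) - p.2 x =
          (β n * e n x - g x) + inner ℝ (B x) (E n x) := by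
        simp only [hgdef, E, inner_sub_right]; ring
      rw [e1]
      exact abs_add_le _ _
  · have hw2 : MemLp (fun x => β n * e n x) 2 μ := (hse n).grad.1.const_mul _
    refine ⟨D n, fun x => β n * e n x, ⟨(hU n).grad.congr (iU n).coeFn_toL1.symm EventuallyEq.rfl,
      hw2, ?_, fun v H hv => ?_⟩, ?_, (iW n).coeFn_toL1⟩
    · filter_upwards [(hse n).grad.ae_eq_zero] with x hx hxV
      rw [(hx hxV).1, mul_zero]
    · refine WeakSol.energy_eq hc hV ((hU n).congr EventuallyEq.rfl
        (Eventually.of_forall fun x => ?_)) hw2 hv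
      simp only [e]; ring
    · exact memLp_top_of_ae_bound (L1.integrable_coeFn _).1 (M := M) (by
        filter_upwards [(iU n).coeFn_toL1, hUb n] with x h1 h2
        rwa [h1])

/-! ### Tools for `L¹` -/

/-- Multiplication by the indicator function of `s`, on `L¹`. -/
def indicatorL1 {α : Type*} [MeasurableSpace α] (ν : Measure α) {s : Set α} (hs : MeasurableSet s) :
    Lp ℝ 1 ν →L[ℝ] Lp ℝ 1 ν :=
  LinearMap.mkContinuous
    { toFun := fun f => ((L1.integrable_coeFn f).indicator hs).toL1 _
      map_add' := fun f g => by
        rw [← Integrable.toL1_add]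
        refine (Integrable.toL1_eq_toL1_iff _ _ _ _).2 ?_
        filter_upwards [Lp.coeFn_add f g] with x hx
        by_cases hxs : x ∈ s
        · simp only [Set.indicator_of_mem hxs, hx, Pi.add_apply]
        · simp [hxs]
      map_smul' := fun c f => by
        rw [RingHom.id_apply, ← Integrable.toL1_smul]
        refine (Integrable.toL1_eq_toL1_iff _ _ _ _).2 ?_
        filter_upwards [Lp.coeFn_smul c f] with x hx
        by_cases hxs : x ∈ s <;> simp [hxs, hx] } 1 fun f => by
    rw [one_mul]
    refine Lp.norm_le_norm_of_ae_le ?_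
    filter_upwards [((L1.integrable_coeFn f).indicator hs).coeFn_toL1] with x hx
    refine (congrArg norm hx).trans_le (norm_indicator_le_norm_self _ _)

theorem coeFn_indicatorL1 {α : Type*} [MeasurableSpace α] {ν : Measure α} {s : Set α}
    (hs : MeasurableSet s) (f : Lp ℝ 1 ν) : indicatorL1 ν hs f =ᵐ[ν] s.indicator f :=
  ((L1.integrable_coeFn f).indicator hs).coeFn_toL1

theorem norm_indicatorL1_le {α : Type*} [MeasurableSpace α] {ν : Measure α} {s : Set α}
    (hs : MeasurableSet s) (f : Lp ℝ 1 ν) : ‖indicatorL1 ν hs f‖ ≤ ‖f‖ := by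
  refine Lp.norm_le_norm_of_ae_le ?_
  filter_upwards [coeFn_indicatorL1 hs f] with x hx
  rw [hx]
  exact norm_indicator_le_norm_self _ _

theorem indicatorL1_eq_self {α : Type*} [MeasurableSpace α] {ν : Measure α} {s : Set α}
    (hs : MeasurableSet s) {f : Lp ℝ 1 ν} (hf : ∀ᵐ x ∂ν, x ∉ s → f x = 0) :
    indicatorL1 ν hs f = f := by
  refine Lp.ext ((coeFn_indicatorL1 hs f).trans ?_)
  filter_upwards [hf] with x hx
  by_cases hxs : x ∈ s <;> simp [hxs, hx]

/-- `∫ (f - k)⁺`. -/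
def posMass {α : Type*} [MeasurableSpace α] {ν : Measure α} (k : ℝ) (f : Lp ℝ 1 ν) : ℝ :=
  ∫ x, max (f x - k) 0 ∂ν

/-- The positive part is `1`-Lipschitz. Continuity is what carries the basic estimate over to
closures, and pointwise bounds over to `L¹` limits. -/
theorem continuous_posMass {α : Type*} [MeasurableSpace α] {ν : Measure α} {k : ℝ} (hk : 0 ≤ k) :
    Continuous (posMass (ν := ν) k) := by
  refine LipschitzWith.continuous (K := 1) (LipschitzWith.of_dist_le_mul fun f g => ?_)
  have i1 := integrable_posPart_sub (L1.integrable_coeFn f) hk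
  have i2 := integrable_posPart_sub (L1.integrable_coeFn g) hk
  rw [Real.dist_eq, posMass, posMass, ← integral_sub i1 i2, L1_dist_eq, NNReal.coe_one, one_mul]
  refine abs_integral_le_integral_abs.trans (integral_mono (i1.sub i2).abs
    ((L1.integrable_coeFn f).sub (L1.integrable_coeFn g)).abs fun x => ?_)
  simpa using abs_max_sub_max_le_abs (f x - k) (g x - k) 0

theorem norm_eq_posMass {α : Type*} [MeasurableSpace α] {ν : Measure α} (f : Lp ℝ 1 ν) :
    ‖f‖ = posMass 0 f + posMass 0 (-f) := by
  rw [L1.norm_eq_integral_norm]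
  simp only [Real.norm_eq_abs]
  rw [integral_abs_eq_posPart (L1.integrable_coeFn f)]
  congr 1
  refine integral_congr_ae ?_
  filter_upwards [Lp.coeFn_neg f] with x hx
  rw [hx]; rfl

theorem posMass_nonpos_iff {α : Type*} [MeasurableSpace α] {ν : Measure α} {k : ℝ} (hk : 0 ≤ k)
    {f : Lp ℝ 1 ν} : posMass k f ≤ 0 ↔ ∀ᵐ x ∂ν, f x ≤ k := by
  refine ⟨ae_le_of_integral_posPart_nonpos (L1.integrable_coeFn f) hk, fun h => ?_⟩
  refine integral_nonpos_of_ae ?_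
  filter_upwards [h] with x hx
  simp [hx]

/-! ### The closed operator on a relatively compact open set -/

theorem WeakSol.zero [IsFiniteMeasureOnCompacts μ] :
    WeakSol μ A B V (fun _ => 0) (fun _ => 0) (fun _ => 0) := by
  refine ⟨⟨MemLp.zero, MemLp.zero, fun _ _ => 0, fun _ => IsTestFun.zero V, by simp, ?_⟩,
    integrable_zero _ _ _, by simp, fun v H hv hvb => ?_⟩
  · simp [gradient_fun_const]
  · simp [energy, matInner]

/-- The graph of weak solutions as a subspace. -/
def weakOperator (hc : AdmissibleCoeff μ A B) (hV : IsCompact (closure V)) :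
    Submodule ℝ (Lp ℝ 1 μ × Lp ℝ 1 μ) where
  carrier := weakGraph μ A B V
  zero_mem' := by
    have := hc.finite
    exact ⟨fun _ => 0, WeakSol.zero.congr (Lp.coeFn_zero _ _ _).symm (Lp.coeFn_zero _ _ _).symm,
      (memLp_congr_ae (Lp.coeFn_zero _ _ _)).2 MemLp.zero⟩
  add_mem' := by
    rintro p q ⟨F, hp, hpb⟩ ⟨H, hq, hqb⟩
    refine ⟨fun x => F x - -H x, (hp.sub hc hV (hq.neg hc)).congr ?_ ?_,
      (memLp_congr_ae (Lp.coeFn_add _ _)).2 (hpb.add hqb)⟩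
    · filter_upwards [Lp.coeFn_add p.1 q.1] with x hx
      rw [Prod.fst_add, hx, sub_neg_eq_add, Pi.add_apply]
    · filter_upwards [Lp.coeFn_add p.2 q.2] with x hx
      rw [Prod.snd_add, hx, sub_neg_eq_add, Pi.add_apply]
  smul_mem' := by
    rintro c p ⟨F, hp, hpb⟩
    exact ⟨fun x => c • F x, (hp.const_mul hc c).congr (Lp.coeFn_smul c p.1).symm
      (Lp.coeFn_smul c p.2).symm, (memLp_congr_ae (Lp.coeFn_smul c p.1)).2 (hpb.const_smul c)⟩

/-- The closure in `L¹` of the operator `L^V`. -/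
def closedOperator (hc : AdmissibleCoeff μ A B) (hV : IsCompact (closure V)) :
    Submodule ℝ (Lp ℝ 1 μ × Lp ℝ 1 μ) :=
  (weakOperator hc hV).topologicalClosure

/-- The weak graph lies between `L^V` and its closure. It is closed instead of `L^V` because it is a
subspace on which the estimates hold and resolvents of bounded functions are found. -/
theorem coe_closedOperator (hc : AdmissibleCoeff μ A B) (hVo : IsOpen V)
    (hV : IsCompact (closure V)) :
    (closedOperator hc hV : Set (Lp ℝ 1 μ × Lp ℝ 1 μ)) = closure (dirichletOpGraph μ A B V) := by
  rw [closedOperator, Submodule.topologicalClosure_coe]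
  refine subset_antisymm ?_ (closure_mono (dirichletOpGraph_subset_weakGraph hc hV))
  exact closure_minimal (weakGraph_subset_closure hc hVo hV) isClosed_closure

theorem isClosed_closedOperator (hc : AdmissibleCoeff μ A B) (hV : IsCompact (closure V)) :
    IsClosed (closedOperator hc hV : Set (Lp ℝ 1 μ × Lp ℝ 1 μ)) :=
  Submodule.isClosed_topologicalClosure _

theorem WeakSol.mem_closedOperator (hc : AdmissibleCoeff μ A B) (hV : IsCompact (closure V))
    {p : Lp ℝ 1 μ × Lp ℝ 1 μ} (hs : WeakSol μ A B V u F h) (hu : MemLp u ∞ μ)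
    (h1 : p.1 =ᵐ[μ] u) (h2 : p.2 =ᵐ[μ] h) : p ∈ closedOperator hc hV :=
  Submodule.le_topologicalClosure _
    ⟨F, hs.congr h1.symm h2.symm, (memLp_congr_ae h1).2 hu⟩

section closedOperator

variable {hc : AdmissibleCoeff μ A B} {hV : IsCompact (closure V)} {p : Lp ℝ 1 μ × Lp ℝ 1 μ}

theorem closedOperator.indicator_fst (hp : p ∈ closedOperator hc hV) (hVm : MeasurableSet V) :
    indicatorL1 μ hVm p.1 = p.1 := by
  have := hc.finite
  refine closure_minimal (t := {p : Lp ℝ 1 μ × Lp ℝ 1 μ | indicatorL1 μ hVm p.1 = p.1}) ?_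
    (isClosed_eq (by fun_prop) (by fun_prop)) hp
  rintro p ⟨F, hs, -⟩
  exact indicatorL1_eq_self _ (hs.grad.ae_eq_zero.mono fun x hx hxV => (hx hxV).1)

theorem closedOperator.posMass_le (hp : p ∈ closedOperator hc hV) (hVo : IsOpen V) {α k : ℝ}
    (hα : 0 < α) (hk : 0 ≤ k) :
    α * posMass k p.1 ≤ posMass (α * k) (α • p.1 - p.2) := by
  refine closure_minimal
    (t := {p : Lp ℝ 1 μ × Lp ℝ 1 μ | α * posMass k p.1 ≤ posMass (α * k) (α • p.1 - p.2)}) ?_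
    (isClosed_le (continuous_const.mul ((continuous_posMass hk).comp continuous_fst))
      ((continuous_posMass (by positivity)).comp (by fun_prop))) hp
  rintro p ⟨F, hs, -⟩
  refine (hs.estimate hc hVo hV hα hk).trans_eq (integral_congr_ae ?_)
  filter_upwards [Lp.coeFn_sub (α • p.1) p.2, Lp.coeFn_smul α p.1] with x h1 h2
  rw [h1, Pi.sub_apply, h2, Pi.smul_apply, smul_eq_mul]

theorem closedOperator.norm_le (hp : p ∈ closedOperator hc hV) (hVo : IsOpen V) {α : ℝ}
    (hα : 0 < α) : α * ‖p.1‖ ≤ ‖α • p.1 - p.2‖ := by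
  have h1 := closedOperator.posMass_le hp hVo hα le_rfl
  have h2 := closedOperator.posMass_le (Submodule.neg_mem _ hp) hVo hα le_rfl
  rw [norm_eq_posMass, norm_eq_posMass, mul_add]
  rw [mul_zero] at h1 h2
  refine add_le_add h1 (h2.trans_eq ?_)
  congr 1
  simp only [Prod.fst_neg, Prod.snd_neg, smul_neg]
  abel

end closedOperator

theorem exists_weakSol_of_bdd (hc : AdmissibleCoeff μ A B) (hVo : IsOpen V)
    (hV : IsCompact (closure V)) {α : ℝ} (hα : 0 < α) {f : RSpace d → ℝ} {M : ℝ} (hM : 0 ≤ M)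
    (hfm : AEStronglyMeasurable f μ) (hf : ∀ᵐ x ∂μ, |f x| ≤ M) :
    ∃ u F, WeakSol μ A B V u F (fun x => α * u x - V.indicator f x) ∧ MemLp u ∞ μ ∧
      ∀ᵐ x ∂μ, |u x| ≤ M / α := by
  have := hc.finite
  have hfb : ∀ᵐ x ∂μ, |V.indicator f x| ≤ M := by
    filter_upwards [hf] with x hx
    by_cases hxV : x ∈ V <;> simp [hxV, hx, hM]
  have hf2 : MemLp (V.indicator f) 2 μ := by
    rw [memLp_indicator_iff_restrict hVo.measurableSet]
    have : IsFiniteMeasure (μ.restrict V) :=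
      ⟨by simpa using measure_lt_top_of_isCompact_closure hV⟩
    exact MemLp.of_bound hfm.restrict M (ae_restrict_of_ae hf)
  obtain ⟨u, F, hs⟩ := exists_weakSol hc hV hα hf2
    (Eventually.of_forall fun x hx => Set.indicator_of_notMem hx f)
  have hb := hs.ae_abs_le hc hVo hV hα hM (by
    filter_upwards [hfb] with x hx
    rwa [_root_.sub_sub_cancel])
  exact ⟨u, F, hs, memLp_top_of_ae_bound hs.grad.1.1 hb, hb⟩

/-- On the complete graph, `α - L̄^V` is bounded below by the `L¹` estimate, so it is injective with
closed range. The range contains all test functions in `V`, and these are dense among the integrable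
functions vanishing off `V`. -/
theorem exists_dirichletResolvent (hc : AdmissibleCoeff μ A B) (hVo : IsOpen V)
    (hV : IsCompact (closure V)) {α : ℝ} (hα : 0 < α) : ∃ S : Lp ℝ 1 μ →L[ℝ] Lp ℝ 1 μ,
      ∀ f, (S f, α • S f - indicatorL1 μ hVo.measurableSet f) ∈ closedOperator hc hV := by
  have := hc.finite
  let Φ : closedOperator hc hV →L[ℝ] Lp ℝ 1 μ :=
    (α • ContinuousLinearMap.fst ℝ (Lp ℝ 1 μ) (Lp ℝ 1 μ) -
      ContinuousLinearMap.snd ℝ (Lp ℝ 1 μ) (Lp ℝ 1 μ)).comp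
      (closedOperator hc hV).subtypeL
  have hΦ : ∀ p : closedOperator hc hV, Φ p = α • (p : Lp ℝ 1 μ × Lp ℝ 1 μ).1 - p.1.2 :=
    fun p => rfl
  have h1 : ∀ p : closedOperator hc hV, ‖p.1.1‖ ≤ α⁻¹ * ‖Φ p‖ := fun p => by
    rw [le_inv_mul_iff₀ hα, hΦ]
    exact closedOperator.norm_le p.2 hVo hα
  -- The graph carries the maximum norm of a pair; the second component is recovered as `αp₁ - Φp`.
  have h2 : ∀ p : closedOperator hc hV, ‖p‖ ≤ (α⁻¹ + 2) * ‖Φ p‖ := fun p => by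
    have h3 : ‖p.1.2‖ ≤ 2 * ‖Φ p‖ := by
      have e : p.1.2 = α • p.1.1 - Φ p := by rw [hΦ]; abel
      rw [e]
      refine (norm_sub_le _ _).trans ?_
      have := h1 p
      rw [le_inv_mul_iff₀ hα] at this
      rw [norm_smul, Real.norm_of_nonneg hα.le]; linarith
    have h0 : 0 ≤ α⁻¹ * ‖Φ p‖ := by positivity
    have h0' := norm_nonneg (Φ p)
    rw [Submodule.coe_norm, Prod.norm_def, add_mul]
    exact max_le (by linarith [h1 p]) (by linarith)
  have hanti : AntilipschitzWith (Real.toNNReal (α⁻¹ + 2)) Φ :=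
    ContinuousLinearMap.antilipschitz_of_bound _ fun p => by
      rw [Real.coe_toNNReal _ (by positivity)]; exact h2 p
  have : CompleteSpace (closedOperator hc hV) := (isClosed_closedOperator hc hV).completeSpace_coe
  have hrc : IsClosed (Set.range Φ) := hanti.isClosed_range Φ.uniformContinuous
  have hex : ∀ f : Lp ℝ 1 μ, ∃ p : closedOperator hc hV,
      Φ p = indicatorL1 μ hVo.measurableSet f := by
    intro f
    change _ ∈ Set.range Φ
    rw [← hrc.closure_eq, Metric.mem_closure_iff]
    intro ε hε
    obtain ⟨g, hg, hfg⟩ := exists_test_integral_abs_sub_le hVo hV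
      (L1.integrable_coeFn (indicatorL1 μ hVo.measurableSet f)) (by
        filter_upwards [coeFn_indicatorL1 hVo.measurableSet f] with x hx hxV
        rw [hx, Set.indicator_of_notMem hxV]) (half_pos hε)
    obtain ⟨M, hM⟩ := hg.exists_bound
    obtain ⟨u, F, hs, hub, -⟩ := exists_weakSol_of_bdd hc hVo hV hα ((norm_nonneg _).trans (hM 0))
      hg.smooth.continuous.aestronglyMeasurable (Eventually.of_forall hM)
    have iu := hs.grad.integrable hV
    have ig := hg.hasGradZero (μ := μ) |>.integrable hV
    have hgV : V.indicator g = g := Set.indicator_eq_self.2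
      (subset_tsupport _ |>.trans hg.subset)
    rw [hgV] at hs
    refine ⟨ig.toL1 g, ⟨⟨(iu.toL1 u, α • iu.toL1 u - ig.toL1 g),
      hs.mem_closedOperator hc hV hub iu.coeFn_toL1 ?_⟩, ?_⟩, ?_⟩
    · filter_upwards [Lp.coeFn_sub (α • iu.toL1 u) (ig.toL1 g), Lp.coeFn_smul α (iu.toL1 u),
        iu.coeFn_toL1, ig.coeFn_toL1] with x a b c d
      simp only [a, b, c, d, Pi.sub_apply, Pi.smul_apply, smul_eq_mul]
    · rw [hΦ]; simp
    · rw [L1_dist_eq]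
      refine lt_of_le_of_lt (le_of_eq_of_le (integral_congr_ae ?_) hfg) (half_lt_self hε)
      filter_upwards [ig.coeFn_toL1] with x hx
      rw [hx]
  choose P hP using hex
  have hinj := hanti.injective
  let S : Lp ℝ 1 μ →ₗ[ℝ] Lp ℝ 1 μ :=
    { toFun := fun f => (P f).1.1
      map_add' := fun f g => by
        have : P (f + g) = P f + P g := hinj (by rw [map_add Φ, hP, hP, hP, map_add])
        rw [this]; rfl
      map_smul' := fun c f => by
        have : P (c • f) = c • P f := hinj (by rw [map_smul Φ, hP, hP, map_smul])
        rw [this]; rfl }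
  refine ⟨S.mkContinuous α⁻¹ fun f => ?_, fun f => ?_⟩
  · refine (h1 (P f)).trans ?_
    rw [hP]
    exact mul_le_mul_of_nonneg_left (norm_indicatorL1_le _ _) (by positivity)
  · convert (P f).2 using 1
    refine Prod.ext rfl ?_
    rw [← hP, hΦ]
    exact _root_.sub_sub_cancel _ _

/-! ### The resolvent on a relatively compact open set -/

/-- `f ↦ (α - L̄^V)⁻¹ (f 1_V)`, for `α > 0`. -/
def dirichletResolvent (hc : AdmissibleCoeff μ A B) (hVo : IsOpen V) (hV : IsCompact (closure V))
    (α : ℝ) : Lp ℝ 1 μ →L[ℝ] Lp ℝ 1 μ :=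
  if hα : 0 < α then (exists_dirichletResolvent hc hVo hV hα).choose else 0

section dirichletResolvent

variable (hc : AdmissibleCoeff μ A B) (hVo : IsOpen V) (hV : IsCompact (closure V)) {α : ℝ}

theorem dirichletResolvent_mem (hα : 0 < α) (f : Lp ℝ 1 μ) :
    (dirichletResolvent hc hVo hV α f, α • dirichletResolvent hc hVo hV α f -
      indicatorL1 μ hVo.measurableSet f) ∈ closedOperator hc hV := by
  rw [dirichletResolvent, dif_pos hα]
  exact (exists_dirichletResolvent hc hVo hV hα).choose_spec f

theorem dirichletResolvent_eq_iff (hα : 0 < α) {f g : Lp ℝ 1 μ} :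
    dirichletResolvent hc hVo hV α f = g ↔
      (g, α • g - indicatorL1 μ hVo.measurableSet f) ∈ closedOperator hc hV := by
  refine ⟨fun h => h ▸ dirichletResolvent_mem hc hVo hV hα f, fun h => ?_⟩
  have h1 := Submodule.sub_mem _ (dirichletResolvent_mem hc hVo hV hα f) h
  have h2 := closedOperator.norm_le h1 hVo hα
  simp only [Prod.fst_sub, Prod.snd_sub] at h2
  rw [smul_sub, sub_sub_sub_cancel_right, sub_self, norm_zero] at h2
  have h3 := norm_nonneg (dirichletResolvent hc hVo hV α f - g)
  exact sub_eq_zero.1 (norm_eq_zero.1 (by nlinarith))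

theorem isDirichletResolvent_iff (hα : 0 < α) {f g : Lp ℝ 1 μ} :
    IsDirichletResolvent μ A B V α f g ↔ g = dirichletResolvent hc hVo hV α f := by
  rw [eq_comm, dirichletResolvent_eq_iff hc hVo hV hα, IsDirichletResolvent,
    ← coe_closedOperator hc hVo hV]
  constructor
  · rintro ⟨h, h1, h2⟩
    have e : h = α • g - indicatorL1 μ hVo.measurableSet f := by
      rw [eq_sub_iff_add_eq', ← eq_sub_iff_add_eq]
      exact Lp.ext ((coeFn_indicatorL1 _ _).trans h2.symm)
    rwa [← e]
  · intro h1
    refine ⟨_, h1, ?_⟩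
    rw [_root_.sub_sub_cancel]
    exact coeFn_indicatorL1 _ _

theorem posMass_dirichletResolvent_le (hα : 0 < α) {k : ℝ} (hk : 0 ≤ k) (f : Lp ℝ 1 μ) :
    α * posMass k (dirichletResolvent hc hVo hV α f) ≤
      posMass (α * k) (indicatorL1 μ hVo.measurableSet f) := by
  have := closedOperator.posMass_le (dirichletResolvent_mem hc hVo hV hα f) hVo hα hk
  rwa [_root_.sub_sub_cancel] at this

theorem norm_dirichletResolvent_le (hα : 0 < α) (f : Lp ℝ 1 μ) :
    ‖dirichletResolvent hc hVo hV α f‖ ≤ α⁻¹ * ‖f‖ := by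
  have := closedOperator.norm_le (dirichletResolvent_mem hc hVo hV hα f) hVo hα
  rw [_root_.sub_sub_cancel] at this
  rw [le_inv_mul_iff₀ hα]
  exact this.trans (norm_indicatorL1_le _ _)

theorem dirichletResolvent_ae_le (hα : 0 < α) {k : ℝ} (hk : 0 ≤ k) {f : Lp ℝ 1 μ}
    (hf : ∀ᵐ x ∂μ, f x ≤ k) : ∀ᵐ x ∂μ, dirichletResolvent hc hVo hV α f x ≤ k / α := by
  have h1 := posMass_dirichletResolvent_le hc hVo hV hα (k := k / α) (by positivity) f
  rw [mul_div_cancel₀ _ hα.ne'] at h1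
  have h2 : posMass k (indicatorL1 μ hVo.measurableSet f) ≤ 0 := by
    rw [posMass_nonpos_iff hk]
    filter_upwards [hf, coeFn_indicatorL1 hVo.measurableSet f] with x a b
    rw [b]
    by_cases hx : x ∈ V <;> simp [hx, a, hk]
  exact (posMass_nonpos_iff (by positivity)).1 (nonpos_of_mul_nonpos_right (h1.trans h2) hα)

theorem dirichletResolvent_nonneg (hα : 0 < α) {f : Lp ℝ 1 μ} (hf : 0 ≤ f) :
    0 ≤ dirichletResolvent hc hVo hV α f := by
  have h1 := dirichletResolvent_ae_le hc hVo hV hα le_rfl (f := -f) (by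
    filter_upwards [(Lp.coeFn_nonneg f).2 hf, Lp.coeFn_neg f] with x a b
    rw [b, Pi.neg_apply]
    exact neg_nonpos.2 a)
  rw [map_neg] at h1
  rw [← Lp.coeFn_nonneg]
  filter_upwards [h1, Lp.coeFn_neg (dirichletResolvent hc hVo hV α f)] with x a b
  rw [b, Pi.neg_apply, zero_div] at a
  exact neg_nonpos.1 a

theorem indicatorL1_dirichletResolvent (hα : 0 < α) (f : Lp ℝ 1 μ) :
    indicatorL1 μ hVo.measurableSet (dirichletResolvent hc hVo hV α f) =
      dirichletResolvent hc hVo hV α f :=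
  closedOperator.indicator_fst (dirichletResolvent_mem hc hVo hV hα f) _

/-- With `g = R_β f`, the equation `(β - L)g = f` on `V` can be rewritten as `(α - L)g = f + (α -
β)g`. The indicator does no harm, since `g` vanishes off `V`. -/
theorem dirichletResolvent_resolvent_eq {β : ℝ} (hα : 0 < α) (hβ : 0 < β) (f : Lp ℝ 1 μ) :
    dirichletResolvent hc hVo hV α f - dirichletResolvent hc hVo hV β f =
      (β - α) • dirichletResolvent hc hVo hV α (dirichletResolvent hc hVo hV β f) := by
  set g := dirichletResolvent hc hVo hV β f with hg
  have h1 : dirichletResolvent hc hVo hV α (f + (α - β) • g) = g := by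
    rw [dirichletResolvent_eq_iff hc hVo hV hα, map_add, map_smul, hg,
      indicatorL1_dirichletResolvent hc hVo hV hβ]
    convert dirichletResolvent_mem hc hVo hV hβ f using 2
    module
  rw [map_add, map_smul] at h1
  nth_rw 1 [← h1]
  module

/-- Resolvents of bounded functions are weak solutions. -/
theorem exists_weakSol_dirichletResolvent (hα : 0 < α) {f : Lp ℝ 1 μ} {M : ℝ} (hM : 0 ≤ M)
    (hf : ∀ᵐ x ∂μ, |f x| ≤ M) :
    ∃ F, WeakSol μ A B V (dirichletResolvent hc hVo hV α f) F
        (fun x => α * dirichletResolvent hc hVo hV α f x - V.indicator f x) ∧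
      ∀ᵐ x ∂μ, |dirichletResolvent hc hVo hV α f x| ≤ M / α := by
  have := hc.finite
  obtain ⟨u, F, hs, hub, hb⟩ := exists_weakSol_of_bdd hc hVo hV hα hM (L1.integrable_coeFn f).1 hf
  have iu := hs.grad.integrable hV
  have e : dirichletResolvent hc hVo hV α f = iu.toL1 u := by
    rw [dirichletResolvent_eq_iff hc hVo hV hα]
    refine hs.mem_closedOperator hc hV hub iu.coeFn_toL1 ?_
    filter_upwards [Lp.coeFn_sub (α • iu.toL1 u) (indicatorL1 μ hVo.measurableSet f),
      Lp.coeFn_smul α (iu.toL1 u), iu.coeFn_toL1, coeFn_indicatorL1 hVo.measurableSet f]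
      with x a b c d
    rw [a, Pi.sub_apply, b, Pi.smul_apply, c, d, smul_eq_mul]
  rw [e]
  refine ⟨F, hs.congr iu.coeFn_toL1.symm ?_, ?_⟩
  · filter_upwards [iu.coeFn_toL1] with x hx
    rw [hx]
  · filter_upwards [iu.coeFn_toL1, hb] with x hx hx'
    rwa [hx]

/-- Bounded weak solutions are resolvents. -/
theorem WeakSol.dirichletResolvent_eq {f g : Lp ℝ 1 μ} (hα : 0 < α) (hs : WeakSol μ A B V u F h)
    (hu : MemLp u ∞ μ) (hg : g =ᵐ[μ] u) (hf : f =ᵐ[μ] fun x => α * u x - h x) :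
    dirichletResolvent hc hVo hV α f = g := by
  have := hc.finite
  rw [dirichletResolvent_eq_iff hc hVo hV hα]
  refine hs.mem_closedOperator hc hV hu hg ?_
  filter_upwards [Lp.coeFn_sub (α • g) (indicatorL1 μ hVo.measurableSet f),
    Lp.coeFn_smul α g, hg, coeFn_indicatorL1 hVo.measurableSet f, hf, hs.supp,
    hs.grad.ae_eq_zero] with x a b c d e k l
  rw [a, Pi.sub_apply, b, Pi.smul_apply, c, d, smul_eq_mul]
  by_cases hx : x ∈ V
  · rw [Set.indicator_of_mem hx, e]; ring
  · rw [Set.indicator_of_notMem hx, k hx, (l hx).1]; ring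

end dirichletResolvent

/-! ### Monotonicity in the domain -/

/-- Comparison of weak solutions on `V ⊆ W` with a nonnegative right-hand side. -/
theorem WeakSol.le_of_subset (hc : AdmissibleCoeff μ A B) (hV : IsCompact (closure V))
    (hW : IsCompact (closure W)) (hVW : V ⊆ W) {α : ℝ} (hα : 0 < α) {f u₁ u₂ : RSpace d → ℝ}
    {F₁ F₂ : RSpace d → RSpace d} (hf : ∀ᵐ x ∂μ, 0 ≤ f x)
    (hs₁ : WeakSol μ A B V u₁ F₁ (fun x => α * u₁ x - V.indicator f x))
    (hs₂ : WeakSol μ A B W u₂ F₂ (fun x => α * u₂ x - W.indicator f x))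
    (hu₂ : ∀ᵐ x ∂μ, 0 ≤ u₂ x) : ∀ᵐ x ∂μ, u₁ x ≤ u₂ x := by
  have := hc.finite
  have hw : HasGradZero μ W (fun x => u₁ x - u₂ x) (fun x => F₁ x - F₂ x) :=
    (hs₁.grad.mono hVW).sub hs₂.grad
  have step : ∀ ε > 0, ∀ᵐ x ∂μ, u₁ x - u₂ x ≤ ε + ε := by
    intro ε hε
    obtain ⟨ψ, Ψ, hψ, hΨ, hΨ0, hΨψ, h01, hmono, ⟨C, hC⟩, hz, hone⟩ := exists_smooth_step ε hε
    obtain ⟨θ, -, hθ, -, -, -, hθ01, -, ⟨D, hD⟩, hθz, hθone⟩ := exists_smooth_step 0 hε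
    have hψ1 : ∀ t, |ψ t| ≤ 1 := fun t => abs_le.2 ⟨by linarith [(h01 t).1], (h01 t).2⟩
    have hθ1 : ∀ t, |θ t| ≤ 1 := fun t => abs_le.2 ⟨by linarith [(hθ01 t).1], (hθ01 t).2⟩
    set z : RSpace d → ℝ := fun x => ψ (u₁ x - u₂ x) with hzdef
    set Z : RSpace d → RSpace d := fun x => deriv ψ (u₁ x - u₂ x) • (F₁ x - F₂ x) with hZdef
    have hzW : HasGradZero μ W z Z := hw.comp hψ (hz 0 hε.le) hC
    have hzb : MemLp z ∞ μ := memLp_top_of_ae_bound hzW.1.1 (Eventually.of_forall fun x => hψ1 _)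
    -- To test the equation on the smaller set, `z` must lie in `H₀^{1,2}(V, μ)`. Where `z ≠ 0`, the
    -- inequalities `u₁ - u₂ > ε` and `u₂ ≥ 0` force `θ(u₁) = 1`, so `z = θ(u₁)z` with `θ(u₁)` in
    -- `H₀^{1,2}(V, μ)`. Uniqueness of the gradient keeps `Z`.
    have hzV : HasGradZero μ V z Z := by
      have h1 := hs₁.grad.comp hθ (hθz 0 le_rfl) hD
      have h2 := (h1.mul (memLp_top_of_ae_bound h1.1.1 (Eventually.of_forall fun x => hθ1 _))
        hzW hzb).mono Set.inter_subset_left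
      have e : (fun x => θ (u₁ x) * z x) =ᵐ[μ] z := by
        filter_upwards [hu₂] with x hx
        rcases le_total (u₁ x - u₂ x) ε with h | h
        · simp only [hzdef, hz _ h, mul_zero]
        · rw [hθone _ (by linarith), one_mul]
      have h3 := h2.congr e EventuallyEq.rfl
      exact h3.congr EventuallyEq.rfl (h3.ae_unique hc hzW)
    have k1 := hs₁.eq z Z hzV hzb
    have k2 := hs₂.eq z Z hzW hzb
    have k3 : ∫ x, inner ℝ (B x) (F₁ x - F₂ x) * z x ∂μ = 0 := by
      have h3 := (hw.comp hΨ hΨ0 (by rw [hΨψ]; exact hψ1)).integral_inner_drift hc hW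
      simp_rw [hΨψ, inner_smul_right] at h3
      simpa only [mul_comm] using h3
    have i1 : Integrable (fun x => inner ℝ (B x) (F₁ x) * z x) μ :=
      integrable_mul_bdd (hs₁.grad.integrable_inner_drift hc hV) hzb
    have i2 : Integrable (fun x => inner ℝ (B x) (F₂ x) * z x) μ :=
      integrable_mul_bdd (hs₂.grad.integrable_inner_drift hc hW) hzb
    simp only [inner_sub_right, sub_mul] at k3
    rw [integral_sub i1 i2] at k3
    have k4 : 0 ≤ energy μ A Z (fun x => F₁ x - F₂ x) := by
      unfold energy
      refine mul_nonneg (by norm_num) (integral_nonneg_of_ae ?_)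
      filter_upwards [hc.ae_nonneg] with x hx
      simp only [hZdef, matInner_smul_left]
      exact mul_nonneg (hmono _) (hx _)
    rw [hzV.energy_sub_right hc hV hs₁.grad.2.1 hs₂.grad.2.1, hc.energy_symm Z F₁,
      hc.energy_symm Z F₂] at k4
    have i3 : Integrable (fun x => (α * u₁ x - V.indicator f x) * z x) μ :=
      integrable_mul_bdd hs₁.int hzb
    have i4 : Integrable (fun x => (α * u₂ x - W.indicator f x) * z x) μ :=
      integrable_mul_bdd hs₂.int hzb
    have i5 : Integrable (fun x => (u₁ x - u₂ x) * z x) μ :=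
      integrable_mul_bdd (hw.integrable hW) hzb
    -- Subtracting the two equations removes the drift and leaves the energy with a favourable sign;
    -- `f ≥ 0` and `V ⊆ W` settle the data terms.
    have k5 : α * ∫ x, (u₁ x - u₂ x) * z x ∂μ ≤ 0 := by
      calc α * ∫ x, (u₁ x - u₂ x) * z x ∂μ
          ≤ ∫ x, ((α * u₁ x - V.indicator f x) * z x - (α * u₂ x - W.indicator f x) * z x) ∂μ := by
            rw [← integral_const_mul]
            refine integral_mono_ae (i5.const_mul α) (i3.sub i4) ?_
            filter_upwards [hf] with x hx
            have h1 : V.indicator f x ≤ W.indicator f x := by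
              by_cases hxV : x ∈ V
              · rw [Set.indicator_of_mem hxV, Set.indicator_of_mem (hVW hxV)]
              · rw [Set.indicator_of_notMem hxV]
                exact Set.indicator_apply_nonneg fun _ => hx
            have h2 : 0 ≤ z x := (h01 _).1
            nlinarith [mul_nonneg (sub_nonneg.2 h1) h2]
        _ ≤ 0 := by rw [integral_sub i3 i4]; linarith
    have hpos : 0 ≤ fun x => (u₁ x - u₂ x) * z x := fun x => by
      simp only [Pi.zero_apply, hzdef]
      rcases le_total (u₁ x - u₂ x) ε with h | h
      · rw [hz _ h, mul_zero]
      · exact mul_nonneg (by linarith) (h01 _).1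
    have k6 : ∫ x, (u₁ x - u₂ x) * z x ∂μ = 0 :=
      le_antisymm (nonpos_of_mul_nonpos_right k5 hα) (integral_nonneg hpos)
    filter_upwards [(integral_eq_zero_iff_of_nonneg hpos i5).1 k6] with x hx
    by_contra hlt
    push Not at hlt
    simp only [hzdef, hone _ hlt.le, mul_one, Pi.zero_apply] at hx
    linarith
  have hall : ∀ n : ℕ, ∀ᵐ x ∂μ, u₁ x - u₂ x ≤ 1 / ((n : ℝ) + 1) + 1 / ((n : ℝ) + 1) :=
    fun n => step _ (by positivity)
  filter_upwards [ae_all_iff.2 hall] with x hx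
  have hlim : Tendsto (fun n : ℕ => 1 / ((n : ℝ) + 1) + 1 / ((n : ℝ) + 1)) atTop (𝓝 (0 + 0)) :=
    tendsto_one_div_add_atTop_nhds_zero_nat.add tendsto_one_div_add_atTop_nhds_zero_nat
  rw [add_zero] at hlim
  exact sub_nonpos.1 (ge_of_tendsto' hlim hx)

/-- Nonnegative integrable functions are limits in `L¹` of their truncations. -/
theorem exists_seq_bdd_tendsto {α : Type*} [MeasurableSpace α] {ν : Measure α} {f : Lp ℝ 1 ν}
    (hf : 0 ≤ f) : ∃ g : ℕ → Lp ℝ 1 ν, (∀ n, 0 ≤ g n) ∧ (∀ n, ∀ᵐ x ∂ν, |g n x| ≤ n) ∧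
      Tendsto g atTop (𝓝 f) := by
  have hf' := (Lp.coeFn_nonneg f).2 hf
  have hi := L1.integrable_coeFn f
  have i1 : ∀ n : ℕ, Integrable (fun x => min (f x) n) ν := fun n => by
    refine hi.norm.mono' (hi.1.inf aestronglyMeasurable_const) ?_
    filter_upwards [hf'] with x hx
    have hx : 0 ≤ f x := hx
    rw [Real.norm_of_nonneg (le_min hx (Nat.cast_nonneg _))]
    exact (min_le_left _ _).trans (le_abs_self _)
  refine ⟨fun n => (i1 n).toL1 _, fun n => ?_, fun n => ?_, ?_⟩
  · rw [← Lp.coeFn_nonneg]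
    filter_upwards [hf', (i1 n).coeFn_toL1] with x hx h
    rw [h]; exact le_min hx (Nat.cast_nonneg _)
  · filter_upwards [hf', (i1 n).coeFn_toL1] with x hx h
    rw [h, abs_of_nonneg (le_min hx (Nat.cast_nonneg _))]
    exact min_le_right _ _
  · rw [tendsto_iff_dist_tendsto_zero]
    have h1 : Tendsto (fun n : ℕ => ∫ x, |min (f x) n - f x| ∂ν) atTop (𝓝 (∫ _, (0 : ℝ) ∂ν)) := by
      refine tendsto_integral_of_dominated_convergence (fun x => ‖f x‖)
        (fun n => ((i1 n).1.sub hi.1).norm) hi.norm (fun n => ?_) (Eventually.of_forall fun x => ?_)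
      · filter_upwards [hf'] with x hx
        have hx : 0 ≤ f x := hx
        rw [Real.norm_eq_abs, abs_abs, abs_of_nonpos (by linarith [min_le_left (f x) (n : ℝ)]),
          Real.norm_of_nonneg hx]
        linarith [le_min hx (Nat.cast_nonneg n : (0 : ℝ) ≤ n)]
      · refine tendsto_const_nhds.congr' ?_
        filter_upwards [eventually_ge_atTop ⌈f x⌉₊] with n hn
        rw [min_eq_left (Nat.ceil_le.1 hn), sub_self, abs_zero]
    rw [integral_zero] at h1
    refine h1.congr fun n => ?_
    rw [L1_dist_eq]
    refine integral_congr_ae ?_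
    filter_upwards [(i1 n).coeFn_toL1] with x hx
    rw [hx]

/-- Comparison is available for weak solutions, that is for bounded data. Truncation and continuity
of the resolvents extend it to all nonnegative integrable data. -/
theorem dirichletResolvent_mono (hc : AdmissibleCoeff μ A B) (hVo : IsOpen V)
    (hV : IsCompact (closure V)) (hWo : IsOpen W) (hW : IsCompact (closure W)) (hVW : V ⊆ W) {α : ℝ}
    (hα : 0 < α) {f : Lp ℝ 1 μ} (hf : 0 ≤ f) :
    dirichletResolvent hc hVo hV α f ≤ dirichletResolvent hc hWo hW α f := by
  obtain ⟨g, hg0, hgb, hgt⟩ := exists_seq_bdd_tendsto hf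
  refine le_of_tendsto_of_tendsto' (((dirichletResolvent hc hVo hV α).continuous.tendsto _).comp hgt)
    (((dirichletResolvent hc hWo hW α).continuous.tendsto _).comp hgt) fun n => ?_
  obtain ⟨F₁, hs₁, -⟩ := exists_weakSol_dirichletResolvent hc hVo hV hα (Nat.cast_nonneg n) (hgb n)
  obtain ⟨F₂, hs₂, -⟩ := exists_weakSol_dirichletResolvent hc hWo hW hα (Nat.cast_nonneg n) (hgb n)
  rw [← Lp.coeFn_le]
  exact hs₁.le_of_subset hc hV hW hVW hα ((Lp.coeFn_nonneg _).2 (hg0 n)) hs₂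
    ((Lp.coeFn_nonneg _).2 (dirichletResolvent_nonneg hc hWo hW hα (hg0 n)))

/-! ### The resolvent on the whole space -/

theorem L1_dist_eq_of_le {α : Type*} [MeasurableSpace α] {ν : Measure α} {f g : Lp ℝ 1 ν}
    (h : f ≤ g) : dist g f = (∫ x, g x ∂ν) - ∫ x, f x ∂ν := by
  rw [L1_dist_eq, ← integral_sub (L1.integrable_coeFn g) (L1.integrable_coeFn f)]
  refine integral_congr_ae ?_
  filter_upwards [(Lp.coeFn_le f g).2 h] with x hx
  rw [abs_of_nonneg (sub_nonneg.2 hx)]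

/-- Monotone convergence in `L¹`. -/
theorem exists_tendsto_of_monotone {α : Type*} [MeasurableSpace α] {ν : Measure α}
    {g : ℕ → Lp ℝ 1 ν} (hg : Monotone g) {C : ℝ} (hC : ∀ n, ‖g n‖ ≤ C) :
    ∃ l, Tendsto g atTop (𝓝 l) := by
  have hmono : Monotone fun n => ∫ x, g n x ∂ν := fun m n hmn =>
    integral_mono_ae (L1.integrable_coeFn _) (L1.integrable_coeFn _)
      ((Lp.coeFn_le _ _).2 (hg hmn))
  have hbdd : BddAbove (Set.range fun n => ∫ x, g n x ∂ν) := by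
    refine ⟨C, ?_⟩
    rintro _ ⟨n, rfl⟩
    refine (Real.le_norm_self _).trans ((norm_integral_le_integral_norm _).trans ?_)
    rw [← L1.norm_eq_integral_norm]
    exact hC n
  have hcau := (tendsto_atTop_ciSup hmono hbdd).cauchySeq
  refine cauchySeq_tendsto_of_complete ?_
  rw [Metric.cauchySeq_iff'] at hcau ⊢
  intro ε hε
  obtain ⟨N, hN⟩ := hcau ε hε
  refine ⟨N, fun n hn => ?_⟩
  rw [L1_dist_eq_of_le (hg hn)]
  exact (le_abs_self _).trans_lt (hN n hn)

/-- On nonnegative data the sequence is increasing with norm at most `α⁻¹‖f‖`. General data are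
split into positive and negative part. -/
theorem exists_tendsto_dirichletResolvent (hc : AdmissibleCoeff μ A B) {V : ℕ → Set (RSpace d)}
    (hVo : ∀ n, IsOpen (V n)) (hV : ∀ n, IsCompact (closure (V n))) (hm : Monotone V) {α : ℝ}
    (hα : 0 < α) (f : Lp ℝ 1 μ) :
    ∃ l, Tendsto (fun n => dirichletResolvent hc (hVo n) (hV n) α f) atTop (𝓝 l) := by
  have key : ∀ f : Lp ℝ 1 μ, 0 ≤ f →
      ∃ l, Tendsto (fun n => dirichletResolvent hc (hVo n) (hV n) α f) atTop (𝓝 l) := fun f hf =>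
    exists_tendsto_of_monotone
      (fun m n hmn => dirichletResolvent_mono hc (hVo m) (hV m) (hVo n) (hV n) (hm hmn) hα hf)
      (fun n => norm_dirichletResolvent_le hc (hVo n) (hV n) hα f)
  obtain ⟨l₁, h₁⟩ := key _ (posPart_nonneg f)
  obtain ⟨l₂, h₂⟩ := key _ (negPart_nonneg f)
  refine ⟨l₁ - l₂, (h₁.sub h₂).congr fun n => ?_⟩
  rw [← map_sub, posPart_sub_negPart]

/-- The balls `B_{n+1}(0)`. -/
def exhBall (d n : ℕ) : Set (RSpace d) := Metric.ball 0 ((n : ℝ) + 1)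

theorem isOpen_exhBall (d n : ℕ) : IsOpen (exhBall d n) := Metric.isOpen_ball

theorem isCompact_closure_exhBall (d n : ℕ) : IsCompact (closure (exhBall d n)) :=
  (isCompact_closedBall (0 : RSpace d) ((n : ℝ) + 1)).of_isClosed_subset isClosed_closure
    Metric.closure_ball_subset_closedBall

theorem monotone_exhBall (d : ℕ) : Monotone (exhBall d) := fun m n hmn =>
  Metric.ball_subset_ball (by gcongr)

theorem iUnion_exhBall (d : ℕ) : ⋃ n, exhBall d n = Set.univ := by
  refine Set.eq_univ_of_forall fun x => Set.mem_iUnion.2 ⟨⌈‖x‖⌉₊, ?_⟩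
  rw [exhBall, mem_ball_zero_iff]
  exact (Nat.le_ceil _).trans_lt (lt_add_one _)

theorem exists_subset_of_isCompact {K : Set (RSpace d)} (hK : IsCompact K)
    {V : ℕ → Set (RSpace d)} (hVo : ∀ n, IsOpen (V n)) (hm : Monotone V)
    (hU : ⋃ n, V n = Set.univ) : ∃ n, K ⊆ V n := by
  obtain ⟨n, hn⟩ := hK.elim_directed_cover V hVo (by rw [hU]; exact Set.subset_univ _)
    hm.directed_le
  exact ⟨n, hn⟩

/-- `dirichletResolvent` for the ball `B_{n+1}(0)`. -/
def ballResolvent (hc : AdmissibleCoeff μ A B) (n : ℕ) (α : ℝ) : Lp ℝ 1 μ →L[ℝ] Lp ℝ 1 μ :=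
  dirichletResolvent hc (isOpen_exhBall d n) (isCompact_closure_exhBall d n) α

theorem exists_tendsto_ballResolvent (hc : AdmissibleCoeff μ A B) {α : ℝ} (hα : 0 < α)
    (f : Lp ℝ 1 μ) : ∃ l, Tendsto (fun n => ballResolvent hc n α f) atTop (𝓝 l) :=
  exists_tendsto_dirichletResolvent hc (isOpen_exhBall d) (isCompact_closure_exhBall d)
    (monotone_exhBall d) hα f

/-- The resolvent on `L¹(ℝ^d, μ)`, as limit of the resolvents on balls. -/
def fullResolvent (hc : AdmissibleCoeff μ A B) (α : ℝ) : Lp ℝ 1 μ →L[ℝ] Lp ℝ 1 μ :=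
  if hα : 0 < α then
    continuousLinearMapOfTendsto (fun n => ballResolvent hc n α)
      (tendsto_pi_nhds.2 fun f => (exists_tendsto_ballResolvent hc hα f).choose_spec)
  else 0

section fullResolvent

variable (hc : AdmissibleCoeff μ A B) {α : ℝ}

theorem tendsto_ballResolvent (hα : 0 < α) (f : Lp ℝ 1 μ) :
    Tendsto (fun n => ballResolvent hc n α f) atTop (𝓝 (fullResolvent hc α f)) := by
  rw [fullResolvent, dif_pos hα]
  exact (exists_tendsto_ballResolvent hc hα f).choose_spec

theorem monotone_ballResolvent (hα : 0 < α) {f : Lp ℝ 1 μ} (hf : 0 ≤ f) :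
    Monotone fun n => ballResolvent hc n α f := fun _ _ hmn =>
  dirichletResolvent_mono hc _ _ _ _ (monotone_exhBall d hmn) hα hf

theorem dirichletResolvent_le_fullResolvent (hVo : IsOpen V) (hV : IsCompact (closure V))
    (hα : 0 < α) {f : Lp ℝ 1 μ} (hf : 0 ≤ f) :
    dirichletResolvent hc hVo hV α f ≤ fullResolvent hc α f := by
  obtain ⟨n, hn⟩ := exists_subset_of_isCompact hV (isOpen_exhBall d) (monotone_exhBall d)
    (iUnion_exhBall d)
  exact (dirichletResolvent_mono hc hVo hV _ _ (subset_closure.trans hn) hα hf).trans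
    ((monotone_ballResolvent hc hα hf).ge_of_tendsto (tendsto_ballResolvent hc hα f) n)

/-- The sets `V n` and the balls interlace: the compact closure of each is contained in a later
member of the other sequence. On nonnegative data the two monotone limits therefore dominate each
other. -/
theorem tendsto_dirichletResolvent {V : ℕ → Set (RSpace d)} (hVo : ∀ n, IsOpen (V n))
    (hV : ∀ n, IsCompact (closure (V n))) (hm : Monotone V) (hU : ⋃ n, V n = Set.univ)
    (hα : 0 < α) (f : Lp ℝ 1 μ) :
    Tendsto (fun n => dirichletResolvent hc (hVo n) (hV n) α f) atTop
      (𝓝 (fullResolvent hc α f)) := by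
  have key : ∀ f : Lp ℝ 1 μ, 0 ≤ f → Tendsto (fun n => dirichletResolvent hc (hVo n) (hV n) α f)
      atTop (𝓝 (fullResolvent hc α f)) := by
    intro f hf
    obtain ⟨l, hl⟩ := exists_tendsto_dirichletResolvent hc hVo hV hm hα f
    have hmono : Monotone fun n => dirichletResolvent hc (hVo n) (hV n) α f := fun m n hmn =>
      dirichletResolvent_mono hc (hVo m) (hV m) (hVo n) (hV n) (hm hmn) hα hf
    have e : l = fullResolvent hc α f := by
      refine le_antisymm (le_of_tendsto' hl fun n =>
        dirichletResolvent_le_fullResolvent hc (hVo n) (hV n) hα hf)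
        (le_of_tendsto' (tendsto_ballResolvent hc hα f) fun n => ?_)
      obtain ⟨m, hmn⟩ := exists_subset_of_isCompact (isCompact_closure_exhBall d n) hVo hm hU
      exact (dirichletResolvent_mono hc _ _ (hVo m) (hV m) (subset_closure.trans hmn) hα hf).trans
        (hmono.ge_of_tendsto hl m)
    rwa [← e]
  have h := (key _ (posPart_nonneg f)).sub (key _ (negPart_nonneg f))
  simp only [← map_sub, posPart_sub_negPart] at h
  exact h

theorem norm_fullResolvent_le (hα : 0 < α) (f : Lp ℝ 1 μ) :
    ‖fullResolvent hc α f‖ ≤ α⁻¹ * ‖f‖ :=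
  le_of_tendsto' (tendsto_ballResolvent hc hα f).norm fun _ => norm_dirichletResolvent_le hc _ _ hα f

theorem fullResolvent_nonneg (hα : 0 < α) {f : Lp ℝ 1 μ} (hf : 0 ≤ f) :
    0 ≤ fullResolvent hc α f :=
  ge_of_tendsto' (tendsto_ballResolvent hc hα f) fun _ => dirichletResolvent_nonneg hc _ _ hα hf

theorem ae_le_of_tendsto {α : Type*} [MeasurableSpace α] {ν : Measure α} {k : ℝ} (hk : 0 ≤ k)
    {ι : Type*} {l : Filter ι} [l.NeBot] {g : ι → Lp ℝ 1 ν} {f : Lp ℝ 1 ν}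
    (hg : Tendsto g l (𝓝 f)) (h : ∀ i, ∀ᵐ x ∂ν, g i x ≤ k) : ∀ᵐ x ∂ν, f x ≤ k := by
  rw [← posMass_nonpos_iff hk]
  exact le_of_tendsto' (((continuous_posMass hk).tendsto _).comp hg) fun i =>
    (posMass_nonpos_iff hk).2 (h i)

theorem fullResolvent_ae_le (hα : 0 < α) {k : ℝ} (hk : 0 ≤ k) {f : Lp ℝ 1 μ}
    (hf : ∀ᵐ x ∂μ, f x ≤ k) : ∀ᵐ x ∂μ, fullResolvent hc α f x ≤ k / α :=
  ae_le_of_tendsto (by positivity) (tendsto_ballResolvent hc hα f) fun _ =>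
    dirichletResolvent_ae_le hc _ _ hα hk hf

theorem fullResolvent_resolvent_eq {β : ℝ} (hα : 0 < α) (hβ : 0 < β) :
    fullResolvent hc α - fullResolvent hc β =
      (β - α) • (fullResolvent hc α).comp (fullResolvent hc β) := by
  ext1 f
  set g := fullResolvent hc β f with hg
  have h1 : Tendsto (fun n => ballResolvent hc n α (ballResolvent hc n β f)) atTop
      (𝓝 (fullResolvent hc α g)) := by
    -- Both the operator and its argument vary with `n`; the norm bound `α⁻¹`, uniform in `n`,
    -- absorbs the change of argument.
    have h2 : Tendsto (fun n => ballResolvent hc n α (ballResolvent hc n β f - g)) atTop (𝓝 0) := by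
      refine squeeze_zero_norm (fun n => norm_dirichletResolvent_le hc _ _ hα _) ?_
      have := ((tendsto_ballResolvent hc hβ f).sub_const g).norm.const_mul α⁻¹
      rwa [← hg, sub_self, norm_zero, mul_zero] at this
    have h3 := h2.add (tendsto_ballResolvent hc hα g)
    rw [zero_add] at h3
    refine h3.congr fun n => ?_
    rw [← map_add, sub_add_cancel]
  have h4 := (tendsto_ballResolvent hc hα f).sub (tendsto_ballResolvent hc hβ f)
  refine tendsto_nhds_unique h4 ((h1.const_smul (β - α)).congr fun n => ?_)
  exact (dirichletResolvent_resolvent_eq hc _ _ hα hβ f).symm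

/-- Functions that are weak solutions on all large balls are resolvents. -/
theorem fullResolvent_eq_of_weakSol (hα : 0 < α) {N : ℕ}
    (hs : ∀ n ≥ N, ∃ F, WeakSol μ A B (exhBall d n) u F h) (hu : MemLp u ∞ μ) {f g : Lp ℝ 1 μ}
    (hg : g =ᵐ[μ] u) (hf : f =ᵐ[μ] fun x => α * u x - h x) : fullResolvent hc α f = g := by
  refine tendsto_nhds_unique (tendsto_ballResolvent hc hα f) (tendsto_const_nhds.congr' ?_)
  filter_upwards [eventually_ge_atTop N] with n hn
  obtain ⟨F, hF⟩ := hs n hn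
  exact (hF.dirichletResolvent_eq hc _ _ hα hu hg hf).symm

theorem fullResolvent_isSubMarkovian (hα : 0 < α) : IsSubMarkovian (α • fullResolvent hc α) := by
  intro f hf
  have h1 := fullResolvent_nonneg hc hα (f := f) ((Lp.coeFn_nonneg f).1 (hf.mono fun x h => h.1))
  have h2 := fullResolvent_ae_le hc hα zero_le_one (hf.mono fun x h => h.2)
  filter_upwards [(Lp.coeFn_nonneg _).2 h1, h2, Lp.coeFn_smul α (fullResolvent hc α f)] with x a b c
  have a : 0 ≤ fullResolvent hc α f x := a
  rw [_root_.smul_apply, c, Pi.smul_apply, smul_eq_mul]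
  exact ⟨mul_nonneg hα.le a, by rwa [le_div_iff₀' hα] at b⟩

end fullResolvent

/-! ### The theorem of Hille and Yosida -/

section HilleYosida

variable {X : Type*} [NormedAddCommGroup X] [NormedSpace ℝ X]

/-- `exp(s(P - 1))` equals `e^{-s} ∑ sᵏPᵏ/k!`, a Poisson average of the iterates of `P`. Applied to
`f` it is a limit of convex combinations of points of `C`. Contractivity and the sub-Markov property
are both instances. -/
theorem exp_smul_sub_one_mem [CompleteSpace X] {P : X →L[ℝ] X} {C : Set X} (hC : IsClosed C)
    (hconv : Convex ℝ C) (hP : ∀ f ∈ C, P f ∈ C) {s : ℝ} (hs : 0 ≤ s) {f : X} (hf : f ∈ C) :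
    NormedSpace.exp (s • (P - 1)) f ∈ C := by
  let _ : NormedAlgebra ℚ (X →L[ℝ] X) := NormedAlgebra.restrictScalars ℚ ℝ _
  have e1 : NormedSpace.exp (s • (P - 1)) = Real.exp (-s) • NormedSpace.exp (s • P) := by
    have h1 : s • (P - 1) = algebraMap ℝ (X →L[ℝ] X) (-s) + s • P := by
      rw [Algebra.algebraMap_eq_smul_one, smul_sub, neg_smul]; abel
    rw [h1, NormedSpace.exp_add_of_commute (Algebra.commutes _ _), ← NormedSpace.algebraMap_exp_comm,
      Algebra.algebraMap_eq_smul_one, smul_mul_assoc, one_mul, Real.exp_eq_exp_ℝ]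
  have hpow : ∀ k : ℕ, (P ^ k) f ∈ C := by
    intro k
    induction k with
    | zero => simpa using hf
    | succ k ih => rw [pow_succ']; exact hP _ ih
  let w : ℕ → ℝ := fun k => (k.factorial : ℝ)⁻¹ * s ^ k
  have hw : ∀ k, 0 ≤ w k := fun k => by positivity
  have h2 : Tendsto (fun N => ∑ k ∈ Finset.range N, w k • (P ^ k) f) atTop
      (𝓝 (NormedSpace.exp (s • P) f)) := by
    have h3 := ((NormedSpace.exp_series_hasSum_exp' (𝕂 := ℝ) (s • P)).mapL
      (ContinuousLinearMap.apply ℝ X f)).tendsto_sum_nat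
    refine h3.congr fun N => Finset.sum_congr rfl fun k _ => ?_
    simp [w, smul_pow, smul_smul]
  have h4 : Tendsto (fun N => ∑ k ∈ Finset.range N, w k) atTop (𝓝 (Real.exp s)) := by
    have h5 := (NormedSpace.exp_series_hasSum_exp' (𝕂 := ℝ) (𝔸 := ℝ) s).tendsto_sum_nat
    rw [← Real.exp_eq_exp_ℝ] at h5
    exact h5
  -- The partial sums are normalized by the partial sums of the scalar series, which makes them
  -- genuine convex combinations with the same limit.
  have h6 := (h4.inv₀ (Real.exp_pos s).ne').smul h2
  rw [← Real.exp_neg] at h6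
  rw [e1]
  refine hC.mem_of_tendsto h6 ?_
  filter_upwards [eventually_ge_atTop 1] with N hN
  have hpos : 0 < ∑ k ∈ Finset.range N, w k :=
    Finset.sum_pos' (fun k _ => hw k) ⟨0, Finset.mem_range.2 hN, by simp [w]⟩
  exact hconv.centerMass_mem (fun k _ => hw k) hpos fun k _ => hpow k

theorem norm_exp_smul_sub_one_le [CompleteSpace X] {P : X →L[ℝ] X} (hP : ‖P‖ ≤ 1) {s : ℝ}
    (hs : 0 ≤ s) (f : X) : ‖NormedSpace.exp (s • (P - 1)) f‖ ≤ ‖f‖ := by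
  have := exp_smul_sub_one_mem (P := P) (C := Metric.closedBall 0 ‖f‖) Metric.isClosed_closedBall
    (convex_closedBall _ _) (fun g hg => by
      rw [mem_closedBall_zero_iff] at hg ⊢
      exact (P.le_of_opNorm_le hP g).trans (by rwa [one_mul])) hs (f := f) (by simp)
  rwa [mem_closedBall_zero_iff] at this

/-- The path `s ↦ exp(sA) exp((t - s)A') f` joins the two vectors. As `A` and `A'` commute, its
derivative is `exp(sA) exp((t - s)A')(Af - A'f)`, of norm at most `‖Af - A'f‖`. -/
theorem norm_exp_sub_exp_le [CompleteSpace X] {A A' : X →L[ℝ] X} (hAA' : Commute A A')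
    (hA : ∀ s : ℝ, 0 ≤ s → ∀ f, ‖NormedSpace.exp (s • A) f‖ ≤ ‖f‖)
    (hA' : ∀ s : ℝ, 0 ≤ s → ∀ f, ‖NormedSpace.exp (s • A') f‖ ≤ ‖f‖) {t : ℝ} (ht : 0 ≤ t) (f : X) :
    ‖NormedSpace.exp (t • A) f - NormedSpace.exp (t • A') f‖ ≤ t * ‖A f - A' f‖ := by
  let _ : NormedAlgebra ℚ (X →L[ℝ] X) := NormedAlgebra.restrictScalars ℚ ℝ _
  let φ : ℝ → X := fun s => (NormedSpace.exp (s • A) * NormedSpace.exp ((t - s) • A')) f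
  have hd : ∀ s, HasDerivAt φ ((NormedSpace.exp (s • A) * NormedSpace.exp ((t - s) • A')) (A f - A' f)) s := by
    intro s
    have h1 := hasDerivAt_exp_smul_const (𝕂 := ℝ) A s
    have h2 := (hasDerivAt_exp_smul_const (𝕂 := ℝ) A' (t - s)).comp_const_sub t s
    have h3 := (ContinuousLinearMap.apply ℝ X f).hasFDerivAt.comp_hasDerivAt s (h1.mul h2)
    refine h3.congr_deriv ?_
    have hcm : A * NormedSpace.exp ((t - s) • A') = NormedSpace.exp ((t - s) • A') * A :=
      ((hAA'.smul_right _).exp_right).eq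
    simp only [ContinuousLinearMap.apply_apply]
    rw [mul_assoc, hcm, mul_neg, ← mul_assoc, ← mul_assoc, ← sub_eq_add_neg, ← mul_sub]
    rfl
  have h := norm_image_sub_le_of_norm_deriv_le_segment' (f := φ) (a := 0) (b := t)
    (C := ‖A f - A' f‖) (fun s _ => (hd s).hasDerivWithinAt) (fun s hs => by
      exact (hA s hs.1 _).trans (hA' _ (by linarith [hs.2]) _)) t ⟨ht, le_rfl⟩
  simpa [φ, mul_comm] using h

/-- Mean value inequality for `s ↦ exp(sA)f - sw`. The choice `w = 0` measures how far the orbit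
moves; `w` near `Af` measures its deviation from a straight line. -/
theorem norm_exp_sub_self_sub_le [CompleteSpace X] {A : X →L[ℝ] X} {t K : ℝ} (ht : 0 ≤ t) {f w : X}
    (hK : ∀ s, 0 ≤ s → s ≤ t → ‖NormedSpace.exp (s • A) (A f) - w‖ ≤ K) :
    ‖NormedSpace.exp (t • A) f - f - t • w‖ ≤ K * t := by
  let φ : ℝ → X := fun s => NormedSpace.exp (s • A) f - s • w
  have hd : ∀ s, HasDerivAt φ (NormedSpace.exp (s • A) (A f) - w) s := by
    intro s
    have h3 := (ContinuousLinearMap.apply ℝ X f).hasFDerivAt.comp_hasDerivAt s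
      (hasDerivAt_exp_smul_const (𝕂 := ℝ) A s)
    exact (h3.sub ((hasDerivAt_id s).smul_const w)).congr_deriv (by simp)
  have h := norm_image_sub_le_of_norm_deriv_le_segment' (f := φ) (a := 0) (b := t)
    (C := K) (fun s _ => (hd s).hasDerivWithinAt) (fun s hs => hK s hs.1 hs.2.le) t ⟨ht, le_rfl⟩
  simpa [φ, sub_right_comm] using h

/-- The graph of the operator with resolvent `R`. -/
def resolventGraph (R : ℝ → X →L[ℝ] X) : Submodule ℝ (X × X) :=
  LinearMap.ker ((R 1).comp (ContinuousLinearMap.fst ℝ X X - ContinuousLinearMap.snd ℝ X X) -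
    ContinuousLinearMap.fst ℝ X X).toLinearMap

theorem mem_resolventGraph {R : ℝ → X →L[ℝ] X} {p : X × X} :
    p ∈ resolventGraph R ↔ R 1 (p.1 - p.2) = p.1 := by
  simp [resolventGraph, sub_eq_zero]

theorem isClosed_resolventGraph (R : ℝ → X →L[ℝ] X) :
    IsClosed (resolventGraph R : Set (X × X)) := by
  have : (resolventGraph R : Set (X × X)) = {p | R 1 (p.1 - p.2) = p.1} :=
    Set.ext fun p => mem_resolventGraph
  rw [this]
  exact isClosed_eq (by fun_prop) (by fun_prop)

/-- The operator with resolvent `R`. -/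
def resolventOperator (R : ℝ → X →L[ℝ] X) : X →ₗ.[ℝ] X := (resolventGraph R).toLinearPMap

theorem natCast_add_one_pos (n : ℕ) : (0 : ℝ) < n + 1 := by positivity

/-- The Yosida approximation of the operator with resolvent `R`, at `λ = n + 1`. -/
def yosida (R : ℝ → X →L[ℝ] X) (n : ℕ) : X →L[ℝ] X :=
  ((n : ℝ) + 1) • (((n : ℝ) + 1) • R (n + 1) - 1)

namespace IsContractionResolvent

variable {R : ℝ → X →L[ℝ] X} (hR : IsContractionResolvent R) {α β : ℝ}

include hR

theorem apply_sub (hα : 0 < α) (hβ : 0 < β) (f : X) :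
    R α f - R β f = (β - α) • R α (R β f) :=
  congrArg (fun S : X →L[ℝ] X => S f) (hR.resolvent_eq α β hα hβ)

theorem apply_comm (hα : 0 < α) (hβ : 0 < β) (f : X) : R α (R β f) = R β (R α f) := by
  rcases eq_or_ne α β with rfl | hne
  · rfl
  · have h1 := hR.apply_sub hα hβ f
    have h2 := hR.apply_sub hβ hα f
    rw [← neg_sub, h2, ← neg_smul, neg_sub] at h1
    exact (smul_right_injective X (sub_ne_zero.2 hne.symm) h1).symm

theorem norm_smul_apply_le (hα : 0 < α) (f : X) : ‖α • R α f‖ ≤ ‖f‖ := by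
  simpa using (α • R α).le_of_opNorm_le (hR.contraction α hα) f

/-- By the resolvent equation all `R α` have the same kernel, and strong continuity reduces it to
zero. This makes the graph single-valued. -/
theorem eq_zero_of_apply_eq_zero {f : X} (h : R 1 f = 0) : f = 0 := by
  have h1 : ∀ α, 0 < α → R α f = 0 := fun α hα => by
    have := hR.apply_sub hα one_pos f
    rwa [h, map_zero, smul_zero, sub_zero] at this
  refine tendsto_nhds_unique (hR.continuity f) (tendsto_const_nhds.congr' ?_)
  filter_upwards [eventually_gt_atTop 0] with α hα
  rw [h1 α hα, smul_zero]

theorem graph_eq : (resolventOperator R).graph = resolventGraph R := by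
  refine Submodule.toLinearPMap_graph_eq _ fun p hp h0 => ?_
  rw [mem_resolventGraph, h0, zero_sub] at hp
  exact neg_eq_zero.1 (hR.eq_zero_of_apply_eq_zero hp)

/-- The graph is defined through `R 1` alone; the resolvent equation shows that any other parameter
gives the same one. -/
theorem mem_graph_iff (hα : 0 < α) {u w : X} :
    (u, w) ∈ (resolventOperator R).graph ↔ R α (α • u - w) = u := by
  rw [hR.graph_eq, mem_resolventGraph]
  have key : ∀ α β, 0 < α → 0 < β → R α (α • u - w) = u → R β (β • u - w) = u := by
    intro α β hα hβ h
    have h1 := hR.apply_sub hβ hα (α • u - w)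
    rw [h] at h1
    have h2 : β • u - w = (α • u - w) + (β - α) • u := by module
    rw [h2, map_add, map_smul, sub_eq_iff_eq_add.1 h1]
    module
  constructor
  · intro h; exact key 1 α one_pos hα (by simpa using h)
  · intro h; simpa using key α 1 hα one_pos h

theorem isInverseOfSub (hα : 0 < α) : IsInverseOfSub (resolventOperator R) α (R α) := by
  intro f u
  rw [hR.mem_graph_iff hα, _root_.sub_sub_cancel]

theorem isClosed_operator : (resolventOperator R).IsClosed := by
  rw [LinearPMap.IsClosed, hR.graph_eq]
  exact isClosed_resolventGraph R

theorem dense_domain (f : X) {ε : ℝ} (hε : 0 < ε) :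
    ∃ u w, (u, w) ∈ (resolventOperator R).graph ∧ ‖f - u‖ < ε := by
  obtain ⟨α, h1, hα⟩ := (((Metric.tendsto_nhds.1 (hR.continuity f)) ε hε).and
    (eventually_gt_atTop 0)).exists
  refine ⟨α • R α f, α • (α • R α f - f), ?_, ?_⟩
  · rw [hR.mem_graph_iff hα, ← smul_sub, _root_.sub_sub_cancel, map_smul]
  · rwa [← dist_eq_norm, dist_comm]

theorem tendsto_nat (f : X) :
    Tendsto (fun n : ℕ => ((n : ℝ) + 1) • R (n + 1) f) atTop (𝓝 f) :=
  (hR.continuity f).comp (tendsto_atTop_add_const_right _ 1 tendsto_natCast_atTop_atTop)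

/-- On the domain the Yosida approximations act as `λR_λw`, so they converge to `w`, with norms
bounded by `‖w‖`. -/
theorem yosida_apply {u w : X} (h : (u, w) ∈ (resolventOperator R).graph) (n : ℕ) :
    yosida R n u = ((n : ℝ) + 1) • R (n + 1) w := by
  have h1 := (hR.mem_graph_iff (natCast_add_one_pos n)).1 h
  rw [map_sub, map_smul, sub_eq_iff_eq_add] at h1
  simp only [yosida, _root_.smul_apply, _root_.sub_apply, one_apply_eq_self]
  congr 1
  rw [h1]; abel

theorem commute_yosida (m n : ℕ) : Commute (yosida R m) (yosida R n) := by
  have h : Commute (R ((m : ℝ) + 1)) (R ((n : ℝ) + 1)) := by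
    ext f
    exact hR.apply_comm (natCast_add_one_pos m) (natCast_add_one_pos n) f
  exact (((h.smul_left _).smul_right _).sub_left (Commute.one_left _)).sub_right
    (Commute.one_right _) |>.smul_left _ |>.smul_right _

variable [CompleteSpace X]

omit hR in
theorem exp_yosida_mem {C : Set X} (hC : IsClosed C) (hconv : Convex ℝ C)
    (hRC : ∀ α, 0 < α → ∀ f ∈ C, α • R α f ∈ C) (n : ℕ) {t : ℝ} (ht : 0 ≤ t) {f : X} (hf : f ∈ C) :
    NormedSpace.exp (t • yosida R n) f ∈ C := by
  rw [yosida, smul_smul]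
  exact exp_smul_sub_one_mem hC hconv (hRC _ (natCast_add_one_pos n))
    (mul_nonneg ht (natCast_add_one_pos n).le) hf

theorem norm_exp_yosida_le (n : ℕ) (t : ℝ) (ht : 0 ≤ t) (f : X) :
    ‖NormedSpace.exp (t • yosida R n) f‖ ≤ ‖f‖ := by
  rw [yosida, smul_smul]
  exact norm_exp_smul_sub_one_le (hR.contraction _ (natCast_add_one_pos n))
    (mul_nonneg ht (natCast_add_one_pos n).le) f

/-- On the domain the exponentials differ by at most `t` times the difference of the Yosida
approximations, which is Cauchy. Uniform contractivity extends this from the dense domain to all of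
`X`. -/
theorem exists_tendsto_exp_yosida (t : ℝ≥0) (f : X) :
    ∃ l, Tendsto (fun n => NormedSpace.exp ((t : ℝ) • yosida R n) f) atTop (𝓝 l) := by
  refine cauchySeq_tendsto_of_complete (Metric.cauchySeq_iff'.2 fun ε hε => ?_)
  obtain ⟨u, w, huw, hfu⟩ := hR.dense_domain f (ε := ε / 4) (by positivity)
  have h1 : Tendsto (fun n => yosida R n u) atTop (𝓝 w) := by
    simp only [hR.yosida_apply huw]
    exact hR.tendsto_nat w
  obtain ⟨N, hN⟩ := Metric.cauchySeq_iff'.1 h1.cauchySeq (ε / (4 * (t + 1))) (by positivity)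
  refine ⟨N, fun n hn => ?_⟩
  have h2 := norm_exp_sub_exp_le (hR.commute_yosida n N) (hR.norm_exp_yosida_le n)
    (hR.norm_exp_yosida_le N) t.2 u
  have h3 := hN n hn
  rw [dist_eq_norm] at h3 ⊢
  have h4 : (t : ℝ) * ‖yosida R n u - yosida R N u‖ ≤ ε / 4 := by
    calc (t : ℝ) * ‖yosida R n u - yosida R N u‖ ≤ (t + 1) * (ε / (4 * (t + 1))) := by
          gcongr; linarith
      _ = ε / 4 := by field_simp
  have h5 := hR.norm_exp_yosida_le n t t.2 (f - u)
  have h6 := hR.norm_exp_yosida_le N t t.2 (f - u)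
  have e : NormedSpace.exp ((t : ℝ) • yosida R n) f - NormedSpace.exp ((t : ℝ) • yosida R N) f =
      NormedSpace.exp ((t : ℝ) • yosida R n) (f - u) +
        (NormedSpace.exp ((t : ℝ) • yosida R n) u - NormedSpace.exp ((t : ℝ) • yosida R N) u) -
      NormedSpace.exp ((t : ℝ) • yosida R N) (f - u) := by
    rw [map_sub, map_sub]; abel
  rw [e]
  refine (norm_sub_le _ _).trans_lt ?_
  have h7 := norm_add_le (NormedSpace.exp ((t : ℝ) • yosida R n) (f - u))
    (NormedSpace.exp ((t : ℝ) • yosida R n) u - NormedSpace.exp ((t : ℝ) • yosida R N) u)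
  have h8 : (t : ℝ) * ‖yosida R n u - yosida R N u‖ =
    NNReal.toReal t * ‖yosida R n u - yosida R N u‖ := rfl
  linarith [show ‖NormedSpace.exp ((t : ℝ) • yosida R n) u -
    NormedSpace.exp ((t : ℝ) • yosida R N) u‖ ≤ (t : ℝ) * ‖yosida R n u - yosida R N u‖ from h2]

/-- The theorem of Hille and Yosida: a contraction resolvent is the resolvent of the generator of
a contraction semigroup. -/
theorem exists_semigroup : ∃ T : ℝ≥0 → X →L[ℝ] X, IsContractionSemigroup T ∧
    IsGeneratorOf (resolventOperator R) T ∧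
    ∀ C : Set X, IsClosed C → Convex ℝ C → (∀ α, 0 < α → ∀ f ∈ C, α • R α f ∈ C) →
      ∀ t, ∀ f ∈ C, T t f ∈ C := by
  choose l hl using hR.exists_tendsto_exp_yosida
  let T : ℝ≥0 → X →L[ℝ] X := fun t => continuousLinearMapOfTendsto
    (fun n => NormedSpace.exp ((t : ℝ) • yosida R n)) (tendsto_pi_nhds.2 (hl t))
  have hT : ∀ (t : ℝ≥0) f, Tendsto (fun n => NormedSpace.exp ((t : ℝ) • yosida R n) f) atTop
    (𝓝 (T t f)) := hl
  have hTn : ∀ t f, ‖T t f‖ ≤ ‖f‖ := fun t f =>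
    le_of_tendsto' (hT t f).norm fun n => hR.norm_exp_yosida_le n t t.2 f
  have hfirst : ∀ u w, (u, w) ∈ (resolventOperator R).graph → ∀ t : ℝ≥0, ‖T t u - u‖ ≤ t * ‖w‖ := by
    intro u w huw t
    refine le_of_tendsto' ((hT t u).sub_const u).norm fun n => ?_
    have h1 := norm_exp_sub_self_sub_le (A := yosida R n) (f := u) (w := 0) (K := ‖w‖) t.2
      fun s hs _ => by
        rw [sub_zero, hR.yosida_apply huw]
        exact (hR.norm_exp_yosida_le n s hs _).trans
          (hR.norm_smul_apply_le (natCast_add_one_pos n) w)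
    rw [smul_zero, sub_zero, mul_comm] at h1
    exact h1
  -- The image `w` need not lie in the domain, so it is replaced by a nearby `u'` that does. The
  -- error is `2‖w - u'‖` for the replacement and `t‖w'‖` for the motion of `u'`, both multiplied by
  -- `t`.
  have hsecond : ∀ u w, (u, w) ∈ (resolventOperator R).graph →
      ∀ u' w', (u', w') ∈ (resolventOperator R).graph → ∀ t : ℝ≥0,
      ‖T t u - u - (t : ℝ) • w‖ ≤ (2 * ‖w - u'‖ + t * ‖w'‖) * t := by
    intro u w huw u' w' huw' t
    have hn : ∀ n : ℕ, ‖NormedSpace.exp ((t : ℝ) • yosida R n) u - u - (t : ℝ) • w‖ ≤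
        (‖yosida R n u - w‖ + (2 * ‖w - u'‖ + t * ‖w'‖)) * t := by
      intro n
      refine norm_exp_sub_self_sub_le t.2 fun s hs hst => ?_
      have h1 := norm_exp_sub_self_sub_le (A := yosida R n) (f := u') (w := 0) (K := ‖w'‖) hs
        fun r hr _ => by
          rw [sub_zero, hR.yosida_apply huw']
          exact (hR.norm_exp_yosida_le n r hr _).trans
            (hR.norm_smul_apply_le (natCast_add_one_pos n) w')
      rw [smul_zero, sub_zero] at h1
      have h2 := hR.norm_exp_yosida_le n s hs (yosida R n u - w)
      have h3 := hR.norm_exp_yosida_le n s hs (w - u')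
      have e : NormedSpace.exp (s • yosida R n) (yosida R n u) - w =
          (NormedSpace.exp (s • yosida R n) (yosida R n u - w) +
          NormedSpace.exp (s • yosida R n) (w - u')) +
          (NormedSpace.exp (s • yosida R n) u' - u') - (w - u') := by
        simp only [map_sub]; abel
      rw [e]
      refine (norm_sub_le _ _).trans ?_
      have h4 := norm_add₃_le (a := NormedSpace.exp (s • yosida R n) (yosida R n u - w))
        (b := NormedSpace.exp (s • yosida R n) (w - u'))
        (c := NormedSpace.exp (s • yosida R n) u' - u')
      have h5 : ‖w'‖ * s ≤ ‖w'‖ * t := mul_le_mul_of_nonneg_left hst (norm_nonneg _)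
      linarith
    have hlim : Tendsto (fun n : ℕ => (‖yosida R n u - w‖ + (2 * ‖w - u'‖ + t * ‖w'‖)) * (t : ℝ))
        atTop (𝓝 ((0 + (2 * ‖w - u'‖ + t * ‖w'‖)) * t)) := by
      refine Tendsto.mul_const _ (Tendsto.add_const _ ?_)
      simp only [hR.yosida_apply huw]
      simpa using ((hR.tendsto_nat w).sub_const w).norm
    rw [zero_add] at hlim
    exact le_of_tendsto_of_tendsto' (((hT t u).sub_const u).sub_const _).norm hlim hn
  have hcont : ∀ f, Tendsto (fun t => T t f) (𝓝[>] 0) (𝓝 f) := by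
    intro f
    rw [Metric.tendsto_nhds]
    intro ε hε
    obtain ⟨u, w, huw, hfu⟩ := hR.dense_domain f (ε := ε / 3) (by positivity)
    have hev : ∀ᶠ t : ℝ≥0 in 𝓝[>] 0, (t : ℝ) * ‖w‖ < ε / 3 := by
      refine nhdsWithin_le_nhds ?_
      have hc : Tendsto (fun t : ℝ≥0 => (t : ℝ) * ‖w‖) (𝓝 0) (𝓝 (((0 : ℝ≥0) : ℝ) * ‖w‖)) :=
        (NNReal.continuous_coe.tendsto 0).mul_const _
      rw [NNReal.coe_zero, zero_mul] at hc
      exact (tendsto_order.1 hc).2 _ (by positivity)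
    filter_upwards [hev] with t ht
    have h1 := hTn t (f - u)
    have h2 := hfirst u w huw t
    have e : T t f - f = T t (f - u) + (T t u - u) - (f - u) := by rw [map_sub]; abel
    rw [dist_eq_norm, e]
    refine (norm_sub_le _ _).trans_lt ?_
    linarith [norm_add_le (T t (f - u)) (T t u - u)]
  have hgen : ∀ u w, (u, w) ∈ (resolventOperator R).graph →
      Tendsto (fun t : ℝ≥0 => (t : ℝ)⁻¹ • (T t u - u)) (𝓝[>] 0) (𝓝 w) := by
    intro u w huw
    rw [Metric.tendsto_nhds]
    intro ε hε
    obtain ⟨u', w', huw', hw⟩ := hR.dense_domain w (ε := ε / 4) (by positivity)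
    have hev : ∀ᶠ t : ℝ≥0 in 𝓝[>] 0, (t : ℝ) * ‖w'‖ < ε / 2 := by
      refine nhdsWithin_le_nhds ?_
      have hc : Tendsto (fun t : ℝ≥0 => (t : ℝ) * ‖w'‖) (𝓝 0) (𝓝 (((0 : ℝ≥0) : ℝ) * ‖w'‖)) :=
        (NNReal.continuous_coe.tendsto 0).mul_const _
      rw [NNReal.coe_zero, zero_mul] at hc
      exact (tendsto_order.1 hc).2 _ (by positivity)
    filter_upwards [hev, self_mem_nhdsWithin] with t ht ht0
    have ht0 : (0 : ℝ) < t := ht0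
    have h1 := hsecond u w huw u' w' huw' t
    have e : (t : ℝ)⁻¹ • (T t u - u) - w = (t : ℝ)⁻¹ • (T t u - u - (t : ℝ) • w) := by
      rw [smul_sub _ (T t u - u), inv_smul_smul₀ ht0.ne']
    rw [dist_eq_norm, e, norm_smul, Real.norm_of_nonneg (inv_pos.2 ht0).le, inv_mul_lt_iff₀ ht0,
      mul_comm]
    refine h1.trans_lt (mul_lt_mul_of_pos_right ?_ ht0)
    linarith
  refine ⟨T, ⟨?_, ?_, ?_, hcont⟩, ?_, ?_⟩
  · ext f
    refine tendsto_nhds_unique (hT 0 f) (tendsto_const_nhds.congr fun n => ?_)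
    simp [NormedSpace.exp_zero]
  · intro s t
    ext f
    have h1 : Tendsto (fun n => NormedSpace.exp ((s : ℝ) • yosida R n)
        (NormedSpace.exp ((t : ℝ) • yosida R n) f)) atTop (𝓝 (T s (T t f))) := by
      have h2 : Tendsto (fun n => NormedSpace.exp ((s : ℝ) • yosida R n)
          (NormedSpace.exp ((t : ℝ) • yosida R n) f - T t f)) atTop (𝓝 0) := by
        refine squeeze_zero_norm (fun n => hR.norm_exp_yosida_le n s s.2 _) ?_
        simpa using ((hT t f).sub_const (T t f)).norm
      have h3 := h2.add (hT s (T t f))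
      rw [zero_add] at h3
      refine h3.congr fun n => ?_
      rw [← map_add, sub_add_cancel]
    refine tendsto_nhds_unique (hT (s + t) f) (h1.congr fun n => ?_)
    let _ : NormedAlgebra ℚ (X →L[ℝ] X) := NormedAlgebra.restrictScalars ℚ ℝ _
    rw [NNReal.coe_add, add_smul, NormedSpace.exp_add_of_commute
      (((Commute.refl _).smul_left _).smul_right _)]
    rfl
  · exact fun t => ContinuousLinearMap.opNorm_le_bound _ zero_le_one fun f => by
      simpa using hTn t f
  · intro f g
    refine ⟨hgen f g, fun hfg => ?_⟩
    -- The generator cannot be larger than the operator: `u` is the domain element with `u - Lu = f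
    -- - g`, and `v = f - u` would be an eigenvector of the generator with eigenvalue `1`.
    set u := R 1 (f - g) with hu
    have hmem : (u, u - (f - g)) ∈ (resolventOperator R).graph := by
      rw [hR.mem_graph_iff one_pos, one_smul, _root_.sub_sub_cancel]
    have h1 := hfg.sub (hgen _ _ hmem)
    set v := f - u with hv
    have h2 : Tendsto (fun t : ℝ≥0 => (t : ℝ)⁻¹ • (T t v - v)) (𝓝[>] 0) (𝓝 v) := by
      have e : g - (u - (f - g)) = v := by rw [hv]; abel
      rw [e] at h1
      refine h1.congr fun t => ?_
      rw [← smul_sub, hv, map_sub]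
      congr 1; abel
    -- Since `‖T t v‖ ≤ ‖v‖`, the vector `T t v - (1 + t)v` has norm at least `t‖v‖`. In the limit
    -- this forces `v = 0`.
    have h3 : ∀ᶠ t : ℝ≥0 in 𝓝[>] 0, ‖v‖ ≤ ‖(t : ℝ)⁻¹ • (T t v - v) - v‖ := by
      filter_upwards [self_mem_nhdsWithin] with t ht
      have ht : (0 : ℝ) < t := ht
      have e : (t : ℝ)⁻¹ • (T t v - v) - v = (t : ℝ)⁻¹ • (T t v - (1 + (t : ℝ)) • v) := by
        rw [add_smul, one_smul, ← sub_sub, smul_sub _ (T t v - v), inv_smul_smul₀ ht.ne']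
      rw [e, norm_smul, Real.norm_of_nonneg (inv_pos.2 ht).le, le_inv_mul_iff₀ ht]
      have h4 := norm_sub_norm_le ((1 + (t : ℝ)) • v) (T t v)
      rw [norm_smul, Real.norm_of_nonneg (by positivity), norm_sub_rev ((1 + (t : ℝ)) • v)] at h4
      linarith [hTn t v]
    have h4 : ‖v‖ ≤ 0 := by
      have h5 := (h2.sub_const v).norm
      rw [sub_self, norm_zero] at h5
      have : (𝓝[>] (0 : ℝ≥0)).NeBot := inferInstance
      exact ge_of_tendsto h5 h3
    have h5 : f = u := sub_eq_zero.1 (norm_le_zero_iff.1 h4)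
    rw [hR.mem_graph_iff one_pos, one_smul, ← hu, ← h5]
  · intro C hC hconv hRC t f hf
    exact hC.mem_of_tendsto (hT t f) (Eventually.of_forall fun n =>
      exp_yosida_mem hC hconv hRC n t.2 hf)

end IsContractionResolvent

end HilleYosida

/-! ### The form domain -/

/-- `∫ ⟨A F, F⟩ dμ`, as an extended nonnegative real. -/
def formMass (μ : Measure (RSpace d)) (A : RSpace d → Matrix (Fin d) (Fin d) ℝ)
    (F : RSpace d → RSpace d) : ℝ≥0∞ :=
  ∫⁻ x, ENNReal.ofReal (matInner (A x) (F x) (F x)) ∂μ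

theorem HasGradZero.formMass_eq (hc : AdmissibleCoeff μ A B) (hV : IsCompact (closure V))
    (hu : HasGradZero μ V u F) : formMass μ A F = ENNReal.ofReal (2 * energy μ A F F) := by
  rw [formMass, ← ofReal_integral_eq_lintegral_ofReal (hu.integrable_matInner hc hV hu.2.1)
    (hc.ae_nonneg.mono fun x hx => hx _), energy]
  congr 1; ring

/-- A triangle inequality up to the factor `2`, from `|⟨Aξ, ζ⟩| ≤ (⟨Aξ, ξ⟩ + ⟨Aζ, ζ⟩)/2`. Values in
`[0, ∞]` avoid integrability questions, since `A` may be unbounded on the whole space. -/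
theorem formMass_sub_le (hc : AdmissibleCoeff μ A B) (hF : AEStronglyMeasurable F μ)
    (G H : RSpace d → RSpace d) (hG : AEStronglyMeasurable G μ) :
    formMass μ A (fun x => F x - H x) ≤
      2 * formMass μ A (fun x => F x - G x) + 2 * formMass μ A (fun x => G x - H x) := by
  unfold formMass
  have hm : AEMeasurable (fun x => (2 : ℝ≥0∞) *
      ENNReal.ofReal (matInner (A x) (F x - G x) (F x - G x))) μ :=
    (hc.aestronglyMeasurable_matInner (hF.sub hG)
      (hF.sub hG)).aemeasurable.ennreal_ofReal.const_mul _
  rw [← lintegral_const_mul' _ _ (by norm_num), ← lintegral_const_mul' _ _ (by norm_num),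
    ← lintegral_add_left' hm]
  refine lintegral_mono_ae ?_
  filter_upwards [hc.ae_nonneg, hc.symm] with x hx hs
  have h2 : ∀ r : ℝ, (2 : ℝ≥0∞) * ENNReal.ofReal r = ENNReal.ofReal (2 * r) := fun r => by
    rw [ENNReal.ofReal_mul (by norm_num)]; norm_num
  rw [h2, h2, ← ENNReal.ofReal_add (mul_nonneg (by norm_num) (hx _))
    (mul_nonneg (by norm_num) (hx _))]
  refine ENNReal.ofReal_le_ofReal ?_
  have h1 := abs_matInner_le hs hx (F x - G x) (G x - H x)
  have e : F x - H x = (F x - G x) + (G x - H x) := by abel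
  rw [e, matInner_add_left, matInner_add_right, matInner_add_right, matInner_symm hs (G x - H x)]
  linarith [(abs_le.1 h1).2]

/-- Local ellipticity: convergence of the global energy implies convergence of the gradients in `L²`
on every bounded set. -/
theorem AdmissibleCoeff.exists_eLpNorm_le_formMass (hc : AdmissibleCoeff μ A B) (hVo : IsOpen V)
    (hV : IsCompact (closure V)) : ∃ ν : ℝ, 0 < ν ∧ ∀ F : RSpace d → RSpace d,
      eLpNorm F 2 (μ.restrict V) ≤ (ENNReal.ofReal ν * formMass μ A F) ^ (1 / (2 : ℝ)) := by
  obtain ⟨ν, hν, hell⟩ := hc.bounds hV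
  refine ⟨ν, hν, fun F => ?_⟩
  rw [eLpNorm_eq_lintegral_rpow_enorm_toReal (by norm_num) (by norm_num)]
  simp only [ENNReal.toReal_ofNat]
  refine ENNReal.rpow_le_rpow ?_ (by norm_num)
  rw [formMass, ← lintegral_const_mul' _ _ ENNReal.ofReal_ne_top]
  refine le_trans ?_ (setLIntegral_le_lintegral V _)
  refine lintegral_mono_ae ((ae_restrict_iff' hVo.measurableSet).2 ?_)
  filter_upwards [hell] with x hx hxV
  have h1 := (hx hxV (F x)).1
  rw [inv_mul_le_iff₀ hν] at h1
  rw [← ENNReal.ofReal_mul hν.le, ← ofReal_norm, ENNReal.ofReal_rpow_of_nonneg (norm_nonneg _)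
    (by norm_num)]
  exact ENNReal.ofReal_le_ofReal (by simpa using h1)

/-- Completeness of the space of gradients with respect to the energy. -/
theorem AdmissibleCoeff.exists_limit_gradient (hc : AdmissibleCoeff μ A B)
    {G : ℕ → RSpace d → RSpace d} (hG : ∀ k, AEStronglyMeasurable (G k) μ)
    (hE : ∀ N n, N ≤ n → formMass μ A (fun x => G n x - G N x) ≤ ENNReal.ofReal ((1 / 16) ^ N)) :
    ∃ F, AEStronglyMeasurable F μ ∧ (∀ᵐ x ∂μ, Tendsto (fun k => G k x) atTop (𝓝 (F x))) ∧
      ∀ N, formMass μ A (fun x => F x - G N x) ≤ ENNReal.ofReal ((1 / 16) ^ N) := by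
  have hneg : ∀ m n, formMass μ A (fun x => G m x - G n x) =
      formMass μ A (fun x => G n x - G m x) := fun m n => by
    unfold formMass
    congr 1; ext1 x
    simp only
    rw [← neg_sub (G n x), ← neg_one_smul ℝ (G n x - G m x), matInner_smul_left,
      matInner_smul_right]
    ring_nf
  have hE' : ∀ N n m, N ≤ n → N ≤ m →
      formMass μ A (fun x => G n x - G m x) ≤ ENNReal.ofReal ((1 / 16) ^ N) := by
    intro N n m hn hm
    rcases le_total n m with hnm | hnm
    · rw [hneg]
      exact (hE n m hnm).trans (ENNReal.ofReal_le_ofReal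
        (pow_le_pow_of_le_one (by norm_num) (by norm_num) hn))
    · exact (hE m n hnm).trans (ENNReal.ofReal_le_ofReal
        (pow_le_pow_of_le_one (by norm_num) (by norm_num) hm))
  have hball : ∀ m, ∀ᵐ x ∂(μ.restrict (exhBall d m)), ∃ l, Tendsto (fun k => G k x) atTop (𝓝 l) := by
    intro m
    obtain ⟨ν, hν, hle⟩ := hc.exists_eLpNorm_le_formMass (isOpen_exhBall d m)
      (isCompact_closure_exhBall d m)
    -- The square root of the energy bound `ν(1/16)^N` is `√ν(1/4)^N`, which is summable. The added
    -- `1` makes the required inequality strict.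
    have hsum : Summable fun N : ℕ => (√ν + 1) * (1 / 4 : ℝ) ^ N :=
      (summable_geometric_of_lt_one (by norm_num) (by norm_num)).mul_left _
    refine Lp.ae_tendsto_of_cauchy_eLpNorm (p := 2)
      (B := fun N => ENNReal.ofReal ((√ν + 1) * (1 / 4) ^ N)) (fun k => (hG k).restrict)
      (by norm_num) hsum.tsum_ofReal_ne_top fun N n k hn hk => ?_
    refine (hle _).trans_lt ?_
    have h1 : (ENNReal.ofReal ν * formMass μ A (G n - G k)) ^ (1 / (2 : ℝ)) ≤
        ENNReal.ofReal (√ν * (1 / 4) ^ N) := by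
      refine (ENNReal.rpow_le_rpow (mul_le_mul_right (hE' N n k hn hk) _) (by norm_num)).trans ?_
      rw [← ENNReal.ofReal_mul hν.le, ENNReal.ofReal_rpow_of_nonneg (by positivity) (by norm_num),
        ← Real.sqrt_eq_rpow, Real.sqrt_mul hν.le]
      have : ((1 / 16 : ℝ)) ^ N = ((1 / 4) ^ N) ^ 2 := by
        rw [← pow_mul, mul_comm, pow_mul]; norm_num
      rw [this, Real.sqrt_sq (by positivity)]
    refine h1.trans_lt ((ENNReal.ofReal_lt_ofReal_iff (by positivity)).2 ?_)
    have : (0 : ℝ) < (1 / 4) ^ N := by positivity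
    nlinarith
  have hae : ∀ᵐ x ∂μ, ∃ l, Tendsto (fun k => G k x) atTop (𝓝 l) := by
    have h1 := ae_all_iff.2 fun m => (ae_restrict_iff' (isOpen_exhBall d m).measurableSet).1 (hball m)
    filter_upwards [h1] with x hx
    have h2 : x ∈ ⋃ n, exhBall d n := by rw [iUnion_exhBall]; trivial
    obtain ⟨m, hm⟩ := Set.mem_iUnion.1 h2
    exact hx m hm
  obtain ⟨F, hF, hlim⟩ := exists_stronglyMeasurable_limit_of_tendsto_ae hG hae
  refine ⟨F, hF.aestronglyMeasurable, hlim, fun N => ?_⟩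
  unfold formMass
  -- Fatou's lemma: the energy distance to the limit is at most the lower limit of the distances to
  -- `G k`.
  calc ∫⁻ x, ENNReal.ofReal (matInner (A x) (F x - G N x) (F x - G N x)) ∂μ
      = ∫⁻ x, liminf (fun k => ENNReal.ofReal (matInner (A x) (G k x - G N x) (G k x - G N x)))
          atTop ∂μ := by
        refine lintegral_congr_ae ?_
        filter_upwards [hlim] with x hx
        refine (Tendsto.liminf_eq ?_).symm
        refine (ENNReal.continuous_ofReal.tendsto _).comp ?_
        have hcont : Continuous fun ξ : RSpace d => matInner (A x) (ξ - G N x) (ξ - G N x) := by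
          unfold matInner; fun_prop
        exact (hcont.tendsto _).comp hx
    _ ≤ liminf (fun k => formMass μ A (fun x => G k x - G N x)) atTop :=
        lintegral_liminf_le' fun k => (hc.aestronglyMeasurable_matInner ((hG k).sub (hG N))
          ((hG k).sub (hG N))).aemeasurable.ennreal_ofReal
    _ ≤ _ := by
        refine liminf_le_of_le (by isBoundedDefault) fun b hb => ?_
        obtain ⟨k, hk, hk'⟩ := (hb.and (eventually_ge_atTop N)).exists
        exact hk.trans (hE N k hk')

theorem HasGradZero.inFormDomain (hc : AdmissibleCoeff μ A B) (hV : IsCompact (closure V))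
    (hu : HasGradZero μ V u F) : InFormDomain μ A u F := by
  have := hc.finite
  have hu' := hu
  obtain ⟨hu2, hF, f, hf, h1, h2⟩ := hu
  refine ⟨hu2, hF.1, f, fun n => (hf n).mono (Set.subset_univ _), h1, ?_⟩
  have hd : ∀ n, HasGradZero μ V (fun x => u x - f n x) (fun x => F x - ∇ (f n) x) := fun n =>
    hu'.sub (hf n).hasGradZero
  have h3 : ∀ n, ∫⁻ x, ENNReal.ofReal (matInner (A x) (F x - ∇ (f n) x) (F x - ∇ (f n) x)) ∂μ =
      ENNReal.ofReal (2 * energy μ A (fun x => F x - ∇ (f n) x) (fun x => F x - ∇ (f n) x)) :=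
    fun n => (hd n).formMass_eq hc hV
  simp only [h3]
  have h4 : Tendsto (fun n => energy μ A (fun x => F x - ∇ (f n) x) (fun x => F x - ∇ (f n) x))
      atTop (𝓝 0) := by
    have hz : Tendsto (fun n => eLpNorm (fun x => (0 : RSpace d) - (F x - ∇ (f n) x)) 2 μ) atTop
        (𝓝 0) := by
      refine h2.congr fun n => ?_
      rw [← eLpNorm_neg]
      congr 1; ext1 x; simp
    have hzm : Tendsto (fun n => eLpNorm (fun x => (0 : RSpace d) -
        matVec (A x) (F x - ∇ (f n) x)) 2 μ) atTop (𝓝 0) := by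
      obtain ⟨ν, hν, hb⟩ := hc.bounds hV
      refine tendsto_eLpNorm_zero_of_le (C := ν) (fun n => ?_) h2
      filter_upwards [hb, (hd n).ae_eq_zero] with x hx h0
      by_cases hxV : x ∈ V
      · simpa using (hx hxV (F x - ∇ (f n) x)).2
      · rw [(h0 hxV).2]; simp
    have h5 := tendsto_integral_inner (ν := μ) (f := fun _ => (0 : RSpace d))
      (g := fun _ => (0 : RSpace d)) (fn := fun n x => matVec (A x) (F x - ∇ (f n) x))
      (gn := fun n x => F x - ∇ (f n) x) MemLp.zero MemLp.zero
      (fun n => (hd n).memLp_matVec hc hV) (fun n => (hd n).2.1) hzm hz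
    simp only [inner_matVec, inner_zero_left, integral_zero] at h5
    have h6 := h5.const_mul (1 / 2 : ℝ)
    rw [mul_zero] at h6
    exact h6
  have h5 := (ENNReal.continuous_ofReal.tendsto _).comp (h4.const_mul 2)
  simpa [Function.comp_def] using h5

/-- The form domain is closed under limits in `L²` and energy; each approximant is replaced by a
test function within `1/(k+1)` of it in both senses. -/
theorem InFormDomain.of_tendsto (hc : AdmissibleCoeff μ A B) {w : ℕ → RSpace d → ℝ}
    {G : ℕ → RSpace d → RSpace d} (hw : ∀ k, InFormDomain μ A (w k) (G k)) (hu : MemLp u 2 μ)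
    (hF : AEStronglyMeasurable F μ)
    (h1 : Tendsto (fun k => eLpNorm (fun x => u x - w k x) 2 μ) atTop (𝓝 0))
    (h2 : Tendsto (fun k => formMass μ A (fun x => F x - G k x)) atTop (𝓝 0)) :
    InFormDomain μ A u F := by
  have := hc.finite
  have hex : ∀ k : ℕ, ∃ f, IsTestFun Set.univ f ∧ eLpNorm (fun x => w k x - f x) 2 μ ≤
      ENNReal.ofReal (1 / ((k : ℝ) + 1)) ∧
      formMass μ A (fun x => G k x - ∇ f x) ≤ ENNReal.ofReal (1 / ((k : ℝ) + 1)) := by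
    intro k
    obtain ⟨-, -, f, hf, k1, k2⟩ := hw k
    have hpos : (0 : ℝ≥0∞) < ENNReal.ofReal (1 / ((k : ℝ) + 1)) :=
      ENNReal.ofReal_pos.2 (by positivity)
    obtain ⟨n, hn1, hn2⟩ := (((tendsto_order.1 k1).2 _ hpos).and
      ((tendsto_order.1 k2).2 _ hpos)).exists
    exact ⟨f n, hf n, hn1.le, hn2.le⟩
  choose f hf k1 k2 using hex
  have h0 : Tendsto (fun k : ℕ => ENNReal.ofReal (1 / ((k : ℝ) + 1))) atTop (𝓝 0) := by
    simpa [Function.comp_def] using (ENNReal.continuous_ofReal.tendsto _).comp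
      (tendsto_one_div_add_atTop_nhds_zero_nat (𝕜 := ℝ))
  refine ⟨hu, hF, f, hf, ?_, ?_⟩
  · have h3 := tendsto_eLpNorm_zero_add (p := 2) (by norm_num) (fun k => hu.1.sub (hw k).1.1)
      (fun k => (hw k).1.1.sub ((hf k).memLp 2).1) h1
      (tendsto_of_tendsto_of_tendsto_of_le_of_le tendsto_const_nhds h0 (fun _ => zero_le) k1)
    refine h3.congr fun k => ?_
    congr 1; ext1 x; simp
  · have h4 := tendsto_of_tendsto_of_tendsto_of_le_of_le tendsto_const_nhds h0
      (fun _ => zero_le) k2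
    have h5 : Tendsto (fun k => 2 * formMass μ A (fun x => F x - G k x) +
        2 * formMass μ A (fun x => G k x - ∇ (f k) x)) atTop (𝓝 (2 * 0 + 2 * 0)) :=
      (ENNReal.Tendsto.const_mul h2 (by simp)).add (ENNReal.Tendsto.const_mul h4 (by simp))
    rw [mul_zero, add_zero] at h5
    exact tendsto_of_tendsto_of_tendsto_of_le_of_le tendsto_const_nhds h5 (fun _ => zero_le)
      fun k => formMass_sub_le hc hF (G k) _ (hw k).2.1

/-! ### Convex combinations -/

/-- In decreasing convex sets there is a sequence which is Cauchy with respect to a bounded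
quadratic form, in the sense of the parallelogram law. -/
theorem exists_seq_of_parallelogram {P : Type*} [AddCommGroup P] [Module ℝ P] {K : ℕ → Set P}
    (hanti : Antitone K) (hconv : ∀ n, Convex ℝ (K n)) (hne : ∀ n, (K n).Nonempty) {q : P → ℝ}
    {C : ℝ} (hq0 : ∀ x ∈ K 0, 0 ≤ q x) (hqC : ∀ x ∈ K 0, q x ≤ C) {ε : ℕ → ℝ} (hε : ∀ n, 0 < ε n)
    (hεa : Antitone ε) : ∃ x : ℕ → P, (∀ k, x k ∈ K k) ∧ ∀ N n, N ≤ n →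
      2 * q (x n) + 2 * q (x N) - 4 * q ((1 / 2 : ℝ) • x n + (1 / 2 : ℝ) • x N) ≤ ε N := by
  let c : ℕ → ℝ := fun n => sInf (q '' K n)
  have hbelow : ∀ n, BddBelow (q '' K n) := fun n => by
    refine ⟨0, ?_⟩
    rintro _ ⟨x, hx, rfl⟩
    exact hq0 x (hanti (Nat.zero_le n) hx)
  have hcmono : Monotone c := fun m n hmn =>
    csInf_le_csInf (hbelow m) ((hne n).image q) (Set.image_mono (hanti hmn))
  have hcC : BddAbove (Set.range c) := by
    refine ⟨C, ?_⟩
    rintro _ ⟨n, rfl⟩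
    obtain ⟨x, hx⟩ := hne n
    exact (csInf_le (hbelow n) ⟨x, hx, rfl⟩).trans (hqC x (hanti (Nat.zero_le n) hx))
  have hlim := tendsto_atTop_ciSup hcmono hcC
  set s := ⨆ n, c n
  have hcs : ∀ n, c n ≤ s := fun n => le_ciSup hcC n
  -- The infima of `q` over `K n` increase to a finite limit `s`. At `φ N` the infimum is within `ε
  -- N / 8` of `s`, and `x N` is chosen within `ε N / 8` of the infimum. The midpoint of `x n` and
  -- `x N` still lies in `K (φ N)`, so `q` there is at least the infimum.
  obtain ⟨φ, hφ, hφs⟩ := extraction_forall_of_eventually (P := fun n k => s - ε n / 8 < c k)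
    fun n => (tendsto_order.1 hlim).1 _ (by linarith [hε n])
  have hex : ∀ k, ∃ x ∈ K (φ k), q x < c (φ k) + ε k / 8 := fun k => by
    obtain ⟨_, ⟨x, hx, rfl⟩, hlt⟩ := exists_lt_of_csInf_lt ((hne (φ k)).image q)
      (show sInf (q '' K (φ k)) < c (φ k) + ε k / 8 by linarith [hε k])
    exact ⟨x, hx, hlt⟩
  choose x hx hxq using hex
  refine ⟨x, fun k => hanti (hφ.id_le k) (hx k), fun N n hNn => ?_⟩
  have hmid : (1 / 2 : ℝ) • x n + (1 / 2 : ℝ) • x N ∈ K (φ N) :=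
    hconv (φ N) (hanti (hφ.monotone hNn) (hx n)) (hx N) (by norm_num) (by norm_num) (by norm_num)
  have h1 : c (φ N) ≤ q ((1 / 2 : ℝ) • x n + (1 / 2 : ℝ) • x N) :=
    csInf_le (hbelow _) ⟨_, hmid, rfl⟩
  linarith [hxq n, hxq N, hcs (φ n), hcs (φ N), hφs N, hεa hNn]

theorem convexHull_tail_subset {P : Type*} [AddCommGroup P] [Module ℝ P] {x : ℕ → P} {S : Set P}
    (hS : Convex ℝ S) {N : ℕ} (h : ∀ k ≥ N, x k ∈ S) : convexHull ℝ (x '' Set.Ici N) ⊆ S :=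
  convexHull_min (by rintro _ ⟨k, hk, rfl⟩; exact h k hk) hS

/-- Pairs of functions and their gradients in `H₀^{1,2}` of some ball. -/
def gradPairs (μ : Measure (RSpace d)) : Set ((RSpace d → ℝ) × (RSpace d → RSpace d)) :=
  {p | ∃ m, HasGradZero μ (exhBall d m) p.1 p.2}

section gradPairs

variable {p p' : (RSpace d → ℝ) × (RSpace d → RSpace d)}

theorem exists_hasGradZero_of_gradPairs (hp : p ∈ gradPairs μ) (hp' : p' ∈ gradPairs μ) :
    ∃ m, HasGradZero μ (exhBall d m) p.1 p.2 ∧ HasGradZero μ (exhBall d m) p'.1 p'.2 := by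
  obtain ⟨m, hm⟩ := hp
  obtain ⟨n, hn⟩ := hp'
  exact ⟨max m n, hm.mono (monotone_exhBall d (le_max_left _ _)),
    hn.mono (monotone_exhBall d (le_max_right _ _))⟩

theorem convex_gradPairs [IsFiniteMeasureOnCompacts μ] : Convex ℝ (gradPairs (d := d) μ) := by
  rintro p hp p' hp' s t - - -
  obtain ⟨m, h1, h2⟩ := exists_hasGradZero_of_gradPairs hp hp'
  exact ⟨m, (h1.const_smul s).add (h2.const_smul t)⟩

theorem integrable_of_gradPairs [IsFiniteMeasureOnCompacts μ] (hp : p ∈ gradPairs μ) :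
    Integrable p.1 μ := by
  obtain ⟨m, hm⟩ := hp
  exact hm.integrable (isCompact_closure_exhBall d m)

theorem convex_gradPairs_abs_le (M : ℝ) : Convex ℝ
    {p : (RSpace d → ℝ) × (RSpace d → RSpace d) | ∀ᵐ x ∂μ, |p.1 x| ≤ M} := by
  rintro p hp p' hp' s t hs ht hst
  have hp : ∀ᵐ x ∂μ, |p.1 x| ≤ M := hp
  have hp' : ∀ᵐ x ∂μ, |p'.1 x| ≤ M := hp'
  change ∀ᵐ x ∂μ, |(s • p + t • p').1 x| ≤ M
  filter_upwards [hp, hp'] with x h1 h2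
  calc |s * p.1 x + t * p'.1 x| ≤ |s * p.1 x| + |t * p'.1 x| := abs_add_le _ _
    _ = s * |p.1 x| + t * |p'.1 x| := by rw [abs_mul, abs_mul, abs_of_nonneg hs, abs_of_nonneg ht]
    _ ≤ s * M + t * M := by gcongr
    _ = M := by rw [← add_mul, hst, one_mul]

theorem convex_gradPairs_dist [IsFiniteMeasureOnCompacts μ] (hu : Integrable u μ) (a : ℝ) :
    Convex ℝ {p | p ∈ gradPairs μ ∧ ∫ x, |p.1 x - u x| ∂μ ≤ a} := by
  rintro p ⟨hp, h1⟩ p' ⟨hp', h2⟩ s t hs ht hst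
  refine ⟨convex_gradPairs hp hp' hs ht hst, ?_⟩
  have i1 : Integrable (fun x => |p.1 x - u x|) μ := ((integrable_of_gradPairs hp).sub hu).abs
  have i2 : Integrable (fun x => |p'.1 x - u x|) μ := ((integrable_of_gradPairs hp').sub hu).abs
  calc ∫ x, |(s • p + t • p').1 x - u x| ∂μ ≤ ∫ x, (s * |p.1 x - u x| + t * |p'.1 x - u x|) ∂μ := by
        refine integral_mono_of_nonneg (Eventually.of_forall fun x => abs_nonneg _)
          ((i1.const_mul s).add (i2.const_mul t)) (Eventually.of_forall fun x => ?_)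
        have e : (s • p + t • p').1 x - u x = s * (p.1 x - u x) + t * (p'.1 x - u x) := by
          have : u x = (s + t) * u x := by rw [hst, one_mul]
          simp only [Prod.fst_add, Prod.smul_fst, Pi.add_apply, Pi.smul_apply, smul_eq_mul]
          linear_combination -this
        simp only [e]
        refine (abs_add_le _ _).trans_eq ?_
        rw [abs_mul, abs_mul, abs_of_nonneg hs, abs_of_nonneg ht]
    _ = s * (∫ x, |p.1 x - u x| ∂μ) + t * ∫ x, |p'.1 x - u x| ∂μ := by
        rw [integral_add (i1.const_mul s) (i2.const_mul t), integral_const_mul, integral_const_mul]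
    _ ≤ s * a + t * a := by gcongr
    _ = a := by rw [← add_mul, hst, one_mul]

theorem energy_convexComb (hc : AdmissibleCoeff μ A B) (hp : p ∈ gradPairs μ)
    (hp' : p' ∈ gradPairs μ) (s t : ℝ) :
    energy μ A (s • p + t • p').2 (s • p + t • p').2 =
      s ^ 2 * energy μ A p.2 p.2 + 2 * s * t * energy μ A p.2 p'.2 +
        t ^ 2 * energy μ A p'.2 p'.2 := by
  have := hc.finite
  obtain ⟨m, h1, h2⟩ := exists_hasGradZero_of_gradPairs hp hp'
  have hm := isCompact_closure_exhBall d m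
  have h3 := (h1.const_smul s).add (h2.const_smul t)
  have e : (s • p + t • p').2 = fun x => s • p.2 x + t • p'.2 x := rfl
  rw [e, h3.energy_add_right hc hm (h1.const_smul s).2.1 (h2.const_smul t).2.1,
    energy_smul_right, energy_smul_right, hc.energy_symm _ p.2, hc.energy_symm _ p'.2,
    h1.energy_add_right hc hm (h1.const_smul s).2.1 (h2.const_smul t).2.1,
    h2.energy_add_right hc hm (h1.const_smul s).2.1 (h2.const_smul t).2.1]
  simp only [energy_smul_right]
  rw [hc.energy_symm p'.2 p.2]
  ring

/-- The parallelogram law in the form controlled by `exists_seq_of_parallelogram`: nearly minimal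
energies force small energy distances. -/
theorem energy_gradPairs_sub (hc : AdmissibleCoeff μ A B) (hp : p ∈ gradPairs μ)
    (hp' : p' ∈ gradPairs μ) : energy μ A (fun x => p.2 x - p'.2 x) (fun x => p.2 x - p'.2 x) =
      2 * energy μ A p.2 p.2 + 2 * energy μ A p'.2 p'.2 -
        4 * energy μ A ((1 / 2 : ℝ) • p + (1 / 2 : ℝ) • p').2
          ((1 / 2 : ℝ) • p + (1 / 2 : ℝ) • p').2 := by
  have h1 := energy_convexComb hc hp hp' 1 (-1)
  have e : (fun x => p.2 x - p'.2 x) = ((1 : ℝ) • p + (-1 : ℝ) • p').2 := by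
    ext1 x; simp [sub_eq_add_neg]
  rw [energy_convexComb hc hp hp', e, h1]
  ring

/-- For `s + t = 1` the energy falls short of the convex combination of the two energies by `st`
times the energy of the difference. -/
theorem convex_gradPairs_energy (hc : AdmissibleCoeff μ A B) (a : ℝ) :
    Convex ℝ {p | p ∈ gradPairs μ ∧ energy μ A p.2 p.2 ≤ a} := by
  have := hc.finite
  rintro p ⟨hp, h1⟩ p' ⟨hp', h2⟩ s t hs ht hst
  refine ⟨convex_gradPairs hp hp' hs ht hst, ?_⟩
  have h3 := energy_convexComb hc hp hp' 1 (-1)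
  have h4 := hc.energy_nonneg ((1 : ℝ) • p + (-1 : ℝ) • p').2
  rw [energy_convexComb hc hp hp']
  obtain rfl : t = 1 - s := by linarith
  nlinarith [mul_nonneg hs ht, mul_le_mul_of_nonneg_left h1 hs, mul_le_mul_of_nonneg_left h2 ht]

/-- A linear functional of the gradient, nearly equal to `L` on a sequence, stays so on convex
combinations. The weak equation passes to the limit in this way. -/
theorem convex_gradPairs_dual [IsFiniteMeasureOnCompacts μ] {Z : RSpace d → RSpace d}
    (hZ : MemLp Z 2 (μ.restrict V)) (L ε : ℝ) :
    Convex ℝ {p | p ∈ gradPairs μ ∧ |(∫ x in V, inner ℝ (Z x) (p.2 x) ∂μ) - L| ≤ ε} := by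
  rintro p ⟨hp, h1⟩ p' ⟨hp', h2⟩ s t hs ht hst
  refine ⟨convex_gradPairs hp hp' hs ht hst, ?_⟩
  obtain ⟨m, k1, k2⟩ := exists_hasGradZero_of_gradPairs hp hp'
  have i1 := (integrable_inner_of_memLp hZ (k1.2.1.restrict V)).const_mul s
  have i2 := (integrable_inner_of_memLp hZ (k2.2.1.restrict V)).const_mul t
  have e : (∫ x in V, inner ℝ (Z x) ((s • p + t • p').2 x) ∂μ) - L =
      s * ((∫ x in V, inner ℝ (Z x) (p.2 x) ∂μ) - L) +
        t * ((∫ x in V, inner ℝ (Z x) (p'.2 x) ∂μ) - L) := by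
    have h3 : ∫ x in V, inner ℝ (Z x) ((s • p + t • p').2 x) ∂μ =
        s * (∫ x in V, inner ℝ (Z x) (p.2 x) ∂μ) + t * ∫ x in V, inner ℝ (Z x) (p'.2 x) ∂μ := by
      rw [← integral_const_mul, ← integral_const_mul, ← integral_add i1 i2]
      congr 1; ext1 x
      simp [inner_add_right, inner_smul_right]
    rw [h3]
    linear_combination L * hst
  rw [e]
  calc _ ≤ _ := abs_add_le _ _
    _ = s * _ + t * _ := by rw [abs_mul, abs_mul, abs_of_nonneg hs, abs_of_nonneg ht]
    _ ≤ s * ε + t * ε := by gcongr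
    _ = ε := by rw [← add_mul, hst, one_mul]

end gradPairs

theorem tendsto_eLpNorm_two_of_bdd {α : Type*} [MeasurableSpace α] {ν : Measure α}
    {e : ℕ → α → ℝ} (he : ∀ n, Integrable (e n) ν) {C : ℝ} (hC : ∀ n, ∀ᵐ x ∂ν, |e n x| ≤ C)
    (hlim : Tendsto (fun n => ∫ x, |e n x| ∂ν) atTop (𝓝 0)) :
    Tendsto (fun n => eLpNorm (e n) 2 ν) atTop (𝓝 0) := by
  have h1 : ∀ n, eLpNorm (e n) 2 ν ≤ ENNReal.ofReal (C * ∫ x, |e n x| ∂ν) ^ (1 / (2 : ℝ)) := by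
    intro n
    rw [eLpNorm_eq_lintegral_rpow_enorm_toReal (by norm_num) (by norm_num)]
    simp only [ENNReal.toReal_ofNat]
    refine ENNReal.rpow_le_rpow ?_ (by norm_num)
    rw [← integral_const_mul, ofReal_integral_eq_lintegral_ofReal ((he n).abs.const_mul C)]
    · refine lintegral_mono_ae ?_
      filter_upwards [hC n] with x hx
      rw [← ofReal_norm, ENNReal.ofReal_rpow_of_nonneg (norm_nonneg _) (by norm_num),
        Real.norm_eq_abs]
      refine ENNReal.ofReal_le_ofReal ?_
      rw [Real.rpow_two, sq]
      exact mul_le_mul_of_nonneg_right hx (abs_nonneg _)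
    · filter_upwards [hC n] with x hx
      exact mul_nonneg ((abs_nonneg _).trans hx) (abs_nonneg _)
  have h2 : Tendsto (fun n => ENNReal.ofReal (C * ∫ x, |e n x| ∂ν) ^ (1 / (2 : ℝ))) atTop
      (𝓝 (ENNReal.ofReal (C * 0) ^ (1 / (2 : ℝ)))) :=
    ((ENNReal.continuous_rpow_const.tendsto _).comp
      ((ENNReal.continuous_ofReal.tendsto _).comp (hlim.const_mul C)))
  rw [mul_zero, ENNReal.ofReal_zero, ENNReal.zero_rpow_of_pos (by norm_num)] at h2
  exact tendsto_of_tendsto_of_tendsto_of_le_of_le tendsto_const_nhds h2 (fun _ => zero_le) h1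

/-- Testing a bounded weak solution with itself. -/
theorem WeakSol.energy_self_of_bdd (hc : AdmissibleCoeff μ A B) (hV : IsCompact (closure V))
    (hs : WeakSol μ A B V u F h) (hb : MemLp u ∞ μ) :
    energy μ A F F = - ∫ x, h x * u x ∂μ := by
  have := hc.finite
  have h1 := (hs.grad.mul hb hs.grad hb).mono (Set.inter_subset_left)
  have h2 := h1.integral_inner_drift hc hV
  have h3 : ∫ x, inner ℝ (B x) (u x • F x + u x • F x) ∂μ =
      2 * ∫ x, inner ℝ (B x) (F x) * u x ∂μ := by
    rw [← integral_const_mul]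
    congr 1; ext1 x
    rw [inner_add_right, inner_smul_right]; ring
  have h4 := hs.eq u F hs.grad hb
  rw [h3] at h2
  linarith

/-- The functional `F ↦ E⁰(F, ∇v) - ∫ ⟨B, F⟩ v` is given by a square integrable field. -/
theorem HasGradZero.exists_dual_field (hc : AdmissibleCoeff μ A B) (hVo : IsOpen V)
    (hV : IsCompact (closure V)) (hv : HasGradZero μ V v H) (hvb : MemLp v ∞ μ) :
    ∃ Z : RSpace d → RSpace d, MemLp Z 2 (μ.restrict V) ∧ ∀ F, MemLp F 2 (μ.restrict V) →
      Integrable (fun x => inner ℝ (B x) (F x) * v x) μ ∧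
      energy μ A F H - ∫ x, inner ℝ (B x) (F x) * v x ∂μ =
        ∫ x in V, inner ℝ (Z x) (F x) ∂μ := by
  have := hc.finite
  obtain ⟨M, -, hM⟩ := exists_ae_bound hvb
  have m1 : MemLp (fun x => matVec (A x) (H x)) 2 (μ.restrict V) :=
    (hv.memLp_matVec hc hV).restrict V
  have m2 : MemLp (fun x => v x • B x) 2 (μ.restrict V) :=
    (hc.drift V hV).of_le_mul (c := M) (hvb.1.restrict.smul (hc.drift V hV).1) (by
      filter_upwards [ae_restrict_of_ae hM] with x hx
      rw [norm_smul]
      exact mul_le_mul_of_nonneg_right hx (norm_nonneg _))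
  refine ⟨fun x => (1 / 2 : ℝ) • matVec (A x) (H x) - v x • B x,
    (m1.const_smul (1 / 2 : ℝ)).sub m2, fun F hF => ?_⟩
  have i1 : IntegrableOn (fun x => inner ℝ (matVec (A x) (H x)) (F x)) V μ :=
    integrable_inner_of_memLp m1 hF
  have i2 : IntegrableOn (fun x => inner ℝ (v x • B x) (F x)) V μ :=
    integrable_inner_of_memLp m2 hF
  have i3 : IntegrableOn (fun x => inner ℝ (B x) (F x) * v x) V μ :=
    i2.congr_fun (fun x _ => by simp only [real_inner_smul_left, mul_comm]) hVo.measurableSet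
  have z3 : ∀ᵐ x ∂μ, x ∉ V → inner ℝ (B x) (F x) * v x = 0 := by
    filter_upwards [hv.ae_eq_zero] with x hx hxV
    rw [(hx hxV).1, mul_zero]
  refine ⟨i3.integrable_of_ae_notMem_eq_zero z3, ?_⟩
  have e1 : ∫ x, matInner (A x) (F x) (H x) ∂μ =
      ∫ x in V, inner ℝ (matVec (A x) (H x)) (F x) ∂μ := by
    rw [← setIntegral_eq_integral_of_ae_compl_eq_zero (s := V)]
    · refine integral_congr_ae (ae_restrict_of_ae ?_)
      filter_upwards [hc.symm] with x hx
      rw [inner_matVec, matInner_symm hx]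
    · filter_upwards [hv.ae_eq_zero] with x hx hxV
      rw [(hx hxV).2]; simp [matInner]
  have e2 : ∫ x, inner ℝ (B x) (F x) * v x ∂μ = ∫ x in V, inner ℝ (v x • B x) (F x) ∂μ := by
    rw [← setIntegral_eq_integral_of_ae_compl_eq_zero z3]
    congr 1; ext1 x
    rw [real_inner_smul_left, mul_comm]
  rw [energy, e1, e2, ← integral_const_mul, ← integral_sub (i1.const_mul _) i2]
  congr 1; ext1 x
  rw [inner_sub_left, real_inner_smul_left (matVec (A x) (H x))]

/-! ### Bounded elements of the domain of the generator -/

theorem memLp_two_of_integrable_of_bdd {α : Type*} [MeasurableSpace α] {ν : Measure α} {f : α → ℝ}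
    (hf : Integrable f ν) {M : ℝ} (hM : ∀ᵐ x ∂ν, |f x| ≤ M) : MemLp f 2 ν := by
  rw [memLp_two_iff_integrable_sq hf.1]
  simpa only [sq] using integrable_mul_bdd hf (memLp_top_of_ae_bound hf.1 hM)

/-- The difference is `(h - w)U + w(U - u)`: the first summand uses the uniform bound on `U`, the
second is a fixed integrable function times a bounded null sequence. -/
theorem tendsto_integral_mul_of_L1 {α : Type*} [MeasurableSpace α] {ν : Measure α}
    {h U : ℕ → α → ℝ} {w u : α → ℝ} (hh : ∀ k, Integrable (h k) ν) (hw : Integrable w ν)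
    (hU : ∀ k, AEStronglyMeasurable (U k) ν) (hu : AEStronglyMeasurable u ν)
    (hUu : ∀ k, Integrable (fun x => U k x - u x) ν) {M : ℝ}
    (hM : ∀ k, ∀ᵐ x ∂ν, |U k x| ≤ M) (huM : ∀ᵐ x ∂ν, |u x| ≤ M)
    (h1 : Tendsto (fun k => ∫ x, |h k x - w x| ∂ν) atTop (𝓝 0))
    (h2 : Tendsto (fun k => ∫ x, |U k x - u x| ∂ν) atTop (𝓝 0)) :
    Tendsto (fun k => ∫ x, h k x * U k x ∂ν) atTop (𝓝 (∫ x, w x * u x ∂ν)) := by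
  have hUb : ∀ k, MemLp (U k) ∞ ν := fun k => memLp_top_of_ae_bound (hU k) (hM k)
  have hub : MemLp u ∞ ν := memLp_top_of_ae_bound hu huM
  have i1 : ∀ k, Integrable (fun x => (h k x - w x) * U k x) ν := fun k =>
    integrable_mul_bdd ((hh k).sub hw) (hUb k)
  have i2 : ∀ k, Integrable (fun x => w x * (U k x - u x)) ν := fun k =>
    integrable_mul_bdd hw ((hUb k).sub hub)
  have i3 : Integrable (fun x => w x * u x) ν := integrable_mul_bdd hw hub
  have t1 : Tendsto (fun k => ∫ x, (h k x - w x) * U k x ∂ν) atTop (𝓝 0) := by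
    refine squeeze_zero_norm (a := fun k => (∫ x, |h k x - w x| ∂ν) * M) (fun k => ?_) (by
      simpa using h1.mul_const M)
    refine (norm_integral_le_integral_norm _).trans ?_
    rw [← integral_mul_const]
    refine integral_mono_ae (i1 k).norm (((hh k).sub hw).abs.mul_const M) ?_
    filter_upwards [hM k] with x hx
    rw [norm_mul]
    exact mul_le_mul_of_nonneg_left hx (abs_nonneg _)
  have t2 : Tendsto (fun k => ∫ x, w x * (U k x - u x) ∂ν) atTop (𝓝 0) := by
    refine tendsto_integral_mul_of_bdd hw hUu (C := M + M) (fun k => ?_) h2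
    filter_upwards [hM k, huM] with x a b
    exact (abs_sub _ _).trans (add_le_add a b)
  have t3 := (t1.add t2).add_const (∫ x, w x * u x ∂ν)
  rw [add_zero, zero_add] at t3
  refine t3.congr fun k => ?_
  have i12 : Integrable (fun x => (h k x - w x) * U k x + w x * (U k x - u x)) ν := (i1 k).add (i2 k)
  rw [← integral_add (i1 k) (i2 k), ← integral_add i12 i3]
  congr 1; ext1 x; ring

theorem memLp_of_tendsto_eLpNorm {α E : Type*} [MeasurableSpace α] {ν : Measure α}
    [NormedAddCommGroup E] {F : α → E} {G : ℕ → α → E} (hF : AEStronglyMeasurable F ν)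
    (hG : ∀ n, MemLp (G n) 2 ν)
    (h : Tendsto (fun n => eLpNorm (fun x => F x - G n x) 2 ν) atTop (𝓝 0)) : MemLp F 2 ν := by
  obtain ⟨n, hn⟩ := ((tendsto_order.1 h).2 1 (by norm_num)).exists
  have h1 : MemLp (fun x => F x - G n x) 2 ν := ⟨hF.sub (hG n).1, hn.trans_le (by norm_num)⟩
  refine (memLp_congr_ae (Eventually.of_forall fun x => ?_)).1 (h1.add (hG n))
  simp

theorem AdmissibleCoeff.tendsto_eLpNorm_of_formMass (hc : AdmissibleCoeff μ A B)
    {G : ℕ → RSpace d → RSpace d}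
    (h : Tendsto (fun k => formMass μ A (fun x => F x - G k x)) atTop (𝓝 0)) {K : Set (RSpace d)}
    (hK : IsCompact K) :
    Tendsto (fun k => eLpNorm (fun x => F x - G k x) 2 (μ.restrict K)) atTop (𝓝 0) := by
  obtain ⟨n, hn⟩ := exists_subset_of_isCompact hK (isOpen_exhBall d) (monotone_exhBall d)
    (iUnion_exhBall d)
  obtain ⟨ν, hν, hle⟩ := hc.exists_eLpNorm_le_formMass (isOpen_exhBall d n)
    (isCompact_closure_exhBall d n)
  have k1 : Tendsto (fun k => (ENNReal.ofReal ν * formMass μ A (fun x => F x - G k x)) ^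
      (1 / (2 : ℝ))) atTop (𝓝 ((ENNReal.ofReal ν * 0) ^ (1 / (2 : ℝ)))) :=
    (ENNReal.continuous_rpow_const.tendsto _).comp
      (ENNReal.Tendsto.const_mul h (Or.inr ENNReal.ofReal_ne_top))
  rw [mul_zero, ENNReal.zero_rpow_of_pos (by norm_num)] at k1
  exact tendsto_of_tendsto_of_tendsto_of_le_of_le tendsto_const_nhds k1 (fun _ => zero_le)
    fun k => (eLpNorm_mono_measure _ (Measure.restrict_mono_set μ hn)).trans (hle _)

/-- Limits of weak solutions on balls are in the form domain. -/
theorem exists_inFormDomain_of_weakSol (hc : AdmissibleCoeff μ A B) {n : ℕ → ℕ}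
    (hn : ∀ k, k ≤ n k) {U h : ℕ → RSpace d → ℝ} {D : ℕ → RSpace d → RSpace d}
    (hs : ∀ k, WeakSol μ A B (exhBall d (n k)) (U k) (D k) (h k)) {M : ℝ}
    (hM : ∀ k, ∀ᵐ x ∂μ, |U k x| ≤ M) {u w : RSpace d → ℝ} (hu : Integrable u μ)
    (huM : ∀ᵐ x ∂μ, |u x| ≤ M) (hw : Integrable w μ)
    (hUu : Tendsto (fun k => ∫ x, |U k x - u x| ∂μ) atTop (𝓝 0))
    (hhw : Tendsto (fun k => ∫ x, |h k x - w x| ∂μ) atTop (𝓝 0)) :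
    ∃ F, InFormDomain μ A u F ∧
      (∀ m v H, HasGradZero μ (exhBall d m) v H → MemLp v ∞ μ →
        Integrable (fun x => inner ℝ (B x) (F x) * v x) μ ∧
        energy μ A F H - ∫ x, inner ℝ (B x) (F x) * v x ∂μ = - ∫ x, w x * v x ∂μ) ∧
      energy μ A F F ≤ - ∫ x, w x * u x ∂μ := by
  have := hc.finite
  have hUi : ∀ k, Integrable (U k) μ := fun k =>
    (hs k).grad.integrable (isCompact_closure_exhBall d _)
  have hUb : ∀ k, MemLp (U k) ∞ μ := fun k => memLp_top_of_ae_bound (hUi k).1 (hM k)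
  set x : ℕ → (RSpace d → ℝ) × (RSpace d → RSpace d) := fun k => (U k, D k) with hx
  have hxg : ∀ k, x k ∈ gradPairs μ := fun k => ⟨n k, (hs k).grad⟩
  set e := - ∫ x, w x * u x ∂μ with he
  -- Testing each solution with itself removes the drift, so the energy is `-∫ hU`, which converges.
  have tE : Tendsto (fun k => energy μ A (D k) (D k)) atTop (𝓝 e) := by
    refine (tendsto_integral_mul_of_L1 (fun k => (hs k).int) hw (fun k => (hUi k).1) hu.1
      (fun k => (hUi k).sub hu) hM huM hhw hUu).neg.congr fun k => ?_
    exact ((hs k).energy_self_of_bdd hc (isCompact_closure_exhBall d _) (hUb k)).symm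
  obtain ⟨C, hC⟩ := tE.bddAbove_range
  let K : ℕ → Set ((RSpace d → ℝ) × (RSpace d → RSpace d)) := fun N =>
    convexHull ℝ (x '' Set.Ici N)
  have hKanti : Antitone K := fun m n hmn =>
    convexHull_mono (Set.image_mono (Set.Ici_subset_Ici.2 hmn))
  have hKg : ∀ N, K N ⊆ gradPairs μ := fun N =>
    convexHull_tail_subset convex_gradPairs fun k _ => hxg k
  have hKC : K 0 ⊆ {p | p ∈ gradPairs μ ∧ energy μ A p.2 p.2 ≤ C} :=
    convexHull_tail_subset (convex_gradPairs_energy hc C) fun k _ => ⟨hxg k, hC ⟨k, rfl⟩⟩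
  -- `formMass` is twice the energy; the factor `1/2` in the tolerance produces exactly the bound
  -- `(1/16)^N` needed for completeness.
  obtain ⟨p, hpK, hpar⟩ := exists_seq_of_parallelogram (K := K) hKanti
    (fun N => convex_convexHull ℝ _)
    (fun N => ⟨x N, subset_convexHull ℝ _ ⟨N, Set.self_mem_Ici, rfl⟩⟩)
    (q := fun p => energy μ A p.2 p.2) (C := C) (fun p _ => hc.energy_nonneg _)
    (fun p hp => (hKC hp).2) (ε := fun N => 1 / 2 * (1 / 16) ^ N) (fun N => by positivity)
    (fun m n hmn => by
      have := pow_le_pow_of_le_one (by norm_num : (0 : ℝ) ≤ 1 / 16) (by norm_num) hmn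
      simp only
      linarith)
  have hpg : ∀ k, p k ∈ gradPairs μ := fun k => hKg k (hpK k)
  choose b hb using hpg
  -- Each `p k` is a convex combination of members `x j` with `j ≥ k`, so every convex property that
  -- holds eventually along `x` holds eventually along `p`.
  have hev : ∀ {S : Set ((RSpace d → ℝ) × (RSpace d → RSpace d))}, Convex ℝ S →
      (∀ᶠ k in atTop, x k ∈ S) → ∀ᶠ k in atTop, p k ∈ S := by
    intro S hS h1
    obtain ⟨N, hN⟩ := eventually_atTop.1 h1
    filter_upwards [eventually_ge_atTop N] with k hk
    exact convexHull_tail_subset hS hN (hKanti hk (hpK k))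
  obtain ⟨F, hF, hae, hFN⟩ := hc.exists_limit_gradient (G := fun k => (p k).2)
    (fun k => (hb k).2.1.1) (fun N n hNn => by
      obtain ⟨m, h1, h2⟩ := exists_hasGradZero_of_gradPairs (hKg n (hpK n)) (hKg N (hpK N))
      rw [(h1.sub h2).formMass_eq hc (isCompact_closure_exhBall d m)]
      refine ENNReal.ofReal_le_ofReal ?_
      rw [energy_gradPairs_sub hc (hKg n (hpK n)) (hKg N (hpK N))]
      have := hpar N n hNn
      linarith)
  have hF0 : Tendsto (fun N => formMass μ A (fun x => F x - (p N).2 x)) atTop (𝓝 0) := by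
    have h1 := (ENNReal.continuous_ofReal.tendsto _).comp
      (tendsto_pow_atTop_nhds_zero_of_lt_one (by norm_num : (0 : ℝ) ≤ 1 / 16) (by norm_num))
    rw [ENNReal.ofReal_zero] at h1
    exact tendsto_of_tendsto_of_tendsto_of_le_of_le tendsto_const_nhds h1 (fun _ => zero_le) hFN
  have hpi : ∀ k, Integrable (p k).1 μ := fun k => integrable_of_gradPairs (hKg k (hpK k))
  have hpM : ∀ k, ∀ᵐ x ∂μ, |(p k).1 x| ≤ M := fun k =>
    convexHull_tail_subset (convex_gradPairs_abs_le M) (fun j _ => hM j) (hpK k)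
  have hpu : Tendsto (fun k => ∫ x, |u x - (p k).1 x| ∂μ) atTop (𝓝 0) := by
    rw [tendsto_order]
    refine ⟨fun a ha => Eventually.of_forall fun k =>
      ha.trans_le (integral_nonneg fun x => abs_nonneg _), fun a ha => ?_⟩
    have h1 : ∀ᶠ k in atTop, x k ∈ {p | p ∈ gradPairs μ ∧ ∫ x, |p.1 x - u x| ∂μ ≤ a / 2} := by
      filter_upwards [(tendsto_order.1 hUu).2 (a / 2) (by linarith)] with k hk
      exact ⟨hxg k, hk.le⟩
    filter_upwards [hev (convex_gradPairs_dist hu (a / 2)) h1] with k hk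
    simp only [abs_sub_comm (u _)]
    linarith [hk.2]
  have hball : ∀ m, Tendsto (fun k => eLpNorm (fun x => F x - (p k).2 x) 2
      (μ.restrict (exhBall d m))) atTop (𝓝 0) := fun m =>
    tendsto_of_tendsto_of_tendsto_of_le_of_le tendsto_const_nhds
      (hc.tendsto_eLpNorm_of_formMass hF0 (isCompact_closure_exhBall d m)) (fun _ => zero_le)
      fun k => eLpNorm_mono_measure _ (Measure.restrict_mono_set μ subset_closure)
  have hFm : ∀ m, MemLp F 2 (μ.restrict (exhBall d m)) := fun m =>
    memLp_of_tendsto_eLpNorm hF.restrict (fun k => (hb k).2.1.restrict _) (hball m)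
  refine ⟨F, ?_, fun m v H hv hvb => ?_, ?_⟩
  · refine InFormDomain.of_tendsto hc
      (fun k => (hb k).inFormDomain hc (isCompact_closure_exhBall d _))
      (memLp_two_of_integrable_of_bdd hu huM) hF ?_ hF0
    refine tendsto_eLpNorm_two_of_bdd (fun k => hu.sub (hpi k)) (C := M + M) (fun k => ?_) hpu
    filter_upwards [huM, hpM k] with x h1 h2
    exact (abs_sub _ _).trans (add_le_add h1 h2)
  · obtain ⟨Z, hZ, hZF⟩ := hv.exists_dual_field hc (isOpen_exhBall d m)
      (isCompact_closure_exhBall d m) hvb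
    obtain ⟨hint, heq⟩ := hZF F (hFm m)
    refine ⟨hint, heq.trans ?_⟩
    obtain ⟨Mv, -, hMv⟩ := exists_ae_bound hvb
    -- For `k ≥ m` the function `v` is an admissible test function for the equation on the ball of
    -- index `n k`. The limit is first identified along the solutions themselves, then transferred
    -- to the convex combinations.
    have t1 : Tendsto (fun k => ∫ x in exhBall d m, inner ℝ (Z x) (D k x) ∂μ) atTop
        (𝓝 (- ∫ x, w x * v x ∂μ)) := by
      have h1 := (tendsto_integral_mul_of_L1 (U := fun _ => v) (u := v) (fun k => (hs k).int) hw
        (fun _ => hvb.1) hvb.1 (by simp) (fun _ => hMv) hMv hhw (by simp)).neg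
      refine h1.congr' ?_
      filter_upwards [eventually_ge_atTop m] with k hk
      rw [← (hZF (D k) ((hs k).grad.2.1.restrict _)).2]
      exact ((hs k).eq v H (hv.mono (monotone_exhBall d (hk.trans (hn k)))) hvb).symm
    have t2 : Tendsto (fun k => ∫ x in exhBall d m, inner ℝ (Z x) ((p k).2 x) ∂μ) atTop
        (𝓝 (- ∫ x, w x * v x ∂μ)) := by
      rw [Metric.tendsto_nhds]
      intro ε hε
      have h1 : ∀ᶠ k in atTop, x k ∈ {p | p ∈ gradPairs μ ∧
          |(∫ x in exhBall d m, inner ℝ (Z x) (p.2 x) ∂μ) - (- ∫ x, w x * v x ∂μ)| ≤ ε / 2} := by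
        filter_upwards [Metric.tendsto_nhds.1 t1 (ε / 2) (by linarith)] with k hk
        exact ⟨hxg k, hk.le⟩
      filter_upwards [hev (convex_gradPairs_dual hZ _ (ε / 2)) h1] with k hk
      exact hk.2.trans_lt (by linarith)
    refine tendsto_nhds_unique (tendsto_integral_inner hZ (hFm m) (fun _ => hZ)
      (fun k => (hb k).2.1.restrict _) (eLpNorm_sub_self_tendsto _ _) (hball m)) t2
  -- For every `a > e` the energies of the convex combinations are eventually at most `a`. Fatou's
  -- lemma gives the bound with `a`, and `a` then decreases to `e`.
  · have h1 : formMass μ A F ≤ ENNReal.ofReal (2 * e) := by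
      have hle : ∀ a > e, formMass μ A F ≤ ENNReal.ofReal (2 * a) := by
        intro a ha
        have h2 : ∀ᶠ k in atTop, x k ∈ {p | p ∈ gradPairs μ ∧ energy μ A p.2 p.2 ≤ a} := by
          filter_upwards [(tendsto_order.1 tE).2 a ha] with k hk
          exact ⟨hxg k, hk.le⟩
        have h3 := hev (convex_gradPairs_energy hc a) h2
        calc formMass μ A F = ∫⁻ x, liminf (fun k => ENNReal.ofReal
                (matInner (A x) ((p k).2 x) ((p k).2 x))) atTop ∂μ := by
              refine lintegral_congr_ae ?_
              filter_upwards [hae] with x hx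
              refine (Tendsto.liminf_eq ?_).symm
              refine (ENNReal.continuous_ofReal.tendsto _).comp ?_
              have hcont : Continuous fun ξ : RSpace d => matInner (A x) ξ ξ := by
                unfold matInner; fun_prop
              exact (hcont.tendsto _).comp hx
          _ ≤ liminf (fun k => formMass μ A (p k).2) atTop :=
              lintegral_liminf_le' fun k => (hc.aestronglyMeasurable_matInner (hb k).2.1.1
                (hb k).2.1.1).aemeasurable.ennreal_ofReal
          _ ≤ _ := by
              refine liminf_le_of_le (by isBoundedDefault) fun c hcb => ?_
              obtain ⟨k, hk, hk'⟩ := (hcb.and h3).exists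
              refine hk.trans ?_
              rw [(hb k).formMass_eq hc (isCompact_closure_exhBall d _)]
              exact ENNReal.ofReal_le_ofReal (by linarith [hk'.2])
      have h4 : Tendsto (fun a : ℝ => ENNReal.ofReal (2 * a)) (𝓝[>] e)
          (𝓝 (ENNReal.ofReal (2 * e))) :=
        ((ENNReal.continuous_ofReal.comp (continuous_const.mul continuous_id)).tendsto e).mono_left
          nhdsWithin_le_nhds
      exact ge_of_tendsto h4 (eventually_nhdsWithin_of_forall hle)
    have he0 : 0 ≤ e := ge_of_tendsto' tE fun k => hc.energy_nonneg _
    have h5 : ∫ x, matInner (A x) (F x) (F x) ∂μ = (formMass μ A F).toReal :=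
      integral_eq_lintegral_of_nonneg_ae (hc.ae_nonneg.mono fun x hx => hx _)
        (hc.aestronglyMeasurable_matInner hF hF)
    have h6 := ENNReal.toReal_mono ENNReal.ofReal_ne_top h1
    rw [ENNReal.toReal_ofReal (by linarith)] at h6
    rw [energy, h5]
    linarith

/-! ### Localization -/

theorem tendsto_eLpNorm_of_restrict {E : Type*} [NormedAddCommGroup E] {S : Set (RSpace d)}
    (hS : MeasurableSet S) {f : ℕ → RSpace d → E} (h0 : ∀ n, ∀ x ∉ S, f n x = 0)
    (h : Tendsto (fun n => eLpNorm (f n) 2 (μ.restrict S)) atTop (𝓝 0)) :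
    Tendsto (fun n => eLpNorm (f n) 2 μ) atTop (𝓝 0) := by
  refine h.congr fun n => ?_
  rw [← eLpNorm_indicator_eq_eLpNorm_restrict hS, Set.indicator_eq_self.2]
  exact fun x hx => by_contra fun h => hx (h0 n x h)

/-- A function that vanishes off a compact subset of `V`, and which is a limit of test functions
with respect to the local Sobolev norms, is in `H₀^{1,2}(V, μ)`. -/
theorem AdmissibleCoeff.hasGradZero_of_locally (hc : AdmissibleCoeff μ A B) {f : ℕ → RSpace d → ℝ}
    (hu : MemLp u 2 μ) (hF : AEStronglyMeasurable F μ) (hf : ∀ n, IsTestFun Set.univ (f n))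
    (h1 : ∀ K, IsCompact K →
      Tendsto (fun n => eLpNorm (fun x => u x - f n x) 2 (μ.restrict K)) atTop (𝓝 0))
    (h2 : ∀ K, IsCompact K →
      Tendsto (fun n => eLpNorm (fun x => F x - ∇ (f n) x) 2 (μ.restrict K)) atTop (𝓝 0))
    {K : Set (RSpace d)} (hK : IsCompact K) (hKu : ∀ᵐ x ∂μ, x ∉ K → u x = 0) (hVo : IsOpen V)
    (hKV : K ⊆ V) : HasGradZero μ V u F := by
  have := hc.finite
  obtain ⟨χ, hχ, -, hχ1, -⟩ := exists_cutoff hK hVo hKV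
  obtain ⟨C, hC⟩ := hχ.exists_bound
  obtain ⟨C', hC'⟩ := hχ.exists_bound_gradient
  have hFK : ∀ K, IsCompact K → MemLp F 2 (μ.restrict K) := fun K hK =>
    memLp_of_tendsto_eLpNorm hF.restrict (fun n => ((hf n).memLp_gradient 2 (μ := μ)).restrict K)
      (h2 K hK)
  have hS := hχ.compact.isCompact
  have hSm : MeasurableSet (tsupport χ) := hS.isClosed.measurableSet
  have hχ0 : ∀ x ∉ tsupport χ, χ x = 0 := fun x hx => image_eq_zero_of_notMem_tsupport hx
  have hχ0' : ∀ x ∉ tsupport χ, ∇ χ x = 0 := fun x hx => gradient_eq_zero_of_notMem_tsupport hx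
  have hχm : AEStronglyMeasurable χ μ := hχ.smooth.continuous.aestronglyMeasurable
  have hχm' : AEStronglyMeasurable (∇ χ) μ := hχ.continuous_gradient.aestronglyMeasurable
  have hχu : ∀ᵐ x ∂μ, χ x * u x = u x := by
    filter_upwards [hKu] with x hx
    by_cases hxK : x ∈ K
    · rw [hχ1 x hxK, one_mul]
    · rw [hx hxK, mul_zero]
  have hfm : ∀ n, AEStronglyMeasurable (f n) μ := fun n => ((hf n).memLp 2 (μ := μ)).1
  have hfm' : ∀ n, AEStronglyMeasurable (∇ (f n)) μ := fun n => ((hf n).memLp_gradient 2 (μ := μ)).1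
  have hg : ∀ n, IsTestFun V (fun x => χ x * f n x) := fun n => by
    simpa using hχ.mul (hf n)
  have t1 : Tendsto (fun n => eLpNorm (fun x => χ x * u x - χ x * f n x) 2 μ) atTop (𝓝 0) := by
    refine tendsto_eLpNorm_of_restrict hSm (fun n x hx => by simp [hχ0 x hx]) ?_
    refine tendsto_eLpNorm_zero_of_le (C := C) (fun n => Eventually.of_forall fun x => ?_)
      (h1 _ hS)
    rw [← mul_sub, norm_mul]
    exact mul_le_mul_of_nonneg_right (hC x) (norm_nonneg _)
  have t2 : Tendsto (fun n => eLpNorm (fun x => χ x • (F x - ∇ (f n) x)) 2 μ) atTop (𝓝 0) := by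
    refine tendsto_eLpNorm_of_restrict hSm (fun n x hx => by simp [hχ0 x hx]) ?_
    refine tendsto_eLpNorm_zero_of_le (C := C) (fun n => Eventually.of_forall fun x => ?_)
      (h2 _ hS)
    rw [norm_smul]
    exact mul_le_mul_of_nonneg_right (hC x) (norm_nonneg _)
  have t3 : Tendsto (fun n => eLpNorm (fun x => (u x - f n x) • ∇ χ x) 2 μ) atTop (𝓝 0) := by
    refine tendsto_eLpNorm_of_restrict hSm (fun n x hx => by simp [hχ0' x hx]) ?_
    refine tendsto_eLpNorm_zero_of_le (C := C') (fun n => Eventually.of_forall fun x => ?_)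
      (h1 _ hS)
    rw [norm_smul, mul_comm]
    exact mul_le_mul_of_nonneg_right (hC' x) (norm_nonneg _)
  have t4 : Tendsto (fun n => eLpNorm (fun x => (χ x • F x + u x • ∇ χ x) -
      ∇ (fun y => χ y * f n y) x) 2 μ) atTop (𝓝 0) := by
    refine (tendsto_eLpNorm_zero_add (by norm_num) (fun n => hχm.smul (hF.sub (hfm' n)))
      (fun n => (hu.1.sub (hfm n)).smul hχm') t2 t3).congr fun n => ?_
    congr 1; ext1 x
    rw [gradient_mul_test hχ (hf n)]
    simp only [Pi.smul_apply', Pi.sub_apply]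
    module
  have mF : MemLp (fun x => χ x • F x) 2 μ := by
    have k1 : MemLp ((tsupport χ).indicator fun x => χ x • F x) 2 μ :=
      (memLp_indicator_iff_restrict hSm).2
        (memLp_bdd_smul (hFK _ hS) hχm.restrict (Eventually.of_forall hC))
    rwa [Set.indicator_eq_self.2] at k1
    exact fun x hx => by_contra fun h => hx (by simp [hχ0 x h])
  have mu : MemLp (fun x => u x • ∇ χ x) 2 μ := by
    refine hu.of_le_mul (c := C') (hu.1.smul hχm') (Eventually.of_forall fun x => ?_)
    rw [norm_smul, mul_comm]
    exact mul_le_mul_of_nonneg_right (hC' x) (norm_nonneg _)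
  have t1' : Tendsto (fun n => eLpNorm (fun x => u x - χ x * f n x) 2 μ) atTop (𝓝 0) := by
    refine t1.congr fun n => eLpNorm_congr_ae ?_
    filter_upwards [hχu] with x hx
    rw [hx]
  -- The cut-off sequence approximates `χu = u`, with gradient `χF + u∇χ`. Uniqueness identifies
  -- this with `F`, so no pointwise argument about `F` off `K` is needed.
  have key : F =ᵐ[μ] fun x => χ x • F x + u x • ∇ χ x :=
    hc.ae_gradient_unique (fun K _ => hu.restrict K) hFK (fun K _ => (mF.add mu).restrict K) hf
      (fun n => (hg n).mono (Set.subset_univ _)) h1 h2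
      (fun K _ => tendsto_eLpNorm_restrict t1' K) (fun K _ => tendsto_eLpNorm_restrict t4 K)
  exact HasGradZero.congr ⟨hu, mF.add mu, _, hg, t1', t4⟩ EventuallyEq.rfl key.symm

theorem HasGradZero.of_subset (hc : AdmissibleCoeff μ A B) (h : HasGradZero μ W v H)
    {K : Set (RSpace d)} (hK : IsCompact K) (hKv : ∀ᵐ x ∂μ, x ∉ K → v x = 0) (hVo : IsOpen V)
    (hKV : K ⊆ V) : HasGradZero μ V v H := by
  obtain ⟨hv, hH, f, hf, h1, h2⟩ := h
  exact hc.hasGradZero_of_locally hv hH.1 (fun n => (hf n).mono (Set.subset_univ _))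
    (fun K _ => tendsto_eLpNorm_restrict h1 K) (fun K _ => tendsto_eLpNorm_restrict h2 K) hK hKv
    hVo hKV

theorem InFormDomain.hasGradZero (hc : AdmissibleCoeff μ A B) (h : InFormDomain μ A u F)
    {K : Set (RSpace d)} (hK : IsCompact K) (hKu : ∀ᵐ x ∂μ, x ∉ K → u x = 0) (hVo : IsOpen V)
    (hKV : K ⊆ V) : HasGradZero μ V u F := by
  obtain ⟨hu, hF, f, hf, h1, h2⟩ := h
  exact hc.hasGradZero_of_locally hu hF hf (fun K _ => tendsto_eLpNorm_restrict h1 K)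
    (fun L hL => hc.tendsto_eLpNorm_of_formMass h2 hL) hK hKu hVo hKV

theorem tendsto_indicatorL1 {α : Type*} [MeasurableSpace α] {ν : Measure α} {V : ℕ → Set α}
    (hV : ∀ n, MeasurableSet (V n)) (hm : Monotone V) (hU : ⋃ n, V n = Set.univ) (f : Lp ℝ 1 ν) :
    Tendsto (fun n => indicatorL1 ν (hV n) f) atTop (𝓝 f) := by
  rw [tendsto_iff_dist_tendsto_zero]
  have hi := L1.integrable_coeFn f
  have h1 : Tendsto (fun n : ℕ => ∫ x, |(V n).indicator f x - f x| ∂ν) atTop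
      (𝓝 (∫ _, (0 : ℝ) ∂ν)) := by
    refine tendsto_integral_of_dominated_convergence (fun x => ‖f x‖)
      (fun n => ((hi.1.indicator (hV n)).sub hi.1).norm) hi.norm
      (fun n => Eventually.of_forall fun x => ?_) (Eventually.of_forall fun x => ?_)
    · by_cases hx : x ∈ V n <;> simp [hx]
    · obtain ⟨N, hN⟩ := Set.mem_iUnion.1 (hU.symm ▸ Set.mem_univ x : x ∈ ⋃ n, V n)
      refine tendsto_const_nhds.congr' ?_
      filter_upwards [eventually_ge_atTop N] with n hn
      simp [hm hn hN]
  rw [integral_zero] at h1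
  refine h1.congr fun n => ?_
  rw [L1_dist_eq]
  refine integral_congr_ae ?_
  filter_upwards [coeFn_indicatorL1 (hV n) f] with x hx
  rw [hx]

/-- Bounded elements of the domain of the generator are in the form domain. -/
theorem exists_inFormDomain_of_mem_graph (hc : AdmissibleCoeff μ A B)
    (hR : IsContractionResolvent (fullResolvent hc)) {u w : Lp ℝ 1 μ}
    (huw : (u, w) ∈ (resolventOperator (fullResolvent hc)).graph) (hub : MemLp u ∞ μ) :
    ∃ F, InFormDomain μ A u F ∧
      (∀ v H, HasGradZero μ Set.univ v H → HasCompactEssSupp μ v → MemLp v ∞ μ →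
        Integrable (fun x => inner ℝ (B x) (F x) * v x) μ ∧
        energy μ A F H - ∫ x, inner ℝ (B x) (F x) * v x ∂μ = - ∫ x, w x * v x ∂μ) ∧
      energy μ A F F ≤ - ∫ x, w x * u x ∂μ := by
  obtain ⟨M, hM0, hM⟩ := exists_ae_bound hub
  have hβ : ∀ k : ℕ, (0 : ℝ) < k + 1 := natCast_add_one_pos
  -- With `λ = k + 1`, this says that the operator sends `λR_λu` to `λR_λw`.
  have hRw : ∀ k : ℕ, ((k : ℝ) + 1) • (((k : ℝ) + 1) • fullResolvent hc (k + 1) u) -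
      ((k : ℝ) + 1) • u = ((k : ℝ) + 1) • fullResolvent hc (k + 1) w := by
    intro k
    have h1 := (hR.mem_graph_iff (hβ k)).1 huw
    rw [map_sub, map_smul, sub_eq_iff_eq_add] at h1
    rw [h1]
    module
  -- For each `λ = k + 1` a ball is chosen so large that its resolvent of `λu`, and the image of
  -- that resolvent under the operator on the ball, are close to their global counterparts.
  have hn : ∀ k : ℕ, ∃ n ≥ k,
      dist (ballResolvent hc n (k + 1) (((k : ℝ) + 1) • u))
        (((k : ℝ) + 1) • fullResolvent hc (k + 1) u) < 1 / (k + 1) ∧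
      dist (((k : ℝ) + 1) • ballResolvent hc n (k + 1) (((k : ℝ) + 1) • u) -
        indicatorL1 μ (isOpen_exhBall d n).measurableSet (((k : ℝ) + 1) • u))
        (((k : ℝ) + 1) • fullResolvent hc (k + 1) w) < 1 / (k + 1) := by
    intro k
    have t1 := tendsto_ballResolvent hc (hβ k) (((k : ℝ) + 1) • u)
    have t2 := (t1.const_smul ((k : ℝ) + 1)).sub (tendsto_indicatorL1 (ν := μ)
      (fun n => (isOpen_exhBall d n).measurableSet) (monotone_exhBall d) (iUnion_exhBall d)
      (((k : ℝ) + 1) • u))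
    rw [map_smul] at t1 t2
    rw [hRw] at t2
    have hpos : (0 : ℝ) < 1 / (k + 1) := by positivity
    obtain ⟨n, ⟨h1, h2⟩, h3⟩ := (((Metric.tendsto_nhds.1 t1 _ hpos).and
      (Metric.tendsto_nhds.1 t2 _ hpos)).and (eventually_ge_atTop k)).exists
    exact ⟨n, h3, h1, h2⟩
  choose n hnk hn1 hn2 using hn
  have tk : Tendsto (fun k : ℕ => (1 : ℝ) / (k + 1)) atTop (𝓝 0) :=
    tendsto_one_div_add_atTop_nhds_zero_nat
  set U : ℕ → Lp ℝ 1 μ := fun k => ballResolvent hc (n k) (k + 1) (((k : ℝ) + 1) • u) with hUdef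
  set h : ℕ → Lp ℝ 1 μ := fun k => ((k : ℝ) + 1) • U k -
    indicatorL1 μ (isOpen_exhBall d (n k)).measurableSet (((k : ℝ) + 1) • u) with hhdef
  have close : ∀ {a b : ℕ → Lp ℝ 1 μ} {l : Lp ℝ 1 μ}, (∀ k : ℕ, dist (a k) (b k) < 1 / (k + 1)) →
      Tendsto b atTop (𝓝 l) → Tendsto (fun k => ∫ x, |a k x - l x| ∂μ) atTop (𝓝 0) := by
    intro a b l hab hb
    have h1 : Tendsto a atTop (𝓝 l) := by
      refine hb.congr_dist (squeeze_zero (fun _ => dist_nonneg) (fun k => ?_) tk)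
      rw [dist_comm]
      exact (hab k).le
    rw [tendsto_iff_dist_tendsto_zero] at h1
    exact h1.congr fun k => L1_dist_eq _ _
  have hbd : ∀ k : ℕ, ∀ᵐ x ∂μ, |(((k : ℝ) + 1) • u : Lp ℝ 1 μ) x| ≤ ((k : ℝ) + 1) * M := by
    intro k
    filter_upwards [Lp.coeFn_smul ((k : ℝ) + 1) u, hM] with x hx hx'
    rw [hx, Pi.smul_apply, smul_eq_mul, abs_mul, abs_of_pos (hβ k)]
    exact mul_le_mul_of_nonneg_left hx' (hβ k).le
  have hsol : ∀ k : ℕ, ∃ D, WeakSol μ A B (exhBall d (n k)) (U k) D (h k) ∧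
      ∀ᵐ x ∂μ, |U k x| ≤ M := by
    intro k
    obtain ⟨D, hD, hb⟩ := exists_weakSol_dirichletResolvent hc (isOpen_exhBall d (n k))
      (isCompact_closure_exhBall d (n k)) (hβ k) (mul_nonneg (hβ k).le hM0) (hbd k)
    rw [mul_div_cancel_left₀ _ (hβ k).ne'] at hb
    refine ⟨D, hD.congr EventuallyEq.rfl ?_, hb⟩
    filter_upwards [Lp.coeFn_sub (((k : ℝ) + 1) • U k)
      (indicatorL1 μ (isOpen_exhBall d (n k)).measurableSet (((k : ℝ) + 1) • u)),
      Lp.coeFn_smul ((k : ℝ) + 1) (U k),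
      coeFn_indicatorL1 (isOpen_exhBall d (n k)).measurableSet (((k : ℝ) + 1) • u)] with x a b c
    rw [hhdef, a, Pi.sub_apply, b, c]
    rfl
  choose D hD hDM using hsol
  obtain ⟨F, hF, heq, hen⟩ := exists_inFormDomain_of_weakSol hc hnk hD hDM
    (L1.integrable_coeFn u) hM (L1.integrable_coeFn w) (close hn1 (hR.tendsto_nat u))
    (close hn2 (hR.tendsto_nat w))
  refine ⟨F, hF, fun v H hv ⟨K, hK, hKv⟩ hvb => ?_, hen⟩
  obtain ⟨m, hm⟩ := exists_subset_of_isCompact hK (isOpen_exhBall d) (monotone_exhBall d)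
    (iUnion_exhBall d)
  exact heq m v H (hv.of_subset hc hK hKv (isOpen_exhBall d m) hm) hvb

/-! ### The core of test functions -/

theorem integral_inner_gradient_eq_zero {f : RSpace d → ℝ} {S : Set (RSpace d)}
    (h0 : ∀ᵐ x ∂μ, x ∉ S → F x = 0) (hf : Disjoint (tsupport f) S) : energy μ A F (∇ f) = 0 := by
  rw [energy]
  have : (fun x => matInner (A x) (F x) (∇ f x)) =ᵐ[μ] 0 := by
    filter_upwards [h0] with x hx
    by_cases hxS : x ∈ S
    · rw [gradient_eq_zero_of_notMem_tsupport (Set.disjoint_right.1 hf hxS)]; simp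
    · simp [hx hxS]
  rw [integral_congr_ae this]; simp

/-- Compactly supported elements of the domain of `L⁰` are weak solutions on large balls. -/
theorem FullGenerator.exists_weakSol (hc : AdmissibleCoeff μ A B) {w : RSpace d → ℝ}
    (hg : FullGenerator μ A u F w) (hu : HasCompactEssSupp μ u) :
    ∃ N, ∀ n ≥ N, WeakSol μ A B (exhBall d n) u F (fun x => w x + inner ℝ (B x) (F x)) := by
  have := hc.finite
  obtain ⟨hdom, hw, -, heq⟩ := hg
  obtain ⟨K, hK, hKu⟩ := hu
  obtain ⟨N, hN⟩ := exists_subset_of_isCompact hK (isOpen_exhBall d) (monotone_exhBall d)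
    (iUnion_exhBall d)
  have hgrad : ∀ n ≥ N, HasGradZero μ (exhBall d n) u F := fun n hn =>
    hdom.hasGradZero hc hK hKu (isOpen_exhBall d n) (hN.trans (monotone_exhBall d hn))
  have htest : ∀ g, IsTestFun Set.univ g → energy μ A F (∇ g) = - ∫ x, w x * g x ∂μ := by
    intro g hg
    obtain ⟨n, hn⟩ := exists_subset_of_isCompact hg.compact (isOpen_exhBall d)
      (monotone_exhBall d) (iUnion_exhBall d)
    have hg' : IsTestFun (exhBall d n) g := ⟨hg.smooth, hg.compact, hn⟩
    exact heq g _ (hg'.hasGradZero.inFormDomain hc (isCompact_closure_exhBall d n))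
  -- Locality of `L⁰`: test functions supported away from the ball do not see the gradient, so `w`
  -- vanishes there. Hence `w`, given in `L²` only, is integrable and admissible as a source on
  -- larger balls.
  have hw0 : ∀ᵐ x ∂μ, x ∈ (closure (exhBall d N))ᶜ → w x = 0 := by
    refine isClosed_closure.isOpen_compl.ae_eq_zero_of_integral_contDiff_smul_eq_zero
      ((hw.locallyIntegrable (by norm_num)).locallyIntegrableOn _) fun g hg hgc hgs => ?_
    have h1 := htest g ⟨hg, hgc, Set.subset_univ _⟩
    rw [integral_inner_gradient_eq_zero (S := exhBall d N)
      ((hgrad N le_rfl).ae_eq_zero.mono fun x hx h => (hx h).2)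
      (Set.disjoint_left.2 fun x hx hx' => hgs hx (subset_closure hx'))] at h1
    simp only [smul_eq_mul, mul_comm (g _)]
    linarith
  obtain ⟨N', hN'⟩ := exists_subset_of_isCompact (isCompact_closure_exhBall d N) (isOpen_exhBall d)
    (monotone_exhBall d) (iUnion_exhBall d)
  refine ⟨max N N', fun n hn => ?_⟩
  have hV := isCompact_closure_exhBall d n
  have hu := hgrad n ((le_max_left _ _).trans hn)
  have hsub : closure (exhBall d N) ⊆ exhBall d n :=
    hN'.trans (monotone_exhBall d ((le_max_right _ _).trans hn))
  have hw0' : ∀ᵐ x ∂μ, x ∉ exhBall d n → w x = 0 := by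
    filter_upwards [hw0] with x hx hxn using hx fun h => hxn (hsub h)
  have hwi := integrable_of_memLp_of_support hV (by norm_num) hw hw0'
  have hBi := hu.integrable_inner_drift hc hV
  refine WeakSol.of_test hc hV hu (hwi.add hBi) ?_ fun v hv => ?_
  · filter_upwards [hw0', hu.ae_eq_zero] with x a b hx
    rw [a hx, (b hx).2, inner_zero_right, add_zero]
  · have hvb : MemLp v ∞ μ := hv.memLp ∞
    rw [htest v (hv.mono (Set.subset_univ _))]
    simp_rw [add_mul]
    rw [integral_add (integrable_mul_bdd hwi hvb) (integrable_mul_bdd hBi hvb)]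
    ring

/-- A single function solves the equation on all large balls, so the sequence of ball resolvents is
eventually constant. -/
theorem FullGenerator.exists_fullResolvent_eq (hc : AdmissibleCoeff μ A B) {w : RSpace d → ℝ}
    (hg : FullGenerator μ A u F w) (hu : HasCompactEssSupp μ u) (hub : MemLp u ∞ μ) :
    ∃ p q : Lp ℝ 1 μ, p =ᵐ[μ] u ∧ (q =ᵐ[μ] fun x => w x + inner ℝ (B x) (F x)) ∧
      ∀ α, 0 < α → fullResolvent hc α (α • p - q) = p := by
  have := hc.finite
  obtain ⟨N, hN⟩ := hg.exists_weakSol hc hu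
  have iu := (hN N le_rfl).grad.integrable (isCompact_closure_exhBall d N)
  have ih := (hN N le_rfl).int
  refine ⟨iu.toL1 _, ih.toL1 _, iu.coeFn_toL1, ih.coeFn_toL1, fun α hα => ?_⟩
  refine fullResolvent_eq_of_weakSol hc hα (fun n hn => ⟨F, hN n hn⟩) hub iu.coeFn_toL1 ?_
  filter_upwards [Lp.coeFn_sub (α • iu.toL1 _) (ih.toL1 _), Lp.coeFn_smul α (iu.toL1 _),
    iu.coeFn_toL1, ih.coeFn_toL1] with x a b c e
  rw [a, Pi.sub_apply, b, Pi.smul_apply, c, e, smul_eq_mul]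

theorem IsTestFun.hasCompactEssSupp {f : RSpace d → ℝ} (hf : IsTestFun V f) :
    HasCompactEssSupp μ f :=
  ⟨tsupport f, hf.compact, Eventually.of_forall fun _ hx => image_eq_zero_of_notMem_tsupport hx⟩

theorem exists_test_dist_le [IsFiniteMeasureOnCompacts μ] (f : Lp ℝ 1 μ) {ε : ℝ} (hε : 0 < ε) :
    ∃ g, IsTestFun Set.univ g ∧ ∀ p : Lp ℝ 1 μ, p =ᵐ[μ] g → dist f p ≤ ε := by
  have t := tendsto_indicatorL1 (ν := μ) (fun n => (isOpen_exhBall d n).measurableSet)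
    (monotone_exhBall d) (iUnion_exhBall d) f
  obtain ⟨n, hn⟩ := (Metric.tendsto_nhds.1 t (ε / 2) (by positivity)).exists
  set q := indicatorL1 μ (isOpen_exhBall d n).measurableSet f with hq
  obtain ⟨g, hg, hgε⟩ := exists_test_integral_abs_sub_le (isOpen_exhBall d n)
    (isCompact_closure_exhBall d n) (L1.integrable_coeFn q) (by
      filter_upwards [coeFn_indicatorL1 (isOpen_exhBall d n).measurableSet f] with x hx hxn
      rw [hq, hx, Set.indicator_of_notMem hxn]) (ε := ε / 2) (by positivity)
  refine ⟨g, hg.mono (Set.subset_univ _), fun p hp => ?_⟩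
  have h1 : dist q p ≤ ε / 2 := by
    rw [L1_dist_eq]
    refine le_of_eq_of_le (integral_congr_ae ?_) hgε
    filter_upwards [hp] with x hx
    rw [hx]
  have h2 := dist_triangle f q p
  rw [dist_comm f q] at h2
  linarith

/-- If the test functions are in the domain of `L⁰`, then the resolvent is strongly continuous. -/
theorem isContractionResolvent_fullResolvent (hc : AdmissibleCoeff μ A B)
    (hcore : ∀ f, IsTestFun Set.univ f → ∃ w, FullGenerator μ A f (∇ f) w) :
    IsContractionResolvent (fullResolvent hc) := by
  have := hc.finite
  have hcontr : ∀ α, 0 < α → ∀ f, ‖α • fullResolvent hc α f‖ ≤ ‖f‖ := by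
    intro α hα f
    rw [norm_smul, Real.norm_of_nonneg hα.le, ← le_inv_mul_iff₀ hα]
    exact norm_fullResolvent_le hc hα f
  refine ⟨fun α β hα hβ => fullResolvent_resolvent_eq hc hα hβ, fun α hα =>
    ContinuousLinearMap.opNorm_le_bound _ zero_le_one fun f => by
      rw [one_mul]; exact hcontr α hα f, fun f => ?_⟩
  rw [Metric.tendsto_nhds]
  intro ε hε
  obtain ⟨g, hg, hgε⟩ := exists_test_dist_le f (ε := ε / 4) (by positivity)
  obtain ⟨w, hw⟩ := hcore g hg
  obtain ⟨p, q, hp, -, hpq⟩ := hw.exists_fullResolvent_eq hc hg.hasCompactEssSupp (hg.memLp ∞)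
  have hfp := hgε p hp
  have t : Tendsto (fun α : ℝ => α⁻¹ * ‖q‖) atTop (𝓝 0) := by
    simpa using tendsto_inv_atTop_zero.mul_const ‖q‖
  -- The relation `αR_αp = p + R_αq` with `‖R_αq‖ ≤ ‖q‖/α` gives convergence at `p`. Contractivity
  -- absorbs the distance from `f` to `p`.
  filter_upwards [eventually_gt_atTop 0, (tendsto_order.1 t).2 (ε / 4) (by positivity)] with α hα hq
  have h1 := hpq α hα
  rw [map_sub, map_smul, sub_eq_iff_eq_add] at h1
  rw [dist_eq_norm] at hfp ⊢
  have h2 : α • fullResolvent hc α f - f =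
      α • fullResolvent hc α (f - p) + fullResolvent hc α q - (f - p) := by
    rw [map_sub, smul_sub, h1]; abel
  rw [h2]
  have h3 := norm_sub_le (α • fullResolvent hc α (f - p) + fullResolvent hc α q) (f - p)
  have h4 := norm_add_le (α • fullResolvent hc α (f - p)) (fullResolvent hc α q)
  have h5 := hcontr α hα (f - p)
  have h6 := norm_fullResolvent_le hc hα q
  linarith

theorem FullGenerator.exists_mem_graph (hc : AdmissibleCoeff μ A B)
    (hR : IsContractionResolvent (fullResolvent hc)) {w : RSpace d → ℝ}
    (hg : FullGenerator μ A u F w) (hu : HasCompactEssSupp μ u) (hub : MemLp u ∞ μ) :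
    ∃ p ∈ (resolventOperator (fullResolvent hc)).graph, p.1 =ᵐ[μ] u ∧
      p.2 =ᵐ[μ] fun x => w x + inner ℝ (B x) (F x) := by
  obtain ⟨p, q, hp, hq, hpq⟩ := hg.exists_fullResolvent_eq hc hu hub
  exact ⟨(p, q), (hR.mem_graph_iff one_pos).2 (hpq 1 one_pos), hp, hq⟩

/-- Together with convexity, this allows the invariance clause of the Hille–Yosida theorem to
transfer the sub-Markov property from the resolvent to the semigroup. -/
theorem isClosed_unitInterval {α : Type*} [MeasurableSpace α] {ν : Measure α} :
    IsClosed {f : Lp ℝ 1 ν | ∀ᵐ x ∂ν, 0 ≤ f x ∧ f x ≤ 1} := by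
  have h1 : {f : Lp ℝ 1 ν | ∀ᵐ x ∂ν, 0 ≤ f x ∧ f x ≤ 1} = Set.Ici 0 ∩ posMass 1 ⁻¹' Set.Iic 0 := by
    ext f
    simp only [Set.mem_ofPred_eq, Set.mem_inter_iff, Set.mem_Ici, Set.mem_preimage, Set.mem_Iic,
      posMass_nonpos_iff zero_le_one, ← Lp.coeFn_nonneg, eventually_and]
    rfl
  rw [h1]
  exact isClosed_Ici.inter (isClosed_Iic.preimage (continuous_posMass zero_le_one))

theorem convex_unitInterval {α : Type*} [MeasurableSpace α] {ν : Measure α} :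
    Convex ℝ {f : Lp ℝ 1 ν | ∀ᵐ x ∂ν, 0 ≤ f x ∧ f x ≤ 1} := by
  intro f hf g hg a b ha hb hab
  filter_upwards [hf, hg, Lp.coeFn_add (a • f) (b • g), Lp.coeFn_smul a f, Lp.coeFn_smul b g]
    with x h1 h2 h3 h4 h5
  rw [h3, Pi.add_apply, h4, h5, Pi.smul_apply, Pi.smul_apply]
  exact convex_Icc (0 : ℝ) 1 h1 h2 ha hb hab

end

noncomputable section

variable {d : ℕ} {μ : Measure (RSpace d)} {A : RSpace d → Matrix (Fin d) (Fin d) ℝ}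
  {B : RSpace d → RSpace d} {V W : Set (RSpace d)} {u v : RSpace d → ℝ}
  {F H : RSpace d → RSpace d} {h : RSpace d → ℝ}

/-! ### The operator on test functions -/

variable {DA : Fin d → Fin d → RSpace d → RSpace d} {Λ : RSpace d → RSpace d} {f g : RSpace d → ℝ}

theorem MemL2Loc.aestronglyMeasurable {E : Type*} [NormedAddCommGroup E] {f : RSpace d → E}
    (hf : MemL2Loc μ f) : AEStronglyMeasurable f μ := by
  rw [← Measure.restrict_univ (μ := μ), ← iUnion_exhBall d, aestronglyMeasurable_iUnion_iff]
  exact fun n => (hf _ (isCompact_closure_exhBall d n)).1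

theorem memL2Loc_of_cutoff {E : Type*} [NormedAddCommGroup E] {f : RSpace d → E}
    (hf : ∀ K, IsCompact K → ∃ g, MemLp g 2 μ ∧ ∀ x ∈ K, g x = f x) : MemL2Loc μ f := by
  intro V hV
  obtain ⟨g, hg, hgf⟩ := hf _ hV
  refine MemLp.mono_measure (Measure.restrict_mono_set μ subset_closure)
    ((memLp_congr_ae ?_).1 (hg.restrict (closure V)))
  exact (ae_restrict_mem isClosed_closure.measurableSet).mono hgf

theorem HasGradLoc.memL2Loc {D : RSpace d → RSpace d} (h : HasGradLoc μ u D) : MemL2Loc μ u := by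
  refine memL2Loc_of_cutoff fun K hK => ?_
  obtain ⟨χ, hχ, -, hχ1, -⟩ := exists_cutoff hK isOpen_univ (Set.subset_univ _)
  exact ⟨_, (h χ hχ).1, fun x hx => by simp [hχ1 x hx]⟩

theorem HasGradLoc.grad_memL2Loc {D : RSpace d → RSpace d} (h : HasGradLoc μ u D) :
    MemL2Loc μ D := by
  refine memL2Loc_of_cutoff fun K hK => ?_
  obtain ⟨χ, hχ, -, hχ1, hχ0⟩ := exists_cutoff hK isOpen_univ (Set.subset_univ _)
  exact ⟨_, (h χ hχ).2.1, fun x hx => by simp [hχ1 x hx, hχ0 x hx]⟩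

/-- Integration by parts in `H₀^{1,2}`. -/
theorem HasGradZero.integral_mul_fderiv [IsFiniteMeasureOnCompacts μ] (hΛ : MemL2Loc μ Λ)
    (hlog : ∀ η e, IsTestFun Set.univ η →
      ∫ x, fderiv ℝ η x e ∂μ = - ∫ x, η x * inner ℝ (Λ x) e ∂μ)
    (hu : HasGradZero μ Set.univ u F) (hg : IsTestFun Set.univ g) (e : RSpace d) :
    Integrable (fun x => u x * fderiv ℝ g x e) μ ∧
      Integrable (fun x => (inner ℝ (F x) e + u x * inner ℝ (Λ x) e) * g x) μ ∧
      ∫ x, u x * fderiv ℝ g x e ∂μ =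
        - ∫ x, (inner ℝ (F x) e + u x * inner ℝ (Λ x) e) * g x ∂μ := by
  obtain ⟨hu2, hF, f, hf, h1, h2⟩ := hu
  have m1 : MemLp (fun x => fderiv ℝ g x e) 2 μ :=
    ((hg.smooth.continuous_fderiv (by simp)).clm_apply
      continuous_const).memLp_of_hasCompactSupport (hg.compact.fderiv_apply ℝ e)
  have m2 : MemLp (fun x => g x * inner ℝ (Λ x) e) 2 μ :=
    (hΛ.inner_const e).memLp_test_smul hg.smooth.continuous hg.compact
  have m3 : MemLp (fun x => g x • e) 2 μ :=
    (hg.smooth.continuous.smul continuous_const).memLp_of_hasCompactSupport hg.compact.smul_right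
  have i1 : Integrable (fun x => u x * fderiv ℝ g x e) μ := hu2.integrable_mul m1
  have i2 : Integrable (fun x => u x * (g x * inner ℝ (Λ x) e)) μ := hu2.integrable_mul m2
  have i3 : Integrable (fun x => inner ℝ (F x) (g x • e)) μ := integrable_inner_of_memLp hF m3
  have e0 : ∀ x, (inner ℝ (F x) e + u x * inner ℝ (Λ x) e) * g x =
      inner ℝ (F x) (g x • e) + u x * (g x * inner ℝ (Λ x) e) := fun x => by
    rw [real_inner_smul_right]; ring
  have m4 : MemLp (fun x => fderiv ℝ g x e + g x * inner ℝ (Λ x) e) 2 μ := m1.add m2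
  have t1 := tendsto_integral_mul hu2 m4 (fun n => (hf n).memLp 2) (fun _ => m4) h1
    (eLpNorm_sub_self_tendsto _ _)
  have t2 := tendsto_integral_inner hF m3 (fun n => (hf n).memLp_gradient 2) (fun _ => m3) h2
    (eLpNorm_sub_self_tendsto _ _)
  have h3 := tendsto_nhds_unique t1 (t2.neg.congr fun n =>
    ((hf n).integral_mul_fderiv hΛ hlog hg e).symm)
  simp_rw [mul_add] at h3
  rw [integral_add i1 i2] at h3
  simp_rw [e0]
  refine ⟨i1, i3.add i2, ?_⟩
  rw [integral_add i3 i2]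
  linarith

theorem IsTestFun.fderiv_apply (hf : IsTestFun V f) (e : RSpace d) :
    IsTestFun V fun x => fderiv ℝ f x e :=
  ⟨(hf.smooth.fderiv_right (by simp)).clm_apply contDiff_const, hf.compact.fderiv_apply ℝ e,
    (tsupport_fderiv_apply_subset ℝ e).trans hf.subset⟩

theorem IsTestFun.partial2 (hf : IsTestFun V f) (i j : Fin d) : IsTestFun V (partial2 i j f) :=
  (hf.fderiv_apply _).fderiv_apply _

theorem gradient_apply (f : RSpace d → ℝ) (x : RSpace d) (i : Fin d) :
    ∇ f x i = fderiv ℝ f x (EuclideanSpace.single i 1) := by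
  rw [← inner_gradient_eq, EuclideanSpace.inner_single_right]; simp

/-- The vector field `½ ∑_j (∂_j a_{ij} + a_{ij} Λ_j)`. -/
def divField (A : RSpace d → Matrix (Fin d) (Fin d) ℝ) (DA : Fin d → Fin d → RSpace d → RSpace d)
    (Λ : RSpace d → RSpace d) (x : RSpace d) : RSpace d :=
  WithLp.toLp 2 fun i => (1 / 2) * ∑ j, (DA i j x j + A x i j * Λ x j)

theorem matInner_gradient (M : Matrix (Fin d) (Fin d) ℝ) (f g : RSpace d → ℝ) (x : RSpace d) :
    matInner M (∇ g x) (∇ f x) = ∑ i, ∑ j, (fderiv ℝ f x (EuclideanSpace.single i 1) * M i j) *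
      fderiv ℝ g x (EuclideanSpace.single j 1) := by
  rw [matInner]
  refine Finset.sum_congr rfl fun i _ => Finset.sum_congr rfl fun j _ => ?_
  rw [gradient_apply, gradient_apply]; ring

/-- Integration by parts produces `∂_j(∂_i f)` in front of `a_{ij}`. Symmetry of `A` identifies the
sum with that in `diffOp`, so symmetry of second derivatives is not needed. -/
theorem diffOp_divField {x : RSpace d} (hA : ∀ i j, A x j i = A x i j) :
    diffOp A (divField A DA Λ) f x = (1 / 2) * ∑ i, ∑ j,
      (fderiv ℝ f x (EuclideanSpace.single i 1) * DA i j x j + A x i j * partial2 j i f x +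
        (fderiv ℝ f x (EuclideanSpace.single i 1) * A x i j) * Λ x j) := by
  have h1 : ∑ i, ∑ j, A x i j * partial2 i j f x = ∑ i, ∑ j, A x i j * partial2 j i f x := by
    rw [Finset.sum_comm]
    refine Finset.sum_congr rfl fun i _ => Finset.sum_congr rfl fun j _ => ?_
    rw [hA]
  have h2 : inner ℝ (divField A DA Λ x) (∇ f x) = (1 / 2) * ∑ i, ∑ j,
      (fderiv ℝ f x (EuclideanSpace.single i 1) * DA i j x j +
        (fderiv ℝ f x (EuclideanSpace.single i 1) * A x i j) * Λ x j) := by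
    rw [PiLp.inner_apply, Finset.mul_sum]
    refine Finset.sum_congr rfl fun i _ => ?_
    rw [gradient_apply]
    simp only [divField, RCLike.inner_apply, conj_trivial, Finset.mul_sum]
    refine Finset.sum_congr rfl fun j _ => ?_
    ring
  rw [diffOp, h1, h2, ← mul_add, ← Finset.sum_add_distrib]
  congr 1
  refine Finset.sum_congr rfl fun i _ => ?_
  rw [← Finset.sum_add_distrib]
  refine Finset.sum_congr rfl fun j _ => ?_
  ring

/-- Integration by parts for test functions. -/
theorem energy_gradient_gradient [IsFiniteMeasureOnCompacts μ]
    (hsymm : ∀ᵐ x ∂μ, ∀ i j, A x j i = A x i j)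
    (hA : ∀ i j, HasGradLoc μ (fun x => A x i j) (DA i j)) (hΛ : MemL2Loc μ Λ)
    (hlog : ∀ η e, IsTestFun Set.univ η →
      ∫ x, fderiv ℝ η x e ∂μ = - ∫ x, η x * inner ℝ (Λ x) e ∂μ)
    (hf : IsTestFun Set.univ f) (hg : IsTestFun Set.univ g) :
    energy μ A (∇ f) (∇ g) = - ∫ x, diffOp A (divField A DA Λ) f x * g x ∂μ := by
  -- The derivative `∂_i f` serves as the cutoff in the definition of `H^{1,2}_loc`, so `a_{ij}∂_i
  -- f` lies in `H₀^{1,2}` and can be integrated by parts against `∂_j g`.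
  have key := fun i j => (hA i j _ (hf.fderiv_apply (EuclideanSpace.single i 1))).integral_mul_fderiv
    hΛ hlog hg (EuclideanSpace.single j 1)
  have e1 : ∫ x, matInner (A x) (∇ f x) (∇ g x) ∂μ = ∑ i, ∑ j,
      ∫ x, (fderiv ℝ f x (EuclideanSpace.single i 1) * A x i j) *
        fderiv ℝ g x (EuclideanSpace.single j 1) ∂μ := by
    have : ∀ᵐ x ∂μ, matInner (A x) (∇ f x) (∇ g x) = ∑ i, ∑ j,
        (fderiv ℝ f x (EuclideanSpace.single i 1) * A x i j) *
          fderiv ℝ g x (EuclideanSpace.single j 1) := by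
      filter_upwards [hsymm] with x hx
      rw [matInner_symm hx, matInner_gradient]
    rw [integral_congr_ae this, integral_finsetSum _ fun i _ =>
      integrable_finsetSum _ fun j _ => (key i j).1]
    exact Finset.sum_congr rfl fun i _ => integral_finsetSum _ fun j _ => (key i j).1
  have e2 : ∫ x, diffOp A (divField A DA Λ) f x * g x ∂μ = (1 / 2) * ∑ i, ∑ j,
      ∫ x, (inner ℝ (fderiv ℝ f x (EuclideanSpace.single i 1) • DA i j x +
          A x i j • ∇ (fun y => fderiv ℝ f y (EuclideanSpace.single i 1)) x)
            (EuclideanSpace.single j 1) +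
        (fderiv ℝ f x (EuclideanSpace.single i 1) * A x i j) *
          inner ℝ (Λ x) (EuclideanSpace.single j 1)) * g x ∂μ := by
    have : ∀ᵐ x ∂μ, diffOp A (divField A DA Λ) f x * g x = (1 / 2) * ∑ i, ∑ j,
        (inner ℝ (fderiv ℝ f x (EuclideanSpace.single i 1) • DA i j x +
          A x i j • ∇ (fun y => fderiv ℝ f y (EuclideanSpace.single i 1)) x)
            (EuclideanSpace.single j 1) +
        (fderiv ℝ f x (EuclideanSpace.single i 1) * A x i j) *
          inner ℝ (Λ x) (EuclideanSpace.single j 1)) * g x := by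
      filter_upwards [hsymm] with x hx
      rw [diffOp_divField hx, mul_assoc, Finset.sum_mul]
      congr 1
      refine Finset.sum_congr rfl fun i _ => ?_
      rw [Finset.sum_mul]
      refine Finset.sum_congr rfl fun j _ => ?_
      rw [inner_add_left, real_inner_smul_left, real_inner_smul_left, inner_gradient_eq,
        EuclideanSpace.inner_single_right, EuclideanSpace.inner_single_right]
      simp [_root_.partial2]
    rw [integral_congr_ae this, integral_const_mul, integral_finsetSum _ fun i _ =>
      integrable_finsetSum _ fun j _ => (key i j).2.1]
    congr 1
    exact Finset.sum_congr rfl fun i _ => integral_finsetSum _ fun j _ => (key i j).2.1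
  rw [energy, e1, e2, ← mul_neg, ← Finset.sum_neg_distrib]
  congr 1
  refine Finset.sum_congr rfl fun i _ => ?_
  rw [← Finset.sum_neg_distrib]
  exact Finset.sum_congr rfl fun j _ => (key i j).2.2

theorem memLp_diffOp [IsFiniteMeasureOnCompacts μ] (hA : ∀ i j, MemL2Loc μ fun x => A x i j)
    (hB : MemL2Loc μ B) (hf : IsTestFun Set.univ f) : MemLp (diffOp A B f) 2 μ := by
  have h1 : MemLp (fun x => (1 / 2) * ∑ i, ∑ j, A x i j * partial2 i j f x) 2 μ := by
    have hp : ∀ i j, MemLp (fun x => A x i j * partial2 i j f x) 2 μ := fun i j => by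
      have hp := hf.partial2 i j
      have := (hA i j).memLp_test_smul hp.smooth.continuous hp.compact
      simpa only [smul_eq_mul, mul_comm] using this
    have hs : MemLp (fun x => ∑ i, ∑ j, A x i j * partial2 i j f x) 2 μ :=
      memLp_finsetSum _ fun i _ => memLp_finsetSum _ fun j _ => hp i j
    exact hs.const_mul _
  refine h1.add ?_
  obtain ⟨χ, hχ, -, hχ1, -⟩ := exists_cutoff hf.compact isOpen_univ (Set.subset_univ _)
  obtain ⟨C, hC⟩ := hf.exists_bound_gradient
  refine (hB.memLp_test_smul hχ.smooth.continuous hχ.compact).of_le_mul (c := C)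
    (hB.aestronglyMeasurable.inner hf.continuous_gradient.aestronglyMeasurable)
    (Eventually.of_forall fun x => ?_)
  by_cases hx : x ∈ tsupport f
  · rw [hχ1 x hx, one_smul, mul_comm]
    exact (norm_inner_le_norm _ _).trans (mul_le_mul_of_nonneg_left (hC x) (norm_nonneg _))
  · rw [gradient_eq_zero_of_notMem_tsupport hx, inner_zero_right, norm_zero]
    exact mul_nonneg ((norm_nonneg _).trans (hC x)) (norm_nonneg _)

theorem diffOp_eq_zero_of_notMem_tsupport {x : RSpace d} (hx : x ∉ tsupport f) :
    diffOp A B f x = 0 := by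
  have h : ∀ i j, partial2 i j f x = 0 := fun i j => by
    refine image_eq_zero_of_notMem_tsupport (f := partial2 i j f) fun h => hx ?_
    exact tsupport_fderiv_apply_subset ℝ _ (tsupport_fderiv_apply_subset ℝ _ h)
  simp [diffOp, h, gradient_eq_zero_of_notMem_tsupport hx]

theorem integrable_diffOp [IsFiniteMeasureOnCompacts μ] (hA : ∀ i j, MemL2Loc μ fun x => A x i j)
    (hB : MemL2Loc μ B) (hf : IsTestFun Set.univ f) : Integrable (diffOp A B f) μ :=
  integrable_of_memLp_of_support (V := tsupport f)
    (by rw [(isClosed_tsupport f).closure_eq]; exact hf.compact) (by norm_num)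
    (memLp_diffOp hA hB hf) (Eventually.of_forall fun _ hx => diffOp_eq_zero_of_notMem_tsupport hx)

/-- Each entry `a_{ij}` is a coordinate of `Ae_j`, hence locally bounded by ellipticity, so
`a_{ij}Λ_j` inherits local square integrability from `Λ`. -/
theorem AdmissibleCoeff.memL2Loc_divField (hc : AdmissibleCoeff μ A B)
    (hDA : ∀ i j, MemL2Loc μ (DA i j)) (hΛ : MemL2Loc μ Λ) : MemL2Loc μ (divField A DA Λ) := by
  intro V hV
  refine MemLp.mono_measure (Measure.restrict_mono_set μ subset_closure) ?_
  have hK : IsCompact (closure (closure V)) := by simpa using hV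
  obtain ⟨ν, hν, hb⟩ := hc.bounds hK
  refine MemLp.of_eval_piLp fun i => ?_
  suffices hs : ∀ j, MemLp (fun x => DA i j x j + A x i j * Λ x j) 2 (μ.restrict (closure V)) by
    have hs' : MemLp (fun x => ∑ j, (DA i j x j + A x i j * Λ x j)) 2 (μ.restrict (closure V)) :=
      memLp_finsetSum _ fun j _ => hs j
    exact hs'.const_mul _
  intro j
  have hDj : MemLp (fun x => DA i j x j) 2 (μ.restrict (closure V)) := (hDA i j _ hK).eval_piLp j
  refine hDj.add ?_
  refine ((hΛ _ hK).eval_piLp j).of_le_mul (c := ν)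
    ((hc.meas i j).restrict.mul ((hΛ _ hK).eval_piLp j).1) ?_
  filter_upwards [ae_restrict_of_ae hb, ae_restrict_mem isClosed_closure.measurableSet] with x hx hxV
  rw [norm_mul]
  refine mul_le_mul_of_nonneg_right ?_ (norm_nonneg _)
  have h1 := (hx hxV (EuclideanSpace.single j 1)).2
  have h2 : matVec (A x) (EuclideanSpace.single j 1) i = A x i j := by simp [matVec]
  rw [← h2]
  refine (PiLp.norm_apply_le _ i).trans (h1.trans ?_)
  simp

/-- Test functions are in the domain of `L⁰`. -/
theorem AdmissibleCoeff.fullGenerator (hc : AdmissibleCoeff μ A B)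
    (hA : ∀ i j, HasGradLoc μ (fun x => A x i j) (DA i j)) (hΛ : MemL2Loc μ Λ)
    (hlog : ∀ η e, IsTestFun Set.univ η →
      ∫ x, fderiv ℝ η x e ∂μ = - ∫ x, η x * inner ℝ (Λ x) e ∂μ)
    (hf : IsTestFun Set.univ f) :
    FullGenerator μ A f (∇ f) (diffOp A (divField A DA Λ) f) := by
  have := hc.finite
  have hw := memLp_diffOp (fun i j => (hA i j).memL2Loc)
    (hc.memL2Loc_divField (fun i j => (hA i j).grad_memL2Loc) hΛ) hf
  obtain ⟨n, hn⟩ := exists_subset_of_isCompact hf.compact (isOpen_exhBall d) (monotone_exhBall d)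
    (iUnion_exhBall d)
  have hV := isCompact_closure_exhBall d n
  have hf' : HasGradZero μ (exhBall d n) f (∇ f) :=
    IsTestFun.hasGradZero ⟨hf.smooth, hf.compact, hn⟩
  refine ⟨hf'.inFormDomain hc hV, hw, by simp, fun v H hv => ?_⟩
  -- The identity is known for test functions `g k` and passes to the limit. Energy convergence
  -- controls their gradients only locally, which suffices as `∇f` vanishes off the ball.
  obtain ⟨hv2, hH, g, hg, h1, h2⟩ := hv
  have hm := (hf'.memLp_matVec hc hV).restrict (closure (exhBall d n))
  have hHn := hc.tendsto_eLpNorm_of_formMass h2 hV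
  have hgm : ∀ k, MemLp (∇ (g k)) 2 (μ.restrict (closure (exhBall d n))) := fun k =>
    ((hg k).memLp_gradient 2).restrict _
  have t1 := tendsto_integral_inner hm (memLp_of_tendsto_eLpNorm hH.restrict hgm hHn)
    (fun _ => hm) hgm (eLpNorm_sub_self_tendsto _ _) hHn
  have hres : ∀ H : RSpace d → RSpace d, energy μ A (∇ f) H =
      (1 / 2) * ∫ x in closure (exhBall d n), inner ℝ (matVec (A x) (∇ f x)) (H x) ∂μ := by
    intro H
    rw [energy_eq_integral_inner, setIntegral_eq_integral_of_forall_compl_eq_zero]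
    intro x hx
    rw [gradient_eq_zero_of_notMem_tsupport fun h => hx (subset_closure (hn h)), matVec_zero,
      inner_zero_left]
  have t2 := tendsto_integral_mul hw hv2 (fun _ => hw) (fun k => (hg k).memLp 2)
    (eLpNorm_sub_self_tendsto _ _) h1
  rw [hres]
  refine tendsto_nhds_unique (t1.const_mul (1 / 2)) (t2.neg.congr fun k => ?_)
  rw [← hres, energy_gradient_gradient hc.symm hA hΛ hlog hf (hg k)]

end

noncomputable section

variable {d : ℕ} {μ : Measure (RSpace d)} {A : RSpace d → Matrix (Fin d) (Fin d) ℝ}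
  {B : RSpace d → RSpace d} {V W : Set (RSpace d)} {u v : RSpace d → ℝ}
  {F H : RSpace d → RSpace d} {h : RSpace d → ℝ}

/-! ### The measure `φ² dx` -/

variable {φ : RSpace d → ℝ} {Dφ : RSpace d → RSpace d}
  {DA : Fin d → Fin d → RSpace d → RSpace d} {Λ : RSpace d → RSpace d}

/-- The measure `φ² dx`. -/
def sqMeasure (φ : RSpace d → ℝ) : Measure (RSpace d) :=
  volume.withDensity fun x => ENNReal.ofReal (φ x ^ 2)

/-- The logarithmic gradient `∇(φ²) / φ²`. -/
def sqLogGradient (φ : RSpace d → ℝ) (Dφ : RSpace d → RSpace d) (x : RSpace d) : RSpace d :=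
  WithLp.toLp 2 fun j => (2 * φ x * Dφ x j) / (φ x) ^ 2

theorem sqLogGradient_eq (x : RSpace d) :
    sqLogGradient φ Dφ x = (2 * φ x / φ x ^ 2) • Dφ x := by
  ext j; simp [sqLogGradient]; ring

/-- The convention for division by zero makes both sides vanish where `φ = 0`, so the zero set of
`φ` needs no separate treatment. -/
theorem sq_smul_sqLogGradient (x : RSpace d) :
    φ x ^ 2 • sqLogGradient φ Dφ x = (2 * φ x) • Dφ x := by
  rw [sqLogGradient_eq, smul_smul]
  by_cases h : φ x = 0
  · simp [h]
  · congr 1; field_simp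

namespace HasWeakGradLoc

variable (hφ : HasWeakGradLoc φ Dφ)

include hφ

theorem aemeasurable_density :
    AEMeasurable (fun x => ENNReal.ofReal (φ x ^ 2)) (volume : Measure (RSpace d)) :=
  (hφ.memL2Loc.aestronglyMeasurable.aemeasurable.pow_const 2).ennreal_ofReal

theorem integral_sqMeasure {E : Type*} [NormedAddCommGroup E] [NormedSpace ℝ E]
    (f : RSpace d → E) : ∫ x, f x ∂(sqMeasure φ) = ∫ x, φ x ^ 2 • f x := by
  rw [sqMeasure, integral_withDensity_eq_integral_toReal_smul₀ hφ.aemeasurable_density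
    (Eventually.of_forall fun _ => ENNReal.ofReal_lt_top)]
  simp only [ENNReal.toReal_ofReal (sq_nonneg _)]

theorem isFiniteMeasureOnCompacts : IsFiniteMeasureOnCompacts (sqMeasure φ) := by
  refine ⟨fun K hK => ?_⟩
  rw [sqMeasure, withDensity_apply _ hK.measurableSet]
  have h := (hφ.memL2Loc K (by rwa [hK.isClosed.closure_eq])).integrable_sq
  exact (hasFiniteIntegral_iff_ofReal (Eventually.of_forall fun _ => sq_nonneg _)).1 h.2

theorem integral_fderiv_sqMeasure {η : RSpace d → ℝ} (e : RSpace d)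
    (hη : IsTestFun Set.univ η) : ∫ x, fderiv ℝ η x e ∂(sqMeasure φ) =
      - ∫ x, η x * inner ℝ (sqLogGradient φ Dφ x) e ∂(sqMeasure φ) := by
  rw [hφ.integral_sqMeasure, hφ.integral_sqMeasure]
  simp only [smul_eq_mul]
  rw [hφ.integral_sq_mul_fderiv e hη]
  congr 2; ext1 x
  have h := congrArg (fun v => inner ℝ v e) (sq_smul_sqLogGradient (φ := φ) (Dφ := Dφ) x)
  simp only [real_inner_smul_left] at h
  linear_combination -η x * h

/-- The density cancels the singularity: `φ²‖2∇φ/φ‖²` is at most `4‖∇φ‖²`, locally integrable for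
Lebesgue measure. -/
theorem memL2Loc_sqLogGradient : MemL2Loc (sqMeasure φ) (sqLogGradient φ Dφ) := by
  intro V hV
  refine MemLp.mono_measure (Measure.restrict_mono_set _ subset_closure) ?_
  have hm : AEStronglyMeasurable (sqLogGradient φ Dφ) volume := by
    have h1 := hφ.memL2Loc.aestronglyMeasurable.aemeasurable
    have h2 : AEStronglyMeasurable (fun x => 2 * φ x / φ x ^ 2) volume :=
      ((h1.const_mul 2).div (h1.pow_const 2)).aestronglyMeasurable
    simp only [funext sqLogGradient_eq]
    exact h2.smul hφ.grad_memL2Loc.aestronglyMeasurable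
  have hac : sqMeasure φ ≪ volume := withDensity_absolutelyContinuous _ _
  refine (memLp_two_iff_integrable_sq_norm (hm.mono_ac hac).restrict).2 ?_
  rw [sqMeasure, restrict_withDensity isClosed_closure.measurableSet,
    integrable_withDensity_iff_integrable_smul₀' hφ.aemeasurable_density.restrict
      (Eventually.of_forall fun _ => ENNReal.ofReal_lt_top)]
  have h3 : Integrable (fun x => 4 * ‖Dφ x‖ ^ 2) (volume.restrict (closure V)) :=
    ((memLp_two_iff_integrable_sq_norm (hφ.grad_memL2Loc _ (by simpa using hV)).1).1
      (hφ.grad_memL2Loc _ (by simpa using hV))).const_mul 4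
  have h1 := hφ.memL2Loc.aestronglyMeasurable
  refine h3.mono' ?_ (Eventually.of_forall fun x => ?_)
  · simp only [ENNReal.toReal_ofReal (sq_nonneg _)]
    exact ((h1.pow 2).smul (hm.norm.pow 2)).restrict
  · rw [ENNReal.toReal_ofReal (sq_nonneg _), smul_eq_mul, Real.norm_of_nonneg (by positivity)]
    by_cases h : φ x = 0
    · rw [h]; simp
    · have h4 : φ x ^ 2 * ‖sqLogGradient φ Dφ x‖ ^ 2 * φ x ^ 2 = (4 * ‖Dφ x‖ ^ 2) * φ x ^ 2 := by
        have h5 := congrArg (fun v => ‖v‖ ^ 2) (sq_smul_sqLogGradient (φ := φ) (Dφ := Dφ) x)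
        simp only [norm_smul, mul_pow, Real.norm_eq_abs, sq_abs] at h5
        linarith
      exact (mul_right_cancel₀ (by positivity) h4).le

end HasWeakGradLoc

theorem betaField_eq : betaField φ Dφ A DA = divField A DA (sqLogGradient φ Dφ) := rfl

theorem diffOp_sub {G : RSpace d → RSpace d} (f : RSpace d → ℝ) (x : RSpace d) :
    diffOp A G f x = diffOp A B f x + inner ℝ (G x - B x) (∇ f x) := by
  rw [diffOp, diffOp, inner_sub_left]; ring

/-- The case without drift comes first: its local bounds on `A` are needed to see that `β` is
locally square integrable. -/
theorem admissibleCoeff_zero (hφ : HasWeakGradLoc φ Dφ)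
    (hAsymm : ∀ i j, ∀ᵐ x ∂(sqMeasure φ), A x j i = A x i j)
    (hA : ∀ i j, HasGradLoc (sqMeasure φ) (fun x => A x i j) (DA i j))
    (hell : LocallyElliptic (sqMeasure φ) A) : AdmissibleCoeff (sqMeasure φ) A 0 where
  finite := hφ.isFiniteMeasureOnCompacts
  meas i j := (hA i j).memL2Loc.aestronglyMeasurable
  symm := ae_all_iff.2 fun i => ae_all_iff.2 fun j => hAsymm i j
  elliptic := hell
  drift _ _ := MemLp.zero
  divFree f _ := by simp
  logGrad := ⟨_, hφ.memL2Loc_sqLogGradient, fun _ e hη => hφ.integral_fderiv_sqMeasure e hη⟩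

/-- An infinitesimally invariant measure has a drift of the form `β + B` where `B` has divergence
zero. -/
theorem admissibleCoeff (hφ : HasWeakGradLoc φ Dφ)
    (hAsymm : ∀ i j, ∀ᵐ x ∂(sqMeasure φ), A x j i = A x i j)
    (hA : ∀ i j, HasGradLoc (sqMeasure φ) (fun x => A x i j) (DA i j))
    (hell : LocallyElliptic (sqMeasure φ) A)
    {G : RSpace d → RSpace d} (hG : MemL2Loc (sqMeasure φ) G)
    (hinv : ∀ f : RSpace d → ℝ, IsTestFun Set.univ f → ∫ x, diffOp A G f x ∂(sqMeasure φ) = 0) :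
    AdmissibleCoeff (sqMeasure φ) A fun x => G x - betaField φ Dφ A DA x := by
  have hc := admissibleCoeff_zero hφ hAsymm hA hell
  have := hc.finite
  have hβ : MemL2Loc (sqMeasure φ) (betaField φ Dφ A DA) := by
    rw [betaField_eq]
    exact hc.memL2Loc_divField (fun i j => (hA i j).grad_memL2Loc) hφ.memL2Loc_sqLogGradient
  refine { hc with drift := fun V hV => (hG V hV).sub (hβ V hV), divFree := fun f hf => ?_ }
  have hAl := fun i j => (hA i j).memL2Loc
  have e1 : ∀ x, inner ℝ (G x - betaField φ Dφ A DA x) (∇ f x) =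
      diffOp A G f x - diffOp A (betaField φ Dφ A DA) f x := fun x => by
    rw [diffOp_sub (B := betaField φ Dφ A DA) (G := G)]; ring
  simp_rw [e1]
  rw [integral_sub (integrable_diffOp hAl hG hf) (integrable_diffOp hAl hβ hf), hinv f hf, zero_sub,
    neg_eq_zero]
  -- With `χ = 1` and `∇χ = 0` on the support of `f`, the integral of the `β`-operator applied to
  -- `f` equals `-E⁰(f, χ) = 0`. Thus `μ` is invariant for the `β`-part, and the invariance for `G`
  -- passes to `B`.
  obtain ⟨χ, hχ, -, hχ1, hχ0⟩ := exists_cutoff hf.compact isOpen_univ (Set.subset_univ _)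
  have h1 := energy_gradient_gradient hc.symm hA hφ.memL2Loc_sqLogGradient
    (fun _ e hη => hφ.integral_fderiv_sqMeasure e hη) hf hχ
  have h2 : energy (sqMeasure φ) A (∇ f) (∇ χ) = 0 := by
    rw [energy]
    have : ∀ x, matInner (A x) (∇ f x) (∇ χ x) = 0 := fun x => by
      by_cases hx : x ∈ tsupport f
      · rw [hχ0 x hx, matInner_zero_right]
      · rw [gradient_eq_zero_of_notMem_tsupport hx, matInner_zero_left]
    simp [this]
  rw [h2, eq_comm, neg_eq_zero, ← betaField_eq] at h1
  rw [← h1]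
  congr 1; ext1 x
  by_cases hx : x ∈ tsupport f
  · rw [hχ1 x hx, mul_one]
  · rw [diffOp_eq_zero_of_notMem_tsupport hx, zero_mul]

end

theorem theorem2p1p5 {d : ℕ} (hd : 1 ≤ d)
    -- the measure `μ = φ² dx`, with `φ` in `H^{1,2}_loc(ℝ^d)` and full support
    (φ : RSpace d → ℝ) (Dφ : RSpace d → RSpace d) (hφ : HasWeakGradLoc φ Dφ)
    (μ : Measure (RSpace d))
    (hμ : μ = volume.withDensity (fun x => ENNReal.ofReal (φ x ^ 2)))
    (hsupp : μ.support = Set.univ)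
    -- the diffusion matrix `A = (a_{ij})` and the gradients of its entries
    (A : RSpace d → Matrix (Fin d) (Fin d) ℝ)
    (DA : Fin d → Fin d → RSpace d → RSpace d)
    (hAsymm : ∀ i j, ∀ᵐ x ∂μ, A x j i = A x i j)
    (hA : ∀ i j, HasGradLoc μ (fun x => A x i j) (DA i j))
    (hell : LocallyElliptic μ A)
    -- the drift `G`, and infinitesimal invariance of `μ`
    (G : RSpace d → RSpace d) (hG : MemL2Loc μ G)
    (hinv : ∀ f : RSpace d → ℝ, IsTestFun Set.univ f → ∫ x, diffOp A G f x ∂μ = 0)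
    -- the perturbation `B = G - β^{ρ,A}`
    (B : RSpace d → RSpace d) (hB : B = fun x => G x - betaField φ Dφ A DA x) :
    ∃ L : Lp ℝ 1 μ →ₗ.[ℝ] Lp ℝ 1 μ,
      -- `L` is a closed extension of `L⁰ u + ⟨B, ∇u⟩`, `u ∈ D(L⁰)_{0,b}`
      L.IsClosed ∧
      (∀ u F w, FullGenerator μ A u F w → HasCompactEssSupp μ u → MemLp u ∞ μ →
        ∃ p ∈ L.graph, p.1 =ᵐ[μ] u ∧ p.2 =ᵐ[μ] fun x => w x + inner ℝ (B x) (F x)) ∧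
      -- (i) `L` generates a sub-Markovian `C₀`-semigroup of contractions, and it extends
      -- `½ ∑ a_{ij} ∂_{ij} + ∑ g_i ∂_i` on `C₀^∞(ℝ^d)`
      (∃ T : ℝ≥0 → Lp ℝ 1 μ →L[ℝ] Lp ℝ 1 μ,
        IsContractionSemigroup T ∧ IsGeneratorOf L T ∧ ∀ t, IsSubMarkovian (T t)) ∧
      (∀ f : RSpace d → ℝ, IsTestFun Set.univ f →
        ∃ p ∈ L.graph, p.1 =ᵐ[μ] f ∧ p.2 =ᵐ[μ] diffOp A G f) ∧
      -- (ii) `(α - L)⁻¹` is the limit of the resolvents `G^{V_n}_α` for every exhaustion `(V_n)`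
      (∃ R : ℝ → Lp ℝ 1 μ →L[ℝ] Lp ℝ 1 μ,
        IsContractionResolvent R ∧
        (∀ α, 0 < α → IsInverseOfSub L α (R α) ∧ IsSubMarkovian (α • R α)) ∧
        ∀ V : ℕ → Set (RSpace d), (∀ n, IsOpen (V n)) → (∀ n, IsCompact (closure (V n))) →
          Monotone V → (⋃ n, V n) = Set.univ →
          ∀ α, 0 < α → ∀ f : Lp ℝ 1 μ, ∃ g : ℕ → Lp ℝ 1 μ,
            (∀ n h, IsDirichletResolvent μ A B (V n) α f h ↔ h = g n) ∧
            (0 ≤ f → Monotone g) ∧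
            Tendsto g atTop (𝓝 (R α f))) ∧
      -- (iii) `D(L)_b ⊆ D(E⁰)`, integration by parts, and the energy inequality
      (∀ u w : Lp ℝ 1 μ, (u, w) ∈ L.graph → MemLp u ∞ μ →
        ∃ F, InFormDomain μ A u F ∧
          (∀ v H, HasGradZero μ Set.univ v H → HasCompactEssSupp μ v → MemLp v ∞ μ →
            Integrable (fun x => inner ℝ (B x) (F x) * v x) μ ∧
            energy μ A F H - ∫ x, inner ℝ (B x) (F x) * v x ∂μ = - ∫ x, w x * v x ∂μ) ∧
          energy μ A F F ≤ - ∫ x, w x * u x ∂μ) := by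
  obtain rfl : μ = sqMeasure φ := hμ
  have hc : AdmissibleCoeff (sqMeasure φ) A B := by
    rw [hB]; exact admissibleCoeff hφ hAsymm hA hell hG hinv
  have hcore : ∀ f, IsTestFun Set.univ f →
      FullGenerator (sqMeasure φ) A f (∇ f) (diffOp A (betaField φ Dφ A DA) f) := by
    intro f hf
    rw [betaField_eq]
    exact hc.fullGenerator hA hφ.memL2Loc_sqLogGradient
      (fun _ e hη => hφ.integral_fderiv_sqMeasure e hη) hf
  have hR := isContractionResolvent_fullResolvent hc fun f hf => ⟨_, hcore f hf⟩
  have := hc.finite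
  refine ⟨resolventOperator (fullResolvent hc), hR.isClosed_operator,
    fun u F w hg hu hub => hg.exists_mem_graph hc hR hu hub, ?_, fun f hf => ?_, ?_,
    fun u w huw hub => exists_inFormDomain_of_mem_graph hc hR huw hub⟩
  · obtain ⟨T, hT, hgen, hinvar⟩ := hR.exists_semigroup
    refine ⟨T, hT, hgen, fun t => ?_⟩
    exact hinvar _ isClosed_unitInterval convex_unitInterval
      (fun α hα => fullResolvent_isSubMarkovian hc hα) t
  · obtain ⟨p, hp, h1, h2⟩ := (hcore f hf).exists_mem_graph hc hR hf.hasCompactEssSupp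
      (hf.memLp ∞)
    refine ⟨p, hp, h1, h2.trans (Eventually.of_forall fun x => ?_)⟩
    rw [hB]
    exact (diffOp_sub f x).symm
  · refine ⟨fullResolvent hc, hR,
      fun α hα => ⟨hR.isInverseOfSub hα, fullResolvent_isSubMarkovian hc hα⟩, ?_⟩
    intro V hVo hV hm hU α hα f
    exact ⟨fun n => dirichletResolvent hc (hVo n) (hV n) α f,
      fun n h => isDirichletResolvent_iff hc (hVo n) (hV n) hα,
      fun hf m n hmn => dirichletResolvent_mono hc _ _ _ _ (hm hmn) hα hf,
      tendsto_dirichletResolvent hc hVo hV hm hU hα f⟩
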